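/- **Conventions.** Let $\mathbb F$ be $\mathbb R$ or $\mathbb C$. A *graded $C^*$-algebra* is a $C^*$-algebra $A$ over $\mathbb F$ (for $\mathbb F=\mathbb R$: a real Banach $*$-algebra with $\|a^*a\|=\|a\|^2$ in which all $1+a^*a$ are invertible) with an involutive $*$-automorphism; $\widehat\otimes$ is the maximal graded tensor product, with $(a\widehat\otimes b)(c\widehat\otimes d)=(-1)^{\deg b\deg c}ac\widehat\otimes bd$ and $(a\widehat\otimes b)^*=(-1)^{\deg a\deg b}a^*\widehat\otimes b^*$. Factors of tensor products are permuted with the usual signs. Let $\mathcal S=C_0(\mathbb R)$ with grading $f(x)\mapsto f(-x)$, let $\mathcal K$ be the compact operators on a fixed graded Hilbert space, and let $\mathbb F_{m,0}$ be the Clifford algebra of $\mathbb R^m$ with $v^2=\|v\|^2$. Let $\Delta\colon\mathcal S\to\mathcal S\widehat\otimes\mathcal S$, $f\mapsto f(X\widehat\otimes1+1\widehat\otimes X)$, be the comultiplication, that is, the graded $*$-homomorphism with $\Delta(u)=u\widehat\otimes u$ and $\Delta(v)=u\widehat\otimes v+v\widehat\otimes u$ for $u=e^{-x^2}$, $v=xe^{-x^2}$.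 For $s$ in the circle $S^1=\mathbb R\cup\{\infty\}$ let $b_s\colon\mathcal S\to\mathbb F_{1,0}$ be the Bott map evaluated at $s$: $b_s(f)=f(s)1$ for even $f$, $b_s(f)=f(s)e_1$ for odd $f$, $b_\infty=0$. A *graded asymptotic morphism* $A\dashrightarrow B$ is a family of maps $\varphi_t\colon A\to B$, $t\in[1,\infty)$, with $t\mapsto\varphi_t(a)$ continuous and bounded for all $a$, that is multiplicative, linear, $*$-preserving and grading preserving in the limit $t\to\infty$. Two are *asymptotically equivalent* if $\|\varphi_t(a)-\psi_t(a)\|\to0$ for all $a$. $\mathrm{Asy}_g(A,B)$ is the set of equivalence classes, with the quotient of the quasi-topology in which the quasi-continuous families indexed by a compact Hausdorff space $Y$ are the graded asymptotic morphisms $A\dashrightarrow C(Y,B)$. $\mathrm{Hom}_g(A,B)$ is the space of graded $*$-homomorphisms with the compact-open topology. For asymptotic morphisms, $\mathrm{id}_D\widehat\otimes\varphi$ and $\varphi\widehat\otimes\mathrm{id}_D$ are the classes determined by $d\widehat\otimes a\mapsto d\widehat\otimes\varphi_t(a)$ and $a\widehat\otimes d\mapsto\varphi_t(a)\widehat\otimes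 d$ up to terms tending to $0$. An *orthogonal quasi-spectrum* is a sequence of based quasi-topological spaces $X_m$ (in the sense of Spanier) with based quasi-continuous left actions of $O(m)$ and based quasi-continuous maps $\sigma\colon X_m\wedge S^1\to X_{m+1}$ whose iterates $X_m\wedge S^n\to X_{m+n}$ are quasi-continuous and $O(m)\times O(n)$-equivariant. Morphisms are sequences of based quasi-continuous $O(m)$-equivariant maps that commute with $\sigma$. The smash product $X\wedge Y$ is the tensor product over the sphere spectrum: $(X\wedge Y)_n$ is the quotient of $\bigvee_{p+q=n}O(n)_+\wedge_{O(p)\times O(q)}X_p\wedge Y_q$ that identifies $[g,\sigma(x,s),y]$ with $[g,x,\chi_q\sigma(y,s)]$, where $\chi_q\in O(q+1)$ moves the last coordinate to the front; $O(n)$ acts by left multiplication and $\sigma([g,x,y],s)=[g\oplus1,x,\sigma(y,s)]$. For graded $C^*$-algebras $A,B$ let $$\mathbb K(A)_m=\mathrm{Hom}_g(\mathcal S\widehat\otimes\mathbb F\widehat\otimes\mathcal K,\,A\widehat\otimes\mathbb F_{m,0}\widehat\otimes\mathcal K),\qquad \mathbb E(A,B)_m=\mathrm{Asy}_g(\mathcal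 S\widehat\otimes A\widehat\otimes\mathcal K,\,B\widehat\otimes\mathbb F_{m,0}\widehat\otimes\mathcal K),$$ and $\mathbb K'(B)=\mathbb E(\mathbb F,B)$, all based at $0$, with $O(m)$ acting through $\mathbb F_{m,0}$ and with structure maps $\sigma(x,s)=(b_s\widehat\otimes\mathrm{id})\circ(\mathrm{id}_{\mathcal S}\widehat\otimes x)\circ(\Delta\widehat\otimes\mathrm{id})$, where the new Clifford generator is put last. **Theorem.** The homomorphisms $\Delta$ and $b_s$, the associativity and permutation isomorphisms of tensor products used above, and the classes $\mathrm{id}_D\widehat\otimes\varphi$ and $\varphi\widehat\otimes\mathrm{id}_D$ exist and are unique. For all graded $C^*$-algebras $A$ and $B$ over $\mathbb F$, the sequences $\mathbb K(A)$, $\mathbb E(A,B)$, $\mathbb K'(B)$ and the smash product $\mathbb K(A)\wedge\mathbb E(A,B)$ are orthogonal quasi-spectra, and there are morphisms of orthogonal quasi-spectra $$\nu'_{A,B}\colon\mathbb K(A)\wedge\mathbb E(A,B)\longrightarrow\mathbb K'(B)$$ such that, for $\alpha\in\mathbb K(A)_m$ and $\beta\in\mathbb E(A,B)_n$, $$\nu'_{A,B}([1,\alpha,\beta])=(\beta\widehat\otimes\mathrm{id}_{\mathbb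 F_{m,0}})\circ(\mathrm{id}_{\mathcal S}\widehat\otimes\alpha)\circ(\Delta\widehat\otimes\mathrm{id}_{\mathbb F\widehat\otimes\mathcal K})\in\mathbb K'(B)_{m+n}$$ (with the generators of $\mathbb F_{m,0}$ put before those of $\mathbb F_{n,0}$). They are natural: for $p+q=n$, $g\in O(n)$ and graded $*$-homomorphisms $f$, $\nu'_{A,B'}([g,\alpha,f_*\beta])=f_*\,\nu'_{A,B}([g,\alpha,\beta])$ for $f\colon B\to B'$, $\alpha\in\mathbb K(A)_p$, $\beta\in\mathbb E(A,B)_q$, and $\nu'_{A,B}([g,\alpha,f^*\beta])=\nu'_{A',B}([g,f_*\alpha,\beta])$ for $f\colon A\to A'$, $\alpha\in\mathbb K(A)_p$, $\beta\in\mathbb E(A',B)_q$. -/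

import Mathlib

open Filter Topology
open scoped TensorProduct

noncomputable section

namespace GradedE

universe u v w u' v'

/-! ### Graded C*-algebras over `𝕜 = ℝ` or `ℂ` -/

/-- A graded C*-algebra over `𝕜` (`ℝ` or `ℂ`): a Banach `*`-algebra satisfying
`‖a‖² ≤ ‖a⋆a + b⋆b‖`, with an involutive `*`-automorphism as grading.  With `b = 0` the inequality
is the C*-identity.  Over `ℂ` it follows from the C*-identity; over `ℝ` it is the standard norm
axiom for real C*-algebras, equivalent (for Banach `*`-algebras with the C*-identity) to the
invertibility of all elements `1 + a⋆a` (see `GCAlg.exists_quasiInverse` for one direction).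
That the grading is isometric is automatic and is recorded for convenience. -/
structure GCAlg (𝕜 : Type) [RCLike 𝕜] where
  carrier : Type u
  [ring : NonUnitalNormedRing carrier]
  [starRing : StarRing carrier]
  [space : NormedSpace 𝕜 carrier]
  [tower : IsScalarTower 𝕜 carrier carrier]
  [comm : SMulCommClass 𝕜 carrier carrier]
  [starModule : StarModule 𝕜 carrier]
  [complete : CompleteSpace carrier]
  norm_sq_le : ∀ a b : carrier, ‖a‖ ^ 2 ≤ ‖star a * a + star b * b‖
  grading : carrier →⋆ₙₐ[𝕜] carrier
  grading_grading : ∀ a, grading (grading a) = a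
  norm_grading_le : ∀ a, ‖grading a‖ ≤ ‖a‖

instance (𝕜 : Type) [RCLike 𝕜] : CoeSort (GCAlg.{u} 𝕜) (Type u) := ⟨GCAlg.carrier⟩

attribute [instance] GCAlg.ring GCAlg.starRing GCAlg.space GCAlg.tower GCAlg.comm
  GCAlg.starModule GCAlg.complete

variable {𝕜 : Type} [RCLike 𝕜]
set_option linter.unusedSectionVars false
/-! ### Completion of non-unital seminormed `*`-rings -/

/-- The Hausdorff completion of a non-unital seminormed ring. -/
def Compl (P : Type u) [NonUnitalSeminormedRing P] : Type u := UniformSpace.Completion P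

namespace Compl

open UniformSpace

variable {P : Type u} [NonUnitalSeminormedRing P]

instance : NormedAddCommGroup (Compl P) := inferInstanceAs (NormedAddCommGroup (Completion P))
instance : CompleteSpace (Compl P) := inferInstanceAs (CompleteSpace (Completion P))
instance [NormedSpace 𝕜 P] : NormedSpace 𝕜 (Compl P) :=
  inferInstanceAs (NormedSpace 𝕜 (Completion P))

/-- The canonical map into the completion. -/
def of (x : P) : Compl P := (x : Completion P)

lemma norm_of (x : P) : ‖of x‖ = ‖x‖ := Completion.norm_coe x
lemma of_add (x y : P) : of (x + y) = of x + of y := Completion.coe_add x y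
lemma of_smul [NormedSpace 𝕜 P] (r : 𝕜) (x : P) : of (r • x) = r • of x := Completion.coe_smul r x
lemma continuous_smul_const [NormedSpace 𝕜 P] (r : 𝕜) : Continuous fun a : Compl P => r • a :=
  continuous_const_smul r
lemma of_zero : of (0 : P) = 0 := Completion.coe_zero

lemma continuous_of : Continuous (of : P → Compl P) := Completion.continuous_coe P

lemma denseInducing : IsDenseInducing (of : P → Compl P) := Completion.isDenseInducing_coe

@[elab_as_elim]
lemma ind {p : Compl P → Prop} (a : Compl P) (hc : IsClosed {a | p a}) (h : ∀ x, p (of x)) : p a :=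
  Completion.induction_on (α := P) a hc h

instance : Mul (Compl P) :=
  ⟨Function.curry <| (denseInducing.prodMap denseInducing).extend
    (fun q : P × P => of (q.1 * q.2))⟩

lemma of_mul (x y : P) : of (x * y) = of x * of y :=
  ((denseInducing.prodMap denseInducing).extend_eq (f := fun q : P × P => of (q.1 * q.2))
    (continuous_of.comp continuous_mul) (x, y)).symm

instance : ContinuousMul (Compl P) where
  continuous_mul := by
    let m := (AddMonoidHom.mul : P →+ P →+ P).compr₂ Completion.toCompl
    have : Continuous fun p : P × P => m p.1 p.2 :=
      (Completion.continuous_coe P).comp continuous_mul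
    have di : IsDenseInducing (Completion.toCompl : P → Completion P) :=
      Completion.isDenseInducing_coe
    exact (di.extend_Z_bilin di this :)

protected lemma zero_mul (a : Compl P) : 0 * a = 0 :=
  ind a (isClosed_eq (continuous_const.mul continuous_id) continuous_const) fun a => by
    rw [← of_zero, ← of_mul, zero_mul]

protected lemma mul_zero (a : Compl P) : a * 0 = 0 :=
  ind a (isClosed_eq (continuous_id.mul continuous_const) continuous_const) fun a => by
    rw [← of_zero, ← of_mul, mul_zero]

protected lemma mul_assoc (a b c : Compl P) : a * b * c = a * (b * c) := by
  refine ind a (isClosed_eq ((continuous_id.mul continuous_const).mul continuous_const)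
    (continuous_id.mul continuous_const)) fun a => ?_
  refine ind b (isClosed_eq ((continuous_const.mul continuous_id).mul continuous_const)
    (continuous_const.mul (continuous_id.mul continuous_const))) fun b => ?_
  refine ind c (isClosed_eq (continuous_const.mul continuous_id)
    (continuous_const.mul (continuous_const.mul continuous_id))) fun c => ?_
  simp only [← of_mul, mul_assoc]

protected lemma mul_add (a b c : Compl P) : a * (b + c) = a * b + a * c := by
  refine ind a (isClosed_eq (by fun_prop) (by fun_prop)) fun a => ?_
  refine ind b (isClosed_eq (by fun_prop) (by fun_prop)) fun b => ?_
  refine ind c (isClosed_eq (by fun_prop) (by fun_prop)) fun c => ?_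
  simp only [← of_mul, ← of_add, mul_add]

protected lemma add_mul (a b c : Compl P) : (a + b) * c = a * c + b * c := by
  refine ind a (isClosed_eq (by fun_prop) (by fun_prop)) fun a => ?_
  refine ind b (isClosed_eq (by fun_prop) (by fun_prop)) fun b => ?_
  refine ind c (isClosed_eq (by fun_prop) (by fun_prop)) fun c => ?_
  simp only [← of_mul, ← of_add, add_mul]

protected lemma norm_mul_le (a b : Compl P) : ‖a * b‖ ≤ ‖a‖ * ‖b‖ := by
  refine ind a (isClosed_le (by fun_prop) (by fun_prop)) fun a => ?_
  refine ind b (isClosed_le (by fun_prop) (by fun_prop)) fun b => ?_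
  simp only [← of_mul, norm_of, norm_mul_le]

instance : NonUnitalNormedRing (Compl P) :=
  { (inferInstance : NormedAddCommGroup (Compl P)) with
    mul := (· * ·)
    zero_mul := Compl.zero_mul
    mul_zero := Compl.mul_zero
    mul_assoc := Compl.mul_assoc
    left_distrib := Compl.mul_add
    right_distrib := Compl.add_mul
    norm_mul_le := Compl.norm_mul_le }

/-- Extension of a contraction to the completions. -/
def extend {P' : Type v} [NonUnitalSeminormedRing P'] (f : P → P') : Compl P → Compl P' :=
  Completion.map f

section extend
variable {P' : Type v} [NonUnitalSeminormedRing P'] {f : P → P'}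

lemma extend_of (hf : ∀ x y, ‖f x - f y‖ ≤ ‖x - y‖) (x : P) : extend f (of x) = of (f x) := by
  refine Completion.map_coe (LipschitzWith.uniformContinuous (K := 1) ?_) x
  exact LipschitzWith.of_dist_le_mul fun x y => by
    rw [dist_eq_norm, dist_eq_norm, NNReal.coe_one, one_mul]; exact hf x y

lemma continuous_extend : Continuous (extend f : Compl P → Compl P') :=
  Completion.continuous_map (f := f)

end extend

variable [StarRing P] [NormedStarGroup P]

instance : Star (Compl P) := ⟨extend star⟩

lemma of_star (x : P) : of (star x) = star (of x) :=
  (extend_of (fun x y => by rw [← star_sub, norm_star]) x).symm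

instance : ContinuousStar (Compl P) := ⟨continuous_extend⟩

instance : StarRing (Compl P) where
  star_involutive a := ind a (isClosed_eq (by fun_prop) (by fun_prop)) fun a => by
    rw [← of_star, ← of_star, star_star]
  star_mul a b := by
    refine ind a (isClosed_eq (by fun_prop) (by fun_prop)) fun a => ?_
    refine ind b (isClosed_eq (by fun_prop) (by fun_prop)) fun b => ?_
    simp only [← of_star, ← of_mul, star_mul]
  star_add a b := by
    refine ind a (isClosed_eq (by fun_prop) (by fun_prop)) fun a => ?_
    refine ind b (isClosed_eq (by fun_prop) (by fun_prop)) fun b => ?_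
    simp only [← of_star, ← of_add, star_add]

variable [NormedSpace 𝕜 P]

instance [IsScalarTower 𝕜 P P] : IsScalarTower 𝕜 (Compl P) (Compl P) where
  smul_assoc r a b := by
    simp only [smul_eq_mul]
    refine ind a (isClosed_eq ((continuous_smul_const r).mul continuous_const)
      ((continuous_smul_const r).comp (continuous_id.mul continuous_const))) fun a => ?_
    refine ind b (isClosed_eq (continuous_const.mul continuous_id)
      ((continuous_smul_const r).comp (continuous_const.mul continuous_id))) fun b => ?_
    simp only [← of_smul, ← of_mul, smul_mul_assoc]

instance [SMulCommClass 𝕜 P P] : SMulCommClass 𝕜 (Compl P) (Compl P) where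
  smul_comm r a b := by
    simp only [smul_eq_mul]
    refine ind a (isClosed_eq ((continuous_smul_const r).comp (continuous_id.mul continuous_const))
      (continuous_id.mul continuous_const)) fun a => ?_
    refine ind b (isClosed_eq ((continuous_smul_const r).comp (continuous_const.mul continuous_id))
      (continuous_const.mul (continuous_smul_const r))) fun b => ?_
    simp only [← of_smul, ← of_mul, mul_smul_comm]

instance [StarModule 𝕜 P] : StarModule 𝕜 (Compl P) where
  star_smul r a := ind a (isClosed_eq (continuous_star.comp (continuous_smul_const r))
    ((continuous_smul_const (star r)).comp continuous_star)) fun a => by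
      rw [← of_smul, ← of_star, ← of_star, ← of_smul, star_smul]

variable {P' : Type v} [NonUnitalSeminormedRing P'] [StarRing P'] [NormedStarGroup P']
  [NormedSpace 𝕜 P']

/-- A contractive `*`-homomorphism extends to the completions. -/
def mapHom (f : P →⋆ₙₐ[𝕜] P') (hf : ∀ x, ‖f x‖ ≤ ‖x‖) : Compl P →⋆ₙₐ[𝕜] Compl P' :=
  have h : ∀ x y, ‖f x - f y‖ ≤ ‖x - y‖ := fun x y => by rw [← map_sub]; exact hf _
  { toFun := extend f
    map_smul' := fun r a => ind a
      (isClosed_eq (continuous_extend.comp (continuous_smul_const r))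
        ((continuous_smul_const r).comp continuous_extend))
      fun a => by
        rw [← of_smul, extend_of h, extend_of h, map_smul, of_smul]; rfl
    map_zero' := by rw [← of_zero, extend_of h, map_zero, of_zero]
    map_add' := fun a b => by
      refine ind a (isClosed_eq (continuous_extend.comp (by fun_prop))
        (continuous_extend.add continuous_const)) fun a => ?_
      refine ind b (isClosed_eq (continuous_extend.comp (by fun_prop))
        (continuous_const.add continuous_extend)) fun b => ?_
      rw [← of_add, extend_of h, extend_of h, extend_of h, map_add, of_add]
    map_mul' := fun a b => by
      refine ind a (isClosed_eq (continuous_extend.comp (by fun_prop))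
        (continuous_extend.mul continuous_const)) fun a => ?_
      refine ind b (isClosed_eq (continuous_extend.comp (by fun_prop))
        (continuous_const.mul continuous_extend)) fun b => ?_
      rw [← of_mul, extend_of h, extend_of h, extend_of h, map_mul, of_mul]
    map_star' := fun a => ind a
      (isClosed_eq (continuous_extend.comp (by fun_prop)) continuous_extend.star)
      fun a => by
        rw [← of_star, extend_of h, extend_of h, map_star, of_star] }

lemma continuous_mapHom (f : P →⋆ₙₐ[𝕜] P') (hf : ∀ x, ‖f x‖ ≤ ‖x‖) :
    Continuous (mapHom f hf) := continuous_extend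

lemma mapHom_of (f : P →⋆ₙₐ[𝕜] P') (hf : ∀ x, ‖f x‖ ≤ ‖x‖) (x : P) :
    mapHom f hf (of x) = of (f x) :=
  extend_of (fun x y => by rw [← map_sub]; exact hf _) x

lemma mapHom_involutive (f : P →⋆ₙₐ[𝕜] P) (hf : ∀ x, ‖f x‖ ≤ ‖x‖) (h : ∀ x, f (f x) = x)
    (a : Compl P) : mapHom f hf (mapHom f hf a) = a :=
  ind a (isClosed_eq ((continuous_mapHom f hf).comp (continuous_mapHom f hf)) continuous_id)
    fun a => by rw [mapHom_of, mapHom_of, h]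

lemma mapHom_comm {f : P →⋆ₙₐ[𝕜] P'} {hf : ∀ x, ‖f x‖ ≤ ‖x‖} {d : P →⋆ₙₐ[𝕜] P}
    {hd : ∀ x, ‖d x‖ ≤ ‖x‖} {d' : P' →⋆ₙₐ[𝕜] P'} {hd' : ∀ x, ‖d' x‖ ≤ ‖x‖}
    (h : ∀ x, f (d x) = d' (f x)) (a : Compl P) :
    mapHom f hf (mapHom d hd a) = mapHom d' hd' (mapHom f hf a) :=
  ind a (isClosed_eq ((continuous_mapHom f hf).comp (continuous_mapHom d hd))
      ((continuous_mapHom d' hd').comp (continuous_mapHom f hf)))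
    fun a => by rw [mapHom_of, mapHom_of, mapHom_of, mapHom_of, h]

lemma norm_mapHom_le (f : P →⋆ₙₐ[𝕜] P') (hf : ∀ x, ‖f x‖ ≤ ‖x‖) (a : Compl P) :
    ‖mapHom f hf a‖ ≤ ‖a‖ :=
  ind a (isClosed_le (continuous_mapHom f hf).norm continuous_norm)
    fun a => by rw [mapHom_of, norm_of, norm_of]; exact hf a

end Compl


instance (A : GCAlg.{u} 𝕜) : CStarRing A where
  norm_mul_self_le a := by
    have := A.norm_sq_le a 0
    simpa [sq] using this

/-- `1 + a⋆a` is invertible in the unitization: `a⋆a` has a two-sided quasi-inverse. -/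
theorem GCAlg.exists_quasiInverse (A : GCAlg.{u} 𝕜) (a : A) :
    ∃ q : A, star a * a + q + star a * a * q = 0 ∧ star a * a + q + q * (star a * a) = 0 := by
  set h : A := star a * a with hh
  have hs : star h = h := by simp [hh]
  let L : A →L[𝕜] A := ContinuousLinearMap.mul 𝕜 A h
  have hL : ∀ y, L y = h * y := fun y => rfl
  have key : ∀ (s : ℝ), 0 ≤ s → ∀ y : A, ‖y‖ ≤ ‖y + (s : 𝕜) • (h * y)‖ := by
    intro s hs0 y
    have h1 := A.norm_sq_le y (((Real.sqrt s : ℝ) : 𝕜) • (a * y))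
    have h2 : star y * y + star (((Real.sqrt s : ℝ) : 𝕜) • (a * y)) *
        (((Real.sqrt s : ℝ) : 𝕜) • (a * y)) = star y * (y + (s : 𝕜) • (h * y)) := by
      rw [star_smul, smul_mul_smul_comm, mul_add, mul_smul_comm, star_mul, hh]
      have : star ((Real.sqrt s : ℝ) : 𝕜) * ((Real.sqrt s : ℝ) : 𝕜) = (s : 𝕜) := by
        rw [RCLike.star_def, RCLike.conj_ofReal, ← RCLike.ofReal_mul, Real.mul_self_sqrt hs0]
      rw [this]
      simp only [mul_assoc]
    rw [h2] at h1
    have h3 := h1.trans (norm_mul_le _ _)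
    rw [norm_star, sq] at h3
    rcases (norm_nonneg y).eq_or_lt with h0 | h0
    · rw [← h0]; exact norm_nonneg _
    · exact le_of_mul_le_mul_left h3 h0
  obtain ⟨N, hN⟩ := exists_nat_gt ‖L‖
  have hN0 : (0 : ℝ) < N := (norm_nonneg _).trans_lt hN
  have unit : ∀ k : ℕ, IsUnit (1 + ((k / N : ℝ) : 𝕜) • L) := by
    intro k
    induction k with
    | zero => simp
    | succ k ih =>
      obtain ⟨U, hU⟩ := ih
      let V : A →L[𝕜] A := ↑U⁻¹
      have hV : ‖V‖ ≤ 1 := by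
        refine ContinuousLinearMap.opNorm_le_bound _ zero_le_one fun y => ?_
        have h1 := key (k / N) (by positivity) (V y)
        have h2 : V y + ((k / N : ℝ) : 𝕜) • (h * V y) = (1 + ((k / N : ℝ) : 𝕜) • L) (V y) := rfl
        have h3 : (1 + ((k / N : ℝ) : 𝕜) • L) (V y) = y := by
          rw [← hU]
          exact congrArg (fun T : A →L[𝕜] A => T y) U.mul_inv
        rw [h2, h3] at h1
        rwa [one_mul]
      have h4 : (1 + (((k + 1 : ℕ) / N : ℝ) : 𝕜) • L) =
          ↑U * (1 - (-(((1 / N : ℝ) : 𝕜) • (V * L)))) := by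
        have e1 : (U : A →L[𝕜] A) * (V * L) = L := by
          rw [← mul_assoc]; exact (congrArg (· * L) U.mul_inv).trans (one_mul L)
        rw [sub_neg_eq_add, mul_add, mul_one, mul_smul_comm, e1, hU, add_assoc, ← add_smul,
          ← RCLike.ofReal_add]
        congr 3
        push_cast
        ring
      rw [h4]
      refine U.isUnit.mul (isUnit_one_sub_of_norm_lt_one ?_)
      rw [norm_neg, norm_smul, RCLike.norm_ofReal, abs_of_pos (by positivity)]
      calc 1 / N * ‖V * L‖ ≤ 1 / N * (1 * ‖L‖) := by
            gcongr; exact (norm_mul_le _ _).trans (by gcongr)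
        _ < 1 := by rw [one_mul, one_div, inv_mul_lt_one₀ hN0]; exact hN
  obtain ⟨U, hU⟩ := unit N
  have hU' : ∀ y, (U : A →L[𝕜] A) y = y + h * y := fun y => by
    rw [hU, div_self hN0.ne']; simp [hL]
  obtain ⟨q, hq⟩ : ∃ q : A, q + h * q = -h := ⟨(↑U⁻¹ : A →L[𝕜] A) (-h), by
    rw [← hU']; exact congrArg (fun T : A →L[𝕜] A => T (-h)) U.mul_inv⟩
  have e1 : h + q + h * q = 0 := by rw [add_assoc, hq, add_neg_cancel]
  have e2 : h + star q + star q * h = 0 := by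
    have := congrArg star e1
    simpa [hs] using this
  have e3 : star q * h = h * q := by
    have f1 := congrArg (star q * ·) e1
    have f2 := congrArg (· * q) e2
    simp only [mul_add, add_mul, mul_zero, zero_mul, mul_assoc] at f1 f2
    have := f1.trans f2.symm
    have h5 : star q * h + (star q * q + star q * (h * q)) =
        h * q + (star q * q + star q * (h * q)) := by rw [← add_assoc, this, add_assoc]
    exact add_right_cancel h5
  have e4 : star q = q := by
    have : h + star q + h * q = h + q + h * q := by rw [← e3, e2, e3, e1]
    exact add_left_cancel (add_right_cancel this)
  refine ⟨q, e1, ?_⟩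
  rw [e4] at e2
  exact e2

/-- `a` is homogeneous of degree `i` modulo 2. -/
def GCAlg.Homog (A : GCAlg.{u} 𝕜) (i : ℕ) (a : A) : Prop := A.grading a = (-1 : 𝕜) ^ i • a

/-- Graded `*`-homomorphisms.  (Contractivity holds automatically for `*`-homomorphisms of
C*-algebras; it is recorded for convenience.) -/
structure GHom (A : GCAlg.{u} 𝕜) (B : GCAlg.{v} 𝕜) where
  toHom : A →⋆ₙₐ[𝕜] B
  map_grading : ∀ a, toHom (A.grading a) = B.grading (toHom a)
  norm_le : ∀ a, ‖toHom a‖ ≤ ‖a‖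

namespace GHom

instance (A : GCAlg.{u} 𝕜) (B : GCAlg.{v} 𝕜) : CoeFun (GHom A B) (fun _ => A → B) :=
  ⟨fun f => f.toHom⟩

instance (A : GCAlg.{u} 𝕜) (B : GCAlg.{v} 𝕜) : Zero (GHom A B) :=
  ⟨⟨0, by simp, by simp⟩⟩

/-- The identity homomorphism. -/
def id (A : GCAlg.{u} 𝕜) : GHom A A := ⟨NonUnitalStarAlgHom.id 𝕜 A, by simp, by simp⟩

/-- Composition of graded `*`-homomorphisms. -/
def comp {A : GCAlg.{u} 𝕜} {B : GCAlg.{v} 𝕜} {C : GCAlg.{w} 𝕜} (g : GHom B C) (f : GHom A B) :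
    GHom A C :=
  ⟨g.toHom.comp f.toHom, by simp [f.map_grading, g.map_grading],
    fun a => (g.norm_le _).trans (f.norm_le a)⟩

open Classical in
/-- The unique graded `*`-homomorphism with the property `P` (and `0` if there is none). -/
def the {A : GCAlg.{u} 𝕜} {B : GCAlg.{v} 𝕜} (P : GHom A B → Prop) : GHom A B :=
  if h : ∃! f, P f then h.choose else 0

/-- The compact-open topology. -/
instance (A : GCAlg.{u} 𝕜) (B : GCAlg.{v} 𝕜) : TopologicalSpace (GHom A B) :=
  TopologicalSpace.generateFrom
    {W | ∃ (K : Set A) (U : Set B), IsCompact K ∧ IsOpen U ∧ W = {f : GHom A B | Set.MapsTo f K U}}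

end GHom

/-! ### Enveloping C*-algebras -/

section Envelope

variable (𝕜) in
/-- A C*-seminorm on a `*`-algebra: one whose Hausdorff completion is a C*-algebra. -/
structure CStarSeminorm (R : Type u) [NonUnitalRing R] [StarRing R] [Module 𝕜 R]
    extends Seminorm 𝕜 R where
  mul_le : ∀ x y, toFun (x * y) ≤ toFun x * toFun y
  sq_le : ∀ x y, toFun x ^ 2 ≤ toFun (star x * x + star y * y)

variable (𝕜) in
/-- A `*`-algebra with a grading and a pointwise bounded family of C*-seminorms. -/
structure EnvData (R : Type u) [NonUnitalRing R] [StarRing R] [Module 𝕜 R] where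
  grading : R →⋆ₙₐ[𝕜] R
  grading_grading : ∀ x, grading (grading x) = x
  adm : Set (CStarSeminorm 𝕜 R)
  bdd : ∀ x, ∃ M : ℝ, ∀ p ∈ adm, p.toFun x ≤ M
  adm_grading : ∀ p ∈ adm, ∃ q ∈ adm, ∀ x, q.toFun x = p.toFun (grading x)

variable {R : Type u} [NonUnitalRing R] [StarRing R] [Module 𝕜 R]

namespace CStarSeminorm

lemma nonneg (p : CStarSeminorm 𝕜 R) (x : R) : 0 ≤ p.toFun x := apply_nonneg p.toSeminorm x

lemma star_le (p : CStarSeminorm 𝕜 R) (x : R) : p.toFun (star x) ≤ p.toFun x := by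
  have h1 := p.sq_le (star x) 0
  simp only [star_star, star_zero, mul_zero, add_zero] at h1
  have h2 := p.mul_le x (star x)
  have h0 := p.nonneg x
  have h0' := p.nonneg (star x)
  by_contra! h
  nlinarith

end CStarSeminorm

namespace EnvData

variable (E : EnvData 𝕜 R)

lemma bddAbove (x : R) : BddAbove (Set.range fun p : E.adm => p.1.toFun x) := by
  obtain ⟨M, hM⟩ := E.bdd x
  exact ⟨M, by rintro _ ⟨p, rfl⟩; exact hM p.1 p.2⟩

/-- The supremum of the admissible C*-seminorms. -/
def sup (x : R) : ℝ := ⨆ p : E.adm, p.1.toFun x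

lemma le_sup (p : E.adm) (x : R) : p.1.toFun x ≤ E.sup x := le_ciSup (E.bddAbove x) p

lemma sup_nonneg (x : R) : 0 ≤ E.sup x := Real.iSup_nonneg fun p => p.1.nonneg x

lemma sup_le {x : R} {M : ℝ} (hM : 0 ≤ M) (h : ∀ p ∈ E.adm, p.toFun x ≤ M) : E.sup x ≤ M :=
  Real.iSup_le (fun p => h p.1 p.2) hM

/-- The maximal admissible seminorm. -/
def maxSeminorm : Seminorm 𝕜 R :=
  Seminorm.ofSMulLE E.sup
    (le_antisymm (E.sup_le le_rfl fun p _ => (map_zero p.toSeminorm).le) (E.sup_nonneg 0))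
    (fun x y => E.sup_le (add_nonneg (E.sup_nonneg x) (E.sup_nonneg y)) fun p hp =>
      (map_add_le_add p.toSeminorm x y).trans
        (add_le_add (E.le_sup ⟨p, hp⟩ x) (E.le_sup ⟨p, hp⟩ y)))
    (fun r x => E.sup_le (mul_nonneg (norm_nonneg r) (E.sup_nonneg x)) fun p hp =>
      (map_smul_eq_mul p.toSeminorm r x).le.trans
        (mul_le_mul_of_nonneg_left (E.le_sup ⟨p, hp⟩ x) (norm_nonneg r)))

/-- `R` with the maximal admissible seminorm. -/
def Pre (_E : EnvData 𝕜 R) : Type u := R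

instance : NonUnitalRing E.Pre := inferInstanceAs (NonUnitalRing R)
instance : StarRing E.Pre := inferInstanceAs (StarRing R)
instance : Module 𝕜 E.Pre := inferInstanceAs (Module 𝕜 R)
instance [h : IsScalarTower 𝕜 R R] : IsScalarTower 𝕜 E.Pre E.Pre := h
instance [h : SMulCommClass 𝕜 R R] : SMulCommClass 𝕜 E.Pre E.Pre := h
instance [h : StarModule 𝕜 R] : StarModule 𝕜 E.Pre := h

instance : SeminormedAddCommGroup E.Pre :=
  { AddGroupSeminorm.toSeminormedAddCommGroup E.maxSeminorm.toAddGroupSeminorm with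
    toAddCommGroup := inferInstanceAs (AddCommGroup R) }

lemma norm_def (x : E.Pre) : ‖x‖ = E.sup x := rfl

instance : NormedSpace 𝕜 E.Pre where
  norm_smul_le r x := (map_smul_eq_mul E.maxSeminorm r x).le

instance : NonUnitalSeminormedRing E.Pre :=
  { (inferInstance : SeminormedAddCommGroup E.Pre), (inferInstance : NonUnitalRing E.Pre) with
    norm_mul_le := fun x y => E.sup_le (mul_nonneg (E.sup_nonneg x) (E.sup_nonneg y)) fun p hp =>
      (p.mul_le x y).trans
        (mul_le_mul (E.le_sup ⟨p, hp⟩ x) (E.le_sup ⟨p, hp⟩ y) (p.nonneg _) (E.sup_nonneg x)) }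

lemma norm_star_le (x : E.Pre) : ‖star x‖ ≤ ‖x‖ :=
  E.sup_le (E.sup_nonneg x) fun p hp => (p.star_le x).trans (E.le_sup ⟨p, hp⟩ x)

instance : NormedStarGroup E.Pre where
  norm_star_le := E.norm_star_le

lemma sup_sq_le (x y : R) : E.sup x ^ 2 ≤ E.sup (star x * x + star y * y) := by
  rw [← Real.le_sqrt (E.sup_nonneg _) (E.sup_nonneg _)]
  refine E.sup_le (Real.sqrt_nonneg _) fun p hp => ?_
  rw [Real.le_sqrt (p.nonneg _) (E.sup_nonneg _)]
  exact (p.sq_le x y).trans (E.le_sup ⟨p, hp⟩ _)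

lemma norm_sq_le (x y : E.Pre) : ‖x‖ ^ 2 ≤ ‖star x * x + star y * y‖ := E.sup_sq_le x y

lemma norm_grading_le (x : E.Pre) : E.sup (E.grading x) ≤ ‖x‖ :=
  E.sup_le (E.sup_nonneg x) fun p hp => by
    obtain ⟨q, hq, h⟩ := E.adm_grading p hp
    exact (h x).symm.le.trans (E.le_sup ⟨q, hq⟩ x)

variable [IsScalarTower 𝕜 R R] [SMulCommClass 𝕜 R R] [StarModule 𝕜 R]

/-- The grading on `E.Pre`. -/
def preGrading : E.Pre →⋆ₙₐ[𝕜] E.Pre := E.grading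

/-- The enveloping graded C*-algebra: the completion in the largest admissible C*-seminorm. -/
def envelope : GCAlg.{u} 𝕜 where
  carrier := Compl E.Pre
  norm_sq_le a b := by
    refine Compl.ind a (isClosed_le (by fun_prop) (by fun_prop)) fun a => ?_
    refine Compl.ind b (isClosed_le (by fun_prop) (by fun_prop)) fun b => ?_
    simp only [← Compl.of_star, ← Compl.of_mul, ← Compl.of_add, Compl.norm_of]
    exact E.norm_sq_le a b
  grading := Compl.mapHom E.preGrading E.norm_grading_le
  grading_grading := Compl.mapHom_involutive _ _ E.grading_grading
  norm_grading_le := Compl.norm_mapHom_le _ _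

/-- The canonical map into the enveloping C*-algebra. -/
def toEnvelope (x : R) : E.envelope := Compl.of (P := E.Pre) x

variable {R' : Type v} [NonUnitalRing R'] [StarRing R'] [Module 𝕜 R']
  [IsScalarTower 𝕜 R' R'] [SMulCommClass 𝕜 R' R'] [StarModule 𝕜 R']

variable {E} in
/-- Functoriality of the enveloping C*-algebra. -/
def envelopeMap {E' : EnvData 𝕜 R'} (f : R →⋆ₙₐ[𝕜] R')
    (hf : ∀ x, f (E.grading x) = E'.grading (f x))
    (hadm : ∀ p ∈ E'.adm, ∃ q ∈ E.adm, ∀ x, q.toFun x = p.toFun (f x)) :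
    GHom E.envelope E'.envelope :=
  let f' : E.Pre →⋆ₙₐ[𝕜] E'.Pre := f
  have h : ∀ x : E.Pre, ‖f' x‖ ≤ ‖x‖ := fun x =>
    E'.sup_le (E.sup_nonneg x) fun p hp => by
      obtain ⟨q, hq, h⟩ := hadm p hp
      exact (h x).symm.le.trans (E.le_sup ⟨q, hq⟩ x)
  { toHom := Compl.mapHom f' h
    map_grading := Compl.mapHom_comm (hd := E.norm_grading_le) (hd' := E'.norm_grading_le) hf
    norm_le := Compl.norm_mapHom_le f' h }

end EnvData
end Envelope

/-! ### The maximal graded tensor product -/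

section Twist

/-- Two commuting involutive `*`-automorphisms. -/
structure TwistData (𝕜 : Type) [RCLike 𝕜] (R : Type u) [NonUnitalRing R] [StarRing R]
    [Module 𝕜 R] where
  d₁ : R →⋆ₙₐ[𝕜] R
  d₂ : R →⋆ₙₐ[𝕜] R
  d₁_d₁ : ∀ x, d₁ (d₁ x) = x
  d₂_d₂ : ∀ x, d₂ (d₂ x) = x
  comm : ∀ x, d₁ (d₂ x) = d₂ (d₁ x)

namespace TwistData

variable {R : Type u} [NonUnitalRing R] [StarRing R] [Module 𝕜 R] [IsScalarTower 𝕜 R R]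
  [SMulCommClass 𝕜 R R] [StarModule 𝕜 R] (T : TwistData 𝕜 R)

/-- The even part with respect to `d₁`. -/
def even (x : R) : R := (2⁻¹ : 𝕜) • (x + T.d₁ x)
/-- The odd part with respect to `d₁`. -/
def odd (x : R) : R := (2⁻¹ : 𝕜) • (x - T.d₁ x)

/-- `R` with the twisted product `x ⋆ y = x y` for `y` `d₁`-even and `x ⋆ y = d₂(x) y` for `y`
`d₁`-odd, and the twisted involution. -/
@[nolint unusedArguments]
def Tw (_T : TwistData 𝕜 R) : Type u := R

/-- The identity as a map into the twisted algebra. -/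
def toTw (x : R) : T.Tw := x

/-- The twisted multiplication. -/
def tmul (x y : R) : R := x * T.even y + T.d₂ x * T.odd y

/-- The twisted involution. -/
def tstar (x : R) : R := T.even (star x) + T.d₂ (T.odd (star x))

lemma even_add_odd (x : R) : T.even x + T.odd x = x := by
  simp only [even, odd]; module

lemma even_add (x y : R) : T.even (x + y) = T.even x + T.even y := by
  simp only [even, map_add]; module
lemma odd_add (x y : R) : T.odd (x + y) = T.odd x + T.odd y := by
  simp only [odd, map_add]; module
lemma even_smul (r : 𝕜) (x : R) : T.even (r • x) = r • T.even x := by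
  simp only [even, map_smul]; module
lemma odd_smul (r : 𝕜) (x : R) : T.odd (r • x) = r • T.odd x := by
  simp only [odd, map_smul]; module
lemma even_zero : T.even 0 = 0 := by simp [even]
lemma odd_zero : T.odd 0 = 0 := by simp [odd]
lemma d₁_even (x : R) : T.d₁ (T.even x) = T.even x := by
  simp only [even, map_smul, map_add, T.d₁_d₁]; module
lemma d₁_odd (x : R) : T.d₁ (T.odd x) = - T.odd x := by
  simp only [odd, map_smul, map_sub, T.d₁_d₁]; module
lemma d₂_even (x : R) : T.d₂ (T.even x) = T.even (T.d₂ x) := by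
  simp only [even, map_smul, map_add, T.comm]
lemma d₂_odd (x : R) : T.d₂ (T.odd x) = T.odd (T.d₂ x) := by
  simp only [odd, map_smul, map_sub, T.comm]
lemma even_of {x : R} (h : T.d₁ x = x) : T.even x = x := by
  simp only [even, h]; module
lemma odd_of {x : R} (h : T.d₁ x = x) : T.odd x = 0 := by
  simp only [odd, h]; module
lemma even_of' {x : R} (h : T.d₁ x = -x) : T.even x = 0 := by
  simp only [even, h]; module
lemma odd_of' {x : R} (h : T.d₁ x = -x) : T.odd x = x := by
  simp only [odd, h]; module
lemma even_mul_even (x y : R) : T.even (x * T.even y) = T.even x * T.even y := by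
  conv_lhs => rw [even, map_mul, T.d₁_even, ← add_mul, ← smul_mul_assoc]
  rfl
lemma odd_mul_even (x y : R) : T.odd (x * T.even y) = T.odd x * T.even y := by
  conv_lhs => rw [odd, map_mul, T.d₁_even, ← sub_mul, ← smul_mul_assoc]
  rfl
lemma even_mul_odd (x y : R) : T.even (x * T.odd y) = T.odd x * T.odd y := by
  conv_lhs => rw [even, map_mul, T.d₁_odd, mul_neg, ← sub_eq_add_neg, ← sub_mul, ← smul_mul_assoc]
  rfl
lemma odd_mul_odd (x y : R) : T.odd (x * T.odd y) = T.even x * T.odd y := by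
  conv_lhs => rw [odd, map_mul, T.d₁_odd, mul_neg, sub_neg_eq_add, ← add_mul, ← smul_mul_assoc]
  rfl

lemma even_star (x : R) : T.even (star x) = star (T.even x) := by
  simp [even, map_star, star_smul]
lemma odd_star (x : R) : T.odd (star x) = star (T.odd x) := by
  simp [odd, map_star, star_smul]

lemma tmul_assoc (x y z : R) : T.tmul (T.tmul x y) z = T.tmul x (T.tmul y z) := by
  simp only [tmul, even_add, odd_add, even_mul_even, odd_mul_even, even_mul_odd, odd_mul_odd,
    map_add, map_mul, d₂_even, d₂_odd, d₂_d₂, mul_add, add_mul, mul_assoc]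
  abel

lemma even_tstar (x : R) : T.even (T.tstar x) = star (T.even x) := by
  have h : T.even (T.d₂ (T.odd (star x))) = 0 := even_of' T (by rw [T.comm, T.d₁_odd, map_neg])
  rw [tstar, even_add, even_of T (T.d₁_even _), h, add_zero, even_star]

lemma odd_tstar (x : R) : T.odd (T.tstar x) = T.d₂ (star (T.odd x)) := by
  rw [tstar, odd_add, odd_of T (T.d₁_even _),
    odd_of' T (by rw [T.comm, T.d₁_odd, map_neg]), zero_add, odd_star]

lemma tstar_eq (x : R) : T.tstar x = star (T.even x) + T.d₂ (star (T.odd x)) := by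
  rw [tstar, even_star, odd_star]

lemma tstar_tstar (x : R) : T.tstar (T.tstar x) = x := by
  rw [tstar_eq, even_tstar, odd_tstar, star_star, ← map_star T.d₂ (star _), star_star, T.d₂_d₂, even_add_odd]

lemma tstar_tmul (x y : R) : T.tstar (T.tmul x y) = T.tmul (T.tstar y) (T.tstar x) := by
  rw [tmul.eq_def T (T.tstar y), even_tstar, odd_tstar, tstar_eq, tstar_eq, tmul]
  simp only [even_add, odd_add, even_mul_even, odd_mul_even, even_mul_odd, odd_mul_odd,
    star_add, star_mul, map_add, map_mul, map_star, d₂_even, d₂_odd, d₂_d₂, add_mul]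
  abel

lemma tmul_add (x y z : R) : T.tmul x (y + z) = T.tmul x y + T.tmul x z := by
  simp only [tmul, even_add, odd_add, mul_add]; abel
lemma add_tmul (x y z : R) : T.tmul (x + y) z = T.tmul x z + T.tmul y z := by
  simp only [tmul, map_add, add_mul]; abel
lemma zero_tmul (x : R) : T.tmul 0 x = 0 := by simp [tmul]
lemma tmul_zero (x : R) : T.tmul x 0 = 0 := by simp [tmul, even_zero, odd_zero]
lemma smul_tmul (r : 𝕜) (x y : R) : T.tmul (r • x) y = r • T.tmul x y := by
  simp only [tmul, map_smul, smul_mul_assoc, smul_add]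
lemma tmul_smul (r : 𝕜) (x y : R) : T.tmul x (r • y) = r • T.tmul x y := by
  simp only [tmul, even_smul, odd_smul, mul_smul_comm, smul_add]
lemma tstar_add (x y : R) : T.tstar (x + y) = T.tstar x + T.tstar y := by
  simp only [tstar, star_add, even_add, odd_add, map_add]; abel
lemma tstar_smul (r : 𝕜) (x : R) : T.tstar (r • x) = star r • T.tstar x := by
  simp only [tstar, star_smul, even_smul, odd_smul, map_smul, smul_add]

instance : AddCommGroup T.Tw := inferInstanceAs (AddCommGroup R)
instance : Module 𝕜 T.Tw := inferInstanceAs (Module 𝕜 R)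

instance : NonUnitalRing T.Tw :=
  { (inferInstance : AddCommGroup T.Tw) with
    mul := T.tmul
    zero_mul := T.zero_tmul
    mul_zero := T.tmul_zero
    mul_assoc := T.tmul_assoc
    left_distrib := T.tmul_add
    right_distrib := T.add_tmul }

instance : StarRing T.Tw where
  star := T.tstar
  star_involutive := T.tstar_tstar
  star_mul := T.tstar_tmul
  star_add := T.tstar_add

instance : IsScalarTower 𝕜 T.Tw T.Tw := ⟨T.smul_tmul⟩
instance : SMulCommClass 𝕜 T.Tw T.Tw := ⟨fun r x y => (T.tmul_smul r x y).symm⟩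
instance : StarModule 𝕜 T.Tw := ⟨T.tstar_smul⟩

/-- A `*`-homomorphism compatible with the automorphisms is a `*`-homomorphism of twisted
algebras. -/
def twMap {R' : Type v} [NonUnitalRing R'] [StarRing R'] [Module 𝕜 R'] [IsScalarTower 𝕜 R' R']
    [SMulCommClass 𝕜 R' R'] [StarModule 𝕜 R'] {T : TwistData 𝕜 R} {T' : TwistData 𝕜 R'}
    (f : R →⋆ₙₐ[𝕜] R') (h₁ : ∀ x, f (T.d₁ x) = T'.d₁ (f x)) (h₂ : ∀ x, f (T.d₂ x) = T'.d₂ (f x)) :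
    T.Tw →⋆ₙₐ[𝕜] T'.Tw :=
  have he : ∀ x, f (T.even x) = T'.even (f x) := fun x => by simp [even, h₁]
  have ho : ∀ x, f (T.odd x) = T'.odd (f x) := fun x => by simp [odd, h₁]
  have hm : ∀ x y, f (T.tmul x y) = T'.tmul (f x) (f y) := fun x y => by
    simp only [tmul, map_add, map_mul, he, ho, h₂]
  have hs : ∀ x, f (T.tstar x) = T'.tstar (f x) := fun x => by
    simp only [tstar, map_add, he, ho, h₂, map_star]
  { toFun := f
    map_smul' := fun r x => map_smul f r (show R from x)
    map_zero' := map_zero f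
    map_add' := map_add f
    map_mul' := hm
    map_star' := hs }

end TwistData
end Twist

section Tensor

instance (A : GCAlg.{u} 𝕜) (B : GCAlg.{v} 𝕜) : StarRing (A ⊗[𝕜] B) where
  star_mul x y := by
    induction x with
    | zero => simp
    | add x x' h h' => simp [add_mul, mul_add, h, h']
    | tmul a b =>
      induction y with
      | zero => simp
      | add y y' h h' => simp [add_mul, mul_add, h, h']
      | tmul c d => simp
  star_add := star_add

/-- The tensor product of `*`-homomorphisms on algebraic (ungraded) tensor products. -/
def algMap {A : GCAlg.{u} 𝕜} {B : GCAlg.{v} 𝕜} {A' : GCAlg.{u'} 𝕜} {B' : GCAlg.{v'} 𝕜}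
    (f : A →⋆ₙₐ[𝕜] A') (g : B →⋆ₙₐ[𝕜] B') : A ⊗[𝕜] B →⋆ₙₐ[𝕜] A' ⊗[𝕜] B' :=
  let F : A ⊗[𝕜] B →ₗ[𝕜] A' ⊗[𝕜] B' := TensorProduct.map (f : A →ₗ[𝕜] A') (g : B →ₗ[𝕜] B')
  { toFun := F
    map_smul' := map_smul F
    map_zero' := map_zero F
    map_add' := map_add F
    map_mul' := fun x y => by
      induction x with
      | zero => simp
      | add x x' h h' => simp only [add_mul, map_add, h, h']
      | tmul a b =>
        induction y with
        | zero => simp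
        | add y y' h h' => simp only [mul_add, map_add, h, h']
        | tmul c d => simp [F]
    map_star' := fun x => by
      induction x with
      | zero => simp
      | add x x' h h' => simp only [star_add, map_add, h, h']
      | tmul a b => simp [F, map_star] }

lemma algMap_tmul {A : GCAlg.{u} 𝕜} {B : GCAlg.{v} 𝕜} {A' : GCAlg.{u'} 𝕜} {B' : GCAlg.{v'} 𝕜}
    (f : A →⋆ₙₐ[𝕜] A') (g : B →⋆ₙₐ[𝕜] B') (a : A) (b : B) :
    algMap f g (a ⊗ₜ b) = f a ⊗ₜ g b := rfl

variable (A : GCAlg.{u} 𝕜) (B : GCAlg.{v} 𝕜)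

/-- The twist of `A ⊗ B` by the gradings: on homogeneous elements the twisted operations are
`(a ⊗ b)(c ⊗ d) = (-1)^(deg b * deg c) ac ⊗ bd` and `(a ⊗ b)⋆ = (-1)^(deg a * deg b) a⋆ ⊗ b⋆`. -/
def tensorTwist : TwistData 𝕜 (A ⊗[𝕜] B) where
  d₁ := algMap A.grading (NonUnitalStarAlgHom.id 𝕜 B)
  d₂ := algMap (NonUnitalStarAlgHom.id 𝕜 A) B.grading
  d₁_d₁ x := by
    induction x with
    | zero => simp only [map_zero]
    | add x x' h h' => simp only [map_add, h, h']
    | tmul a b => simp [algMap_tmul, A.grading_grading]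
  d₂_d₂ x := by
    induction x with
    | zero => simp only [map_zero]
    | add x x' h h' => simp only [map_add, h, h']
    | tmul a b => simp [algMap_tmul, B.grading_grading]
  comm x := by
    induction x with
    | zero => simp only [map_zero]
    | add x x' h h' => simp only [map_add, h, h']
    | tmul a b => simp [algMap_tmul]

/-- The algebraic graded tensor product. -/
abbrev AlgTensor := (tensorTwist A B).Tw

/-- The elementary tensor `a ⊗ b`. -/
def algTmul (a : A) (b : B) : AlgTensor A B := (tensorTwist A B).toTw (a ⊗ₜ[𝕜] b)

/-- The tensor product of graded `*`-homomorphisms, on algebraic graded tensor products. -/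
def algTensorMap {A : GCAlg.{u} 𝕜} {B : GCAlg.{v} 𝕜} {A' : GCAlg.{u'} 𝕜} {B' : GCAlg.{v'} 𝕜}
    (f : A →⋆ₙₐ[𝕜] A') (g : B →⋆ₙₐ[𝕜] B') (hf : ∀ a, f (A.grading a) = A'.grading (f a))
    (hg : ∀ b, g (B.grading b) = B'.grading (g b)) : AlgTensor A B →⋆ₙₐ[𝕜] AlgTensor A' B' :=
  TwistData.twMap (algMap f g)
    (fun x => by
      induction x with
      | zero => simp only [map_zero]
      | add x x' h h' => simp only [map_add, h, h']
      | tmul a b => simp [algMap_tmul, tensorTwist, hf])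
    (fun x => by
      induction x with
      | zero => simp only [map_zero]
      | add x x' h h' => simp only [map_add, h, h']
      | tmul a b => simp [algMap_tmul, tensorTwist, hg])

/-- Pull-back of a C*-seminorm. -/
def CStarSeminorm.comap {R : Type u} [NonUnitalRing R] [StarRing R] [Module 𝕜 R]
    {S : Type v} [NonUnitalRing S] [StarRing S] [Module 𝕜 S] (p : CStarSeminorm 𝕜 S)
    (f : R →⋆ₙₐ[𝕜] S) : CStarSeminorm 𝕜 R :=
  { p.toSeminorm.comp (f : R →ₗ[𝕜] S) with
    mul_le := fun x y => by
      have := p.mul_le (f x) (f y)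
      rw [← map_mul] at this
      exact this
    sq_le := fun x y => by
      have := p.sq_le (f x) (f y)
      rw [← map_star, ← map_star, ← map_mul, ← map_mul, ← map_add] at this
      exact this }

/-- The C*-seminorms on the algebraic graded tensor product with `p (a ⊗ b) ≤ ‖a‖ ‖b‖`.  (This
bound holds for every C*-seminorm on the tensor product of C*-algebras.) -/
def tensorEnv : EnvData 𝕜 (AlgTensor A B) where
  grading := algTensorMap A.grading B.grading (fun _ => rfl) (fun _ => rfl)
  grading_grading x := by
    change algMap A.grading B.grading (algMap A.grading B.grading x) = x
    induction x using TensorProduct.induction_on with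
    | zero => simp only [map_zero]
    | add x x' h h' => rw [map_add, map_add, h, h']
    | tmul a b => simp [algMap_tmul, A.grading_grading, B.grading_grading]
  adm := {p | ∀ a b, p.toFun (algTmul A B a b) ≤ ‖a‖ * ‖b‖}
  bdd x := by
    induction x using TensorProduct.induction_on with
    | zero => exact ⟨0, fun p _ => (map_zero p.toSeminorm).le⟩
    | add x x' h h' =>
      obtain ⟨M, hM⟩ := h
      obtain ⟨M', hM'⟩ := h'
      exact ⟨M + M', fun p hp =>
        (map_add_le_add p.toSeminorm x x').trans (add_le_add (hM p hp) (hM' p hp))⟩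
    | tmul a b => exact ⟨_, fun p hp => hp a b⟩
  adm_grading p hp :=
    ⟨p.comap (algTensorMap A.grading B.grading (fun _ => rfl) (fun _ => rfl)), fun a b =>
      (hp (A.grading a) (B.grading b)).trans (mul_le_mul (A.norm_grading_le a)
        (B.norm_grading_le b) (norm_nonneg _) (norm_nonneg _)), fun _ => rfl⟩

/-- The maximal graded tensor product of graded C*-algebras. -/
def tensor : GCAlg.{max u v} 𝕜 := (tensorEnv A B).envelope

end Tensor

infixr:70 " ⊗ᵍ " => tensor

/-- The elementary tensor `a ⊗ b` in the maximal graded tensor product. -/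
def tmul {A : GCAlg.{u} 𝕜} {B : GCAlg.{v} 𝕜} (a : A) (b : B) : (A ⊗ᵍ B : GCAlg 𝕜) :=
  (tensorEnv A B).toEnvelope (algTmul A B a b)

infixr:70 " ⊗ₑ " => tmul

/-- The tensor product of graded `*`-homomorphisms. -/
def GHom.tensor {A : GCAlg.{u} 𝕜} {B : GCAlg.{v} 𝕜} {A' : GCAlg.{u'} 𝕜} {B' : GCAlg.{v'} 𝕜}
    (f : GHom A A') (g : GHom B B') : GHom (A ⊗ᵍ B) (A' ⊗ᵍ B') :=
  EnvData.envelopeMap (algTensorMap f.toHom g.toHom f.map_grading g.map_grading)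
    (fun x => by
      change algMap f.toHom g.toHom (algMap A.grading B.grading x) =
        algMap A'.grading B'.grading (algMap f.toHom g.toHom x)
      induction x using TensorProduct.induction_on with
      | zero => simp only [map_zero]
      | add x x' h h' => rw [map_add, map_add, map_add, map_add, h, h']
      | tmul a b => simp [algMap_tmul, f.map_grading, g.map_grading])
    (fun p hp => ⟨p.comap (algTensorMap f.toHom g.toHom f.map_grading g.map_grading), fun a b =>
      (hp (f a) (g b)).trans (mul_le_mul (f.norm_le a) (g.norm_le b) (norm_nonneg _)
        (norm_nonneg _)), fun _ => rfl⟩)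

/-! ### Clifford algebras -/

/-- Euclidean space `ℝᵐ`. -/
abbrev Euc (m : ℕ) := EuclideanSpace ℝ (Fin m)

/-- The quadratic form `‖v‖²` on `ℝᵐ`. -/
def normSqForm (m : ℕ) : QuadraticForm ℝ (Euc m) :=
  LinearMap.BilinMap.toQuadraticMap (innerₗ (Euc m))

lemma normSqForm_apply {m : ℕ} (v : Euc m) : normSqForm m v = ‖v‖ ^ 2 :=
  real_inner_self_eq_norm_sq v

/-- The real Clifford algebra of `ℝᵐ` with relations `v² = ‖v‖²`. -/
def RealCliff (m : ℕ) : Type := CliffordAlgebra (normSqForm m)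

instance (m : ℕ) : Ring (RealCliff m) := inferInstanceAs (Ring (CliffordAlgebra _))
instance (m : ℕ) : Algebra ℝ (RealCliff m) := inferInstanceAs (Algebra ℝ (CliffordAlgebra _))

/-- The inclusion of the generating vectors. -/
def cliffι (m : ℕ) : Euc m →ₗ[ℝ] RealCliff m := CliffordAlgebra.ι (normSqForm m)

/-- The involution with `v⋆ = v` for vectors `v`. -/
instance (m : ℕ) : StarRing (RealCliff m) where
  star := CliffordAlgebra.reverse (Q := normSqForm m)
  star_involutive := CliffordAlgebra.reverse_reverse
  star_mul := CliffordAlgebra.reverse.map_mul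
  star_add := map_add _

instance (m : ℕ) : StarModule ℝ (RealCliff m) where
  star_smul r x := map_smul (CliffordAlgebra.reverse (Q := normSqForm m)) r x

/-- The algebra automorphism with `v ↦ -v`. -/
def cliffInvolute (m : ℕ) : RealCliff m →ₐ[ℝ] RealCliff m :=
  CliffordAlgebra.involute (Q := normSqForm m)

/-- The homomorphism of Clifford algebras induced by a linear isometry. -/
def cliffMap {m n : ℕ} (T : Euc m →ₗᵢ[ℝ] Euc n) : RealCliff m →ₐ[ℝ] RealCliff n :=
  CliffordAlgebra.map (Q₁ := normSqForm m) (Q₂ := normSqForm n)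
    { T.toLinearMap with
      map_app' := fun v => by
        change normSqForm n (T v) = _
        rw [normSqForm_apply, normSqForm_apply, T.norm_map] }

lemma cliffInvolute_star {m : ℕ} (x : RealCliff m) :
    cliffInvolute m (star x) = star (cliffInvolute m x) :=
  CliffordAlgebra.reverse_involute_commute.eq x |>.symm

lemma cliffMap_ι {m n : ℕ} (T : Euc m →ₗᵢ[ℝ] Euc n) (v : Euc m) :
    cliffMap T (cliffι m v) = cliffι n (T v) :=
  CliffordAlgebra.map_apply_ι _ _

lemma cliff_ind {m : ℕ} {C : RealCliff m → Prop} (h₁ : ∀ r : ℝ, C (algebraMap ℝ _ r))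
    (h₂ : ∀ v, C (cliffι m v)) (h₃ : ∀ x y, C x → C y → C (x * y))
    (h₄ : ∀ x y, C x → C y → C (x + y)) (x : RealCliff m) : C x :=
  CliffordAlgebra.induction (Q := normSqForm m) h₁ h₂ h₃ h₄ x

lemma star_cliffι {m : ℕ} (v : Euc m) : star (cliffι m v) = cliffι m v :=
  CliffordAlgebra.reverse_ι v

lemma star_cliffAlg {m : ℕ} (r : ℝ) :
    star (algebraMap ℝ (RealCliff m) r) = algebraMap ℝ _ r :=
  CliffordAlgebra.reverse.commutes r

lemma cliffMap_star {m n : ℕ} (T : Euc m →ₗᵢ[ℝ] Euc n) (x : RealCliff m) :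
    cliffMap T (star x) = star (cliffMap T x) := by
  induction x using cliff_ind with
  | h₁ r => simp only [star_cliffAlg, AlgHom.commutes]
  | h₂ v => simp only [star_cliffι, cliffMap_ι]
  | h₃ x y hx hy => simp only [star_mul, map_mul, hx, hy]
  | h₄ x y hx hy => simp only [star_add, map_add, hx, hy]

lemma cliffMap_involute {m n : ℕ} (T : Euc m →ₗᵢ[ℝ] Euc n) (x : RealCliff m) :
    cliffMap T (cliffInvolute m x) = cliffInvolute n (cliffMap T x) := by
  have hι : ∀ k (v : Euc k), cliffInvolute k (cliffι k v) = -cliffι k v := fun k v =>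
    CliffordAlgebra.involute_ι v
  induction x using cliff_ind with
  | h₁ r => simp only [AlgHom.commutes]
  | h₂ v => rw [hι, map_neg, cliffMap_ι, hι]
  | h₃ x y hx hy => simp only [map_mul, hx, hy]
  | h₄ x y hx hy => simp only [map_add, hx, hy]

/-- Base change of a `*`-homomorphism of real Clifford algebras. -/
def cliffBase {m n : ℕ} (f : RealCliff m →ₐ[ℝ] RealCliff n) (hf : ∀ x, f (star x) = star (f x)) :
    𝕜 ⊗[ℝ] RealCliff m →⋆ₙₐ[𝕜] 𝕜 ⊗[ℝ] RealCliff n :=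
  let F := Algebra.TensorProduct.map (AlgHom.id 𝕜 𝕜) f
  { (F : 𝕜 ⊗[ℝ] RealCliff m →ₙₐ[𝕜] 𝕜 ⊗[ℝ] RealCliff n) with
    map_star' := fun x => by
      change F (star x) = star (F x)
      induction x with
      | zero => simp
      | add x y hx hy => rw [star_add, map_add, map_add, star_add, hx, hy]
      | tmul r x => simp [F, hf] }

instance (m : ℕ) : StarModule 𝕜 (𝕜 ⊗[ℝ] RealCliff m) where
  star_smul r x := by
    induction x with
    | zero => simp
    | add x y hx hy => rw [smul_add, star_add, star_add, hx, hy, smul_add]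
    | tmul s x => simp [TensorProduct.smul_tmul']

variable (𝕜) in
/-- The C*-seminorms on the Clifford algebra `𝕜 ⊗ Cliff(ℝᵐ)` with `p 1 ≤ 1`, `p v ≤ ‖v‖`.  (These
bounds hold for every C*-seminorm.) -/
def cliffEnv (m : ℕ) : EnvData 𝕜 (𝕜 ⊗[ℝ] RealCliff m) where
  grading := cliffBase (cliffInvolute m) cliffInvolute_star
  grading_grading x := by
    induction x with
    | zero => simp only [map_zero]
    | add x y hx hy => rw [map_add, map_add, hx, hy]
    | tmul r x =>
      change r ⊗ₜ[ℝ] _ = _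
      congr 1
      exact CliffordAlgebra.involute_involute (Q := normSqForm m) x
  adm := {p | p.toFun 1 ≤ 1 ∧ ∀ v, p.toFun (1 ⊗ₜ cliffι m v) ≤ ‖v‖}
  bdd x := by
    let adm : Set (CStarSeminorm 𝕜 (𝕜 ⊗[ℝ] RealCliff m)) :=
      {p | p.toFun 1 ≤ 1 ∧ ∀ v, p.toFun (1 ⊗ₜ cliffι m v) ≤ ‖v‖}
    let B : 𝕜 ⊗[ℝ] RealCliff m → Prop := fun x => ∃ M : ℝ, ∀ p ∈ adm, p.toFun x ≤ M
    change B x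
    have hadd : ∀ x y, B x → B y → B (x + y) := by
      rintro x y ⟨M, hM⟩ ⟨M', hM'⟩
      exact ⟨M + M', fun p hp =>
        (map_add_le_add p.toSeminorm x y).trans (add_le_add (hM p hp) (hM' p hp))⟩
    have hsmul : ∀ (r : 𝕜) x, B x → B (r • x) := by
      rintro r x ⟨M, hM⟩
      exact ⟨‖r‖ * M, fun p hp => (map_smul_eq_mul p.toSeminorm r x).le.trans
        (mul_le_mul_of_nonneg_left (hM p hp) (norm_nonneg r))⟩
    induction x with
    | zero => exact ⟨0, fun p _ => (map_zero p.toSeminorm).le⟩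
    | add x y hx hy => exact hadd x y hx hy
    | tmul r x =>
      have : r ⊗ₜ[ℝ] x = r • ((1 : 𝕜) ⊗ₜ[ℝ] x) := by rw [TensorProduct.smul_tmul', smul_eq_mul, mul_one]
      rw [this]
      apply hsmul
      clear this
      induction x using cliff_ind with
      | h₁ s =>
        have : (1 : 𝕜) ⊗ₜ[ℝ] algebraMap ℝ (RealCliff m) s = (s : 𝕜) • 1 := by
          rw [Algebra.algebraMap_eq_smul_one, TensorProduct.tmul_smul,
            ← Algebra.TensorProduct.one_def, RCLike.real_smul_eq_coe_smul (K := 𝕜)]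
        rw [this]
        exact hsmul _ _ ⟨1, fun p hp => hp.1⟩
      | h₂ v => exact ⟨_, fun p hp => hp.2 v⟩
      | h₃ x y hx hy =>
        obtain ⟨M, hM⟩ := hx
        obtain ⟨M', hM'⟩ := hy
        refine ⟨M * M', fun p hp => ?_⟩
        have := p.mul_le ((1 : 𝕜) ⊗ₜ[ℝ] x) (1 ⊗ₜ[ℝ] y)
        rw [Algebra.TensorProduct.tmul_mul_tmul, mul_one] at this
        exact this.trans (mul_le_mul (hM p hp) (hM' p hp) (p.nonneg _)
          ((p.nonneg _).trans (hM p hp)))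
      | h₄ x y hx hy => rw [TensorProduct.tmul_add]; exact hadd _ _ hx hy
  adm_grading p hp := ⟨p.comap (cliffBase (cliffInvolute m) cliffInvolute_star), by
    refine ⟨?_, fun v => ?_⟩
    · have : cliffBase (𝕜 := 𝕜) (cliffInvolute m) cliffInvolute_star 1 = 1 :=
        map_one (Algebra.TensorProduct.map (AlgHom.id 𝕜 𝕜) (cliffInvolute m))
      exact (congrArg p.toFun this).le.trans hp.1
    · have : cliffBase (𝕜 := 𝕜) (cliffInvolute m) cliffInvolute_star (1 ⊗ₜ cliffι m v) =
          1 ⊗ₜ cliffι m (-v) := by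
        change (1 : 𝕜) ⊗ₜ[ℝ] cliffInvolute m (cliffι m v) = _
        rw [map_neg]
        exact congrArg _ (CliffordAlgebra.involute_ι v)
      exact (congrArg p.toFun this).le.trans ((hp.2 (-v)).trans (norm_neg v).le), fun _ => rfl⟩

variable (𝕜) in
/-- The Clifford C*-algebra `𝔽_{m,0}` over `𝕜`, with `m` odd self-adjoint anticommuting generators
of square `1`. -/
def Cliff (m : ℕ) : GCAlg.{0} 𝕜 := (cliffEnv 𝕜 m).envelope

variable (𝕜) in
/-- The unit of the Clifford algebra. -/
def Cliff.one (m : ℕ) : Cliff 𝕜 m := (cliffEnv 𝕜 m).toEnvelope 1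

variable (𝕜) in
/-- A vector as an element of the Clifford algebra. -/
def Cliff.vec {m : ℕ} (v : Euc m) : Cliff 𝕜 m := (cliffEnv 𝕜 m).toEnvelope (1 ⊗ₜ cliffι m v)

variable (𝕜) in
/-- The homomorphism of Clifford algebras with `v ↦ T v`. -/
def Cliff.map {m n : ℕ} (T : Euc m →ₗᵢ[ℝ] Euc n) : GHom (Cliff 𝕜 m) (Cliff 𝕜 n) :=
  EnvData.envelopeMap (cliffBase (cliffMap T) (cliffMap_star T))
    (fun x => by
      induction x with
      | zero => simp only [map_zero]
      | add x y hx hy => rw [map_add, map_add, map_add, map_add, hx, hy]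
      | tmul r x => exact congrArg (r ⊗ₜ[ℝ] ·) (cliffMap_involute T x))
    (fun p hp => ⟨p.comap (cliffBase (cliffMap T) (cliffMap_star T)), by
      refine ⟨?_, fun v => ?_⟩
      · have : cliffBase (𝕜 := 𝕜) (cliffMap T) (cliffMap_star T) 1 = 1 :=
          map_one (Algebra.TensorProduct.map (AlgHom.id 𝕜 𝕜) (cliffMap T))
        exact (congrArg p.toFun this).le.trans hp.1
      · have : cliffBase (𝕜 := 𝕜) (cliffMap T) (cliffMap_star T) (1 ⊗ₜ cliffι m v) =
            1 ⊗ₜ cliffι n (T v) := congrArg ((1 : 𝕜) ⊗ₜ[ℝ] ·) (cliffMap_ι T v)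
        exact (congrArg p.toFun this).le.trans ((hp.2 (T v)).trans (T.norm_map v).le),
      fun _ => rfl⟩)

/-! ### Examples: scalars, functions, compact operators -/

variable (𝕜) in
/-- The field `𝕜`, trivially graded. -/
def scalars : GCAlg.{0} 𝕜 where
  carrier := 𝕜
  norm_sq_le a b := by
    have h : star a * a + star b * b = ((‖a‖ ^ 2 + ‖b‖ ^ 2 : ℝ) : 𝕜) := by
      simp only [RCLike.star_def, RCLike.conj_mul]; push_cast; rfl
    rw [h, RCLike.norm_ofReal, abs_of_nonneg (by positivity)]
    nlinarith [sq_nonneg ‖b‖]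
  grading := NonUnitalStarAlgHom.id 𝕜 𝕜
  grading_grading _ := rfl
  norm_grading_le _ := le_rfl

open scoped ZeroAtInfty in
variable (𝕜) in
/-- The algebra `𝒮 = C₀(ℝ)`, graded by `f(x) ↦ f(-x)`. -/
def funS : GCAlg.{0} 𝕜 where
  carrier := C₀(ℝ, 𝕜)
  norm_sq_le f g := by
    rw [← Real.le_sqrt (norm_nonneg _) (norm_nonneg _),
      ← ZeroAtInftyContinuousMap.norm_toBCF_eq_norm,
      BoundedContinuousFunction.norm_le (Real.sqrt_nonneg _)]
    intro x
    rw [Real.le_sqrt (norm_nonneg _) (norm_nonneg _)]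
    refine ((scalars 𝕜).norm_sq_le (f x) (g x)).trans ?_
    rw [← ZeroAtInftyContinuousMap.norm_toBCF_eq_norm]
    exact BoundedContinuousFunction.norm_coe_le_norm
      (star f * f + star g * g : C₀(ℝ, 𝕜)).toBCF x
  grading :=
    let N : CocompactMap ℝ ℝ := ⟨⟨fun x => -x, continuous_neg⟩,
      (Homeomorph.neg ℝ).isClosedEmbedding.tendsto_cocompact⟩
    { ZeroAtInftyContinuousMap.compNonUnitalAlgHom (R := 𝕜) N with
      map_star' := fun _ => rfl }
  grading_grading f := by
    ext x
    exact congrArg f (neg_neg x)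
  norm_grading_le f := by
    rw [← ZeroAtInftyContinuousMap.norm_toBCF_eq_norm,
      BoundedContinuousFunction.norm_le (norm_nonneg _)]
    intro x
    rw [← ZeroAtInftyContinuousMap.norm_toBCF_eq_norm]
    exact BoundedContinuousFunction.norm_coe_le_norm f.toBCF (-x)

/-- The algebra `C(Y, B)` of continuous functions on a compact space, graded pointwise. -/
def funC (Y : Type w) [TopologicalSpace Y] [CompactSpace Y] (B : GCAlg.{u} 𝕜) :
    GCAlg.{max w u} 𝕜 where
  carrier := C(Y, B)
  norm_sq_le f g := by
    rw [← Real.le_sqrt (norm_nonneg _) (norm_nonneg _),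
      ContinuousMap.norm_le _ (Real.sqrt_nonneg _)]
    intro x
    rw [Real.le_sqrt (norm_nonneg _) (norm_nonneg _)]
    exact (B.norm_sq_le (f x) (g x)).trans ((star f * f + star g * g).norm_coe_le_norm x)
  grading :=
    have hc : Continuous B.grading :=
      AddMonoidHomClass.continuous_of_bound B.grading 1 fun b => by
        rw [one_mul]; exact B.norm_grading_le b
    { toFun := fun f => ⟨fun y => B.grading (f y), hc.comp f.continuous⟩
      map_smul' := fun r f => by ext; simp
      map_zero' := by ext; simp
      map_add' := fun f g => by ext; simp
      map_mul' := fun f g => by ext; simp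
      map_star' := fun f => by ext; simp [map_star] }
  grading_grading f := by
    ext y
    exact B.grading_grading (f y)
  norm_grading_le f := by
    refine (ContinuousMap.norm_le _ (norm_nonneg _)).2 fun y => ?_
    exact (B.norm_grading_le (f y)).trans (f.norm_coe_le_norm y)

/-- A graded Hilbert space: a Hilbert space with a self-adjoint unitary `ε`, whose eigenspaces for
`1` and `-1` are the even and the odd part. -/
structure GradedHilbert (𝕜 : Type) [RCLike 𝕜] where
  carrier : Type u
  [normed : NormedAddCommGroup carrier]
  [inner : InnerProductSpace 𝕜 carrier]
  [complete : CompleteSpace carrier]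
  ε : carrier →L[𝕜] carrier
  ε_adjoint : star ε = ε
  ε_sq : ε * ε = 1

attribute [instance] GradedHilbert.normed GradedHilbert.inner GradedHilbert.complete

section Compact

variable (H : GradedHilbert.{u} 𝕜)

/-- The `*`-algebra of compact operators on `H` (the adjoint of a compact operator is compact). -/
def compactOps : NonUnitalStarSubalgebra 𝕜 (H.carrier →L[𝕜] H.carrier) where
  carrier := {T | IsCompactOperator T ∧ IsCompactOperator (star T : H.carrier →L[𝕜] H.carrier)}
  add_mem' h h' := ⟨h.1.add h'.1, by rw [star_add]; exact h.2.add h'.2⟩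
  zero_mem' := ⟨isCompactOperator_zero, by rw [star_zero]; exact isCompactOperator_zero⟩
  mul_mem' {S T} h h' := ⟨h.1.comp_clm T, by rw [star_mul]; exact h'.2.comp_clm _⟩
  smul_mem' r T h := ⟨h.1.smul r, by rw [star_smul]; exact h.2.smul _⟩
  star_mem' h := ⟨h.2, by rw [star_star]; exact h.1⟩

instance : CompleteSpace (compactOps H) := by
  have h1 : IsClosed {T : H.carrier →L[𝕜] H.carrier | IsCompactOperator T} :=
    isClosed_setOfPred_isCompactOperator
  exact (h1.inter (h1.preimage continuous_star)).completeSpace_coe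

lemma opNorm_sq_le (S T : H.carrier →L[𝕜] H.carrier) : ‖S‖ ^ 2 ≤ ‖star S * S + star T * T‖ := by
  rw [← Real.le_sqrt (norm_nonneg _) (norm_nonneg _)]
  refine ContinuousLinearMap.opNorm_le_bound _ (Real.sqrt_nonneg _) fun x => ?_
  rw [← Real.sqrt_sq (norm_nonneg x), ← Real.sqrt_mul (norm_nonneg _)]
  refine Real.le_sqrt_of_sq_le ?_
  have h : RCLike.re (inner 𝕜 x ((star S * S + star T * T) x)) = ‖S x‖ ^ 2 + ‖T x‖ ^ 2 := by
    have e (R : H.carrier →L[𝕜] H.carrier) :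
        inner 𝕜 x ((star R * R) x) = inner 𝕜 (R x) (R x) :=
      ContinuousLinearMap.adjoint_inner_right R x (R x)
    rw [add_apply, inner_add_right, e, e, map_add,
      inner_self_eq_norm_sq, inner_self_eq_norm_sq]
  calc ‖S x‖ ^ 2 ≤ RCLike.re (inner 𝕜 x ((star S * S + star T * T) x)) := by
        rw [h]; exact le_add_of_nonneg_right (sq_nonneg _)
    _ ≤ ‖x‖ * ‖(star S * S + star T * T) x‖ := re_inner_le_norm _ _
    _ ≤ ‖x‖ * (‖star S * S + star T * T‖ * ‖x‖) := by
        gcongr; exact ContinuousLinearMap.le_opNorm _ _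
    _ = _ := by ring

lemma norm_ε_conj_le (T : H.carrier →L[𝕜] H.carrier) : ‖H.ε * T * H.ε‖ ≤ ‖T‖ := by
  have h1 : ‖H.ε‖ ≤ 1 := by
    have := opNorm_sq_le H H.ε 0
    rw [H.ε_adjoint, H.ε_sq, mul_zero, add_zero] at this
    have h2 := this.trans ContinuousLinearMap.norm_id_le
    nlinarith [norm_nonneg H.ε]
  calc _ ≤ ‖H.ε‖ * ‖T‖ * ‖H.ε‖ :=
        (norm_mul_le _ _).trans (mul_le_mul_of_nonneg_right (norm_mul_le _ _) (norm_nonneg _))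
    _ ≤ 1 * ‖T‖ * 1 := by gcongr
    _ = _ := by ring

/-- The compact operators `𝒦(H)`, with the grading `T ↦ ε T ε` for which diagonal operators are even
and off-diagonal operators are odd. -/
def compacts : GCAlg.{u} 𝕜 where
  carrier := compactOps H
  norm_sq_le S T := opNorm_sq_le H S T
  grading :=
    { toFun := fun T => ⟨H.ε * T * H.ε, (T.2.1.clm_comp H.ε).comp_clm H.ε, by
        rw [star_mul, star_mul, H.ε_adjoint, ← mul_assoc]
        exact (T.2.2.clm_comp H.ε).comp_clm H.ε⟩
      map_smul' := fun r T => by ext1; simp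
      map_zero' := by ext1; simp
      map_add' := fun S T => by ext1; simp [mul_add, add_mul]
      map_mul' := fun S T => by
        ext1
        change H.ε * (S * T) * H.ε = H.ε * S * H.ε * (H.ε * T * H.ε)
        simp only [mul_assoc]
        rw [← mul_assoc H.ε H.ε, H.ε_sq, one_mul]
      map_star' := fun T => by
        ext1
        change H.ε * star (T : H.carrier →L[𝕜] H.carrier) * H.ε = star (H.ε * T * H.ε)
        rw [star_mul, star_mul, H.ε_adjoint, mul_assoc] }
  grading_grading T := by
    ext1
    change H.ε * (H.ε * T * H.ε) * H.ε = T
    rw [mul_assoc H.ε T, ← mul_assoc, ← mul_assoc, H.ε_sq, one_mul, mul_assoc, H.ε_sq, mul_one]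
  norm_grading_le T := norm_ε_conj_le H T

end Compact

/-! ### Quasi-topological spaces -/

/-- A quasi-topology on `X`: for each compact Hausdorff space `C` a set `Q(C, X)` of maps from `C`
to `X`, called quasi-continuous, subject to Spanier's axioms. -/
structure QTop (X : Type u) where
  Q : ∀ (C : Type w) [TopologicalSpace C] [CompactSpace C] [T2Space C], Set (C → X)
  const : ∀ (C : Type w) [TopologicalSpace C] [CompactSpace C] [T2Space C] (x : X),
    (fun _ => x) ∈ Q C
  comp : ∀ {C D : Type w} [TopologicalSpace C] [CompactSpace C] [T2Space C]
    [TopologicalSpace D] [CompactSpace D] [T2Space D] (f : C → D) (h : D → X),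
    Continuous f → h ∈ Q D → h ∘ f ∈ Q C
  sum : ∀ {C D : Type w} [TopologicalSpace C] [CompactSpace C] [T2Space C]
    [TopologicalSpace D] [CompactSpace D] [T2Space D] (h : C ⊕ D → X),
    h ∈ Q (C ⊕ D) ↔ h ∘ Sum.inl ∈ Q C ∧ h ∘ Sum.inr ∈ Q D
  surj : ∀ {C D : Type w} [TopologicalSpace C] [CompactSpace C] [T2Space C]
    [TopologicalSpace D] [CompactSpace D] [T2Space D] (f : C → D) (h : D → X),
    Continuous f → Function.Surjective f → h ∘ f ∈ Q C → h ∈ Q D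

namespace QTop

/-- The quasi-topology of a topological space: the quasi-continuous maps are the continuous maps. -/
def ofTop (X : Type u) [TopologicalSpace X] : QTop.{u, w} X where
  Q _ _ _ _ := {h | Continuous h}
  const _ _ _ _ _ := continuous_const
  comp _ _ hf hh := hh.comp hf
  sum _ := continuous_sum_dom
  surj _ _ hf hs hh := ((hf.isClosedMap.isQuotientMap hf hs).continuous_iff).2 hh

/-- The smallest quasi-topology for which the maps in a given family are quasi-continuous. -/
def generate {X : Type u}
    (S : ∀ (C : Type w) [TopologicalSpace C] [CompactSpace C] [T2Space C], Set (C → X)) :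
    QTop.{u, w} X where
  Q C _ _ _ := {h | ∀ T : QTop.{u, w} X, (∀ (D : Type w) [TopologicalSpace D] [CompactSpace D]
    [T2Space D], S D ⊆ T.Q D) → h ∈ T.Q C}
  const C _ _ _ x T _ := T.const C x
  comp f h hf hh T hT := T.comp f h hf (hh T hT)
  sum h := by
    refine ⟨fun H => ⟨fun T hT => ((T.sum h).1 (H T hT)).1, fun T hT => ((T.sum h).1 (H T hT)).2⟩,
      fun H T hT => (T.sum h).2 ⟨H.1 T hT, H.2 T hT⟩⟩
  surj f h hf hs hh T hT := T.surj f h hf hs (hh T hT)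

/-- Quasi-continuity of a map of quasi-topological spaces. -/
def QCont {X : Type u} {Y : Type v} (TX : QTop.{u, w} X) (TY : QTop.{v, w} Y) (f : X → Y) : Prop :=
  ∀ (C : Type w) [TopologicalSpace C] [CompactSpace C] [T2Space C] (h : C → X),
    h ∈ TX.Q C → f ∘ h ∈ TY.Q C

/-- Joint quasi-continuity of a map `P × X → Y`, for a topological space `P` and quasi-topological
spaces `X` and `Y`. -/
def QCont₂ {P : Type u'} [TopologicalSpace P] {X : Type u} {Y : Type v} (TX : QTop.{u, w} X)
    (TY : QTop.{v, w} Y) (f : P → X → Y) : Prop :=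
  ∀ (C : Type w) [TopologicalSpace C] [CompactSpace C] [T2Space C] (p : C → P) (h : C → X),
    Continuous p → h ∈ TX.Q C → (fun c => f (p c) (h c)) ∈ TY.Q C

end QTop

/-! ### Asymptotic morphisms -/

/-- A graded asymptotic morphism from `A` to `B`. -/
structure Asy (A : GCAlg.{u} 𝕜) (B : GCAlg.{v} 𝕜) where
  toFun : Set.Ici (1 : ℝ) → A → B
  continuous : ∀ a, Continuous fun t => toFun t a
  bounded : ∀ a, ∃ M : ℝ, ∀ t, ‖toFun t a‖ ≤ M
  asymp_mul : ∀ a b, Tendsto (fun t => ‖toFun t (a * b) - toFun t a * toFun t b‖) atTop (𝓝 0)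
  asymp_add_smul : ∀ (a b : A) (r : 𝕜),
    Tendsto (fun t => ‖toFun t (a + r • b) - toFun t a - r • toFun t b‖) atTop (𝓝 0)
  asymp_star : ∀ a, Tendsto (fun t => ‖toFun t (star a) - star (toFun t a)‖) atTop (𝓝 0)
  asymp_grading : ∀ a,
    Tendsto (fun t => ‖toFun t (A.grading a) - B.grading (toFun t a)‖) atTop (𝓝 0)

lemma GHom.continuous {A : GCAlg.{u} 𝕜} {B : GCAlg.{v} 𝕜} (f : GHom A B) : Continuous f :=
  AddMonoidHomClass.continuous_of_bound f.toHom 1 fun a => by rw [one_mul]; exact f.norm_le a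

namespace Asy

variable {A : GCAlg.{u} 𝕜} {B : GCAlg.{v} 𝕜} {C : GCAlg.{w} 𝕜}

instance : Zero (Asy A B) :=
  ⟨⟨fun _ _ => 0, fun _ => continuous_const, fun _ => ⟨0, by simp⟩, by simp, by simp, by simp,
    by simp⟩⟩

/-- Composition of an asymptotic morphism with a homomorphism. -/
def compHom (φ : Asy B C) (f : GHom A B) : Asy A C where
  toFun t a := φ.toFun t (f a)
  continuous a := φ.continuous _
  bounded a := φ.bounded _
  asymp_mul a b := by simpa using φ.asymp_mul (f a) (f b)
  asymp_add_smul a b r := by simpa using φ.asymp_add_smul (f a) (f b) r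
  asymp_star a := by simpa [map_star] using φ.asymp_star (f a)
  asymp_grading a := by simpa [f.map_grading] using φ.asymp_grading (f a)

/-- Composition of a homomorphism with an asymptotic morphism. -/
def homComp (g : GHom B C) (φ : Asy A B) : Asy A C where
  toFun t a := g (φ.toFun t a)
  continuous a := g.continuous.comp (φ.continuous a)
  bounded a := (φ.bounded a).imp fun _ hM t => (g.norm_le _).trans (hM t)
  asymp_mul a b := squeeze_zero (fun _ => norm_nonneg _)
    (fun t => by rw [← map_mul, ← map_sub]; exact g.norm_le _) (φ.asymp_mul a b)
  asymp_add_smul a b r := squeeze_zero (fun _ => norm_nonneg _)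
    (fun t => by rw [← map_smul, ← map_sub, ← map_sub]; exact g.norm_le _) (φ.asymp_add_smul a b r)
  asymp_star a := squeeze_zero (fun _ => norm_nonneg _)
    (fun t => by rw [← map_star, ← map_sub]; exact g.norm_le _) (φ.asymp_star a)
  asymp_grading a := squeeze_zero (fun _ => norm_nonneg _)
    (fun t => by rw [← g.map_grading, ← map_sub]; exact g.norm_le _) (φ.asymp_grading a)

variable (A B) in
/-- Asymptotic equivalence: `‖φ_t a - ψ_t a‖ → 0` for all `a`. -/
def setoid : Setoid (Asy A B) where
  r φ ψ := ∀ a, Tendsto (fun t => ‖φ.toFun t a - ψ.toFun t a‖) atTop (𝓝 0)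
  iseqv :=
    { refl := fun φ a => by simp
      symm := fun h a => by simpa [norm_sub_rev] using h a
      trans := fun {φ ψ χ} h h' a => by
        refine squeeze_zero (fun _ => norm_nonneg _)
          (fun t => norm_sub_le_norm_sub_add_norm_sub _ (ψ.toFun t a) _) ?_
        simpa using (h a).add (h' a) }

/-- The value at `y` of an asymptotic morphism to `C(Y, B)`. -/
def eval {Y : Type w} [TopologicalSpace Y] [CompactSpace Y] (Φ : Asy A (funC Y B)) (y : Y) :
    Asy A B :=
  homComp
    { toHom :=
        { toFun := fun f : C(Y, B) => f y
          map_smul' := fun _ _ => rfl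
          map_zero' := rfl
          map_add' := fun _ _ => rfl
          map_mul' := fun _ _ => rfl
          map_star' := fun _ => rfl }
      map_grading := fun _ => rfl
      norm_le := fun f => ContinuousMap.norm_coe_le_norm (f : C(Y, B)) y } Φ

end Asy

/-- Graded asymptotic morphisms modulo asymptotic equivalence. -/
def AsyClass (A : GCAlg.{u} 𝕜) (B : GCAlg.{v} 𝕜) := Quotient (Asy.setoid A B)

namespace AsyClass

variable {A : GCAlg.{u} 𝕜} {B : GCAlg.{v} 𝕜} {C : GCAlg.{w} 𝕜}

/-- The class of an asymptotic morphism. -/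
def mk (φ : Asy A B) : AsyClass A B := Quotient.mk _ φ

instance : Zero (AsyClass A B) := ⟨mk 0⟩

/-- Composition of an asymptotic morphism with a homomorphism, on classes. -/
def compHom (x : AsyClass B C) (f : GHom A B) : AsyClass A C :=
  Quotient.map (fun φ : Asy B C => φ.compHom f) (fun φ ψ h a => (h : ∀ b, Tendsto (fun t => ‖φ.toFun t b - ψ.toFun t b‖) atTop (𝓝 0)) (f a)) x

/-- Composition of a homomorphism with an asymptotic morphism, on classes. -/
def homComp (g : GHom B C) (x : AsyClass A B) : AsyClass A C :=
  Quotient.map (fun φ : Asy A B => Asy.homComp g φ)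
    (fun φ ψ (h : ∀ b, Tendsto (fun t => ‖φ.toFun t b - ψ.toFun t b‖) atTop (𝓝 0)) a =>
      squeeze_zero (fun _ => norm_nonneg _) (fun t => by
        change ‖g (φ.toFun t a) - g (ψ.toFun t a)‖ ≤ _
        rw [← map_sub]; exact g.norm_le _) (h a)) x

open Classical in
/-- The unique class of asymptotic morphisms with the property `P` (and `0` if there is none). -/
def the (P : AsyClass A B → Prop) : AsyClass A B := if h : ∃! x, P x then h.choose else 0

/-- `z` is the class of `id_D ⊗ φ` for `φ` in the class `x`: the asymptotic morphism with
`d ⊗ a ↦ d ⊗ φ_t(a)`, asymptotically. -/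
def IsLeftTensor (D : GCAlg.{u'} 𝕜) (x : AsyClass A B) (z : AsyClass (D ⊗ᵍ A) (D ⊗ᵍ B)) : Prop :=
  ∃ (φ : Asy A B) (γ : Asy (D ⊗ᵍ A) (D ⊗ᵍ B)), mk φ = x ∧ mk γ = z ∧ ∀ (d : D) (a : A),
    Tendsto (fun t => ‖γ.toFun t (d ⊗ₑ a) - d ⊗ₑ φ.toFun t a‖) atTop (𝓝 0)

/-- `z` is the class of `φ ⊗ id_D` for `φ` in the class `x`: the asymptotic morphism with
`a ⊗ d ↦ φ_t(a) ⊗ d`, asymptotically. -/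
def IsRightTensor (x : AsyClass A B) (D : GCAlg.{u'} 𝕜) (z : AsyClass (A ⊗ᵍ D) (B ⊗ᵍ D)) : Prop :=
  ∃ (φ : Asy A B) (γ : Asy (A ⊗ᵍ D) (B ⊗ᵍ D)), mk φ = x ∧ mk γ = z ∧ ∀ (a : A) (d : D),
    Tendsto (fun t => ‖γ.toFun t (a ⊗ₑ d) - φ.toFun t a ⊗ₑ d‖) atTop (𝓝 0)

/-- The tensor product `id_D ⊗ x`. -/
def leftTensor (D : GCAlg.{u'} 𝕜) (x : AsyClass A B) : AsyClass (D ⊗ᵍ A) (D ⊗ᵍ B) :=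
  the (IsLeftTensor D x)

/-- The tensor product `x ⊗ id_D`. -/
def rightTensor (x : AsyClass A B) (D : GCAlg.{u'} 𝕜) : AsyClass (A ⊗ᵍ D) (B ⊗ᵍ D) :=
  the (IsRightTensor x D)

variable (A B) in
/-- The quasi-topology on classes of asymptotic morphisms.  The quasi-continuous families of
asymptotic morphisms indexed by `Y` are the asymptotic morphisms from `A` to `C(Y, B)`, and the set
of classes carries the corresponding quotient quasi-topology. -/
def qtop : QTop.{max u v, w} (AsyClass A B) :=
  QTop.generate fun Y _ _ _ => {h | ∃ Φ : Asy A (funC Y B), h = fun y => mk (Φ.eval y)}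

end AsyClass

/-! ### Orthogonal groups -/

/-- The orthogonal group `O(n)`. -/
abbrev O (n : ℕ) := Matrix.orthogonalGroup (Fin n) ℝ

/-- The isometry `v ↦ M v` of `ℝⁿ`. -/
def O.isom {n : ℕ} (M : O n) : Euc n →ₗᵢ[ℝ] Euc n where
  toLinearMap := Matrix.toEuclideanLin (M : Matrix (Fin n) (Fin n) ℝ)
  norm_map' v := by
    have h : (M : Matrix (Fin n) (Fin n) ℝ).transpose * M = 1 :=
      (Matrix.mem_orthogonalGroup_iff' (Fin n) ℝ).1 M.2
    rw [EuclideanSpace.norm_eq, EuclideanSpace.norm_eq]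
    congr 1
    simp only [Real.norm_eq_abs, sq, abs_mul_abs_self]
    change (M : Matrix (Fin n) (Fin n) ℝ).mulVec v.ofLp ⬝ᵥ
      (M : Matrix (Fin n) (Fin n) ℝ).mulVec v.ofLp = v.ofLp ⬝ᵥ v.ofLp
    rw [Matrix.dotProduct_mulVec, Matrix.vecMul_mulVec, ← Matrix.dotProduct_mulVec, h]
    simp

/-- The permutation matrix with `e_i ↦ e_{π i}`. -/
def O.perm {n : ℕ} (π : Equiv.Perm (Fin n)) : O n :=
  ⟨Matrix.of fun i j => if i = π j then 1 else 0, by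
    rw [Matrix.mem_orthogonalGroup_iff']
    ext i j
    simp [Matrix.mul_apply, Matrix.one_apply, eq_comm]⟩

/-- The permutation matrix moving the last basis vector to the front. -/
def O.χ (q : ℕ) : O (q + 1) := O.perm (finRotate (q + 1))

/-- The block sum `O(p) × O(q) → O(n)`, `n = p + q`. -/
def O.blk {p q n : ℕ} (h : p + q = n) (a : O p) (b : O q) : O n :=
  ⟨Matrix.reindex (finSumFinEquiv.trans (finCongr h)) (finSumFinEquiv.trans (finCongr h))
      (Matrix.fromBlocks (a : Matrix (Fin p) (Fin p) ℝ) 0 0 (b : Matrix (Fin q) (Fin q) ℝ)), by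
    have ha := (Matrix.mem_orthogonalGroup_iff' (Fin p) ℝ).1 a.2
    have hb := (Matrix.mem_orthogonalGroup_iff' (Fin q) ℝ).1 b.2
    rw [Matrix.mem_orthogonalGroup_iff']
    rw [Matrix.reindex_apply, Matrix.transpose_submatrix, Matrix.submatrix_mul_equiv, Matrix.fromBlocks_transpose,
      Matrix.fromBlocks_multiply]
    rw [ha, hb]
    simp only [Matrix.transpose_zero, Matrix.zero_mul, Matrix.mul_zero, add_zero, zero_add,
      Matrix.fromBlocks_one, Matrix.submatrix_one_equiv]⟩

namespace O

lemma blk_mul {p q n : ℕ} (h : p + q = n) (a a' : O p) (b b' : O q) :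
    blk h (a * a') (b * b') = blk h a b * blk h a' b' := by
  apply Subtype.ext
  simp only [blk, Submonoid.coe_mul, Matrix.reindex_apply]
  rw [Matrix.submatrix_mul_equiv, Matrix.fromBlocks_multiply]
  simp only [Matrix.zero_mul, Matrix.mul_zero, add_zero, zero_add]

section entries

variable {p q : ℕ} (a : O p) (b : O q)

lemma blk_LL (i j : Fin p) : (blk rfl a b).1 (Fin.castAdd q i) (Fin.castAdd q j) = a.1 i j := by
  simp [blk]
lemma blk_LR (i : Fin p) (j : Fin q) :
    (blk rfl a b).1 (Fin.castAdd q i) (Fin.natAdd p j) = 0 := by simp [blk]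
lemma blk_RL (i : Fin q) (j : Fin p) :
    (blk rfl a b).1 (Fin.natAdd p i) (Fin.castAdd q j) = 0 := by simp [blk]
lemma blk_RR (i j : Fin q) : (blk rfl a b).1 (Fin.natAdd p i) (Fin.natAdd p j) = b.1 i j := by
  simp [blk]

end entries

lemma blk_assoc {p q n r : ℕ} (h : p + q = n) (a : O p) (b : O q) (c : O r) :
    blk (n := n + r) rfl (blk h a b) c = blk (by omega) a (blk (n := q + r) rfl b c) := by
  subst h
  have key : ∀ {m : ℕ} (h : p + (q + r) = m) (i j : Fin (p + q + r)),
      (blk (n := p + q + r) rfl (blk rfl a b) c).1 i j =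
        (blk h a (blk (n := q + r) rfl b c)).1 (Fin.cast (by omega) i) (Fin.cast (by omega) j) := by
    rintro m rfl i j
    have e1 : ∀ k : Fin p, Fin.cast (Nat.add_assoc p q r) (Fin.castAdd r (Fin.castAdd q k)) =
      Fin.castAdd (q + r) k := fun k => rfl
    have e2 : ∀ k : Fin q, Fin.cast (Nat.add_assoc p q r) (Fin.castAdd r (Fin.natAdd p k)) =
      Fin.natAdd p (Fin.castAdd r k) := fun k => rfl
    have e3 : ∀ k : Fin r, Fin.cast (Nat.add_assoc p q r) (Fin.natAdd (p + q) k) =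
      Fin.natAdd p (Fin.natAdd q k) := fun k => Fin.ext (Nat.add_assoc p q k)
    refine Fin.addCases (fun i => Fin.addCases (fun i => ?_) (fun i => ?_) i) (fun i => ?_) i <;>
    refine Fin.addCases (fun j => Fin.addCases (fun j => ?_) (fun j => ?_) j) (fun j => ?_) j <;>
    simp only [e1, e2, e3, blk_LL, blk_LR, blk_RL, blk_RR]
  ext i j
  exact key _ i j

lemma χ_swap (q : ℕ) :
    χ (q + 1) * blk (p := q) (q := 2) rfl 1 (perm (Equiv.swap 0 1)) =
      blk (p := q + 1) (q := 1) rfl (χ q) 1 := by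
  ext i j
  obtain ⟨i, rfl⟩ := (finRotate (q + 2)).surjective i
  have h : (χ (q + 1) * blk (p := q) (q := 2) rfl 1 (perm (Equiv.swap 0 1))).1
      (finRotate (q + 2) i) j = (blk (p := q) (q := 2) rfl 1 (perm (Equiv.swap 0 1))).1 i j := by
    change (∑ k, (if finRotate (q + 2) i = finRotate (q + 2) k then (1 : ℝ) else 0) * _) = _
    simp
  rw [h]
  have r1 : ∀ k : Fin q, finRotate (q + 2) (Fin.castAdd 2 k) = Fin.castAdd 1 k.succ := fun k => by
    rw [finRotate_of_lt (by simp)]; rfl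
  have r2 : finRotate (q + 2) (Fin.natAdd q 0) = Fin.natAdd (q + 1) (0 : Fin 1) := by
    rw [finRotate_of_lt (by simp)]; rfl
  have r3 : finRotate (q + 2) (Fin.natAdd q 1) = Fin.castAdd 1 0 := finRotate_last
  have t1 : ∀ k : Fin q, finRotate (q + 1) k.castSucc = k.succ := fun k =>
    finRotate_of_lt k.2
  have t2 : finRotate (q + 1) (Fin.last q) = 0 := finRotate_last
  have s1 : ∀ k : Fin q, Fin.castAdd 2 k = Fin.castAdd 1 k.castSucc := fun _ => rfl
  have s2 : (Fin.natAdd q 0 : Fin (q + 2)) = Fin.castAdd 1 (Fin.last q) := rfl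
  have s3 : (Fin.natAdd q 1 : Fin (q + 2)) = Fin.natAdd (q + 1) (0 : Fin 1) := rfl
  have c1 : ∀ k l : Fin (q + 1), (χ q).1 k l = if k = finRotate (q + 1) l then 1 else 0 :=
    fun _ _ => rfl
  have c2 : ∀ k l : Fin 2, (perm (Equiv.swap (0 : Fin 2) 1)).1 k l =
    if k = Equiv.swap 0 1 l then 1 else 0 := fun _ _ => rfl
  refine Fin.addCases (m := q) (n := 2) (fun i => ?_) (fun i => ?_) i <;>
    refine Fin.addCases (m := q) (n := 2) (motive := fun j : Fin (q + 2) =>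
      (blk (p := q) (q := 2) rfl 1 (perm (Equiv.swap 0 1))).1 _ j =
        (blk (p := q + 1) (q := 1) rfl (χ q) 1).1 _ j) (fun j => ?_) (fun j => ?_) j
  · rw [blk_LL, r1, s1, blk_LL, c1, t1]
    simp [Matrix.one_apply]
  · rw [blk_LR, r1]
    fin_cases j
    · change _ = (blk (p := q + 1) (q := 1) rfl (χ q) 1).1 _ (Fin.natAdd q 0 : Fin (q + 2))
      rw [s2, blk_LL, c1, t2]
      simp [Fin.succ_ne_zero]
    · change _ = (blk (p := q + 1) (q := 1) rfl (χ q) 1).1 _ (Fin.natAdd q 1 : Fin (q + 2))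
      rw [s3, blk_LR]
  · rw [blk_RL]
    fin_cases i
    · change _ = (blk (p := q + 1) (q := 1) rfl (χ q) 1).1 (finRotate (q + 2) (Fin.natAdd q 0)) _
      rw [r2, s1, blk_RL]
    · change _ = (blk (p := q + 1) (q := 1) rfl (χ q) 1).1 (finRotate (q + 2) (Fin.natAdd q 1)) _
      rw [r3, s1, blk_LL, c1, t1]
      simp [(Fin.succ_ne_zero _).symm]
  · rw [blk_RR, c2]
    fin_cases i
    · change _ = (blk (p := q + 1) (q := 1) rfl (χ q) 1).1 (finRotate (q + 2) (Fin.natAdd q 0)) _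
      rw [r2]
      fin_cases j
      · change _ = (blk (p := q + 1) (q := 1) rfl (χ q) 1).1 _ (Fin.natAdd q 0 : Fin (q + 2))
        rw [s2, blk_RL]; simp
      · change _ = (blk (p := q + 1) (q := 1) rfl (χ q) 1).1 _ (Fin.natAdd q 1 : Fin (q + 2))
        rw [s3, blk_RR]; simp
    · change _ = (blk (p := q + 1) (q := 1) rfl (χ q) 1).1 (finRotate (q + 2) (Fin.natAdd q 1)) _
      rw [r3]
      fin_cases j
      · change _ = (blk (p := q + 1) (q := 1) rfl (χ q) 1).1 _ (Fin.natAdd q 0 : Fin (q + 2))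
        rw [s2, blk_LL, c1, t2]; simp
      · change _ = (blk (p := q + 1) (q := 1) rfl (χ q) 1).1 _ (Fin.natAdd q 1 : Fin (q + 2))
        rw [s3, blk_LR]; simp

end O

/-! ### Orthogonal quasi-spectra -/

set_option linter.checkUnivs false in
/-- The data of an orthogonal quasi-spectrum: based quasi-topological spaces `X_m`, an action of
`O(m)` on `X_m`, and structure maps `X_m × S¹ → X_{m+1}`, where `S¹ = ℝ ∪ {∞}` with base point
`∞`. -/
structure OQSData where
  X : ℕ → Type u
  pt : ∀ m, X m
  top : ∀ m, QTop.{u, w} (X m)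
  act : ∀ m, O m → X m → X m
  σ : ∀ m, X m → OnePoint ℝ → X (m + 1)

namespace OQSData

variable (X : OQSData.{u, w})

/-- The iterated structure map on `X_m × ℝⁿ`. -/
def iterAux (m : ℕ) (x : X.X m) : ∀ n : ℕ, (Fin n → ℝ) → X.X (m + n)
  | 0, _ => x
  | n + 1, v => X.σ (m + n) (iterAux m x n fun i => v i.castSucc) (v (Fin.last n) : OnePoint ℝ)

/-- The iterated structure map `X_m × Sⁿ → X_{m+n}`, where `Sⁿ = ℝⁿ ∪ {∞}`. -/
def iter (m n : ℕ) (x : X.X m) (v : OnePoint (Euc n)) : X.X (m + n) :=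
  OnePoint.rec (X.pt _) (fun v => X.iterAux m x n v.ofLp) v

/-- The laws of an orthogonal quasi-spectrum: the actions are basepoint preserving quasi-continuous
actions, the structure maps are quasi-continuous and factor through the smash products `X_m ∧ S¹`,
and the iterated structure maps `X_m ∧ Sⁿ → X_{m+n}` are quasi-continuous and
`O(m) × O(n)`-equivariant. -/
structure IsOQS : Prop where
  one_act : ∀ m x, X.act m 1 x = x
  mul_act : ∀ m a b x, X.act m (a * b) x = X.act m a (X.act m b x)
  act_pt : ∀ m a, X.act m a (X.pt m) = X.pt m
  act_qcont : ∀ m, QTop.QCont₂ (X.top m) (X.top m) (X.act m)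
  σ_pt : ∀ m s, X.σ m (X.pt m) s = X.pt (m + 1)
  σ_infty : ∀ m x, X.σ m x OnePoint.infty = X.pt (m + 1)
  σ_qcont : ∀ m, QTop.QCont₂ (X.top m) (X.top (m + 1)) fun s x => X.σ m x s
  iter_qcont : ∀ m n, QTop.QCont₂ (X.top m) (X.top (m + n)) fun v x => X.iter m n x v
  iter_act : ∀ m n (a : O m) (b : O n) x v,
    X.iter m n (X.act m a x) (OnePoint.map (O.isom b) v) = X.act (m + n) (O.blk rfl a b) (X.iter m n x v)

variable {X}

lemma IsOQS.σ_act (hX : X.IsOQS) (m : ℕ) (a : O m) (x : X.X m) (s : OnePoint ℝ) :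
    X.σ m (X.act m a x) s = X.act (m + 1) (O.blk rfl a 1) (X.σ m x s) := by
  induction s using OnePoint.rec with
  | infty => rw [hX.σ_infty, hX.σ_infty, hX.act_pt]
  | coe r =>
    have h := hX.iter_act m 1 a 1 x ((WithLp.toLp 2 fun _ => r : Euc 1) : OnePoint (Euc 1))
    have e : O.isom (1 : O 1) (WithLp.toLp 2 fun _ => r : Euc 1) = WithLp.toLp 2 fun _ => r := by
      ext i
      simp [O.isom]
    rw [OnePoint.map_some, e] at h
    exact h

lemma IsOQS.σ_σ (hX : X.IsOQS) (m : ℕ) (x : X.X m) (s t : OnePoint ℝ) :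
    X.σ (m + 1) (X.σ m x s) t =
      X.act (m + 2) (O.blk rfl 1 (O.perm (Equiv.swap 0 1))) (X.σ (m + 1) (X.σ m x t) s) := by
  induction s using OnePoint.rec with
  | infty => rw [hX.σ_infty, hX.σ_infty, hX.σ_pt, hX.act_pt]
  | coe s =>
    induction t using OnePoint.rec with
    | infty => rw [hX.σ_infty, hX.σ_infty, hX.σ_pt, hX.act_pt]
    | coe t =>
      have h := hX.iter_act m 2 1 (O.perm (Equiv.swap 0 1)) x
        ((WithLp.toLp 2 ![t, s] : Euc 2) : OnePoint (Euc 2))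
      have e : O.isom (O.perm (Equiv.swap (0 : Fin 2) 1)) (WithLp.toLp 2 ![t, s] : Euc 2) =
          WithLp.toLp 2 ![s, t] := by
        ext i
        change (∑ j, (if i = Equiv.swap 0 1 j then (1 : ℝ) else 0) * ![t, s] j) = ![s, t] i
        rw [Fin.sum_univ_two]
        fin_cases i <;> simp
      rw [hX.one_act, OnePoint.map_some, e] at h
      exact h

/-- Morphisms of orthogonal quasi-spectra. -/
structure IsMorphism (X : OQSData.{u, w}) (Y : OQSData.{v, w}) (f : ∀ m, X.X m → Y.X m) : Prop where
  map_pt : ∀ m, f m (X.pt m) = Y.pt m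
  qcont : ∀ m, QTop.QCont (X.top m) (Y.top m) (f m)
  map_act : ∀ m a x, f m (X.act m a x) = Y.act m a (f m x)
  map_σ : ∀ m x s, f (m + 1) (X.σ m x s) = Y.σ m (f m x) s

/-! ### The smash product -/

/-- Representatives of the points of the smash product in degree `n`: a base point, and the points
of `O(n) × X_p × Y_q` for `p + q = n`. -/
inductive SmashPre (X : OQSData.{u, w}) (Y : OQSData.{v, w}) (n : ℕ) : Type (max u v)
  | base : SmashPre X Y n
  | mk (p q : ℕ) (h : p + q = n) (g : O n) (x : X.X p) (y : Y.X q) : SmashPre X Y n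

/-- The relations of the smash product: those of `⋁ O(n)₊ ∧_{O(p) × O(q)} X_p ∧ Y_q`, together with
the identification of the actions of the sphere `S¹` on `X` and on `Y`. -/
inductive SmashRel (X : OQSData.{u, w}) (Y : OQSData.{v, w}) (n : ℕ) :
    SmashPre X Y n → SmashPre X Y n → Prop
  | left (p q : ℕ) (h : p + q = n) (g : O n) (y : Y.X q) :
      SmashRel X Y n (.mk p q h g (X.pt p) y) .base
  | right (p q : ℕ) (h : p + q = n) (g : O n) (x : X.X p) :
      SmashRel X Y n (.mk p q h g x (Y.pt q)) .base
  | balanced (p q : ℕ) (h : p + q = n) (g : O n) (a : O p) (b : O q) (x : X.X p) (y : Y.X q) :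
      SmashRel X Y n (.mk p q h (g * O.blk h a b) x y) (.mk p q h g (X.act p a x) (Y.act q b y))
  | sphere (p q : ℕ) (h : p + 1 + q = n) (h' : p + (q + 1) = n) (g : O n) (x : X.X p)
      (s : OnePoint ℝ) (y : Y.X q) :
      SmashRel X Y n (.mk (p + 1) q h g (X.σ p x s) y)
        (.mk p (q + 1) h' g x (Y.act (q + 1) (O.χ q) (Y.σ q y s)))

/-- The `n`-th space of the smash product. -/
def SmashSpace (X : OQSData.{u, w}) (Y : OQSData.{v, w}) (n : ℕ) : Type (max u v) :=
  Quot (SmashRel X Y n)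

/-- The class `g [x, y]` in the smash product. -/
def smashMk {X : OQSData.{u, w}} {Y : OQSData.{v, w}} {p q n : ℕ} (h : p + q = n) (g : O n)
    (x : X.X p) (y : Y.X q) : SmashSpace X Y n :=
  Quot.mk _ (.mk p q h g x y)

/-- The action of `O(n)` on representatives. -/
def SmashPre.act {X : OQSData.{u, w}} {Y : OQSData.{v, w}} {n : ℕ} (k : O n) :
    SmashPre X Y n → SmashPre X Y n
  | .base => .base
  | .mk p q h g x y => .mk p q h (k * g) x y

/-- The structure maps on representatives. -/
def SmashPre.σ {X : OQSData.{u, w}} {Y : OQSData.{v, w}} {n : ℕ} (s : OnePoint ℝ) :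
    SmashPre X Y n → SmashPre X Y (n + 1)
  | .base => .base
  | .mk p q h g x y => .mk p (q + 1) (by omega) (O.blk rfl g 1) x (Y.σ q y s)

lemma SmashRel.act {X : OQSData.{u, w}} {Y : OQSData.{v, w}} {n : ℕ} (k : O n)
    {z z' : SmashPre X Y n} (hz : SmashRel X Y n z z') : SmashRel X Y n (z.act k) (z'.act k) := by
  cases hz with
  | left p q h g y => exact .left p q h _ y
  | right p q h g x => exact .right p q h _ x
  | balanced p q h g a b x y =>
    have := SmashRel.balanced (X := X) (Y := Y) p q h (k * g) a b x y
    rwa [mul_assoc] at this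
  | sphere p q h h' g x s y => exact .sphere p q h h' _ x s y

lemma SmashRel.σ {X : OQSData.{u, w}} {Y : OQSData.{v, w}} (hY : Y.IsOQS) {n : ℕ} (s : OnePoint ℝ)
    {z z' : SmashPre X Y n} (hz : SmashRel X Y n z z') :
    Quot.mk (SmashRel X Y (n + 1)) (z.σ s) = Quot.mk _ (z'.σ s) := by
  cases hz with
  | left p q h g y => exact Quot.sound (.left p (q + 1) _ _ _)
  | right p q h g x =>
    have := SmashRel.right (X := X) (Y := Y) p (q + 1) (n := n + 1) (by omega) (O.blk rfl g 1) x
    rw [← hY.σ_pt q s] at this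
    exact Quot.sound this
  | balanced p q h g a b x y =>
    have := SmashRel.balanced (X := X) (Y := Y) p (q + 1) (n := n + 1) (by omega) (O.blk rfl g 1) a
      (O.blk rfl b 1) x (Y.σ q y s)
    rw [← hY.σ_act, ← O.blk_assoc h, ← O.blk_mul, one_mul] at this
    exact Quot.sound this
  | sphere p q h h' g x t y =>
    have h1 := SmashRel.sphere (X := X) (Y := Y) p (q + 1) (n := n + 1) (by omega) (by omega)
      (O.blk rfl g 1) x t (Y.σ q y s)
    rw [hY.σ_σ q y s t, ← hY.mul_act, O.χ_swap, ← hY.σ_act] at h1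
    exact Quot.sound h1

/-- The smash product of orthogonal quasi-spectra: the tensor product over the sphere spectrum, with
`(X ∧ Y)_n` the quotient of `⋁_{p+q=n} O(n)₊ ∧_{O(p) × O(q)} X_p ∧ Y_q` which identifies the two
actions of the sphere spectrum. -/
def smash (X : OQSData.{u, w}) (Y : OQSData.{v, w}) (hY : Y.IsOQS) : OQSData.{max u v, w} where
  X n := SmashSpace X Y n
  pt _ := Quot.mk _ .base
  top n := QTop.generate fun C _ _ _ => {h | ∃ (p q : ℕ) (e : p + q = n) (g : C → O n)
    (x : C → X.X p) (y : C → Y.X q), Continuous g ∧ x ∈ (X.top p).Q C ∧ y ∈ (Y.top q).Q C ∧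
    h = fun c => smashMk e (g c) (x c) (y c)}
  act _ k := Quot.lift (fun z => Quot.mk _ (z.act k)) fun _ _ hz => Quot.sound (hz.act k)
  σ _ z s := Quot.lift (fun z => Quot.mk _ (z.σ s)) (fun _ _ hz => hz.σ hY s) z

end OQSData

/-! ### The canonical homomorphisms -/

/-- The inclusion of `ℝᵐ` as the first `m` coordinates. -/
def Euc.inl (m k : ℕ) : Euc m →ₗᵢ[ℝ] Euc (m + k) where
  toFun v := WithLp.toLp 2 (Fin.append v.ofLp 0)
  map_add' v w := by
    ext i
    refine Fin.addCases (fun i => ?_) (fun i => ?_) i <;> simp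
  map_smul' r v := by
    ext i
    refine Fin.addCases (fun i => ?_) (fun i => ?_) i <;> simp
  norm_map' v := by simp [EuclideanSpace.norm_eq, Fin.sum_univ_add]

/-- The inclusion of `ℝᵏ` as the last `k` coordinates. -/
def Euc.inr (m k : ℕ) : Euc k →ₗᵢ[ℝ] Euc (m + k) where
  toFun v := WithLp.toLp 2 (Fin.append 0 v.ofLp)
  map_add' v w := by
    ext i
    refine Fin.addCases (fun i => ?_) (fun i => ?_) i <;> simp
  map_smul' r v := by
    ext i
    refine Fin.addCases (fun i => ?_) (fun i => ?_) i <;> simp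
  norm_map' v := by simp [EuclideanSpace.norm_eq, Fin.sum_univ_add]

variable (𝕜) in
/-- The product `c, d ↦ c · d` of an element of the Clifford algebra of the first `m` coordinates
with one of the Clifford algebra of the last `k` coordinates. -/
def Cliff.mul (m k : ℕ) (c : Cliff 𝕜 m) (d : Cliff 𝕜 k) : Cliff 𝕜 (m + k) :=
  Cliff.map 𝕜 (Euc.inl m k) c * Cliff.map 𝕜 (Euc.inr m k) d

variable (𝕜) in
/-- The value at `r ∈ ℝ` of the Bott map `b : 𝒮 → C₀(ℝ) ⊗ 𝔽_{1,0}`, `b(f)(x) = f(x e₁)`, where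
`f(r e₁)` (functional calculus) is `f(r) 1` for `f` even and `f(r) e₁` for `f` odd. -/
def IsBott (r : ℝ) (b : GHom (funS 𝕜) (Cliff 𝕜 1)) : Prop :=
  ∀ f : ZeroAtInftyContinuousMap ℝ 𝕜,
    ((funS 𝕜).Homog 0 f → b (f : funS 𝕜) = f r • Cliff.one 𝕜 1) ∧
    ((funS 𝕜).Homog 1 f → b (f : funS 𝕜) =
      f r • Cliff.vec 𝕜 (EuclideanSpace.single (0 : Fin 1) (1 : ℝ)))

variable (𝕜) in
/-- The value of the Bott map at a point of the circle `ℝ ∪ {∞}`. -/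
def bott (s : OnePoint ℝ) : GHom (funS 𝕜) (Cliff 𝕜 1) :=
  OnePoint.rec 0 (fun r => GHom.the (IsBott 𝕜 r)) s

variable (𝕜) in
/-- The comultiplication `Δ : 𝒮 → 𝒮 ⊗ 𝒮`, `f ↦ f(X ⊗ 1 + 1 ⊗ X)`: the homomorphism with
`Δ(u) = u ⊗ u` and `Δ(v) = u ⊗ v + v ⊗ u` for the generators `u = exp(-x²)`, `v = x exp(-x²)`. -/
def IsComult (Δ : GHom (funS 𝕜) (funS 𝕜 ⊗ᵍ funS 𝕜)) : Prop :=
  ∀ u v : ZeroAtInftyContinuousMap ℝ 𝕜,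
    (∀ x : ℝ, u x = (Real.exp (-x ^ 2) : ℝ)) → (∀ x : ℝ, v x = (x * Real.exp (-x ^ 2) : ℝ)) →
    Δ (u : funS 𝕜) = (u : funS 𝕜) ⊗ₑ (u : funS 𝕜) ∧
    Δ (v : funS 𝕜) = (u : funS 𝕜) ⊗ₑ (v : funS 𝕜) + (v : funS 𝕜) ⊗ₑ (u : funS 𝕜)

variable (𝕜) in
/-- The comultiplication `Δ : 𝒮 → 𝒮 ⊗ 𝒮`. -/
def comult : GHom (funS 𝕜) (funS 𝕜 ⊗ᵍ funS 𝕜) := GHom.the (IsComult 𝕜)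

/-- The associativity isomorphism of the tensor product. -/
def IsAssoc {A : GCAlg.{u} 𝕜} {B : GCAlg.{v} 𝕜} {C : GCAlg.{w} 𝕜}
    (θ : GHom ((A ⊗ᵍ B) ⊗ᵍ C) (A ⊗ᵍ B ⊗ᵍ C)) : Prop :=
  ∀ (a : A) (b : B) (c : C), θ ((a ⊗ₑ b) ⊗ₑ c) = a ⊗ₑ b ⊗ₑ c

section Spectra

variable (H : GradedHilbert.{u'} 𝕜)

/-- `𝒮 ⊗ A ⊗ 𝒦`. -/
abbrev src (A : GCAlg.{u} 𝕜) : GCAlg.{max u u'} 𝕜 := funS 𝕜 ⊗ᵍ A ⊗ᵍ compacts H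

/-- `B ⊗ 𝔽_{m,0} ⊗ 𝒦`. -/
abbrev tgt (B : GCAlg.{v} 𝕜) (m : ℕ) : GCAlg.{max v u'} 𝕜 := B ⊗ᵍ Cliff 𝕜 m ⊗ᵍ compacts H

/-- The identification `𝔽_{1,0} ⊗ (B ⊗ 𝔽_{m,0} ⊗ 𝒦) → B ⊗ 𝔽_{m+1,0} ⊗ 𝒦`, with the sign of the
graded permutation of the factors; the new Clifford generator is the last one. -/
def IsShuffle (B : GCAlg.{v} 𝕜) (m : ℕ) (θ : GHom (Cliff 𝕜 1 ⊗ᵍ tgt H B m) (tgt H B (m + 1))) :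
    Prop :=
  ∀ (i j l : ℕ) (d : Cliff 𝕜 1) (b : B) (c : Cliff 𝕜 m) (k : compacts H),
    GCAlg.Homog _ i d → GCAlg.Homog _ j b → GCAlg.Homog _ l c →
    θ (d ⊗ₑ b ⊗ₑ c ⊗ₑ k) = (-1 : 𝕜) ^ (i * (j + l)) • (b ⊗ₑ Cliff.mul 𝕜 m 1 c d ⊗ₑ k)

/-- The identification `𝒮 ⊗ A ⊗ 𝔽_{m,0} ⊗ 𝒦 → (𝒮 ⊗ A ⊗ 𝒦) ⊗ 𝔽_{m,0}`, with the sign of the graded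
permutation of the factors. -/
def IsMoveOut (A : GCAlg.{u} 𝕜) (m : ℕ) (θ : GHom (funS 𝕜 ⊗ᵍ tgt H A m) (src H A ⊗ᵍ Cliff 𝕜 m)) :
    Prop :=
  ∀ (i j : ℕ) (f : funS 𝕜) (a : A) (c : Cliff 𝕜 m) (k : compacts H),
    GCAlg.Homog _ i c → GCAlg.Homog _ j k →
    θ (f ⊗ₑ a ⊗ₑ c ⊗ₑ k) = (-1 : 𝕜) ^ (i * j) • ((f ⊗ₑ a ⊗ₑ k) ⊗ₑ c)

/-- The identification `(B ⊗ 𝔽_{n,0} ⊗ 𝒦) ⊗ 𝔽_{m,0} → B ⊗ 𝔽_{m+n,0} ⊗ 𝒦`, with the sign of the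
graded permutation of the factors; the generators of `𝔽_{m,0}` come first. -/
def IsMoveIn (B : GCAlg.{v} 𝕜) (m n : ℕ) (θ : GHom (tgt H B n ⊗ᵍ Cliff 𝕜 m) (tgt H B (m + n))) :
    Prop :=
  ∀ (i j l : ℕ) (b : B) (c : Cliff 𝕜 n) (k : compacts H) (d : Cliff 𝕜 m),
    GCAlg.Homog _ i d → GCAlg.Homog _ j c → GCAlg.Homog _ l k →
    θ ((b ⊗ₑ c ⊗ₑ k) ⊗ₑ d) = (-1 : 𝕜) ^ (i * (j + l)) • (b ⊗ₑ Cliff.mul 𝕜 m n d c ⊗ₑ k)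

/-! ### The spectra -/

/-- The map `Δ ⊗ id : 𝒮 ⊗ A ⊗ 𝒦 → 𝒮 ⊗ 𝒮 ⊗ A ⊗ 𝒦`. -/
def comultTensor (A : GCAlg.{u} 𝕜) : GHom (src H A) (funS 𝕜 ⊗ᵍ src H A) :=
  (GHom.the IsAssoc).comp ((comult 𝕜).tensor (GHom.id (A ⊗ᵍ compacts H)))

/-- The map `b(s) ⊗ id : 𝒮 ⊗ B ⊗ 𝔽_{m,0} ⊗ 𝒦 → B ⊗ 𝔽_{m+1,0} ⊗ 𝒦`. -/
def bottTensor (B : GCAlg.{v} 𝕜) (m : ℕ) (s : OnePoint ℝ) :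
    GHom (funS 𝕜 ⊗ᵍ tgt H B m) (tgt H B (m + 1)) :=
  (GHom.the (IsShuffle H B m)).comp ((bott 𝕜 s).tensor (GHom.id (tgt H B m)))

/-- The action of `O(m)` on `B ⊗ 𝔽_{m,0} ⊗ 𝒦` through the Clifford algebra. -/
def rot (B : GCAlg.{v} 𝕜) {m : ℕ} (g : O m) : GHom (tgt H B m) (tgt H B m) :=
  (GHom.id B).tensor ((Cliff.map 𝕜 (O.isom g)).tensor (GHom.id (compacts H)))

/-- The K-theory spectrum `𝕂(A)`, with spaces `Hom(𝒮 ⊗ 𝔽 ⊗ 𝒦, A ⊗ 𝔽_{m,0} ⊗ 𝒦)` and structure maps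
`σ(x, s) = (b(s) ⊗ id) ∘ (id_𝒮 ⊗ x) ∘ (Δ ⊗ id)`. -/
def specK (A : GCAlg.{u} 𝕜) : OQSData.{max u u', w} where
  X m := GHom (src H (scalars 𝕜)) (tgt H A m)
  pt _ := 0
  top _ := QTop.ofTop _
  act _ g x := (rot H A g).comp x
  σ m x s := (bottTensor H A m s).comp
    (((GHom.id (funS 𝕜)).tensor x).comp (comultTensor H (scalars 𝕜)))

/-- The E-theory spectrum `𝔼(A, B)`, with spaces the asymptotic morphisms from `𝒮 ⊗ A ⊗ 𝒦` to
`B ⊗ 𝔽_{m,0} ⊗ 𝒦` and structure maps `σ(x, s) = (b(s) ⊗ id) ∘ (id_𝒮 ⊗ x) ∘ (Δ ⊗ id)`. -/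
def specE (A : GCAlg.{u} 𝕜) (B : GCAlg.{v} 𝕜) : OQSData.{max u v u', w} where
  X m := AsyClass (src H A) (tgt H B m)
  pt _ := 0
  top m := AsyClass.qtop (src H A) (tgt H B m)
  act _ g x := x.homComp (rot H B g)
  σ m x s := ((x.leftTensor (funS 𝕜)).compHom (comultTensor H A)).homComp (bottTensor H B m s)

/-- The asymptotic K-theory spectrum `𝕂'(B)`, with spaces the asymptotic morphisms from
`𝒮 ⊗ 𝔽 ⊗ 𝒦` to `B ⊗ 𝔽_{m,0} ⊗ 𝒦`. -/
def specK' (B : GCAlg.{v} 𝕜) : OQSData.{max v u', w} := specE H (scalars 𝕜) B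

/-- The product `(β ⊗ id_{𝔽_{m,0}}) ∘ (id_𝒮 ⊗ α) ∘ (Δ ⊗ id_{𝔽 ⊗ 𝒦})` of a homomorphism `α` and an
asymptotic morphism `β`. -/
def product {A : GCAlg.{u} 𝕜} {B : GCAlg.{v} 𝕜} {m n : ℕ}
    (α : GHom (src H (scalars 𝕜)) (tgt H A m)) (β : AsyClass (src H A) (tgt H B n)) :
    AsyClass (src H (scalars 𝕜)) (tgt H B (m + n)) :=
  ((β.rightTensor (Cliff 𝕜 m)).compHom ((GHom.the (IsMoveOut H A m)).comp
    (((GHom.id (funS 𝕜)).tensor α).comp (comultTensor H (scalars 𝕜))))).homComp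
      (GHom.the (IsMoveIn H B m n))

/-- The map `f_* : B ⊗ 𝔽_{m,0} ⊗ 𝒦 → B' ⊗ 𝔽_{m,0} ⊗ 𝒦` induced by `f : B → B'`. -/
def tgtMap {B : GCAlg.{v} 𝕜} {B' : GCAlg.{v'} 𝕜} (f : GHom B B') (m : ℕ) :
    GHom (tgt H B m) (tgt H B' m) := f.tensor (GHom.id _)

/-- The map `𝒮 ⊗ A ⊗ 𝒦 → 𝒮 ⊗ A' ⊗ 𝒦` induced by `f : A → A'`. -/
def srcMap {A : GCAlg.{u} 𝕜} {A' : GCAlg.{v} 𝕜} (f : GHom A A') : GHom (src H A) (src H A') :=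
  (GHom.id (funS 𝕜)).tensor (f.tensor (GHom.id _))

end Spectra

end GradedE

end

open GradedE GradedE.OQSData

universe u v w h p q

/-!
The proof rests on three ideas.

**Asymptotic morphisms are homomorphisms.** Let `Q B` be the algebra of bounded paths `[1, ∞) → B`
modulo paths that tend to `0`. Classes of asymptotic morphisms from `A` to `B` are the graded
`*`-homomorphisms from `A` to `Q B` (`AsyClass.hat_injective`, `AsyClass.exists_hat`); the tensor
products with identities are the compositions with the canonical maps `D ⊗ Q B → Q (D ⊗ B)` and
`Q B ⊗ D → Q (B ⊗ D)`. A homomorphism is a constant path, so that `𝕂(A)` is a subobject of `𝔼(𝔽, A)`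
and inherits its laws.

**The structure maps are translations.** Homomorphisms on `𝒮 ⊗ A` are determined by their values on
`u ⊗ a` and `v ⊗ a` (`GHom.ext_funS_tensor`), by the Stone–Weierstrass theorem. Think of a point of the
spectrum as an odd operator `X` with functional calculus. The comultiplication replaces `X` by
`X ⊗ 1 + 1 ⊗ X`, and the Bott map at `r` puts `r e₁` for one of the two copies of `X`; so the structure
map sends `X` to `X + r e`, where `e` is the new Clifford generator. On `u` and `v` this gives explicit
formulas (`IsTranslate`, `AsyClass.isTranslate_susp`). Translations compose like affine isometries, and
two of them agree if they have the same vector and the same isometry (`IsTranslate.trans`,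
`IsTranslate.eq`). The iterated structure map at `x ∈ ℝⁿ` is the translation by `x`, which is given by
a Bott map of the sphere `ℝⁿ ∪ {∞}`. A product with a translate is a translate of the product
(`IsTranslate.product_left`, `IsTranslate.product_right`). Hence the equivariance of the iterated
structure maps, the equivariance of the product, its compatibility with the structure maps and the
relation that makes it balanced over the sphere spectrum (`susp_product`) all become identities between
vectors and isometries of Euclidean spaces.

**Quasi-continuity.** The generating families of asymptotic morphisms over a compact space `Y` are the
homomorphisms to `Q (C(Y, B))`. Composition with a continuous family of homomorphisms of the source is
possible since a homomorphism `A → Q (C(Y, B))` extends to `C(Y, A)` (`funC.exists_extension`).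
Families of Bott maps and rotations are continuous, since continuity can be tested on generators.

The canonical homomorphisms have to be constructed from scratch. Homomorphisms to C*-algebras are
contractive because `1 - h` has a square root for a self-adjoint `h` with `‖h‖ < 1`
(`CStarSeminorm.le_norm`); this gives the universal property of the graded tensor product
(`GHom.exists_lift`). The associativity isomorphism comes from the commuting actions of three algebras
(`exists_isAssoc`). The comultiplication is defined on the dense subalgebra generated by `u` and `v`
(`existsUnique_isComult`). There it is bounded, because an even function `f` is sent to the function
`f(√(x² + y²))`, and the norm of an element of `𝒮 ⊗ 𝒮` built from even functions is controlled by the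
supremum norm, by means of two families of tent functions with disjoint supports
(`EvenTensor.norm_le`).
-/

/-! ### Instances on carriers -/

noncomputable section

namespace GradedE

universe u' v' w'

variable {𝕜 : Type} [RCLike 𝕜]

-- These instances are found by instance search anyway; stating them for the carrier of a bundled
-- algebra, and later for algebraic tensor products and algebras of paths, keeps that search short.
section Instances

variable (A : GCAlg.{u} 𝕜)

instance : NonUnitalRing A := inferInstance
instance : NonUnitalSemiring A := inferInstance
instance : NonUnitalNonAssocSemiring A := inferInstance
instance : AddCommGroup A := inferInstance
instance : AddCommMonoid A := inferInstance
instance : AddGroup A := inferInstance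
instance : Module 𝕜 A := inferInstance
instance : MulAction 𝕜 A := inferInstance
instance : DistribMulAction 𝕜 A := inferInstance
instance : SMul 𝕜 A := inferInstance
instance : Add A := inferInstance
instance : Sub A := inferInstance
instance : Neg A := inferInstance
instance : Mul A := inferInstance
instance : Zero A := inferInstance
instance : Star A := inferInstance
instance : Norm A := inferInstance
instance : NormedAddCommGroup A := inferInstance
instance : SeminormedAddCommGroup A := inferInstance
instance : TopologicalSpace A := inferInstance
instance : ContinuousMul A := inferInstance
instance : ContinuousStar A := inferInstance
instance : ContinuousAdd A := inferInstance
instance : ContinuousSub A := inferInstance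
instance : T2Space A := inferInstance
instance : ContinuousSMul 𝕜 A := inferInstance
instance : ContinuousConstSMul 𝕜 A := inferInstance

end Instances

/-! ### Square roots, automatic contractivity and approximate units -/

/-- If `h` is self-adjoint and `‖h‖ < 1`, then `1 - h` has a self-adjoint square root `1 - y`. The
element `y` is the fixed point of `y ↦ (h + y²) / 2` in the ball of radius `‖h‖`. -/
lemma GCAlg.exists_sqrt_one_sub (A : GCAlg.{u} 𝕜) {h : A} (hs : star h = h) (hn : ‖h‖ < 1) :
    ∃ y : A, star y = y ∧ y + y = h + y * y := by
  let s : Set A := {y | star y = y ∧ ‖y‖ ≤ ‖h‖}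
  have hsc : IsClosed s := (isClosed_eq continuous_star continuous_id).inter
    (isClosed_le continuous_norm continuous_const)
  let f : A → A := fun y => (2⁻¹ : 𝕜) • (h + y * y)
  have h2 : ‖(2⁻¹ : 𝕜)‖ = 2⁻¹ := by rw [norm_inv, RCLike.norm_two]
  have hf : Set.MapsTo f s s := by
    rintro y ⟨h1, h3⟩
    refine ⟨by simp [f, hs, h1], ?_⟩
    have h4 : ‖y * y‖ ≤ ‖h‖ * ‖h‖ :=
      (norm_mul_le _ _).trans (mul_le_mul h3 h3 (norm_nonneg _) (norm_nonneg _))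
    have h5 := norm_add_le h (y * y)
    simp only [f, norm_smul, h2]
    nlinarith [norm_nonneg h]
  have hc : ContractingWith ‖h‖₊ (hf.restrict f s s) := by
    refine ⟨by exact_mod_cast hn, LipschitzWith.of_dist_le_mul ?_⟩
    rintro ⟨x, hx⟩ ⟨y, hy⟩
    change dist (f x) (f y) ≤ ‖h‖ * dist x y
    rw [dist_eq_norm, dist_eq_norm]
    have e : f x - f y = (2⁻¹ : 𝕜) • (x * (x - y) + (x - y) * y) := by
      simp only [f, ← smul_sub, mul_sub, sub_mul]
      congr 1
      abel
    have h3 := norm_add_le (x * (x - y)) ((x - y) * y)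
    have h4 : ‖x * (x - y)‖ ≤ ‖h‖ * ‖x - y‖ := (norm_mul_le _ _).trans (by gcongr; exact hx.2)
    have h5 : ‖(x - y) * y‖ ≤ ‖x - y‖ * ‖h‖ := (norm_mul_le _ _).trans (by gcongr; exact hy.2)
    rw [e, norm_smul, h2]
    linarith
  obtain ⟨y, hy, hfix, -⟩ := ContractingWith.exists_fixedPoint' hsc.isComplete hf hc
    (x := 0) ⟨star_zero _, by simp⟩ (edist_ne_top _ _)
  refine ⟨y, hy.1, ?_⟩
  have h3 : (2⁻¹ : 𝕜) • (h + y * y) = y := hfix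
  rw [← h3, ← add_smul, h3]
  norm_num

/-- A `*`-representation of a C*-algebra on a `*`-algebra by left multipliers is contractive in every
C*-seminorm. For `‖n‖ < 1` write `1 - n⋆n = w⋆w`; then `x⋆x = (n x)⋆(n x) + (w x)⋆(w x)`. -/
lemma CStarSeminorm.act_le {R : Type v} [NonUnitalRing R] [StarRing R] [Module 𝕜 R]
    (p : CStarSeminorm 𝕜 R) (N : GCAlg.{u} 𝕜) (ρ : N →ₗ[𝕜] R →ₗ[𝕜] R)
    (hmul : ∀ m n x, ρ (m * n) x = ρ m (ρ n x))
    (hadj : ∀ n x y, star (ρ n x) * y = star x * ρ (star n) y) (n : N) (x : R) :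
    p.toFun (ρ n x) ≤ ‖n‖ * p.toFun x := by
  have key : ∀ n : N, ‖n‖ < 1 → p.toFun (ρ n x) ≤ p.toFun x := by
    intro n hn
    obtain ⟨y, hy, hyy⟩ := N.exists_sqrt_one_sub (h := star n * n) (by simp) (by
      rw [CStarRing.norm_star_mul_self]; nlinarith [norm_nonneg n])
    have e : star (ρ n x) * ρ n x + star (x - ρ y x) * (x - ρ y x) = star x * x := by
      have h1 : star n * n = y + y - y * y := by rw [hyy]; abel
      rw [hadj, ← hmul, h1, star_sub, sub_mul, hadj, hy]
      simp only [map_sub, map_add, LinearMap.sub_apply, LinearMap.add_apply, hmul, mul_sub, mul_add]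
      abel
    have h1 := p.sq_le (ρ n x) (x - ρ y x)
    rw [e] at h1
    have h2 := p.mul_le (star x) x
    have h3 := p.star_le x
    have h4 := p.nonneg x
    have h5 := mul_le_mul_of_nonneg_right h3 h4
    exact le_of_sq_le_sq (by rw [sq (p.toFun x)]; linarith) h4
  have h0 := p.nonneg x
  refine le_of_forall_pos_le_add fun ε hε => ?_
  set t : ℝ := ‖n‖ + ε / (p.toFun x + 1) with ht
  have hd : 0 < ε / (p.toFun x + 1) := by positivity
  have ht0 : 0 < t := by positivity
  have h1 := key (((t⁻¹ : ℝ) : 𝕜) • n) (by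
    rw [norm_smul, RCLike.norm_ofReal, abs_of_pos (by positivity), inv_mul_lt_one₀ ht0]
    linarith)
  rw [map_smul, LinearMap.smul_apply] at h1
  have h2 : p.toFun (((t⁻¹ : ℝ) : 𝕜) • ρ n x) = t⁻¹ * p.toFun (ρ n x) := by
    refine (map_smul_eq_mul p.toSeminorm _ _).trans ?_
    rw [RCLike.norm_ofReal, abs_of_pos (by positivity)]
    rfl
  rw [h2, inv_mul_le_iff₀ ht0] at h1
  refine h1.trans ?_
  rw [ht, add_mul]
  gcongr
  rw [div_mul_eq_mul_div, div_le_iff₀ (by positivity)]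
  nlinarith

/-- Every C*-seminorm on a C*-algebra is dominated by the norm. -/
lemma CStarSeminorm.le_norm {A : GCAlg.{u} 𝕜} (p : CStarSeminorm 𝕜 A) (a : A) :
    p.toFun a ≤ ‖a‖ := by
  have h1 := p.act_le A (LinearMap.mul 𝕜 A) (fun m n x => mul_assoc m n x)
    (fun n x y => by simp [mul_assoc]) (star a) a
  have h2 := p.sq_le a 0
  have h3 : p.toFun (star a * a) ≤ ‖a‖ * p.toFun a := by simpa using h1
  simp only [star_zero, mul_zero, add_zero] at h2
  rcases (p.nonneg a).eq_or_lt with h0 | h0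
  · rw [← h0]; exact norm_nonneg a
  · nlinarith

/-- The C*-seminorm `x ↦ ‖f x‖` of a `*`-homomorphism to a C*-algebra. -/
def CStarSeminorm.ofHom {R : Type v} [NonUnitalRing R] [StarRing R] [Module 𝕜 R] {B : GCAlg.{u} 𝕜}
    (f : R →⋆ₙₐ[𝕜] B) : CStarSeminorm 𝕜 R :=
  { (normSeminorm 𝕜 B).comp (f : R →ₗ[𝕜] B) with
    mul_le := fun x y => by
      change ‖f (x * y)‖ ≤ ‖f x‖ * ‖f y‖
      rw [map_mul]; exact norm_mul_le _ _
    sq_le := fun x y => by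
      change ‖f x‖ ^ 2 ≤ ‖f (star x * x + star y * y)‖
      rw [map_add, map_mul, map_mul, map_star, map_star]
      exact B.norm_sq_le _ _ }

/-- A `*`-homomorphism that preserves the gradings, as a graded `*`-homomorphism. -/
def GHom.ofStarHom {A : GCAlg.{u} 𝕜} {B : GCAlg.{v} 𝕜} (f : A →⋆ₙₐ[𝕜] B)
    (hf : ∀ a, f (A.grading a) = B.grading (f a)) : GHom A B :=
  ⟨f, hf, (CStarSeminorm.ofHom f).le_norm⟩

@[ext]
lemma GHom.ext {A : GCAlg.{u} 𝕜} {B : GCAlg.{v} 𝕜} {f g : GHom A B} (h : ∀ a, f a = g a) :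
    f = g := by
  obtain ⟨f, _, _⟩ := f
  obtain ⟨g, _, _⟩ := g
  congr 1
  exact NonUnitalStarAlgHom.ext h

lemma GHom.comp_apply {A : GCAlg.{u} 𝕜} {B : GCAlg.{v} 𝕜} {C : GCAlg.{w} 𝕜} (g : GHom B C)
    (f : GHom A B) (a : A) : g.comp f a = g (f a) := rfl

lemma GHom.id_apply {A : GCAlg.{u} 𝕜} (a : A) : GHom.id A a = a := rfl

lemma GHom.zero_apply {A : GCAlg.{u} 𝕜} {B : GCAlg.{v} 𝕜} (a : A) : (0 : GHom A B) a = 0 := rfl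

lemma GHom.comp_assoc {A : GCAlg.{u} 𝕜} {B : GCAlg.{v} 𝕜} {C : GCAlg.{w} 𝕜} {D : GCAlg.{u'} 𝕜}
    (k : GHom C D) (g : GHom B C) (f : GHom A B) : (k.comp g).comp f = k.comp (g.comp f) := rfl

lemma GCAlg.continuous_grading (A : GCAlg.{u} 𝕜) : Continuous A.grading :=
  AddMonoidHomClass.continuous_of_bound A.grading 1 fun a => by
    rw [one_mul]; exact A.norm_grading_le a

lemma GHom.the_eq {A : GCAlg.{u} 𝕜} {B : GCAlg.{v} 𝕜} {P : GHom A B → Prop} (hP : ∃! f, P f) :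
    P (GHom.the P) := by
  rw [GHom.the, dif_pos hP]
  exact hP.choose_spec.1

/-! ### Homogeneous elements -/

lemma negOne_pow_congr {i j : ℕ} (h : Even (i + j)) : (-1 : 𝕜) ^ i = (-1) ^ j := by
  rcases Nat.even_or_odd j with hj | hj
  · rw [hj.neg_one_pow, ((Nat.even_add.1 h).2 hj).neg_one_pow]
  · rw [hj.neg_one_pow, Odd.neg_one_pow]
    by_contra hi
    rw [Nat.not_odd_iff_even] at hi
    exact (Nat.not_even_iff_odd.2 hj) ((Nat.even_add.1 h).1 hi)

lemma negOne_pow_mul_self (i : ℕ) : (-1 : 𝕜) ^ i * (-1) ^ i = 1 := by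
  rw [← pow_add, Even.neg_one_pow ⟨i, rfl⟩]

lemma star_negOne_pow (i : ℕ) : star ((-1 : 𝕜) ^ i) = (-1) ^ i := by simp

lemma negOne_pow_smul_smul {M : Type*} [AddCommGroup M] [Module 𝕜 M] (i : ℕ) (x : M) :
    (-1 : 𝕜) ^ i • (-1 : 𝕜) ^ i • x = x := by
  rw [smul_smul, negOne_pow_mul_self, one_smul]

namespace GCAlg

variable (A : GCAlg.{u} 𝕜)

/-- The even part of an element. -/
def evenL : A →ₗ[𝕜] A := (2⁻¹ : 𝕜) • (LinearMap.id + (A.grading : A →ₗ[𝕜] A))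
/-- The odd part of an element. -/
def oddL : A →ₗ[𝕜] A := (2⁻¹ : 𝕜) • (LinearMap.id - (A.grading : A →ₗ[𝕜] A))

lemma evenL_apply (a : A) : A.evenL a = (2⁻¹ : 𝕜) • (a + A.grading a) := rfl
lemma oddL_apply (a : A) : A.oddL a = (2⁻¹ : 𝕜) • (a - A.grading a) := rfl

lemma evenL_add_oddL (a : A) : A.evenL a + A.oddL a = a := by
  simp only [evenL_apply, oddL_apply]; module

variable {A}

lemma homog_zero_iff {a : A} : A.Homog 0 a ↔ A.grading a = a := by simp [Homog]
lemma homog_one_iff {a : A} : A.Homog 1 a ↔ A.grading a = -a := by simp [Homog]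

lemma homog_evenL (a : A) : A.Homog 0 (A.evenL a) := by
  rw [homog_zero_iff, evenL_apply, map_smul, map_add, A.grading_grading, add_comm]
lemma homog_oddL (a : A) : A.Homog 1 (A.oddL a) := by
  rw [homog_one_iff, oddL_apply, map_smul, map_sub, A.grading_grading, ← smul_neg, neg_sub]

lemma Homog.evenL_of_even {i : ℕ} {a : A} (h : A.Homog i a) (hi : Even i) : A.evenL a = a := by
  rw [Homog, hi.neg_one_pow, one_smul] at h
  rw [evenL_apply, h]; module
lemma Homog.oddL_of_even {i : ℕ} {a : A} (h : A.Homog i a) (hi : Even i) : A.oddL a = 0 := by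
  rw [Homog, hi.neg_one_pow, one_smul] at h
  rw [oddL_apply, h]; module
lemma Homog.evenL_of_odd {i : ℕ} {a : A} (h : A.Homog i a) (hi : Odd i) : A.evenL a = 0 := by
  rw [Homog, hi.neg_one_pow] at h
  rw [evenL_apply, h]; module
lemma Homog.oddL_of_odd {i : ℕ} {a : A} (h : A.Homog i a) (hi : Odd i) : A.oddL a = a := by
  rw [Homog, hi.neg_one_pow] at h
  rw [oddL_apply, h]; module

lemma Homog.congr {i j : ℕ} {a : A} (h : A.Homog i a) (hij : Even (i + j)) : A.Homog j a := by
  rw [Homog, ← negOne_pow_congr hij]; exact h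

lemma Homog.grading_eq {i : ℕ} {a : A} (h : A.Homog i a) : A.grading a = (-1 : 𝕜) ^ i • a := h

lemma homog_of_zero (i : ℕ) : A.Homog i 0 := by simp [Homog]
lemma Homog.add {i : ℕ} {a b : A} (ha : A.Homog i a) (hb : A.Homog i b) : A.Homog i (a + b) := by
  rw [Homog] at *; rw [map_add, ha, hb, smul_add]
lemma Homog.smul {i : ℕ} {a : A} (ha : A.Homog i a) (r : 𝕜) : A.Homog i (r • a) := by
  rw [Homog] at *; rw [map_smul, ha, smul_comm]
lemma Homog.star {i : ℕ} {a : A} (ha : A.Homog i a) : A.Homog i (star a) := by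
  rw [Homog] at *; rw [map_star, ha, star_smul, star_negOne_pow]
lemma Homog.mul {i j : ℕ} {a b : A} (ha : A.Homog i a) (hb : A.Homog j b) :
    A.Homog (i + j) (a * b) := by
  rw [Homog] at *; rw [map_mul, ha, hb, smul_mul_smul_comm, pow_add]
lemma Homog.map {B : GCAlg.{v} 𝕜} {i : ℕ} {a : A} (ha : A.Homog i a) (f : GHom A B) :
    B.Homog i (f a) := by
  rw [Homog] at *; rw [← f.map_grading, ha, map_smul]

/-- A property that is preserved by addition holds for all elements if it holds for the even and
the odd ones. -/
lemma homog_ind {P : A → Prop} (add : ∀ a b, P a → P b → P (a + b))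
    (hom : ∀ i a, A.Homog i a → P a) (a : A) : P a := by
  rw [← A.evenL_add_oddL a]
  exact add _ _ (hom _ _ (homog_evenL a)) (hom _ _ (homog_oddL a))

/-- A homogeneous element `a` is approximately fixed by left multiplication with an even element,
namely `e = 1 - (1 + s a a⋆)⁻¹` for large `s`. The inverse is available as a quasi-inverse `q = -e`
of `h = s a a⋆`; that `q` is bounded independently of `s` is seen without functional calculus, from
the Cayley transform `(1 - h) (1 + h)⁻¹ = 1 + 2 q`. -/
lemma exists_approx_unit {i : ℕ} {a : A} (ha : A.Homog i a) {ε : ℝ} (hε : 0 < ε) :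
    ∃ e : A, A.Homog 0 e ∧ ‖a - e * a‖ ≤ ε := by
  set s : ℝ := 2 / ε ^ 2 with hsdef
  have hs : 0 < s := by positivity
  set b : A := ((Real.sqrt s : ℝ) : 𝕜) • star a with hb
  set h : A := star b * b with hh
  have hhs : h = (s : 𝕜) • (a * star a) := by
    rw [hh, hb, star_smul, star_star, smul_mul_smul_comm, RCLike.star_def, RCLike.conj_ofReal,
      ← RCLike.ofReal_mul, Real.mul_self_sqrt hs.le]
  have hstar : star h = h := by simp [hh]
  -- A left quasi-inverse and a right quasi-inverse agree; hence `q` is self-adjoint and even.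
  have uniq : ∀ q q' : A, h + q + h * q = 0 → h + q' + q' * h = 0 → q = q' := by
    intro q q' h1 h2
    have f1 := congrArg (q' * ·) h1
    have f2 := congrArg (· * q) h2
    simp only [mul_add, add_mul, mul_zero, zero_mul, mul_assoc] at f1 f2
    have f3 : q' * h = h * q := by
      have := f1.trans f2.symm
      rw [add_assoc, add_assoc] at this
      exact add_right_cancel this
    rw [f3] at h2
    exact add_left_cancel (add_right_cancel (h1.trans h2.symm))
  obtain ⟨q, hq1, hq2⟩ := A.exists_quasiInverse b
  rw [← hh] at hq1 hq2
  have hqs : star q = q := by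
    refine (uniq _ _ hq1 ?_).symm
    have := congrArg star hq1
    simpa [hstar] using this
  have hqg : A.grading q = q := by
    have hgh : A.grading h = h := by
      rw [hhs, map_smul, map_mul, map_star, ha.grading_eq, star_smul, star_negOne_pow,
        smul_mul_smul_comm, negOne_pow_mul_self, one_smul]
    refine (uniq _ _ hq1 ?_).symm
    have := congrArg A.grading hq2
    simpa [hgh] using this
  -- With `w = (1 + h)⁻¹ z` one has `‖(1 - h) w‖ ≤ ‖(1 + h) w‖ = ‖z‖`, because the squares of the two
  -- sides differ by `4 (b w)⋆ (b w)`.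
  have hq : ∀ z : A, ‖q * z‖ ≤ ‖z‖ := by
    intro z
    obtain ⟨w, hw⟩ : ∃ w : A, w = z + q * z := ⟨_, rfl⟩
    have h1 : h * w = -(q * z) := by
      have : h * z + q * z + h * (q * z) = 0 := by rw [← mul_assoc, ← add_mul, ← add_mul, hq1, zero_mul]
      rw [hw, mul_add, eq_neg_iff_add_eq_zero, ← this]
      abel
    have h2 : z = w + h * w := by rw [h1, hw]; abel
    have h3 := A.norm_sq_le (w - h * w) ((2 : 𝕜) • (b * w))
    have h4 : star (w - h * w) * (w - h * w) + star ((2 : 𝕜) • (b * w)) * ((2 : 𝕜) • (b * w)) =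
        star z * z := by
      have h5 : star (b * w) * (b * w) = star w * (h * w) := by
        rw [star_mul, hh]; simp only [mul_assoc]
      have h6 : star (h * w) = star w * h := by rw [star_mul, hstar]
      rw [star_smul, smul_mul_smul_comm, h5, h2, star_add, star_sub, h6]
      simp only [sub_mul, mul_sub, add_mul, mul_add, mul_assoc, RCLike.star_def, map_ofNat]
      module
    rw [h4] at h3
    have h7 : ‖w - h * w‖ ≤ ‖z‖ := by
      rw [CStarRing.norm_star_mul_self] at h3
      exact le_of_sq_le_sq (by rw [sq ‖z‖]; exact h3) (norm_nonneg _)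
    have h8 : q * z = (2⁻¹ : 𝕜) • ((w - h * w) - z) := by
      rw [h1, hw]; module
    have h9 := norm_sub_le (w - h * w) z
    rw [h8, norm_smul, norm_inv, RCLike.norm_two]
    linarith
  have hqn : ‖q‖ ≤ 1 := by
    have h1 := hq q
    nth_rw 1 [← hqs] at h1
    rw [CStarRing.norm_star_mul_self] at h1
    by_contra! h2
    nlinarith
  refine ⟨-q, by rw [homog_zero_iff, map_neg, hqg], ?_⟩
  set x : A := a - -q * a with hx
  -- `s x x⋆ = (1 + q) h (1 + q)` stays bounded, so `x` is small when `s` is large.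
  have h1 : (s : 𝕜) • (x * star x) = -q - q * q := by
    have e1 : x = a + q * a := by rw [hx]; simp
    have e2 : star x = star a + star a * q := by rw [e1, star_add, star_mul, hqs]
    have e3 : h + q * h = -q := by
      rw [eq_neg_iff_add_eq_zero, ← hq2]; abel
    calc (s : 𝕜) • (x * star x) = (h + q * h) + (h + q * h) * q := by
          rw [e2, e1, hhs]
          simp only [add_mul, mul_add, mul_smul_comm, smul_mul_assoc, mul_assoc, smul_add]
      _ = -q - q * q := by rw [e3]; simp [sub_eq_add_neg]
  have h2 : s * ‖x‖ ^ 2 ≤ 2 := by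
    have h3 : ‖(s : 𝕜) • (x * star x)‖ = s * ‖x‖ ^ 2 := by
      rw [norm_smul, RCLike.norm_ofReal, abs_of_pos hs, CStarRing.norm_self_mul_star, sq]
    rw [← h3, h1]
    have h4 := norm_sub_le (-q) (q * q)
    have h5 := norm_mul_le q q
    rw [norm_neg] at h4
    nlinarith [norm_nonneg q]
  rw [hsdef, div_mul_eq_mul_div, div_le_iff₀ (by positivity)] at h2
  exact le_of_sq_le_sq (by linarith) hε.le

end GCAlg

/-! ### Extension of homomorphisms from dense subalgebras -/

/-- A `*`-homomorphism defined on a dense `*`-subalgebra and bounded by a multiple of the norm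
extends to a graded `*`-homomorphism. -/
lemma GHom.exists_extend {A : GCAlg.{u} 𝕜} {B : GCAlg.{v} 𝕜} {R : Type w} [NonUnitalRing R]
    [StarRing R] [Module 𝕜 R] (ι : R →⋆ₙₐ[𝕜] A) (f : R →⋆ₙₐ[𝕜] B) (hd : DenseRange ι) (K : ℝ)
    (hK : ∀ x, ‖f x‖ ≤ K * ‖ι x‖) (d : R → R) (hι : ∀ x, ι (d x) = A.grading (ι x))
    (hf : ∀ x, f (d x) = B.grading (f x)) : ∃ F : GHom A B, ∀ x, F (ι x) = f x := by
  let L : A →L[𝕜] B := (f : R →ₗ[𝕜] B).extendOfNorm (ι : R →ₗ[𝕜] A)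
  have hL : ∀ x, L (ι x) = f x := LinearMap.extendOfNorm_eq hd ⟨K, hK⟩
  let F : A →⋆ₙₐ[𝕜] B :=
    { toFun := L
      map_smul' := map_smul L
      map_zero' := map_zero L
      map_add' := map_add L
      map_mul' := fun a b => by
        refine hd.induction_on₂ (isClosed_eq (by fun_prop) (by fun_prop)) (fun x y => ?_) a b
        rw [← map_mul, hL, hL, hL, map_mul]
      map_star' := fun a => by
        refine hd.induction_on (p := fun a => L (star a) = star (L a)) a
          (isClosed_eq (by fun_prop) (by fun_prop)) (fun x => ?_)
        rw [← map_star, hL, hL, map_star] }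
  refine ⟨GHom.ofStarHom F fun a => ?_, hL⟩
  refine hd.induction_on (p := fun a => L (A.grading a) = B.grading (L a)) a
    (isClosed_eq (L.continuous.comp A.continuous_grading) (B.continuous_grading.comp L.continuous))
    (fun x => ?_)
  rw [← hι, hL, hL, hf]

end GradedE

end

/-! ### Graded tensor products -/

noncomputable section

namespace GradedE

universe u' v' w'

variable {𝕜 : Type} [RCLike 𝕜]

namespace EnvData

variable {R : Type u} [NonUnitalRing R] [StarRing R] [Module 𝕜 R] [IsScalarTower 𝕜 R R]
  [SMulCommClass 𝕜 R R] [StarModule 𝕜 R] (E : EnvData 𝕜 R)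

/-- The canonical `*`-homomorphism into the enveloping C*-algebra. -/
def toEnvelopeHom : R →⋆ₙₐ[𝕜] E.envelope where
  toFun := E.toEnvelope
  map_smul' r x := Compl.of_smul (P := E.Pre) r x
  map_zero' := Compl.of_zero (P := E.Pre)
  map_add' x y := Compl.of_add (P := E.Pre) x y
  map_mul' x y := Compl.of_mul (P := E.Pre) x y
  map_star' x := Compl.of_star (P := E.Pre) x

lemma toEnvelopeHom_apply (x : R) : E.toEnvelopeHom x = E.toEnvelope x := rfl

lemma norm_toEnvelope (x : R) : ‖E.toEnvelope x‖ = E.sup x := Compl.norm_of (P := E.Pre) x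

lemma denseRange_toEnvelope : DenseRange E.toEnvelope := (Compl.denseInducing (P := E.Pre)).dense

lemma denseRange_toEnvelopeHom : DenseRange E.toEnvelopeHom := E.denseRange_toEnvelope

lemma grading_toEnvelope (x : R) :
    E.envelope.grading (E.toEnvelope x) = E.toEnvelope (E.grading x) :=
  Compl.mapHom_of (P := E.Pre) E.preGrading E.norm_grading_le x

/-- The universal property of the enveloping C*-algebra. -/
lemma exists_hom {B : GCAlg.{v} 𝕜} (f : R →⋆ₙₐ[𝕜] B) (hf : ∀ x, f (E.grading x) = B.grading (f x))
    (hadm : CStarSeminorm.ofHom f ∈ E.adm) :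
    ∃ F : GHom E.envelope B, ∀ x, F (E.toEnvelope x) = f x :=
  GHom.exists_extend E.toEnvelopeHom f E.denseRange_toEnvelopeHom 1
    (fun x => by
      rw [one_mul, toEnvelopeHom_apply, norm_toEnvelope]
      exact E.le_sup ⟨_, hadm⟩ x)
    E.grading (fun x => (E.grading_toEnvelope x).symm) hf

lemma envelopeMap_toEnvelope {R' : Type v} [NonUnitalRing R'] [StarRing R'] [Module 𝕜 R']
    [IsScalarTower 𝕜 R' R'] [SMulCommClass 𝕜 R' R'] [StarModule 𝕜 R'] {E' : EnvData 𝕜 R'}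
    (f : R →⋆ₙₐ[𝕜] R') (hf : ∀ x, f (E.grading x) = E'.grading (f x))
    (hadm : ∀ p ∈ E'.adm, ∃ q ∈ E.adm, ∀ x, q.toFun x = p.toFun (f x)) (x : R) :
    envelopeMap (E := E) f hf hadm (E.toEnvelope x) = E'.toEnvelope (f x) :=
  Compl.mapHom_of (P := E.Pre) (P' := E'.Pre) f (fun x : E.Pre =>
    E'.sup_le (E.sup_nonneg x) fun p hp => by
      obtain ⟨q, hq, h⟩ := hadm p hp
      exact (h x).symm.le.trans (E.le_sup ⟨q, hq⟩ x)) x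

end EnvData

section Instances

variable (A : GCAlg.{u} 𝕜) (B : GCAlg.{v} 𝕜)

instance : NonUnitalRing (AlgTensor A B) := inferInstance
instance : AddCommGroup (AlgTensor A B) := inferInstance
instance : AddCommMonoid (AlgTensor A B) := inferInstance
instance : Module 𝕜 (AlgTensor A B) := inferInstance
instance : MulAction 𝕜 (AlgTensor A B) := inferInstance
instance : DistribMulAction 𝕜 (AlgTensor A B) := inferInstance
instance : SMul 𝕜 (AlgTensor A B) := inferInstance
instance : Add (AlgTensor A B) := inferInstance
instance : Mul (AlgTensor A B) := inferInstance
instance : Zero (AlgTensor A B) := inferInstance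
instance : StarRing (AlgTensor A B) := inferInstance
instance : Star (AlgTensor A B) := inferInstance

end Instances

section Alg

variable {A : GCAlg.{u} 𝕜} {B : GCAlg.{v} 𝕜}

/-- An additive property of elements of the algebraic tensor product holds if it holds for the tensors
of homogeneous elements. -/
lemma algTensor_ind {P : AlgTensor A B → Prop} (add : ∀ x y, P x → P y → P (x + y))
    (tmul : ∀ i j a b, A.Homog i a → B.Homog j b → P (algTmul A B a b)) (x : AlgTensor A B) :
    P x := by
  induction x using TensorProduct.induction_on with
  | zero =>
    have := tmul 0 0 0 0 (GCAlg.homog_of_zero 0) (GCAlg.homog_of_zero 0)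
    rwa [show algTmul A B 0 0 = 0 from TensorProduct.zero_tmul _ _] at this
  | add x y hx hy => exact add x y hx hy
  | tmul a b =>
    refine GCAlg.homog_ind (P := fun a => P (algTmul A B a b)) (fun a a' h h' => ?_)
      (fun i a ha => ?_) a
    · rw [show algTmul A B (a + a') b = algTmul A B a b + algTmul A B a' b from
        TensorProduct.add_tmul _ _ _]
      exact add _ _ h h'
    · refine GCAlg.homog_ind (P := fun b => P (algTmul A B a b)) (fun b b' h h' => ?_)
        (fun j b hb => tmul i j a b ha hb) b
      rw [show algTmul A B a (b + b') = algTmul A B a b + algTmul A B a b' from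
        TensorProduct.tmul_add _ _ _]
      exact add _ _ h h'

lemma algTmul_smul_left (r : 𝕜) (a : A) (b : B) :
    algTmul A B (r • a) b = r • algTmul A B a b := rfl

lemma algTmul_smul_right (r : 𝕜) (a : A) (b : B) :
    algTmul A B a (r • b) = r • algTmul A B a b := TensorProduct.tmul_smul r a b

lemma algTmul_zero_right (a : A) : algTmul A B a 0 = 0 := TensorProduct.tmul_zero _ _

lemma algTmul_add_left (a a' : A) (b : B) :
    algTmul A B (a + a') b = algTmul A B a b + algTmul A B a' b := TensorProduct.add_tmul _ _ _

lemma algTmul_add_right (a : A) (b b' : B) :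
    algTmul A B a (b + b') = algTmul A B a b + algTmul A B a b' := TensorProduct.tmul_add _ _ _

lemma algTmul_mul {i j : ℕ} {a a' : A} {b b' : B} (hb : B.Homog j b) (ha' : A.Homog i a') :
    algTmul A B a b * algTmul A B a' b' = (-1 : 𝕜) ^ (j * i) • algTmul A B (a * a') (b * b') := by
  change (tensorTwist A B).tmul (a ⊗ₜ b) (a' ⊗ₜ b') =
    (-1 : 𝕜) ^ (j * i) • (((a * a') ⊗ₜ (b * b') : A ⊗[𝕜] B))
  have h1 : (tensorTwist A B).d₁ (a' ⊗ₜ[𝕜] b') = (-1 : 𝕜) ^ i • (a' ⊗ₜ[𝕜] b') := by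
    change (A.grading a') ⊗ₜ[𝕜] b' = _
    rw [ha'.grading_eq, TensorProduct.smul_tmul']
  have h2 : (tensorTwist A B).d₂ (a ⊗ₜ[𝕜] b) = (-1 : 𝕜) ^ j • (a ⊗ₜ[𝕜] b) := by
    change a ⊗ₜ[𝕜] (B.grading b) = _
    rw [hb.grading_eq, TensorProduct.tmul_smul]
  rw [TwistData.tmul, h2]
  rcases Nat.even_or_odd i with hi | hi
  · rw [hi.neg_one_pow, one_smul] at h1
    rw [TwistData.even_of _ h1, TwistData.odd_of _ h1, mul_zero, add_zero,
      (hi.mul_left j).neg_one_pow, one_smul, Algebra.TensorProduct.tmul_mul_tmul]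
  · rw [hi.neg_one_pow, neg_one_smul] at h1
    rw [TwistData.even_of' _ h1, TwistData.odd_of' _ h1, mul_zero, zero_add, mul_comm j i, pow_mul,
      hi.neg_one_pow, smul_mul_assoc, Algebra.TensorProduct.tmul_mul_tmul]

lemma star_algTmul {i j : ℕ} {a : A} {b : B} (ha : A.Homog i a) (hb : B.Homog j b) :
    star (algTmul A B a b) = (-1 : 𝕜) ^ (i * j) • algTmul A B (star a) (star b) := by
  change (tensorTwist A B).tstar (a ⊗ₜ b) = (-1 : 𝕜) ^ (i * j) • (star a ⊗ₜ[𝕜] star b)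
  have h1 : (tensorTwist A B).d₁ (star a ⊗ₜ[𝕜] star b) = (-1 : 𝕜) ^ i • (star a ⊗ₜ[𝕜] star b) := by
    change (A.grading (star a)) ⊗ₜ[𝕜] star b = _
    rw [ha.star.grading_eq, TensorProduct.smul_tmul']
  have h2 : (tensorTwist A B).d₂ (star a ⊗ₜ[𝕜] star b) = (-1 : 𝕜) ^ j • (star a ⊗ₜ[𝕜] star b) := by
    change star a ⊗ₜ[𝕜] (B.grading (star b)) = _
    rw [hb.star.grading_eq, TensorProduct.tmul_smul]
  rw [TwistData.tstar, TensorProduct.star_tmul]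
  rcases Nat.even_or_odd i with hi | hi
  · rw [hi.neg_one_pow, one_smul] at h1
    rw [TwistData.even_of _ h1, TwistData.odd_of _ h1, map_zero, add_zero,
      (hi.mul_right j).neg_one_pow, one_smul]
  · rw [hi.neg_one_pow, neg_one_smul] at h1
    rw [TwistData.even_of' _ h1, TwistData.odd_of' _ h1, zero_add, h2, pow_mul, hi.neg_one_pow]

lemma tensorEnv_grading_algTmul (a : A) (b : B) : (tensorEnv A B).grading (algTmul A B a b) =
    algTmul A B (A.grading a) (B.grading b) := rfl

end Alg

/-! ### Graded actions by multipliers -/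

/-- A graded `*`-representation of a C*-algebra `N` on a C*-algebra `A` by left multipliers. -/
structure GAct (N : GCAlg.{u} 𝕜) (A : GCAlg.{v} 𝕜) where
  r : N →ₗ[𝕜] A →ₗ[𝕜] A
  mul : ∀ m n x, r (m * n) x = r m (r n x)
  adj : ∀ n x y, star (r n x) * y = star x * r (star n) y
  grading : ∀ n x, r (N.grading n) (A.grading x) = A.grading (r n x)

namespace GAct

/-- A C*-algebra acts on itself by left multiplication. -/
def self (A : GCAlg.{u} 𝕜) : GAct A A where
  r := LinearMap.mul 𝕜 A
  mul m n x := mul_assoc m n x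
  adj n x y := by simp [mul_assoc]
  grading n x := by simp

lemma self_r {A : GCAlg.{u} 𝕜} (a x : A) : (self A).r a x = a * x := rfl

lemma homog {N : GCAlg.{u} 𝕜} {A : GCAlg.{v} 𝕜} (ρ : GAct N A) {i j : ℕ} {n : N} {x : A}
    (hn : N.Homog i n) (hx : A.Homog j x) : A.Homog (i + j) (ρ.r n x) := by
  rw [GCAlg.Homog, ← ρ.grading, hn.grading_eq, hx.grading_eq, map_smul, map_smul,
    LinearMap.smul_apply, smul_smul, pow_add, mul_comm]

lemma norm_le {N : GCAlg.{u} 𝕜} {A : GCAlg.{v} 𝕜} (ρ : GAct N A) (n : N) (x : A) :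
    ‖ρ.r n x‖ ≤ ‖n‖ * ‖x‖ :=
  (CStarSeminorm.ofHom (NonUnitalStarAlgHom.id 𝕜 A)).act_le N ρ.r ρ.mul ρ.adj n x

lemma continuous_right {N : GCAlg.{u} 𝕜} {A : GCAlg.{v} 𝕜} (ρ : GAct N A) (n : N) :
    Continuous (ρ.r n) :=
  AddMonoidHomClass.continuous_of_bound (ρ.r n) ‖n‖ (ρ.norm_le n)

lemma continuous_left {N : GCAlg.{u} 𝕜} {A : GCAlg.{v} 𝕜} (ρ : GAct N A) (x : A) :
    Continuous fun n => ρ.r n x :=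
  AddMonoidHomClass.continuous_of_bound (ρ.r.flip x) ‖x‖ fun n => by
    rw [mul_comm]; exact ρ.norm_le n x

/-- The operators of an action commute with right multiplication. -/
lemma mul_right {N : GCAlg.{u} 𝕜} {A : GCAlg.{v} 𝕜} (ρ : GAct N A) (n : N) (x y : A) :
    ρ.r n (x * y) = ρ.r n x * y := by
  have h : ∀ z : A, z * (ρ.r n (x * y)) = z * (ρ.r n x * y) := fun z => by
    have e1 := ρ.adj (star n) (star z) (x * y)
    have e2 := ρ.adj (star n) (star z) x
    rw [star_star, star_star] at e1 e2
    rw [← e1, ← mul_assoc, e2, mul_assoc]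
  have h1 := h (star (ρ.r n (x * y) - ρ.r n x * y))
  rw [← sub_eq_zero, ← mul_sub, CStarRing.star_mul_self_eq_zero_iff, sub_eq_zero] at h1
  exact h1

/-- Restriction along a homomorphism. -/
def comp {N : GCAlg.{u} 𝕜} {A : GCAlg.{v} 𝕜} {N' : GCAlg.{w} 𝕜} (ρ : GAct N A) (f : GHom N' N) :
    GAct N' A where
  r := ρ.r.comp (f.toHom : N' →ₗ[𝕜] N)
  mul m n x := by
    change ρ.r (f (m * n)) x = ρ.r (f m) (ρ.r (f n) x)
    rw [map_mul, ρ.mul]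
  adj n x y := by
    change star (ρ.r (f n) x) * y = star x * ρ.r (f (star n)) y
    rw [map_star, ρ.adj]
  grading n x := by
    change ρ.r (f (N'.grading n)) (A.grading x) = A.grading (ρ.r (f n) x)
    rw [f.map_grading, ρ.grading]

section extend

variable {N : GCAlg.{u} 𝕜} {A : GCAlg.{v} 𝕜} {R : Type w} [NonUnitalRing R] [StarRing R]
  [Module 𝕜 R] (ι : R →⋆ₙₐ[𝕜] A) (hd : DenseRange ι) (ρ : N →ₗ[𝕜] R →ₗ[𝕜] R)
  (hmul : ∀ m n x, ρ (m * n) x = ρ m (ρ n x))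
  (hadj : ∀ n x y, star (ρ n x) * y = star x * ρ (star n) y)
  (d : R → R) (hι : ∀ x, ι (d x) = A.grading (ι x))
  (hgr : ∀ n x, ρ (N.grading n) (d x) = d (ρ n x))

/-- The continuous extension of the operators of a `*`-representation on a dense subalgebra. -/
def extendCLM (n : N) : A →L[𝕜] A :=
  ((ι : R →ₗ[𝕜] A).comp (ρ n)).extendOfNorm (ι : R →ₗ[𝕜] A)

include hd hmul hadj in
lemma extendCLM_apply (n : N) (x : R) : extendCLM ι ρ n (ι x) = ι (ρ n x) :=
  LinearMap.extendOfNorm_eq hd ⟨‖n‖, fun x => (CStarSeminorm.ofHom ι).act_le N ρ hmul hadj n x⟩ x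

/-- A `*`-representation on a dense subalgebra extends to the C*-algebra. -/
def extend : GAct N A where
  r :=
    { toFun := fun n => (extendCLM ι ρ n : A →ₗ[𝕜] A)
      map_add' := fun m n => by
        ext x
        refine hd.induction_on (p := fun x => extendCLM ι ρ (m + n) x =
          extendCLM ι ρ m x + extendCLM ι ρ n x) x (isClosed_eq (by fun_prop) (by fun_prop))
          fun x => ?_
        simp only [extendCLM_apply ι hd ρ hmul hadj, map_add, LinearMap.add_apply]
      map_smul' := fun c n => by
        ext x
        refine hd.induction_on (p := fun x => extendCLM ι ρ (c • n) x = c • extendCLM ι ρ n x) x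
          (isClosed_eq (by fun_prop) ((continuous_const_smul c).comp (by fun_prop))) fun x => ?_
        simp only [extendCLM_apply ι hd ρ hmul hadj, map_smul, LinearMap.smul_apply] }
  mul m n x := by
    refine hd.induction_on (p := fun x => extendCLM ι ρ (m * n) x =
      extendCLM ι ρ m (extendCLM ι ρ n x)) x (isClosed_eq (by fun_prop) (by fun_prop)) fun x => ?_
    simp only [extendCLM_apply ι hd ρ hmul hadj, hmul]
  adj n x y := by
    refine hd.induction_on₂ (p := fun x y => star (extendCLM ι ρ n x) * y =
      star x * extendCLM ι ρ (star n) y) (isClosed_eq (by fun_prop) (by fun_prop))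
      (fun x y => ?_) x y
    rw [extendCLM_apply ι hd ρ hmul hadj, extendCLM_apply ι hd ρ hmul hadj, ← map_star ι,
      ← map_star ι, ← map_mul ι, ← map_mul ι, hadj]
  grading n x := by
    refine hd.induction_on (p := fun x => extendCLM ι ρ (N.grading n) (A.grading x) =
      A.grading (extendCLM ι ρ n x)) x (isClosed_eq
        ((extendCLM ι ρ _).continuous.comp A.continuous_grading)
        (A.continuous_grading.comp (extendCLM ι ρ _).continuous)) fun x => ?_
    rw [← hι, extendCLM_apply ι hd ρ hmul hadj, extendCLM_apply ι hd ρ hmul hadj, hgr, hι]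

lemma extend_apply (n : N) (x : R) :
    (extend ι hd ρ hmul hadj d hι hgr).r n (ι x) = ι (ρ n x) :=
  extendCLM_apply ι hd ρ hmul hadj n x

end extend

section tensor

variable {N : GCAlg.{w} 𝕜} {A : GCAlg.{u} 𝕜} {B : GCAlg.{v} 𝕜}

/-- The action on the left factor of an algebraic tensor product. -/
def algLeft (ρ : GAct N A) (B : GCAlg.{v} 𝕜) : N →ₗ[𝕜] AlgTensor A B →ₗ[𝕜] AlgTensor A B :=
  (LinearMap.rTensorHom B : (A →ₗ[𝕜] A) →ₗ[𝕜] (A ⊗[𝕜] B →ₗ[𝕜] A ⊗[𝕜] B)) ∘ₗ ρ.r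

lemma algLeft_apply (ρ : GAct N A) (n : N) (a : A) (b : B) :
    algLeft ρ B n (algTmul A B a b) = algTmul A B (ρ.r n a) b := rfl

/-- The action on the right factor of an algebraic tensor product, with the Koszul sign. -/
def algRight (A : GCAlg.{u} 𝕜) (ρ : GAct N B) : N →ₗ[𝕜] AlgTensor A B →ₗ[𝕜] AlgTensor A B :=
  (LinearMap.lTensorHom A : (B →ₗ[𝕜] B) →ₗ[𝕜] (A ⊗[𝕜] B →ₗ[𝕜] A ⊗[𝕜] B)) ∘ₗ ρ.r ∘ₗ N.evenL +
  (TensorProduct.mapBilinear (RingHom.id 𝕜) A B A B (A.grading : A →ₗ[𝕜] A)) ∘ₗ ρ.r ∘ₗ N.oddL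

lemma algRight_apply (ρ : GAct N B) {i j : ℕ} {n : N} {a : A} (hn : N.Homog i n) (ha : A.Homog j a)
    (b : B) :
    algRight A ρ n (algTmul A B a b) = (-1 : 𝕜) ^ (i * j) • algTmul A B a (ρ.r n b) := by
  change algTmul A B a (ρ.r (N.evenL n) b) + algTmul A B (A.grading a) (ρ.r (N.oddL n) b) = _
  rcases Nat.even_or_odd i with hi | hi
  · rw [hn.evenL_of_even hi, hn.oddL_of_even hi, (hi.mul_right j).neg_one_pow, one_smul, map_zero,
      LinearMap.zero_apply, algTmul_zero_right, add_zero]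
  · rw [hn.evenL_of_odd hi, hn.oddL_of_odd hi, pow_mul, hi.neg_one_pow, map_zero, ha.grading_eq,
      LinearMap.zero_apply, algTmul_zero_right, zero_add, algTmul_smul_left]

lemma algLeft_mul (ρ : GAct N A) (m n : N) (x : AlgTensor A B) :
    algLeft ρ B (m * n) x = algLeft ρ B m (algLeft ρ B n x) := by
  induction x using algTensor_ind with
  | add x y hx hy => rw [map_add, map_add, map_add, hx, hy]
  | tmul i j a b ha hb => rw [algLeft_apply, algLeft_apply, algLeft_apply, ρ.mul]

/-- The adjoint on the left factor is the adjoint of the action: the two Koszul signs that arise from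
moving `n` past the right factor agree. -/
lemma algLeft_adj (ρ : GAct N A) (n : N) (x y : AlgTensor A B) :
    star (algLeft ρ B n x) * y = star x * algLeft ρ B (star n) y := by
  induction x using algTensor_ind with
  | add x x' hx hx' => rw [map_add, star_add, star_add, add_mul, add_mul, hx, hx']
  | tmul i j a b ha hb =>
    induction y using algTensor_ind with
    | add y y' hy hy' => rw [map_add, mul_add, mul_add, hy, hy']
    | tmul k l a' b' ha' hb' =>
      induction n using GCAlg.homog_ind with
      | add n n' h h' =>
        rw [map_add, LinearMap.add_apply, star_add, star_add, map_add, LinearMap.add_apply,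
          add_mul, mul_add, h, h']
      | hom t n hn =>
        rw [algLeft_apply, algLeft_apply, star_algTmul (ρ.homog hn ha) hb, star_algTmul ha hb,
          smul_mul_assoc, smul_mul_assoc, algTmul_mul hb.star ha',
          algTmul_mul hb.star (ρ.homog hn.star ha'), ρ.adj, smul_smul, smul_smul, ← pow_add,
          ← pow_add]
        congr 1
        apply negOne_pow_congr
        simp only [Nat.even_add, Nat.even_mul]; grind

lemma algLeft_grading (ρ : GAct N A) (n : N) (x : AlgTensor A B) :
    algLeft ρ B (N.grading n) ((tensorEnv A B).grading x) =
      (tensorEnv A B).grading (algLeft ρ B n x) := by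
  induction x using algTensor_ind with
  | add x y hx hy => rw [map_add, map_add, map_add, map_add, hx, hy]
  | tmul i j a b ha hb =>
    rw [algLeft_apply, tensorEnv_grading_algTmul, tensorEnv_grading_algTmul, algLeft_apply,
      ρ.grading]

lemma algRight_mul (ρ : GAct N B) (m n : N) (x : AlgTensor A B) :
    algRight A ρ (m * n) x = algRight A ρ m (algRight A ρ n x) := by
  induction x using algTensor_ind with
  | add x y hx hy => rw [map_add, map_add, map_add, hx, hy]
  | tmul i j a b ha hb =>
    induction m using GCAlg.homog_ind with
    | add m m' h h' => simp only [add_mul, map_add, LinearMap.add_apply, h, h']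
    | hom s m hm =>
      induction n using GCAlg.homog_ind with
      | add n n' h h' => simp only [mul_add, map_add, LinearMap.add_apply, h, h']
      | hom t n hn =>
        rw [algRight_apply ρ (hm.mul hn) ha, algRight_apply ρ hn ha, map_smul,
          algRight_apply ρ hm ha, ρ.mul, smul_smul, ← pow_add]
        congr 1
        apply negOne_pow_congr
        simp only [Nat.even_add, Nat.even_mul]; grind

lemma algRight_adj (ρ : GAct N B) (n : N) (x y : AlgTensor A B) :
    star (algRight A ρ n x) * y = star x * algRight A ρ (star n) y := by
  induction x using algTensor_ind with
  | add x x' hx hx' => rw [map_add, star_add, star_add, add_mul, add_mul, hx, hx']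
  | tmul i j a b ha hb =>
    induction y using algTensor_ind with
    | add y y' hy hy' => rw [map_add, mul_add, mul_add, hy, hy']
    | tmul k l a' b' ha' hb' =>
      induction n using GCAlg.homog_ind with
      | add n n' h h' =>
        rw [map_add, LinearMap.add_apply, star_add, star_add, map_add, LinearMap.add_apply,
          add_mul, mul_add, h, h']
      | hom t n hn =>
        rw [algRight_apply ρ hn ha, algRight_apply ρ hn.star ha', star_smul,
          star_algTmul ha (ρ.homog hn hb), star_algTmul ha hb, star_negOne_pow, smul_smul,
          smul_mul_assoc, smul_mul_assoc, mul_smul_comm, algTmul_mul (ρ.homog hn hb).star ha',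
          algTmul_mul hb.star ha', ρ.adj, smul_smul, smul_smul, smul_smul, ← pow_add, ← pow_add,
          ← pow_add, ← pow_add]
        congr 1
        apply negOne_pow_congr
        simp only [Nat.even_add, Nat.even_mul]; grind

lemma algRight_grading (ρ : GAct N B) (n : N) (x : AlgTensor A B) :
    algRight A ρ (N.grading n) ((tensorEnv A B).grading x) =
      (tensorEnv A B).grading (algRight A ρ n x) := by
  induction x using algTensor_ind with
  | add x y hx hy => rw [map_add, map_add, map_add, map_add, hx, hy]
  | tmul i j a b ha hb =>
    induction n using GCAlg.homog_ind with
    | add n n' h h' => simp only [map_add, LinearMap.add_apply, h, h']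
    | hom t n hn =>
      rw [algRight_apply ρ hn ha, tensorEnv_grading_algTmul, map_smul, tensorEnv_grading_algTmul,
        ← ρ.grading, hn.grading_eq, ha.grading_eq, map_smul, LinearMap.smul_apply,
        algTmul_smul_left, map_smul, algRight_apply ρ hn ha, algTmul_smul_left, map_smul,
        LinearMap.smul_apply, algTmul_smul_right, smul_comm ((-1 : 𝕜) ^ t),
        smul_comm ((-1 : 𝕜) ^ t)]
      exact smul_comm _ _ _

/-- The action on the left factor of a tensor product. -/
def left (ρ : GAct N A) (B : GCAlg.{v} 𝕜) : GAct N (A ⊗ᵍ B) :=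
  extend (tensorEnv A B).toEnvelopeHom (tensorEnv A B).denseRange_toEnvelopeHom (algLeft ρ B)
    (algLeft_mul ρ) (algLeft_adj ρ) (tensorEnv A B).grading
    (fun x => ((tensorEnv A B).grading_toEnvelope x).symm) (algLeft_grading ρ)

/-- The action on the right factor of a tensor product. -/
def right (A : GCAlg.{u} 𝕜) (ρ : GAct N B) : GAct N (A ⊗ᵍ B) :=
  extend (tensorEnv A B).toEnvelopeHom (tensorEnv A B).denseRange_toEnvelopeHom (algRight A ρ)
    (algRight_mul ρ) (algRight_adj ρ) (tensorEnv A B).grading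
    (fun x => ((tensorEnv A B).grading_toEnvelope x).symm) (algRight_grading ρ)

lemma left_tmul (ρ : GAct N A) (n : N) (a : A) (b : B) :
    (ρ.left B).r n (a ⊗ₑ b) = ρ.r n a ⊗ₑ b :=
  extend_apply (tensorEnv A B).toEnvelopeHom (tensorEnv A B).denseRange_toEnvelopeHom (algLeft ρ B)
    (algLeft_mul ρ) (algLeft_adj ρ) (tensorEnv A B).grading
    (fun x => ((tensorEnv A B).grading_toEnvelope x).symm) (algLeft_grading ρ) n (algTmul A B a b)

lemma right_tmul (ρ : GAct N B) {i j : ℕ} {n : N} {a : A} (hn : N.Homog i n) (ha : A.Homog j a)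
    (b : B) : (ρ.right A).r n (a ⊗ₑ b) = (-1 : 𝕜) ^ (i * j) • (a ⊗ₑ ρ.r n b) := by
  refine (extend_apply (tensorEnv A B).toEnvelopeHom (tensorEnv A B).denseRange_toEnvelopeHom
    (algRight A ρ) (algRight_mul ρ) (algRight_adj ρ) (tensorEnv A B).grading
    (fun x => ((tensorEnv A B).grading_toEnvelope x).symm) (algRight_grading ρ) n
    (algTmul A B a b)).trans ?_
  rw [algRight_apply ρ hn ha, map_smul]
  rfl

end tensor

end GAct

/-! ### Homomorphisms on graded tensor products -/

section tmul

variable {A : GCAlg.{u} 𝕜} {B : GCAlg.{v} 𝕜}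

/-- The square `(a ⊗ b)⋆ (a ⊗ b)` as the result of two actions on `a ⊗ b`, without any sign. This
bounds a C*-seminorm of `a ⊗ b` even if `a` and `b` are not homogeneous. -/
lemma star_algTmul_mul (a : A) (b : B) (y : AlgTensor A B) : star (algTmul A B a b) * y =
    GAct.algRight A (GAct.self B) (star b) (GAct.algLeft (GAct.self A) B (star a) y) := by
  induction y using algTensor_ind with
  | add y y' hy hy' => rw [mul_add, map_add, map_add, hy, hy']
  | tmul k l a' b' ha' hb' =>
    induction a using GCAlg.homog_ind with
    | add a a' h h' =>
      rw [algTmul_add_left, star_add, add_mul, h, h', star_add, map_add, LinearMap.add_apply, map_add]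
    | hom i a ha =>
      induction b using GCAlg.homog_ind with
      | add b b' h h' =>
        rw [algTmul_add_right, star_add, add_mul, h, h', star_add, map_add, LinearMap.add_apply]
      | hom j b hb =>
        rw [GAct.algLeft_apply, GAct.self_r, GAct.algRight_apply _ hb.star (ha.star.mul ha'),
          star_algTmul ha hb, smul_mul_assoc, algTmul_mul hb.star ha', smul_smul, ← pow_add,
          GAct.self_r]
        congr 1
        apply negOne_pow_congr
        simp only [Nat.even_add, Nat.even_mul]; grind

/-- Every C*-seminorm on an algebraic tensor product of C*-algebras is a subcross seminorm. -/
lemma CStarSeminorm.mem_tensorEnv_adm (p : CStarSeminorm 𝕜 (AlgTensor A B)) :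
    p ∈ (tensorEnv A B).adm := by
  intro a b
  have h1 := p.sq_le (algTmul A B a b) 0
  rw [star_zero, mul_zero, add_zero, star_algTmul_mul] at h1
  have h2 := p.act_le A (GAct.algLeft (GAct.self A) B) (GAct.algLeft_mul _) (GAct.algLeft_adj _)
    (star a) (algTmul A B a b)
  have h3 := p.act_le B (GAct.algRight A (GAct.self B)) (GAct.algRight_mul _)
    (GAct.algRight_adj _) (star b) (GAct.algLeft (GAct.self A) B (star a) (algTmul A B a b))
  rw [norm_star] at h2 h3
  have h5 := h1.trans (h3.trans (mul_le_mul_of_nonneg_left h2 (norm_nonneg b)))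
  rcases (p.nonneg (algTmul A B a b)).eq_or_lt with h0 | h0
  · rw [← h0]; positivity
  · nlinarith

/-- The elementary tensors as a bilinear map. -/
def tmulL (A : GCAlg.{u} 𝕜) (B : GCAlg.{v} 𝕜) : A →ₗ[𝕜] B →ₗ[𝕜] (A ⊗ᵍ B : GCAlg 𝕜) :=
  LinearMap.mk₂ 𝕜 (fun a b => a ⊗ₑ b)
    (fun a a' b => by
      change (tensorEnv A B).toEnvelopeHom _ = _
      rw [algTmul_add_left, map_add]; rfl)
    (fun r a b => by
      change (tensorEnv A B).toEnvelopeHom _ = _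
      rw [algTmul_smul_left, map_smul]; rfl)
    (fun a b b' => by
      change (tensorEnv A B).toEnvelopeHom _ = _
      rw [algTmul_add_right, map_add]; rfl)
    (fun r a b => by
      change (tensorEnv A B).toEnvelopeHom _ = _
      rw [algTmul_smul_right, map_smul]; rfl)

lemma add_tmul' (a a' : A) (b : B) : (a + a') ⊗ₑ b = a ⊗ₑ b + a' ⊗ₑ b :=
  (tmulL A B).map_add₂ a a' b
lemma tmul_add' (a : A) (b b' : B) : a ⊗ₑ (b + b') = a ⊗ₑ b + a ⊗ₑ b' := map_add (tmulL A B a) b b'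
lemma smul_tmul' (r : 𝕜) (a : A) (b : B) : (r • a) ⊗ₑ b = r • (a ⊗ₑ b) :=
  (tmulL A B).map_smul₂ r a b
lemma tmul_smul' (r : 𝕜) (a : A) (b : B) : a ⊗ₑ (r • b) = r • (a ⊗ₑ b) :=
  map_smul (tmulL A B a) r b
lemma zero_tmul' (b : B) : (0 : A) ⊗ₑ b = 0 := (tmulL A B).map_zero₂ b
lemma tmul_zero' (a : A) : a ⊗ₑ (0 : B) = 0 := map_zero (tmulL A B a)
lemma sub_tmul' (a a' : A) (b : B) : (a - a') ⊗ₑ b = a ⊗ₑ b - a' ⊗ₑ b :=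
  (tmulL A B).map_sub₂ a a' b
lemma tmul_sub' (a : A) (b b' : B) : a ⊗ₑ (b - b') = a ⊗ₑ b - a ⊗ₑ b' := map_sub (tmulL A B a) b b'

lemma norm_tmul_le (a : A) (b : B) : ‖a ⊗ₑ b‖ ≤ ‖a‖ * ‖b‖ := by
  have h := ((tensorEnv A B).norm_toEnvelope (algTmul A B a b)).trans_le
    ((tensorEnv A B).sup_le (mul_nonneg (norm_nonneg a) (norm_nonneg b)) fun p hp => hp a b)
  exact h

lemma continuous_tmul_left (b : B) : Continuous fun a : A => a ⊗ₑ b :=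
  AddMonoidHomClass.continuous_of_bound ((tmulL A B).flip b) ‖b‖ fun a => by
    rw [mul_comm]; exact norm_tmul_le a b

lemma continuous_tmul_right (a : A) : Continuous fun b : B => a ⊗ₑ b :=
  AddMonoidHomClass.continuous_of_bound (tmulL A B a) ‖a‖ fun b => norm_tmul_le a b

lemma tmul_mul_tmul {i j : ℕ} {a a' : A} {b b' : B} (hb : B.Homog j b) (ha' : A.Homog i a') :
    (a ⊗ₑ b) * (a' ⊗ₑ b') = (-1 : 𝕜) ^ (j * i) • ((a * a') ⊗ₑ (b * b')) := by
  change (tensorEnv A B).toEnvelopeHom _ * (tensorEnv A B).toEnvelopeHom _ = _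
  rw [← map_mul, algTmul_mul hb ha', map_smul]
  rfl

lemma star_tmul {i j : ℕ} {a : A} {b : B} (ha : A.Homog i a) (hb : B.Homog j b) :
    star (a ⊗ₑ b) = (-1 : 𝕜) ^ (i * j) • (star a ⊗ₑ star b) := by
  change star ((tensorEnv A B).toEnvelopeHom _) = _
  rw [← map_star, star_algTmul ha hb, map_smul]
  rfl

lemma grading_tmul (a : A) (b : B) :
    (A ⊗ᵍ B : GCAlg 𝕜).grading (a ⊗ₑ b) = A.grading a ⊗ₑ B.grading b :=
  (tensorEnv A B).grading_toEnvelope _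

lemma homog_tmul {i j : ℕ} {a : A} {b : B} (ha : A.Homog i a) (hb : B.Homog j b) :
    (A ⊗ᵍ B : GCAlg 𝕜).Homog (i + j) (a ⊗ₑ b) := by
  rw [GCAlg.Homog, grading_tmul, ha.grading_eq, hb.grading_eq, smul_tmul', tmul_smul', smul_smul,
    pow_add]

/-- A closed additive property of elements of a tensor product holds if it holds for the tensors of
homogeneous elements. -/
lemma tensor_ind {P : (A ⊗ᵍ B : GCAlg 𝕜) → Prop} (closed : IsClosed {z | P z})
    (add : ∀ x y, P x → P y → P (x + y))
    (tmul : ∀ i j (a : A) (b : B), A.Homog i a → B.Homog j b → P (a ⊗ₑ b))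
    (z : (A ⊗ᵍ B : GCAlg 𝕜)) : P z := by
  refine (tensorEnv A B).denseRange_toEnvelopeHom.induction_on z closed fun x => ?_
  induction x using algTensor_ind with
  | add x y hx hy => rw [map_add]; exact add _ _ hx hy
  | tmul i j a b ha hb => exact tmul i j a b ha hb

lemma GHom.ext_tensor {C : GCAlg.{w} 𝕜} {f g : GHom (A ⊗ᵍ B) C}
    (h : ∀ i j (a : A) (b : B), A.Homog i a → B.Homog j b → f (a ⊗ₑ b) = g (a ⊗ₑ b)) : f = g := by
  ext z
  induction z using tensor_ind with
  | closed => exact isClosed_eq f.continuous g.continuous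
  | add x y hx hy => rw [map_add, map_add, hx, hy]
  | tmul i j a b ha hb => exact h i j a b ha hb

lemma GHom.tensor_tmul {A' : GCAlg.{u'} 𝕜} {B' : GCAlg.{v'} 𝕜} (f : GHom A A') (g : GHom B B')
    (a : A) (b : B) : f.tensor g (a ⊗ₑ b) = f a ⊗ₑ g b :=
  EnvData.envelopeMap_toEnvelope _ _ _ _ _

/-- A bilinear map that respects products and adjoints of homogeneous elements, with the Koszul
signs, defines a graded `*`-homomorphism on the graded tensor product. -/
lemma GHom.exists_lift {C : GCAlg.{w} 𝕜} (Φ : A →ₗ[𝕜] B →ₗ[𝕜] C)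
    (hmul : ∀ i j k l (a : A) (b : B) (a' : A) (b' : B), A.Homog i a → B.Homog j b → A.Homog k a' →
      B.Homog l b' → Φ a b * Φ a' b' = (-1 : 𝕜) ^ (j * k) • Φ (a * a') (b * b'))
    (hstar : ∀ i j (a : A) (b : B), A.Homog i a → B.Homog j b →
      star (Φ a b) = (-1 : 𝕜) ^ (i * j) • Φ (star a) (star b))
    (hgr : ∀ i j (a : A) (b : B), A.Homog i a → B.Homog j b → C.Homog (i + j) (Φ a b)) :
    ∃ F : GHom (A ⊗ᵍ B) C, ∀ a b, F (a ⊗ₑ b) = Φ a b := by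
  let L : AlgTensor A B →ₗ[𝕜] C := (TensorProduct.lift Φ : A ⊗[𝕜] B →ₗ[𝕜] C)
  have hL : ∀ a b, L (algTmul A B a b) = Φ a b := fun a b => TensorProduct.lift.tmul a b
  let f : AlgTensor A B →⋆ₙₐ[𝕜] C :=
    { toFun := L
      map_smul' := map_smul L
      map_zero' := map_zero L
      map_add' := map_add L
      map_mul' := fun x y => by
        induction x using algTensor_ind with
        | add x x' h h' => rw [add_mul, map_add, map_add, add_mul, h, h']
        | tmul i j a b ha hb =>
          induction y using algTensor_ind with
          | add y y' h h' => rw [mul_add, map_add, map_add, mul_add, h, h']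
          | tmul k l a' b' ha' hb' =>
            rw [algTmul_mul hb ha', map_smul, hL, hL, hL, hmul i j k l a b a' b' ha hb ha' hb']
      map_star' := fun x => by
        induction x using algTensor_ind with
        | add x x' h h' => rw [star_add, map_add, map_add, star_add, h, h']
        | tmul i j a b ha hb => rw [star_algTmul ha hb, map_smul, hL, hL, hstar i j a b ha hb] }
  obtain ⟨F, hF⟩ := (tensorEnv A B).exists_hom f (fun x => by
    change L _ = C.grading (L x)
    induction x using algTensor_ind with
    | add x x' h h' => rw [map_add, map_add, map_add, map_add, h, h']
    | tmul i j a b ha hb =>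
      rw [tensorEnv_grading_algTmul, ha.grading_eq, hb.grading_eq, hL, hL,
        (hgr i j a b ha hb).grading_eq, map_smul, map_smul, LinearMap.smul_apply, smul_smul,
        pow_add, mul_comm]) (CStarSeminorm.mem_tensorEnv_adm _)
  exact ⟨F, fun a b => (hF _).trans (hL a b)⟩

/-- The graded flip `a ⊗ b ↦ (-1)^(deg a deg b) b ⊗ a` exists. -/
lemma GHom.exists_flip (A : GCAlg.{u} 𝕜) (B : GCAlg.{v} 𝕜) : ∃ F : GHom (A ⊗ᵍ B) (B ⊗ᵍ A),
    ∀ i j (a : A) (b : B), A.Homog i a → B.Homog j b →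
      F (a ⊗ₑ b) = (-1 : 𝕜) ^ (i * j) • (b ⊗ₑ a) := by
  -- The sign is expressed by the parts of `a` and the grading of `b`, which makes it bilinear.
  let Φ : A →ₗ[𝕜] B →ₗ[𝕜] (B ⊗ᵍ A : GCAlg 𝕜) := (tmulL B A).flip ∘ₗ A.evenL +
    ((tmulL B A) ∘ₗ (B.grading : B →ₗ[𝕜] B)).flip ∘ₗ A.oddL
  have hΦ : ∀ i j (a : A) (b : B), A.Homog i a → B.Homog j b →
      Φ a b = (-1 : 𝕜) ^ (i * j) • (b ⊗ₑ a) := by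
    intro i j a b ha hb
    change b ⊗ₑ (A.evenL a) + (B.grading b) ⊗ₑ (A.oddL a) = _
    rcases Nat.even_or_odd i with hi | hi
    · rw [ha.evenL_of_even hi, ha.oddL_of_even hi, (hi.mul_right j).neg_one_pow, one_smul,
        tmul_zero', add_zero]
    · rw [ha.evenL_of_odd hi, ha.oddL_of_odd hi, pow_mul, hi.neg_one_pow, hb.grading_eq,
        tmul_zero', zero_add, smul_tmul']
  obtain ⟨F, hF⟩ := GHom.exists_lift Φ
    (fun i j k l a b a' b' ha hb ha' hb' => by
      rw [hΦ i j a b ha hb, hΦ k l a' b' ha' hb', hΦ _ _ _ _ (ha.mul ha') (hb.mul hb'),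
        smul_mul_smul_comm, tmul_mul_tmul ha hb', smul_smul, smul_smul, ← pow_add, ← pow_add,
        ← pow_add]
      congr 1
      apply negOne_pow_congr
      simp only [Nat.even_add, Nat.even_mul]; grind)
    (fun i j a b ha hb => by
      rw [hΦ i j a b ha hb, hΦ _ _ _ _ ha.star hb.star, star_smul, star_tmul hb ha,
        star_negOne_pow, mul_comm j i])
    (fun i j a b ha hb => by
      rw [hΦ i j a b ha hb, add_comm]
      exact (homog_tmul hb ha).smul _)
  exact ⟨F, fun i j a b ha hb => (hF a b).trans (hΦ i j a b ha hb)⟩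

end tmul

end GradedE

end

/-! ### Commuting actions and the associativity isomorphism -/

noncomputable section

namespace GradedE

universe u' v' w'

variable {𝕜 : Type} [RCLike 𝕜]

namespace GAct

variable {A : GCAlg.{u} 𝕜} {B : GCAlg.{v} 𝕜} {C : GCAlg.{w} 𝕜} {E : GCAlg.{u'} 𝕜}

/-- The actions `ρ` and `σ` commute in the graded sense. -/
def Comm (ρ : GAct A E) (σ : GAct B E) : Prop :=
  ∀ i j (a : A) (b : B) (x : E), A.Homog i a → B.Homog j b →
    ρ.r a (σ.r b x) = (-1 : 𝕜) ^ (i * j) • σ.r b (ρ.r a x)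

lemma Comm.symm {ρ : GAct A E} {σ : GAct B E} (h : Comm ρ σ) : Comm σ ρ :=
  fun i j b a x hb ha => by
    rw [h j i a b x ha hb, smul_smul, mul_comm j i, negOne_pow_mul_self, one_smul]

lemma comm_left_right {A' : GCAlg.{v'} 𝕜} {B' : GCAlg.{w'} 𝕜} (ρ : GAct A A') (σ : GAct B B') :
    Comm (ρ.left B') (σ.right A') := fun i j a b x ha hb => by
  induction x using tensor_ind with
  | closed =>
    exact isClosed_eq (((ρ.left B').continuous_right a).comp ((σ.right A').continuous_right b))
      ((continuous_const_smul _).comp (((σ.right A').continuous_right b).comp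
        ((ρ.left B').continuous_right a)))
  | add x y hx hy => rw [map_add, map_add, hx, hy, map_add, map_add, smul_add]
  | tmul k l x y hx hy =>
    rw [right_tmul σ hb hx, map_smul, left_tmul, left_tmul, right_tmul σ hb (ρ.homog ha hx),
      smul_smul, ← pow_add]
    congr 1
    apply negOne_pow_congr
    simp only [Nat.even_add, Nat.even_mul]; grind

lemma Comm.left {E : GCAlg.{v'} 𝕜} {ρ : GAct A E} {σ : GAct B E} (h : Comm ρ σ)
    (F : GCAlg.{w'} 𝕜) : Comm (ρ.left F) (σ.left F) := fun i j a b x ha hb => by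
  induction x using tensor_ind with
  | closed =>
    exact isClosed_eq (((ρ.left F).continuous_right a).comp ((σ.left F).continuous_right b))
      ((continuous_const_smul _).comp (((σ.left F).continuous_right b).comp
        ((ρ.left F).continuous_right a)))
  | add x y hx hy => rw [map_add, map_add, hx, hy, map_add, map_add, smul_add]
  | tmul k l x y hx hy =>
    rw [left_tmul, left_tmul, left_tmul, left_tmul, h i j a b x ha hb, smul_tmul']

lemma Comm.right {E : GCAlg.{v'} 𝕜} {ρ : GAct A E} {σ : GAct B E} (h : Comm ρ σ)
    (F : GCAlg.{w'} 𝕜) : Comm (ρ.right F) (σ.right F) := fun i j a b x ha hb => by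
  induction x using tensor_ind with
  | closed =>
    exact isClosed_eq (((ρ.right F).continuous_right a).comp ((σ.right F).continuous_right b))
      ((continuous_const_smul _).comp (((σ.right F).continuous_right b).comp
        ((ρ.right F).continuous_right a)))
  | add x y hx hy => rw [map_add, map_add, hx, hy, map_add, map_add, smul_add]
  | tmul k l x y hx hy =>
    rw [right_tmul σ hb hx y, right_tmul ρ ha hx y, map_smul, map_smul, right_tmul σ hb hx,
      right_tmul ρ ha hx, h i j a b y ha hb, tmul_smul', smul_smul, smul_smul, smul_smul, smul_smul]
    congr 1
    ring

/-- Graded commuting actions of `A` and `B` define an action of `A ⊗ B`: the operator norm of the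
action of the algebraic tensor product is a C*-seminorm, so it is dominated by the maximal one. -/
lemma exists_pair {ρ : GAct A E} {σ : GAct B E} (h : Comm ρ σ) :
    ∃ τ : GAct (A ⊗ᵍ B) E, ∀ a b x, τ.r (a ⊗ₑ b) x = ρ.r a (σ.r b x) := by
  let L : AlgTensor A B →ₗ[𝕜] E →ₗ[𝕜] E :=
    (TensorProduct.lift ((LinearMap.mul 𝕜 (Module.End 𝕜 E)).compl₁₂ ρ.r σ.r) :
      A ⊗[𝕜] B →ₗ[𝕜] Module.End 𝕜 E)
  have hL : ∀ a b x, L (algTmul A B a b) x = ρ.r a (σ.r b x) := fun a b x => rfl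
  have hmul : ∀ x y e, L (x * y) e = L x (L y e) := by
    intro x y e
    induction x using algTensor_ind with
    | add x x' h h' => rw [add_mul, map_add, map_add, LinearMap.add_apply, LinearMap.add_apply, h, h']
    | tmul i j a b ha hb =>
      induction y using algTensor_ind with
      | add y y' h h' =>
        rw [mul_add, map_add, map_add, LinearMap.add_apply, LinearMap.add_apply, h, h', map_add]
      | tmul k l a' b' ha' hb' =>
        rw [algTmul_mul hb ha', map_smul, LinearMap.smul_apply, hL, hL, hL, ρ.mul, σ.mul,
          h k j a' b _ ha' hb, map_smul, smul_smul, mul_comm j k, negOne_pow_mul_self, one_smul]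
  have hadj : ∀ x e e', star (L x e) * e' = star e * L (star x) e' := by
    intro x e e'
    induction x using algTensor_ind with
    | add x x' h h' =>
      rw [star_add, map_add, map_add, LinearMap.add_apply, LinearMap.add_apply, star_add, add_mul,
        mul_add, h, h']
    | tmul i j a b ha hb =>
      rw [star_algTmul ha hb, map_smul, LinearMap.smul_apply, hL, hL, ρ.adj, σ.adj,
        h i j _ _ _ ha.star hb.star, smul_smul, negOne_pow_mul_self, one_smul]
  have hgr : ∀ x e, L ((tensorEnv A B).grading x) (E.grading e) = E.grading (L x e) := by
    intro x e
    induction x using algTensor_ind with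
    | add x x' h h' =>
      rw [map_add, map_add, map_add, LinearMap.add_apply, LinearMap.add_apply, h, h', map_add]
    | tmul i j a b ha hb => rw [tensorEnv_grading_algTmul, hL, hL, σ.grading, ρ.grading]
  have hcont : ∀ x, Continuous (L x) := fun x => by
    induction x using algTensor_ind with
    | add x x' h h' => rw [map_add]; exact h.add h'
    | tmul i j a b ha hb => exact (ρ.continuous_right a).comp (σ.continuous_right b)
  -- The operator norm of `T x` is a C*-seminorm, hence at most the norm of `x` in `A ⊗ B`.
  let T : AlgTensor A B →ₗ[𝕜] E →L[𝕜] E :=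
    { toFun := fun x => ⟨L x, hcont x⟩
      map_add' := fun x y => ContinuousLinearMap.coe_injective (map_add L x y)
      map_smul' := fun r x => ContinuousLinearMap.coe_injective (map_smul L r x) }
  have hT : ∀ x e, T x e = L x e := fun _ _ => rfl
  let p : CStarSeminorm 𝕜 (AlgTensor A B) :=
    { (normSeminorm 𝕜 (E →L[𝕜] E)).comp T with
      mul_le := fun x y => by
        change ‖T (x * y)‖ ≤ ‖T x‖ * ‖T y‖
        refine ContinuousLinearMap.opNorm_le_bound _ (by positivity) fun e => ?_
        rw [hT, hmul, ← hT, ← hT, mul_assoc]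
        exact (T x).le_opNorm_of_le ((T y).le_opNorm e)
      sq_le := fun x y => by
        change ‖T x‖ ^ 2 ≤ ‖T (star x * x + star y * y)‖
        rw [← Real.le_sqrt (norm_nonneg _) (norm_nonneg _)]
        refine ContinuousLinearMap.opNorm_le_bound _ (Real.sqrt_nonneg _) fun e => ?_
        rw [← Real.sqrt_sq (norm_nonneg e), ← Real.sqrt_mul (norm_nonneg _)]
        refine Real.le_sqrt_of_sq_le ?_
        have h1 := E.norm_sq_le (L x e) (L y e)
        rw [hadj, hadj, ← mul_add, ← hmul, ← hmul, ← LinearMap.add_apply, ← map_add] at h1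
        refine h1.trans ((norm_mul_le _ _).trans ?_)
        rw [norm_star, ← hT]
        have h2 := (T (star x * x + star y * y)).le_opNorm e
        nlinarith [mul_le_mul_of_nonneg_left h2 (norm_nonneg e)] }
  have hp : ∀ x, ‖T x‖ ≤ 1 * ‖(tensorEnv A B).toEnvelopeHom x‖ := fun x => by
    rw [one_mul, EnvData.toEnvelopeHom_apply, EnvData.norm_toEnvelope]
    exact (tensorEnv A B).le_sup ⟨p, p.mem_tensorEnv_adm⟩ x
  have hd := (tensorEnv A B).denseRange_toEnvelopeHom
  let J : AlgTensor A B →ₗ[𝕜] (A ⊗ᵍ B : GCAlg 𝕜) := ((tensorEnv A B).toEnvelopeHom :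
    AlgTensor A B →ₗ[𝕜] (tensorEnv A B).envelope)
  let S : (A ⊗ᵍ B : GCAlg 𝕜) →L[𝕜] E →L[𝕜] E := T.extendOfNorm J
  have hS : ∀ x e, S (J x) e = L x e := fun x e =>
    congrArg (fun t : E →L[𝕜] E => t e) (LinearMap.extendOfNorm_eq (e := J) hd ⟨1, hp⟩ x)
  have hd' : DenseRange J := hd
  have hSc : ∀ e, Continuous fun z => S z e := fun e => by fun_prop
  have hJm : ∀ x y, J x * J y = J (x * y) := fun x y =>
    (map_mul (tensorEnv A B).toEnvelopeHom x y).symm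
  have hJs : ∀ x, star (J x) = J (star x) := fun x =>
    (map_star (tensorEnv A B).toEnvelopeHom x).symm
  have hJg : ∀ x, (A ⊗ᵍ B : GCAlg 𝕜).grading (J x) = J ((tensorEnv A B).grading x) := fun x =>
    (tensorEnv A B).grading_toEnvelope x
  refine ⟨{
    r := (ContinuousLinearMap.coeLM 𝕜).comp (S : (A ⊗ᵍ B : GCAlg 𝕜) →ₗ[𝕜] E →L[𝕜] E)
    mul := fun m n e => by
      change S (m * n) e = S m (S n e)
      refine hd'.induction_on₂ (p := fun m n => S (m * n) e = S m (S n e))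
        (isClosed_eq ((hSc e).comp continuous_mul) (by fun_prop)) (fun x y => ?_) m n
      rw [hJm, hS, hS, hS, hmul]
    adj := fun n x y => by
      change star (S n x) * y = star x * S (star n) y
      refine hd'.induction_on (p := fun n => star (S n x) * y = star x * S (star n) y) n
        (isClosed_eq ((hSc x).star.mul continuous_const)
          (continuous_const.mul ((hSc y).comp continuous_star))) fun n => ?_
      rw [hJs, hS, hS, hadj]
    grading := fun n x => by
      change S ((A ⊗ᵍ B : GCAlg 𝕜).grading n) (E.grading x) = E.grading (S n x)
      refine hd'.induction_on (p := fun n => S ((A ⊗ᵍ B : GCAlg 𝕜).grading n) (E.grading x) =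
        E.grading (S n x)) n (isClosed_eq ((hSc _).comp (GCAlg.continuous_grading _))
          (E.continuous_grading.comp (hSc x))) fun n => ?_
      rw [hJg, hS, hS, hgr] }, fun a b x => hS (algTmul A B a b) x⟩

/-- An action that commutes with actions of `A` and `B` commutes with the action of `A ⊗ B`. -/
lemma Comm.pair {ρ : GAct A E} {σ : GAct B E} {τ : GAct (A ⊗ᵍ B) E} {κ : GAct C E}
    (hτ : ∀ a b x, τ.r (a ⊗ₑ b) x = ρ.r a (σ.r b x)) (h₁ : Comm ρ κ) (h₂ : Comm σ κ) :
    Comm τ κ := by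
  -- The degree of `m` does not survive limits. So the sign is written as the grading applied to `m`,
  -- which makes the relation a closed condition on all `m`.
  have key : ∀ j (n : C) (x : E) (m : (A ⊗ᵍ B : GCAlg 𝕜)), C.Homog j n → τ.r m (κ.r n x) =
      κ.r n (τ.r (if Even j then m else (A ⊗ᵍ B : GCAlg 𝕜).grading m) x) := by
    intro j n x m hn
    have hc : Continuous fun m : (A ⊗ᵍ B : GCAlg 𝕜) =>
        if Even j then m else (A ⊗ᵍ B : GCAlg 𝕜).grading m := by
      split_ifs
      · exact continuous_id
      · exact GCAlg.continuous_grading _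
    induction m using tensor_ind with
    | closed =>
      exact isClosed_eq (τ.continuous_left _)
        ((κ.continuous_right n).comp ((τ.continuous_left x).comp hc))
    | add m m' h h' =>
      rw [map_add, LinearMap.add_apply, h, h', ← map_add, ← LinearMap.add_apply, ← map_add]
      congr 3
      split_ifs
      · rfl
      · rw [map_add]
    | tmul k l a b ha hb =>
      have e : (if Even j then a ⊗ₑ b else (A ⊗ᵍ B : GCAlg 𝕜).grading (a ⊗ₑ b)) =
          (-1 : 𝕜) ^ (j * (k + l)) • (a ⊗ₑ b) := by
        rw [(homog_tmul ha hb).grading_eq]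
        split_ifs with hj
        · rw [(hj.mul_right _).neg_one_pow, one_smul]
        · rw [pow_mul, (Nat.not_even_iff_odd.1 hj).neg_one_pow]
      rw [e, hτ, map_smul, LinearMap.smul_apply, hτ, h₂ l j b n x hb hn, map_smul,
        h₁ k j a n _ ha hn, map_smul, smul_smul]
      congr 1
      ring
  intro i j m n x hm hn
  rw [key j n x m hn]
  split_ifs with hj
  · rw [(hj.mul_left i).neg_one_pow, one_smul]
  · rw [hm.grading_eq, map_smul, LinearMap.smul_apply, map_smul, mul_comm i j, pow_mul,
      (Nat.not_even_iff_odd.1 hj).neg_one_pow]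

lemma eq_of_mul_right {e e' : E} (h : ∀ x, e * x = e' * x) : e = e' := by
  have h1 := h (star (e - e'))
  rw [← sub_eq_zero, ← sub_mul, CStarRing.mul_star_self_eq_zero_iff, sub_eq_zero] at h1
  exact h1

/-- If `a` acts as left multiplication by `e`, then `e` is bounded by `a`. -/
lemma norm_le_of_lmul (ρ : GAct A E) {a : A} {e : E} (h : ∀ x, ρ.r a x = e * x) : ‖e‖ ≤ ‖a‖ := by
  have h1 : ‖e‖ * ‖e‖ ≤ ‖a‖ * ‖e‖ := by
    rw [← CStarRing.norm_self_mul_star, ← h, ← norm_star e]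
    exact ρ.norm_le a (star e)
  rcases (norm_nonneg e).eq_or_lt with h0 | h0
  · rw [← h0]; exact norm_nonneg a
  · exact le_of_mul_le_mul_right h1 h0

/-- The elements that act as left multiplications form a closed set, because the multiplier depends
continuously on the element. -/
lemma isClosed_lmul (ρ : GAct A E) : IsClosed {a | ∃ e, ∀ x, ρ.r a x = e * x} := by
  refine IsSeqClosed.isClosed fun s a hs ha => ?_
  choose e he using hs
  have hc : CauchySeq e := by
    refine Metric.cauchySeq_iff.2 fun ε hε => ?_
    obtain ⟨N, hN⟩ := Metric.cauchySeq_iff.1 ha.cauchySeq ε hε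
    refine ⟨N, fun m hm n hn => (?_ : dist _ _ ≤ _).trans_lt (hN m hm n hn)⟩
    rw [dist_eq_norm, dist_eq_norm]
    exact ρ.norm_le_of_lmul fun x => by
      rw [map_sub, LinearMap.sub_apply, he, he, sub_mul]
  obtain ⟨e₀, he₀⟩ := cauchySeq_tendsto_of_complete hc
  exact ⟨e₀, fun x => tendsto_nhds_unique (((ρ.continuous_left x).tendsto a).comp ha)
    ((he₀.mul_const x).congr fun n => (he n x).symm)⟩

/-- An action by left multiplications is given by a homomorphism. -/
lemma exists_hom_of_lmul (ρ : GAct A E) (h : ∀ a, ∃ e, ∀ x, ρ.r a x = e * x) :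
    ∃ F : GHom A E, ∀ a x, F a * x = ρ.r a x := by
  choose F hF using h
  refine ⟨⟨{
    toFun := F
    map_smul' := fun r a => eq_of_mul_right fun x => by
      rw [← hF, map_smul, LinearMap.smul_apply, hF, MonoidHom.id_apply, smul_mul_assoc]
    map_zero' := eq_of_mul_right fun x => by
      rw [← hF, map_zero, LinearMap.zero_apply, zero_mul]
    map_add' := fun a b => eq_of_mul_right fun x => by
      rw [← hF, map_add, LinearMap.add_apply, hF, hF, add_mul]
    map_mul' := fun a b => eq_of_mul_right fun x => by
      rw [← hF, ρ.mul, hF, hF, mul_assoc]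
    map_star' := fun a => by
      refine eq_of_mul_right fun x => ?_
      have h2 : star x * F a = star (F (star a) * x) := eq_of_mul_right fun z => by
        rw [mul_assoc, ← hF, ← hF, ρ.adj, star_star]
      have h3 := congrArg star h2
      rw [star_star, star_mul, star_star] at h3
      exact h3.symm }, fun a => eq_of_mul_right fun x => ?_, fun a => ρ.norm_le_of_lmul (hF a)⟩,
    fun a x => (hF a x).symm⟩
  change F _ * x = E.grading (F a) * x
  rw [← hF, ← E.grading_grading x, ρ.grading, hF, map_mul]

end GAct

variable {A : GCAlg.{u} 𝕜} {B : GCAlg.{v} 𝕜} {C : GCAlg.{w} 𝕜} {E : GCAlg.{u'} 𝕜}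

/-- A homomorphism and an action that commute in the graded sense define a homomorphism on the
tensor product. -/
lemma GHom.exists_lift_act (ρ : GAct A E) (φ : GHom B E)
    (h : GAct.Comm ρ ((GAct.self E).comp φ)) :
    ∃ F : GHom (A ⊗ᵍ B) E, ∀ a b, F (a ⊗ₑ b) = ρ.r a (φ b) := by
  have h' : ∀ i j (a : A) (b : B) x, A.Homog i a → B.Homog j b →
      φ b * ρ.r a x = (-1 : 𝕜) ^ (j * i) • ρ.r a (φ b * x) := fun i j a b x ha hb =>
    h.symm j i b a x hb ha
  refine GHom.exists_lift (ρ.r.compl₂ (φ.toHom : B →ₗ[𝕜] E)) ?_ ?_ ?_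
  · intro i j k l a b a' b' ha hb ha' hb'
    change ρ.r a (φ b) * ρ.r a' (φ b') = (-1 : 𝕜) ^ (j * k) • ρ.r (a * a') (φ (b * b'))
    rw [← ρ.mul_right, h' k j a' b _ ha' hb, map_smul, ρ.mul, map_mul φ.toHom]
  · intro i j a b ha hb
    change star (ρ.r a (φ b)) = (-1 : 𝕜) ^ (i * j) • ρ.r (star a) (φ (star b))
    refine GAct.eq_of_mul_right fun x => ?_
    rw [ρ.adj, ← map_star, h' i j _ _ _ ha.star hb.star, smul_mul_assoc, ρ.mul_right, mul_comm j i]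
  · intro i j a b ha hb
    exact ρ.homog ha (hb.map φ)

lemma GHom.ext_tensor_left {D : GCAlg.{v'} 𝕜} {f g : GHom ((A ⊗ᵍ B) ⊗ᵍ C) D}
    (h : ∀ i j k (a : A) (b : B) (c : C), A.Homog i a → B.Homog j b → C.Homog k c →
      f ((a ⊗ₑ b) ⊗ₑ c) = g ((a ⊗ₑ b) ⊗ₑ c)) : f = g := by
  refine GHom.ext_tensor fun _ k z c hz hc => ?_
  clear hz
  induction z using tensor_ind with
  | closed =>
    exact isClosed_eq (f.continuous.comp (continuous_tmul_left c))
      (g.continuous.comp (continuous_tmul_left c))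
  | add x y hx hy => rw [add_tmul', map_add, map_add, hx, hy]
  | tmul i j a b ha hb => exact h i j k a b c ha hb hc

lemma GHom.ext_tensor_right {D : GCAlg.{v'} 𝕜} {f g : GHom (A ⊗ᵍ B ⊗ᵍ C) D}
    (h : ∀ i j k (a : A) (b : B) (c : C), A.Homog i a → B.Homog j b → C.Homog k c →
      f (a ⊗ₑ b ⊗ₑ c) = g (a ⊗ₑ b ⊗ₑ c)) : f = g := by
  refine GHom.ext_tensor fun i _ a z ha hz => ?_
  clear hz
  induction z using tensor_ind with
  | closed =>
    exact isClosed_eq (f.continuous.comp (continuous_tmul_right a))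
      (g.continuous.comp (continuous_tmul_right a))
  | add x y hx hy => rw [tmul_add', map_add, map_add, hx, hy]
  | tmul j k b c hb hc => exact h i j k a b c ha hb hc

/-- The associativity isomorphism comes from the commuting actions of the three factors on
`A ⊗ (B ⊗ C)`, under which elementary tensors act as left multiplications. -/
lemma exists_isAssoc (A : GCAlg.{u} 𝕜) (B : GCAlg.{v} 𝕜) (C : GCAlg.{w} 𝕜) :
    ∃ θ : GHom ((A ⊗ᵍ B) ⊗ᵍ C) (A ⊗ᵍ B ⊗ᵍ C), IsAssoc θ := by
  let ρA := (GAct.self A).left (B ⊗ᵍ C)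
  let ρB := ((GAct.self B).left C).right A
  let ρC := ((GAct.self C).right B).right A
  obtain ⟨τ, hτ⟩ := GAct.exists_pair (GAct.comm_left_right (GAct.self A) ((GAct.self B).left C))
  have hAC : GAct.Comm ρA ρC := GAct.comm_left_right _ _
  have hBC : GAct.Comm ρB ρC := (GAct.comm_left_right _ _).right A
  obtain ⟨κ, hκ⟩ := GAct.exists_pair (GAct.Comm.pair hτ hAC hBC)
  have key : ∀ i j k (a : A) (b : B) (c : C), A.Homog i a → B.Homog j b → C.Homog k c →
      ∀ x, κ.r ((a ⊗ₑ b) ⊗ₑ c) x = (a ⊗ₑ b ⊗ₑ c) * x := by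
    intro i j k a b c ha hb hc x
    rw [hκ, hτ]
    induction x using tensor_ind with
    | closed =>
      exact isClosed_eq ((ρA.continuous_right a).comp ((ρB.continuous_right b).comp
        (ρC.continuous_right c))) (continuous_const_mul (a ⊗ₑ b ⊗ₑ c))
    | add x y hx hy => simp only [map_add, mul_add, hx, hy]
    | tmul l _ a' z ha' hz =>
      clear hz
      induction z using tensor_ind with
      | closed =>
        exact isClosed_eq ((ρA.continuous_right a).comp ((ρB.continuous_right b).comp
          ((ρC.continuous_right c).comp (continuous_tmul_right a'))))
          ((continuous_const_mul (a ⊗ₑ b ⊗ₑ c)).comp (continuous_tmul_right a'))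
      | add x y hx hy => simp only [tmul_add', map_add, mul_add, hx, hy]
      | tmul m n b' c' hb' hc' =>
        rw [tmul_mul_tmul (homog_tmul hb hc) ha', tmul_mul_tmul hc hb', GAct.right_tmul _ hc ha',
          GAct.right_tmul _ hc hb', tmul_smul', map_smul, map_smul, map_smul, map_smul,
          GAct.right_tmul _ hb ha', GAct.left_tmul, map_smul, GAct.left_tmul, tmul_smul']
        simp only [smul_smul, GAct.self_r]
        congr 1
        ring
  obtain ⟨F, hF⟩ := κ.exists_hom_of_lmul fun z => by
    have hadd : ∀ y z, (∃ e, ∀ x, κ.r y x = e * x) → (∃ e, ∀ x, κ.r z x = e * x) →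
        ∃ e, ∀ x, κ.r (y + z) x = e * x := by
      rintro y z ⟨e, he⟩ ⟨e', he'⟩
      exact ⟨e + e', fun x => by rw [map_add, LinearMap.add_apply, he, he', add_mul]⟩
    induction z using tensor_ind with
    | closed => exact κ.isClosed_lmul
    | add x y hx hy => exact hadd x y hx hy
    | tmul _ k z c hz hc =>
      clear hz
      induction z using tensor_ind with
      | closed => exact κ.isClosed_lmul.preimage (continuous_tmul_left c)
      | add x y hx hy => rw [add_tmul']; exact hadd _ _ hx hy
      | tmul i j a b ha hb => exact ⟨_, key i j k a b c ha hb hc⟩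
  refine ⟨F, fun a b c => ?_⟩
  induction a using GCAlg.homog_ind with
  | add a a' h h' => simp only [add_tmul', map_add, h, h']
  | hom i a ha =>
    induction b using GCAlg.homog_ind with
    | add b b' h h' => simp only [add_tmul', tmul_add', map_add, h, h']
    | hom j b hb =>
      induction c using GCAlg.homog_ind with
      | add c c' h h' => simp only [tmul_add', map_add, h, h']
      | hom k c hc =>
        exact GAct.eq_of_mul_right fun x => (hF _ x).trans (key i j k a b c ha hb hc x)

lemma existsUnique_isAssoc (A : GCAlg.{u} 𝕜) (B : GCAlg.{v} 𝕜) (C : GCAlg.{w} 𝕜) :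
    ∃! θ : GHom ((A ⊗ᵍ B) ⊗ᵍ C) (A ⊗ᵍ B ⊗ᵍ C), IsAssoc θ := by
  obtain ⟨θ, hθ⟩ := exists_isAssoc A B C
  exact ⟨θ, hθ, fun θ' hθ' => GHom.ext_tensor_left fun _ _ _ a b c _ _ _ =>
    (hθ' a b c).trans (hθ a b c).symm⟩

/-- The inverse of the associativity isomorphism is a composition of flips and associativity
isomorphisms. -/
lemma exists_assoc_symm (A : GCAlg.{u} 𝕜) (B : GCAlg.{v} 𝕜) (C : GCAlg.{w} 𝕜) :
    ∃ θ : GHom (A ⊗ᵍ B ⊗ᵍ C) ((A ⊗ᵍ B) ⊗ᵍ C), ∀ (a : A) (b : B) (c : C),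
      θ (a ⊗ₑ b ⊗ₑ c) = (a ⊗ₑ b) ⊗ₑ c := by
  obtain ⟨τ₁, h₁⟩ := GHom.exists_flip A (B ⊗ᵍ C)
  obtain ⟨α₁, k₁⟩ := exists_isAssoc B C A
  obtain ⟨τ₂, h₂⟩ := GHom.exists_flip B (C ⊗ᵍ A)
  obtain ⟨α₂, k₂⟩ := exists_isAssoc C A B
  obtain ⟨τ₃, h₃⟩ := GHom.exists_flip C (A ⊗ᵍ B)
  refine ⟨τ₃.comp (α₂.comp (τ₂.comp (α₁.comp τ₁))), fun a b c => ?_⟩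
  simp only [GHom.comp_apply]
  induction a using GCAlg.homog_ind with
  | add a a' h h' => simp only [add_tmul', map_add, h, h']
  | hom i a ha =>
    induction b using GCAlg.homog_ind with
    | add b b' h h' => simp only [add_tmul', tmul_add', map_add, h, h']
    | hom j b hb =>
      induction c using GCAlg.homog_ind with
      | add c c' h h' => simp only [tmul_add', map_add, h, h']
      | hom k c hc =>
        rw [h₁ _ _ _ _ ha (homog_tmul hb hc), map_smul, k₁, map_smul,
          h₂ _ _ _ _ hb (homog_tmul hc ha), map_smul, map_smul, map_smul, k₂, map_smul,
          h₃ _ _ _ _ hc (homog_tmul ha hb), smul_smul, smul_smul, ← pow_add, ← pow_add,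
          Even.neg_one_pow, one_smul]
        simp only [Nat.even_add, Nat.even_mul]; grind

end GradedE

end

/-! ### Generators of `C₀(ℝ)` -/

noncomputable section

namespace GradedE

universe u' v' w'

variable {𝕜 : Type} [RCLike 𝕜]

open scoped ZeroAtInfty

/-- Evaluation at a point of the line. -/
def evS (x : ℝ) : funS 𝕜 →⋆ₙₐ[𝕜] 𝕜 where
  toFun f := DFunLike.coe (F := C₀(ℝ, 𝕜)) f x
  map_smul' _ _ := rfl
  map_zero' := rfl
  map_add' _ _ := rfl
  map_mul' _ _ := rfl
  map_star' _ := rfl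

lemma evS_def (x : ℝ) (f : ZeroAtInftyContinuousMap ℝ 𝕜) : evS x (f : funS 𝕜) = f x := rfl

lemma evS_ext {f g : funS 𝕜} (h : ∀ x, evS x f = evS x g) : f = g :=
  ZeroAtInftyContinuousMap.ext h

lemma continuous_evS (f : funS 𝕜) : Continuous fun x => evS x f :=
  map_continuous (F := C₀(ℝ, 𝕜)) f

lemma tendsto_evS (f : funS 𝕜) : Tendsto (fun x => evS x f) (cocompact ℝ) (𝓝 0) :=
  zero_at_infty (F := C₀(ℝ, 𝕜)) f

lemma evS_grading (x : ℝ) (f : funS 𝕜) : evS x ((funS 𝕜).grading f) = evS (-x) f := rfl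

lemma norm_evS_le (x : ℝ) (f : funS 𝕜) : ‖evS x f‖ ≤ ‖f‖ := by
  have h := BoundedContinuousFunction.norm_coe_le_norm (f : C₀(ℝ, 𝕜)).toBCF x
  exact h

lemma norm_funS_le {f : funS 𝕜} {M : ℝ} (hM : 0 ≤ M) (h : ∀ x, ‖evS x f‖ ≤ M) : ‖f‖ ≤ M :=
  (BoundedContinuousFunction.norm_le (f := (f : C₀(ℝ, 𝕜)).toBCF) hM).2 h

/-- The element of `C₀(ℝ)` given by a real function. -/
def mkS (f : ℝ → ℝ) (hc : Continuous f) (h0 : Tendsto f (cocompact ℝ) (𝓝 0)) : funS 𝕜 :=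
  (⟨⟨fun x => (f x : 𝕜), RCLike.continuous_ofReal.comp hc⟩, by
    have := (RCLike.continuous_ofReal (K := 𝕜)).tendsto 0
    rw [RCLike.ofReal_zero] at this
    exact this.comp h0⟩ : C₀(ℝ, 𝕜))

lemma homog_zero_funS_iff {f : funS 𝕜} :
    (funS 𝕜).Homog 0 f ↔ ∀ x, evS (-x) f = evS x f := by
  rw [GCAlg.homog_zero_iff]
  exact ⟨fun h x => by rw [← evS_grading, h], fun h => evS_ext fun x => by rw [evS_grading, h]⟩

lemma homog_one_funS_iff {f : funS 𝕜} :
    (funS 𝕜).Homog 1 f ↔ ∀ x, evS (-x) f = -evS x f := by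
  rw [GCAlg.homog_one_iff]
  exact ⟨fun h x => by rw [← evS_grading, h, map_neg],
    fun h => evS_ext fun x => by rw [evS_grading, h, map_neg]⟩

lemma tendsto_mul_exp_neg_sq : Tendsto (fun x : ℝ => x * Real.exp (-x ^ 2)) (cocompact ℝ) (𝓝 0) := by
  refine squeeze_zero_norm' (a := fun x => ‖x‖⁻¹) ?_ ?_
  · refine Filter.Eventually.of_forall fun x => ?_
    rcases eq_or_ne x 0 with rfl | hx
    · simp
    · have hx' : 0 < |x| := abs_pos.2 hx
      rw [norm_mul, Real.norm_eq_abs, Real.norm_eq_abs, Real.abs_exp, ← one_div,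
        le_div_iff₀ hx', mul_right_comm, abs_mul_abs_self, Real.exp_neg, ← sq,
        mul_inv_le_iff₀ (Real.exp_pos _), one_mul]
      linarith [Real.add_one_le_exp (x ^ 2)]
  · exact tendsto_inv_atTop_zero.comp tendsto_norm_cocompact_atTop

lemma tendsto_exp_neg_sq : Tendsto (fun x : ℝ => Real.exp (-x ^ 2)) (cocompact ℝ) (𝓝 0) := by
  refine Real.tendsto_exp_atBot.comp (tendsto_neg_atTop_atBot.comp ?_)
  have : Tendsto (fun x : ℝ => ‖x‖ ^ 2) (cocompact ℝ) atTop :=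
    (tendsto_pow_atTop two_ne_zero).comp tendsto_norm_cocompact_atTop
  exact this.congr fun x => by rw [Real.norm_eq_abs, sq_abs]

variable (𝕜) in
/-- The generator `u = exp(-x²)` of `C₀(ℝ)`. -/
def uS : funS 𝕜 := mkS (fun x => Real.exp (-x ^ 2)) (by fun_prop) tendsto_exp_neg_sq

variable (𝕜) in
/-- The generator `v = x exp(-x²)` of `C₀(ℝ)`. -/
def vS : funS 𝕜 := mkS (fun x => x * Real.exp (-x ^ 2)) (by fun_prop) tendsto_mul_exp_neg_sq

lemma evS_uS (x : ℝ) : evS x (uS 𝕜) = (Real.exp (-x ^ 2) : ℝ) := rfl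
lemma evS_vS (x : ℝ) : evS x (vS 𝕜) = (x * Real.exp (-x ^ 2) : ℝ) := rfl

lemma homog_uS : (funS 𝕜).Homog 0 (uS 𝕜) :=
  homog_zero_funS_iff.2 fun x => by rw [evS_uS, evS_uS, neg_sq]

lemma homog_vS : (funS 𝕜).Homog 1 (vS 𝕜) :=
  homog_one_funS_iff.2 fun x => by rw [evS_vS, evS_vS, neg_sq, neg_mul, RCLike.ofReal_neg]

lemma star_uS : star (uS 𝕜) = uS 𝕜 :=
  evS_ext fun x => by rw [map_star, evS_uS, RCLike.star_def, RCLike.conj_ofReal]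

lemma star_vS : star (vS 𝕜) = vS 𝕜 :=
  evS_ext fun x => by rw [map_star, evS_vS, RCLike.star_def, RCLike.conj_ofReal]

/-- Extension of functions vanishing at infinity to the one-point compactification. -/
def onePtS : funS 𝕜 →ₙₐ[𝕜] C(OnePoint ℝ, 𝕜) where
  toFun f := OnePoint.continuousMapMk ⟨fun x => evS x f, continuous_evS f⟩ 0 (by
    rw [coclosedCompact_eq_cocompact]; exact tendsto_evS f)
  map_smul' r f := by
    ext x; induction x using OnePoint.rec with
    | infty => exact (smul_zero r).symm
    | coe x => rfl
  map_zero' := by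
    ext x; induction x using OnePoint.rec with
    | infty => rfl
    | coe x => rfl
  map_add' f g := by
    ext x; induction x using OnePoint.rec with
    | infty => exact (add_zero 0).symm
    | coe x => rfl
  map_mul' f g := by
    ext x; induction x using OnePoint.rec with
    | infty => exact (mul_zero 0).symm
    | coe x => rfl

lemma onePtS_coe (f : funS 𝕜) (x : ℝ) : onePtS f (x : OnePoint ℝ) = evS x f := rfl
lemma onePtS_infty (f : funS 𝕜) : onePtS f OnePoint.infty = 0 := rfl

lemma onePtS_star (f : funS 𝕜) : onePtS (star f) = star (onePtS f) := by
  ext x; induction x using OnePoint.rec with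
  | infty => exact (star_zero 𝕜).symm
  | coe x => rfl

/-- By the Stone–Weierstrass theorem, `C₀(ℝ)` is generated by `u = exp(-x²)` and `v = x exp(-x²)`. The
theorem is applied on the one-point compactification, to the algebra of the functions `c + h` with `c`
constant and `h` in the nonunital algebra generated by `u` and `v`. -/
lemma funS_ind {P : funS 𝕜 → Prop} (closed : IsClosed {f | P f})
    (add : ∀ f g, P f → P g → P (f + g)) (smul : ∀ (r : 𝕜) f, P f → P (r • f))
    (mul : ∀ f g, P f → P g → P (f * g)) (u : P (uS 𝕜)) (v : P (vS 𝕜)) (f : funS 𝕜) : P f := by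
  let N := NonUnitalAlgebra.adjoin 𝕜 ({uS 𝕜, vS 𝕜} : Set (funS 𝕜))
  have huN : uS 𝕜 ∈ N := NonUnitalAlgebra.subset_adjoin 𝕜 (by simp)
  have hvN : vS 𝕜 ∈ N := NonUnitalAlgebra.subset_adjoin 𝕜 (by simp)
  have hNP : ∀ f ∈ N, P f := fun f hf => by
    induction hf using NonUnitalAlgebra.adjoin_induction with
    | mem x hx => rcases hx with rfl | rfl <;> assumption
    | add x y _ _ hx hy => exact add x y hx hy
    | zero =>
      have := smul 0 _ u
      rwa [zero_smul] at this
    | mul x y _ _ hx hy => exact mul x y hx hy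
    | smul r x _ hx => exact smul r x hx
  have hNs : ∀ f ∈ N, star f ∈ N := fun f hf => by
    induction hf using NonUnitalAlgebra.adjoin_induction with
    | mem x hx =>
      rcases hx with rfl | rfl
      · rw [star_uS]; exact huN
      · rw [star_vS]; exact hvN
    | add x y _ _ hx hy => rw [star_add]; exact add_mem hx hy
    | zero => rw [star_zero]; exact zero_mem N
    | mul x y _ _ hx hy => rw [star_mul]; exact mul_mem hy hx
    | smul r x _ hx => rw [star_smul]; exact SMulMemClass.smul_mem _ hx
  let A := StarAlgebra.adjoin 𝕜 ({onePtS (uS 𝕜), onePtS (vS 𝕜)} : Set C(OnePoint ℝ, 𝕜))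
  have hA : ∀ g ∈ A, ∃ (c : 𝕜) (h : funS 𝕜), h ∈ N ∧ g = algebraMap 𝕜 _ c + onePtS h := fun g hg => by
    induction hg using StarAlgebra.adjoin_induction with
    | mem x hx =>
      rcases hx with rfl | rfl
      · exact ⟨0, _, huN, by simp⟩
      · exact ⟨0, _, hvN, by simp⟩
    | algebraMap r => exact ⟨r, 0, zero_mem N, by simp⟩
    | add x y _ _ hx hy =>
      obtain ⟨c, h, hh, rfl⟩ := hx
      obtain ⟨c', h', hh', rfl⟩ := hy
      exact ⟨c + c', h + h', add_mem hh hh', by rw [map_add, map_add]; abel⟩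
    | mul x y _ _ hx hy =>
      obtain ⟨c, h, hh, rfl⟩ := hx
      obtain ⟨c', h', hh', rfl⟩ := hy
      refine ⟨c * c', c • h' + c' • h + h * h', add_mem (add_mem (SMulMemClass.smul_mem _ hh')
        (SMulMemClass.smul_mem _ hh)) (mul_mem hh hh'), ?_⟩
      rw [map_add, map_add, map_mul, map_smul, map_smul, map_mul, Algebra.smul_def, Algebra.smul_def]
      ring
    | star x _ hx =>
      obtain ⟨c, h, hh, rfl⟩ := hx
      refine ⟨star c, star h, hNs h hh, ?_⟩
      rw [star_add, onePtS_star, algebraMap_star_comm]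
  have hsep : A.SeparatesPoints := by
    have hu : onePtS (uS 𝕜) ∈ A := StarAlgebra.subset_adjoin 𝕜 _ (by simp)
    have hv : onePtS (vS 𝕜) ∈ A := StarAlgebra.subset_adjoin 𝕜 _ (by simp)
    have h0 : ∀ x : ℝ, onePtS (uS 𝕜) (x : OnePoint ℝ) ≠ 0 := fun x => by
      rw [onePtS_coe, evS_uS]
      exact RCLike.ofReal_ne_zero.2 (Real.exp_pos _).ne'
    intro x y hxy
    induction x using OnePoint.rec with
    | infty =>
      induction y using OnePoint.rec with
      | infty => exact absurd rfl hxy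
      | coe y => exact ⟨_, ⟨_, hu, rfl⟩, (h0 y).symm⟩
    | coe x =>
      induction y using OnePoint.rec with
      | infty => exact ⟨_, ⟨_, hu, rfl⟩, h0 x⟩
      | coe y =>
        by_cases h : onePtS (uS 𝕜) (x : OnePoint ℝ) = onePtS (uS 𝕜) (y : OnePoint ℝ)
        -- The quotient `v / u` is the coordinate `x`.
        · refine ⟨_, ⟨_, hv, rfl⟩, fun h' => hxy ?_⟩
          change onePtS (vS 𝕜) (x : OnePoint ℝ) = onePtS (vS 𝕜) (y : OnePoint ℝ) at h'
          rw [onePtS_coe, onePtS_coe, evS_uS, evS_uS, RCLike.ofReal_inj] at h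
          rw [onePtS_coe, onePtS_coe, evS_vS, evS_vS, RCLike.ofReal_inj, h] at h'
          rw [mul_right_cancel₀ (Real.exp_pos _).ne' h']
        · exact ⟨_, ⟨_, hu, rfl⟩, h⟩
  have htop := ContinuousMap.starSubalgebra_topologicalClosure_eq_top_of_separatesPoints A hsep
  have hf : onePtS f ∈ A.topologicalClosure := by rw [htop]; trivial
  have hmem : f ∈ closure {f | P f} := by
    refine Metric.mem_closure_iff.2 fun ε hε => ?_
    obtain ⟨g, hg, hfg⟩ := Metric.mem_closure_iff.1 hf (ε / 4) (by positivity)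
    obtain ⟨c, h, hh, rfl⟩ := hA g hg
    refine ⟨h, hNP h hh, ?_⟩
    have hd : ∀ x, ‖onePtS f x - (c + onePtS h x)‖ ≤ ε / 4 := fun x => by
      rw [← dist_eq_norm]
      exact (ContinuousMap.dist_apply_le_dist (f := onePtS f) x).trans hfg.le
    -- Evaluation at `∞` shows that the constant is negligible.
    have hc : ‖c‖ ≤ ε / 4 := by
      have := hd OnePoint.infty
      rwa [onePtS_infty, onePtS_infty, add_zero, zero_sub, norm_neg] at this
    rw [dist_eq_norm]
    refine (norm_funS_le (M := ε / 2) (by positivity) fun x => ?_).trans_lt (by linarith)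
    have h1 := hd (x : OnePoint ℝ)
    rw [onePtS_coe, onePtS_coe] at h1
    have h2 : evS x (f - h) = (evS x f - (c + evS x h)) + c := by rw [map_sub]; ring
    rw [h2]
    exact (norm_add_le _ _).trans (by linarith)
  rwa [closed.closure_eq] at hmem

lemma GHom.ext_funS {B : GCAlg.{v} 𝕜} {f g : GHom (funS 𝕜) B} (hu : f (uS 𝕜) = g (uS 𝕜))
    (hv : f (vS 𝕜) = g (vS 𝕜)) : f = g := by
  ext x
  induction x using funS_ind with
  | closed => exact isClosed_eq f.continuous g.continuous
  | add x y hx hy => rw [map_add, map_add, hx, hy]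
  | smul r x hx => rw [map_smul, map_smul, hx]
  | mul x y hx hy => rw [map_mul, map_mul, hx, hy]
  | u => exact hu
  | v => exact hv

lemma tmul_mul_tmul_of_even {A : GCAlg.{u} 𝕜} {B : GCAlg.{v} 𝕜} {b : B} (hb : B.Homog 0 b)
    (a a' : A) (b' : B) : (a ⊗ₑ b) * (a' ⊗ₑ b') = (a * a') ⊗ₑ (b * b') := by
  induction a' using GCAlg.homog_ind with
  | add x y hx hy => rw [add_tmul', mul_add, hx, hy, mul_add, add_tmul']
  | hom i x hx => rw [tmul_mul_tmul hb hx, zero_mul, pow_zero, one_smul]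

/-- Homomorphisms on `𝒮 ⊗ A` are determined by their values on `u ⊗ a` and `v ⊗ a`. As `A` has no unit,
a product `xy ⊗ a` is approximated by `(x ⊗ e) (y ⊗ a) = xy ⊗ e a` with `e` even and `e a` close to `a`. -/
lemma GHom.ext_funS_tensor {A : GCAlg.{u} 𝕜} {B : GCAlg.{v} 𝕜} {f g : GHom (funS 𝕜 ⊗ᵍ A) B}
    (hu : ∀ a, f (uS 𝕜 ⊗ₑ a) = g (uS 𝕜 ⊗ₑ a)) (hv : ∀ a, f (vS 𝕜 ⊗ₑ a) = g (vS 𝕜 ⊗ₑ a)) :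
    f = g := by
  have key : ∀ x (a : A), f (x ⊗ₑ a) = g (x ⊗ₑ a) := by
    intro x
    induction x using funS_ind with
    | closed =>
      rw [Set.ofPred_forall]
      exact isClosed_iInter fun a => isClosed_eq (f.continuous.comp (continuous_tmul_left a))
        (g.continuous.comp (continuous_tmul_left a))
    | add x y hx hy => intro a; rw [add_tmul', map_add, map_add, hx, hy]
    | smul r x hx => intro a; rw [smul_tmul', map_smul, map_smul, hx]
    | mul x y hx hy =>
      intro a
      induction a using GCAlg.homog_ind with
      | add a b ha hb => rw [tmul_add', map_add, map_add, ha, hb]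
      | hom i a ha =>
        have hcl : IsClosed {a | f ((x * y) ⊗ₑ a) = g ((x * y) ⊗ₑ a)} :=
          isClosed_eq (f.continuous.comp (continuous_tmul_right _))
            (g.continuous.comp (continuous_tmul_right _))
        have hmem : a ∈ closure {a | f ((x * y) ⊗ₑ a) = g ((x * y) ⊗ₑ a)} := by
          refine Metric.mem_closure_iff.2 fun ε hε => ?_
          obtain ⟨e, he, hea⟩ := GCAlg.exists_approx_unit ha (half_pos hε)
          refine ⟨e * a, ?_, by rw [dist_eq_norm]; linarith⟩
          change f _ = g _
          rw [← tmul_mul_tmul_of_even he, map_mul, map_mul, hx, hy]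
        rwa [hcl.closure_eq] at hmem
    | u => exact hu
    | v => exact hv
  exact GHom.ext_tensor fun _ _ x a _ _ => key x a

end GradedE

end

/-! ### The comultiplication of `C₀(ℝ)` -/

noncomputable section

namespace GradedE

universe u' v' w'

variable {𝕜 : Type} [RCLike 𝕜]

lemma le_of_forall_pow_two_pow_le {x y N : ℝ} (hy : 0 ≤ y)
    (h : ∀ k : ℕ, x ^ 2 ^ k ≤ N * y ^ 2 ^ k) : x ≤ y := by
  by_contra! hxy
  rcases hy.eq_or_lt with rfl | hy'
  · have := h 0
    simp only [pow_zero, pow_one, mul_zero] at this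
    linarith
  · have h1 : 1 < x / y := (one_lt_div hy').2 hxy
    obtain ⟨n, hn⟩ := ((tendsto_pow_atTop_atTop_of_one_lt h1).comp
      (tendsto_pow_atTop_atTop_of_one_lt (r := 2) (by norm_num))).eventually_gt_atTop N |>.exists
    have h2 := h n
    rw [← div_le_iff₀ (by positivity), ← div_pow] at h2
    exact absurd h2 (not_le.2 hn)

/-- A sum of self-adjoint elements with pairwise products `0` is bounded by the largest norm: the
powers `(∑ h_i)^(2^k) = ∑ h_i^(2^k)` grow like those of the largest summand. -/
lemma GCAlg.norm_sum_le_of_mul_eq_zero (A : GCAlg.{u} 𝕜) {ι : Type} (s : Finset ι) (k : ℕ) :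
    ∀ (a : ι → A) (M : ℝ), (∀ i ∈ s, star (a i) = a i) → (∀ i ∈ s, ‖a i‖ ≤ M) →
      (∀ i ∈ s, ∀ j ∈ s, i ≠ j → a i * a j = 0) →
      ‖∑ i ∈ s, a i‖ ^ 2 ^ k ≤ s.card * M ^ 2 ^ k := by
  induction k with
  | zero =>
    intro a M _ hM _
    rw [pow_zero, pow_one, pow_one]
    exact (norm_sum_le _ _).trans ((Finset.sum_le_sum hM).trans_eq (by simp))
  | succ k ih =>
    intro a M hs hM h0
    have h1 : star (∑ i ∈ s, a i) * ∑ i ∈ s, a i = ∑ i ∈ s, a i * a i := by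
      rw [star_sum, Finset.sum_mul_sum]
      refine Finset.sum_congr rfl fun i hi => ?_
      rw [Finset.sum_eq_single i, hs i hi]
      · intro j hj hij
        rw [hs i hi, h0 i hi j hj hij.symm]
      · exact fun h => absurd hi h
    have h2 := ih (fun i => a i * a i) (M ^ 2) (fun i hi => by rw [star_mul, hs i hi])
      (fun i hi => (norm_mul_le _ _).trans (by
        rw [sq]
        exact mul_le_mul (hM i hi) (hM i hi) (norm_nonneg _) ((norm_nonneg _).trans (hM i hi))))
      (fun i hi j hj hij => by
        rw [mul_assoc, ← mul_assoc (a i) (a j), h0 i hi j hj hij, zero_mul, mul_zero])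
    rwa [← h1, CStarRing.norm_star_mul_self, ← sq, ← pow_mul, ← pow_mul, ← pow_succ'] at h2

/-- The norm of a sum of pairwise orthogonal elements is the largest of the norms. -/
lemma GCAlg.norm_sum_le_of_orthogonal (A : GCAlg.{u} 𝕜) {ι : Type} (s : Finset ι) (a : ι → A)
    {M : ℝ} (hM0 : 0 ≤ M) (hM : ∀ i ∈ s, ‖a i‖ ≤ M)
    (h1 : ∀ i ∈ s, ∀ j ∈ s, i ≠ j → star (a i) * a j = 0)
    (h2 : ∀ i ∈ s, ∀ j ∈ s, i ≠ j → a i * star (a j) = 0) : ‖∑ i ∈ s, a i‖ ≤ M := by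
  have e : star (∑ i ∈ s, a i) * ∑ i ∈ s, a i = ∑ i ∈ s, star (a i) * a i := by
    rw [star_sum, Finset.sum_mul_sum]
    refine Finset.sum_congr rfl fun i hi => ?_
    rw [Finset.sum_eq_single i]
    · exact fun j hj hij => h1 i hi j hj hij.symm
    · exact fun h => absurd hi h
  have h3 : ‖∑ i ∈ s, star (a i) * a i‖ ≤ M ^ 2 := by
    refine le_of_forall_pow_two_pow_le (N := s.card) (sq_nonneg M) fun k =>
      A.norm_sum_le_of_mul_eq_zero s k _ _ (fun i _ => by rw [star_mul, star_star])
        (fun i hi => ?_) fun i hi j hj hij => ?_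
    · rw [CStarRing.norm_star_mul_self, ← sq]
      exact pow_le_pow_left₀ (norm_nonneg _) (hM i hi) 2
    · rw [mul_assoc, ← mul_assoc (a i), h2 i hi j hj hij, zero_mul, mul_zero]
  rw [← e, CStarRing.norm_star_mul_self, ← sq] at h3
  exact (sq_le_sq₀ (norm_nonneg _) hM0).1 h3

/-- The function `t ↦ t` cut off to the unit interval. -/
def ramp (t : ℝ) : ℝ := max 0 (min 1 t)

lemma continuous_ramp : Continuous ramp := by unfold ramp; fun_prop
lemma ramp_nonneg (t : ℝ) : 0 ≤ ramp t := le_max_left _ _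
lemma ramp_le_one (t : ℝ) : ramp t ≤ 1 := max_le zero_le_one (min_le_left _ _)
lemma ramp_of_nonpos {t : ℝ} (h : t ≤ 0) : ramp t = 0 := max_eq_left ((min_le_right _ _).trans h)
lemma ramp_of_one_le {t : ℝ} (h : 1 ≤ t) : ramp t = 1 := by
  rw [ramp, min_eq_left h, max_eq_right zero_le_one]
lemma ramp_mono : Monotone ramp := fun _ _ h => max_le_max le_rfl (min_le_min le_rfl h)

/-- The tent function with peak at `k` and support in `[k - 1, k + 1]`. -/
def tent (k : ℕ) (t : ℝ) : ℝ := ramp (t - k + 1) - ramp (t - k)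

lemma tent_nonneg (k : ℕ) (t : ℝ) : 0 ≤ tent k t := sub_nonneg.2 (ramp_mono (by linarith))
lemma tent_le_one (k : ℕ) (t : ℝ) : tent k t ≤ 1 := by
  have := ramp_nonneg (t - k); have := ramp_le_one (t - k + 1); unfold tent; linarith
lemma tent_of_le {k : ℕ} {t : ℝ} (h : t ≤ k - 1) : tent k t = 0 := by
  rw [tent, ramp_of_nonpos (by linarith), ramp_of_nonpos (by linarith), sub_zero]
lemma tent_of_ge {k : ℕ} {t : ℝ} (h : k + 1 ≤ t) : tent k t = 0 := by
  rw [tent, ramp_of_one_le (by linarith), ramp_of_one_le (by linarith), sub_self]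

lemma tent_mul_tent {k l : ℕ} (h : k + 2 ≤ l) (t : ℝ) : tent k t * tent l t = 0 := by
  have h' : (k : ℝ) + 2 ≤ l := by exact_mod_cast h
  rcases le_total t (l - 1) with ht | ht
  · rw [tent_of_le ht, mul_zero]
  · rw [tent_of_ge (by linarith), zero_mul]

lemma sum_tent {t : ℝ} (ht : 0 ≤ t) (n : ℕ) :
    ∑ k ∈ Finset.range n, tent k t = 1 - ramp (t - n + 1) := by
  have h : ∀ k : ℕ, tent k t = ramp (t - k + 1) - ramp (t - (k + 1 : ℕ) + 1) := fun k => by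
    rw [tent]; congr 2; push_cast; ring
  simp only [h]
  rw [Finset.sum_range_sub' (fun k : ℕ => ramp (t - k + 1)), Nat.cast_zero, sub_zero,
    ramp_of_one_le (by linarith)]

variable (𝕜) in
/-- The even function `x ↦ tent_k(N |x|)` (with `N + 1` for `N`). -/
def tentS (N k : ℕ) : funS 𝕜 := mkS (fun x => tent k (|x| * (N + 1)))
  (by unfold tent; exact (continuous_ramp.comp (by fun_prop)).sub (continuous_ramp.comp (by fun_prop)))
  (by
    refine tendsto_const_nhds.congr' ?_
    have h := (tendsto_norm_cocompact_atTop (E := ℝ)).eventually_ge_atTop ((k : ℝ) + 1)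
    filter_upwards [h] with x hx
    refine (tent_of_ge (hx.trans ?_)).symm
    rw [Real.norm_eq_abs]
    nlinarith [abs_nonneg x, (Nat.cast_nonneg N : (0 : ℝ) ≤ N)])

lemma evS_tentS (N k : ℕ) (x : ℝ) : evS x (tentS 𝕜 N k) = (tent k (|x| * (N + 1)) : ℝ) := rfl

lemma homog_tentS (N k : ℕ) : (funS 𝕜).Homog 0 (tentS 𝕜 N k) :=
  homog_zero_funS_iff.2 fun x => by rw [evS_tentS, evS_tentS, abs_neg]

lemma star_tentS (N k : ℕ) : star (tentS 𝕜 N k) = tentS 𝕜 N k :=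
  evS_ext fun x => by rw [map_star, evS_tentS, RCLike.star_def, RCLike.conj_ofReal]

lemma norm_tentS_le (N k : ℕ) : ‖tentS 𝕜 N k‖ ≤ 1 := norm_funS_le zero_le_one fun x => by
  rw [evS_tentS, RCLike.norm_ofReal, abs_of_nonneg (tent_nonneg _ _)]
  exact tent_le_one _ _

lemma tentS_mul_tentS (N : ℕ) {k l : ℕ} (h : k + 2 ≤ l ∨ l + 2 ≤ k) :
    tentS 𝕜 N k * tentS 𝕜 N l = 0 := evS_ext fun x => by
  rw [map_mul, evS_tentS, evS_tentS, ← RCLike.ofReal_mul, map_zero]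
  rcases h with h | h
  · rw [tent_mul_tent h, RCLike.ofReal_zero]
  · rw [mul_comm, tent_mul_tent h, RCLike.ofReal_zero]

/-- Even functions are limits of their piecewise linear interpolations. -/
lemma tendsto_sum_tentS {a : funS 𝕜} (ha : (funS 𝕜).Homog 0 a) :
    Tendsto (fun N : ℕ => ∑ k ∈ Finset.range ((N + 1) ^ 2),
      evS ((k : ℝ) / (N + 1)) a • tentS 𝕜 N k) atTop (𝓝 a) := by
  rw [Metric.tendsto_atTop]
  intro ε hε
  have huc : UniformContinuous fun x => evS x a :=
    ZeroAtInftyContinuousMap.uniformContinuous (F := ZeroAtInftyContinuousMap ℝ 𝕜) a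
  obtain ⟨δ, hδ, hδ'⟩ := Metric.uniformContinuous_iff.1 huc (ε / 2) (half_pos hε)
  have h0 : ∀ᶠ x in cocompact ℝ, ‖evS x a‖ < ε / 2 := by
    have := (tendsto_evS a).norm
    rw [norm_zero] at this
    exact this.eventually_lt_const (half_pos hε)
  obtain ⟨R, hR⟩ : ∃ R : ℝ, ∀ x : ℝ, R ≤ |x| → ‖evS x a‖ < ε / 2 := by
    rw [← Metric.cobounded_eq_cocompact] at h0
    obtain ⟨r, hr⟩ := (Metric.hasBasis_cobounded_compl_closedBall (0 : ℝ)).eventually_iff.1 h0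
    refine ⟨r + 1, fun x hx => hr.2 ?_⟩
    rw [Set.mem_compl_iff, Metric.mem_closedBall, dist_zero_right, Real.norm_eq_abs]
    linarith
  obtain ⟨N₀, hN₀⟩ := exists_nat_gt (max R δ⁻¹)
  refine ⟨N₀, fun N hN => ?_⟩
  have hN' : (N₀ : ℝ) ≤ N := by exact_mod_cast hN
  have hNR : R ≤ N := ((le_max_left _ _).trans hN₀.le).trans hN'
  have hNδ : δ⁻¹ < N + 1 := ((le_max_right _ _).trans_lt hN₀).trans_le (by linarith)
  have hN1 : (0 : ℝ) < N + 1 := by positivity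
  rw [dist_comm, dist_eq_norm]
  refine (norm_funS_le (M := ε / 2) (by positivity) fun x => ?_).trans_lt (by linarith)
  -- At `x` the error is a combination, with the weights `r` and `tent k t` of total mass `1`, of `a x`
  -- and the differences `a x - a (k / (N + 1))`. The weight `r` lives where `|x| > N`, and there `a` is
  -- small; `tent k t` lives where `|x|` is within `1 / (N + 1)` of `k / (N + 1)`.
  set t : ℝ := |x| * (N + 1) with ht
  have ht0 : 0 ≤ t := by positivity
  set n : ℕ := (N + 1) ^ 2 with hn
  have hsum := sum_tent ht0 n
  set r := ramp (t - n + 1) with hr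
  have hax : evS x a = evS |x| a := by
    rcases abs_choice x with h | h
    · rw [h]
    · rw [h, homog_zero_funS_iff.1 ha]
  have e : evS x (a - ∑ k ∈ Finset.range n, evS ((k : ℝ) / (N + 1)) a • tentS 𝕜 N k) =
      (r : 𝕜) * evS x a +
        ∑ k ∈ Finset.range n, (tent k t : 𝕜) * (evS x a - evS ((k : ℝ) / (N + 1)) a) := by
    have h1 : (r : 𝕜) = 1 - ∑ k ∈ Finset.range n, (tent k t : 𝕜) := by
      rw [← RCLike.ofReal_sum, hsum]; push_cast; ring
    rw [map_sub, map_sum, h1, sub_mul, one_mul, Finset.sum_mul, sub_add, ← Finset.sum_sub_distrib]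
    congr 1
    refine Finset.sum_congr rfl fun k _ => ?_
    rw [map_smul, evS_tentS, smul_eq_mul]
    ring
  rw [e]
  have hr1 : ‖(r : 𝕜) * evS x a‖ ≤ r * (ε / 2) := by
    rw [norm_mul, RCLike.norm_ofReal, abs_of_nonneg (ramp_nonneg _)]
    rcases (ramp_nonneg (t - n + 1)).eq_or_lt with h | h
    · rw [hr, ← h, zero_mul, zero_mul]
    · refine mul_le_mul_of_nonneg_left (hR x ?_).le (ramp_nonneg _)
      have h2 : 0 < t - n + 1 := by
        by_contra! h3
        rw [ramp_of_nonpos h3] at h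
        exact lt_irrefl _ h
      have h4 : (n : ℝ) = (N + 1) * (N + 1) := by rw [hn]; push_cast; ring
      have h5 : ((N : ℝ) + 1) * N < |x| * (N + 1) := by nlinarith
      have h6 : (N : ℝ) < |x| := by nlinarith
      linarith
  have hr2 : ∀ k ∈ Finset.range n, ‖(tent k t : 𝕜) * (evS x a - evS ((k : ℝ) / (N + 1)) a)‖ ≤
      tent k t * (ε / 2) := fun k _ => by
    rw [norm_mul, RCLike.norm_ofReal, abs_of_nonneg (tent_nonneg _ _)]
    rcases le_or_gt t (k - 1) with h | h
    · rw [tent_of_le h, zero_mul, zero_mul]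
    rcases le_or_gt (k + 1 : ℝ) t with h' | h'
    · rw [tent_of_ge h', zero_mul, zero_mul]
    refine mul_le_mul_of_nonneg_left ?_ (tent_nonneg _ _)
    rw [hax, ← dist_eq_norm]
    refine (hδ' ?_).le
    have h3 : |x| - k / (N + 1) = (t - k) / (N + 1) := by rw [ht]; field_simp
    rw [Real.dist_eq, h3, abs_div, abs_of_pos hN1, div_lt_iff₀ hN1]
    refine (abs_lt.2 ⟨by linarith, by linarith⟩ : |t - k| < 1).trans ?_
    rwa [inv_lt_iff_one_lt_mul₀ hδ, mul_comm] at hNδ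
  calc _ ≤ r * (ε / 2) + ∑ k ∈ Finset.range n, tent k t * (ε / 2) :=
        (norm_add_le _ _).trans (add_le_add hr1 ((norm_sum_le _ _).trans (Finset.sum_le_sum hr2)))
    _ = ε / 2 := by rw [← Finset.sum_mul, hsum]; ring

lemma funS_mul_comm (f g : funS 𝕜) : f * g = g * f :=
  evS_ext fun x => by rw [map_mul, map_mul, mul_comm]

/-- The element `ζ` of `𝒮 ⊗ 𝒮` is a sum of elementary tensors of even functions, and represents the
function `(x, y) ↦ F x y`. -/
inductive EvenTensor : (ℝ → funS 𝕜) → (funS 𝕜 ⊗ᵍ funS 𝕜 : GCAlg 𝕜) → Prop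
  | tmul (a b : funS 𝕜) (ha : (funS 𝕜).Homog 0 a) (hb : (funS 𝕜).Homog 0 b) :
      EvenTensor (fun x => evS x a • b) (a ⊗ₑ b)
  | add (F F' : ℝ → funS 𝕜) (ζ ζ' : (funS 𝕜 ⊗ᵍ funS 𝕜 : GCAlg 𝕜)) (h : EvenTensor F ζ)
      (h' : EvenTensor F' ζ') : EvenTensor (fun x => F x + F' x) (ζ + ζ')

namespace EvenTensor

variable {F F' : ℝ → funS 𝕜} {ζ ζ' : (funS 𝕜 ⊗ᵍ funS 𝕜 : GCAlg 𝕜)}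

lemma of_eq (h : EvenTensor F ζ) (hF : ∀ x, F x = F' x) (hζ : ζ = ζ') : EvenTensor F' ζ' := by
  obtain rfl : F = F' := funext hF
  rwa [← hζ]

lemma homog (h : EvenTensor F ζ) (x : ℝ) : (funS 𝕜).Homog 0 (F x) := by
  induction h with
  | tmul a b ha hb => exact hb.smul _
  | add F F' ζ ζ' _ _ h h' => exact h.add h'

lemma smul (r : 𝕜) (h : EvenTensor F ζ) : EvenTensor (fun x => r • F x) (r • ζ) := by
  induction h with
  | tmul a b ha hb =>
    exact (EvenTensor.tmul (r • a) b (ha.smul r) hb).of_eq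
      (fun x => by rw [map_smul, smul_assoc]) (smul_tmul' r a b)
  | add F F' ζ ζ' _ _ h h' =>
    exact (h.add _ _ _ _ h').of_eq (fun x => (smul_add _ _ _).symm) (smul_add _ _ _).symm

lemma star (h : EvenTensor F ζ) : EvenTensor (fun x => star (F x)) (star ζ) := by
  induction h with
  | tmul a b ha hb =>
    refine (EvenTensor.tmul _ _ ha.star hb.star).of_eq (fun x => ?_) ?_
    · rw [map_star, star_smul]
    · rw [star_tmul ha hb, zero_mul, pow_zero, one_smul]
  | add F F' ζ ζ' _ _ h h' =>
    exact (h.add _ _ _ _ h').of_eq (fun x => (star_add _ _).symm) (star_add _ _).symm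

lemma mul (h : EvenTensor F ζ) (h' : EvenTensor F' ζ') :
    EvenTensor (fun x => F x * F' x) (ζ * ζ') := by
  induction h with
  | tmul a b ha hb =>
    induction h' with
    | tmul a' b' ha' hb' =>
      refine (EvenTensor.tmul _ _ (ha.mul ha') (hb.mul hb')).of_eq (fun x => ?_)
        (tmul_mul_tmul_of_even hb _ _ _).symm
      rw [map_mul, smul_mul_smul_comm]
    | add F F' ζ ζ' _ _ h h' =>
      exact (h.add _ _ _ _ h').of_eq (fun x => (mul_add _ _ _).symm) (mul_add _ _ _).symm
  | add F F' ζ ζ' _ _ h h' =>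
    exact (h.add _ _ _ _ h').of_eq (fun x => (add_mul _ _ _).symm) (add_mul _ _ _).symm

/-- Tensors of even functions are central: no Koszul signs arise and `𝒮` is commutative. -/
lemma mul_comm_tmul (h : EvenTensor F ζ) (c d : funS 𝕜) : ζ * (c ⊗ₑ d) = (c ⊗ₑ d) * ζ := by
  induction h with
  | tmul a b ha hb =>
    rw [tmul_mul_tmul_of_even hb]
    induction d using GCAlg.homog_ind with
    | add d d' h h' => rw [mul_add, tmul_add', tmul_add', add_mul, h, h']
    | hom j d hd =>
      rw [tmul_mul_tmul hd ha, mul_zero, pow_zero, one_smul, funS_mul_comm c, funS_mul_comm d]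
  | add F F' ζ ζ' _ _ h h' => rw [add_mul, mul_add, h, h']

lemma tendsto_sum (h : EvenTensor F ζ) :
    Tendsto (fun N : ℕ => ∑ k ∈ Finset.range ((N + 1) ^ 2), tentS 𝕜 N k ⊗ₑ F ((k : ℝ) / (N + 1)))
      atTop (𝓝 ζ) := by
  induction h with
  | tmul a b ha hb =>
    refine (((continuous_tmul_left b).tendsto a).comp (tendsto_sum_tentS ha)).congr fun N => ?_
    change (tmulL (funS 𝕜) (funS 𝕜)).flip b _ = _
    rw [map_sum]
    refine Finset.sum_congr rfl fun k _ => ?_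
    rw [map_smul, tmul_smul']
    rfl
  | add F F' ζ ζ' _ _ h h' =>
    refine (h.add h').congr fun N => ?_
    rw [← Finset.sum_add_distrib]
    exact Finset.sum_congr rfl fun k _ => (tmul_add' _ _ _).symm

/-- The norm of a sum of even tensors is bounded by (twice) the supremum norm of the function that
it represents: split a fine partition of unity in the first variable into two families of functions
with disjoint supports. -/
lemma norm_le (h : EvenTensor F ζ) {M : ℝ} (hM0 : 0 ≤ M) (hM : ∀ x, ‖F x‖ ≤ M) : ‖ζ‖ ≤ 2 * M := by
  refine le_of_tendsto h.tendsto_sum.norm (Filter.Eventually.of_forall fun N => ?_)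
  have key : ∀ s : Finset ℕ, (∀ i ∈ s, ∀ j ∈ s, i ≠ j → i + 2 ≤ j ∨ j + 2 ≤ i) →
      ‖∑ k ∈ s, tentS 𝕜 N k ⊗ₑ F ((k : ℝ) / (N + 1))‖ ≤ M := by
    intro s hs
    have hstar : ∀ k : ℕ, Star.star (tentS 𝕜 N k ⊗ₑ F ((k : ℝ) / (N + 1))) =
        tentS 𝕜 N k ⊗ₑ Star.star (F ((k : ℝ) / (N + 1))) := fun k => by
      rw [star_tmul (homog_tentS N k) (h.homog _), zero_mul, pow_zero, one_smul, star_tentS]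
    refine GCAlg.norm_sum_le_of_orthogonal _ s _ hM0 (fun k _ => ?_) (fun i hi j hj hij => ?_)
      fun i hi j hj hij => ?_
    · refine (norm_tmul_le _ _).trans ?_
      calc _ ≤ 1 * M := mul_le_mul (norm_tentS_le N k) (hM _) (norm_nonneg _) zero_le_one
        _ = M := one_mul M
    · rw [hstar, tmul_mul_tmul_of_even (h.homog _).star, tentS_mul_tentS N (hs i hi j hj hij),
        zero_tmul']
    · rw [hstar, tmul_mul_tmul_of_even (h.homog _), tentS_mul_tentS N (hs i hi j hj hij),
        zero_tmul']
  -- The tents with even index have disjoint supports, and so do those with odd index.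
  rw [← Finset.sum_filter_add_sum_filter_not _ (fun k => Even k), two_mul]
  refine (norm_add_le _ _).trans (add_le_add (key _ ?_) (key _ ?_))
  · intro i hi j hj hij
    have h1 := (Finset.mem_filter.1 hi).2
    have h2 := (Finset.mem_filter.1 hj).2
    grind
  · intro i hi j hj hij
    have h1 := (Finset.mem_filter.1 hi).2
    have h2 := (Finset.mem_filter.1 hj).2
    grind

end EvenTensor

/-- The even function `f` and the element `ζ` of `𝒮 ⊗ 𝒮`, a sum of tensors of even functions, satisfy
`ζ = f(X ⊗ 1 + 1 ⊗ X)`, that is, `ζ` represents the function `f(√(x² + y²))`. -/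
def EvenComult (f : funS 𝕜) (ζ : (funS 𝕜 ⊗ᵍ funS 𝕜 : GCAlg 𝕜)) : Prop :=
  (funS 𝕜).Homog 0 f ∧ ∃ F, EvenTensor F ζ ∧ ∀ x y, evS y (F x) = evS (Real.sqrt (x ^ 2 + y ^ 2)) f

namespace EvenComult

variable {f g : funS 𝕜} {ζ ξ : (funS 𝕜 ⊗ᵍ funS 𝕜 : GCAlg 𝕜)}

lemma add (h : EvenComult f ζ) (h' : EvenComult g ξ) : EvenComult (f + g) (ζ + ξ) := by
  obtain ⟨h0, F, hF, hf⟩ := h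
  obtain ⟨h0', F', hF', hf'⟩ := h'
  exact ⟨h0.add h0', _, hF.add _ _ _ _ hF', fun x y => by rw [map_add, map_add, hf, hf']⟩

lemma mul (h : EvenComult f ζ) (h' : EvenComult g ξ) : EvenComult (f * g) (ζ * ξ) := by
  obtain ⟨h0, F, hF, hf⟩ := h
  obtain ⟨h0', F', hF', hf'⟩ := h'
  exact ⟨h0.mul h0', _, hF.mul hF', fun x y => by rw [map_mul, map_mul, hf, hf']⟩

lemma smul (r : 𝕜) (h : EvenComult f ζ) : EvenComult (r • f) (r • ζ) := by
  obtain ⟨h0, F, hF, hf⟩ := h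
  exact ⟨h0.smul r, _, hF.smul r, fun x y => by rw [map_smul, map_smul, hf]⟩

lemma star (h : EvenComult f ζ) : EvenComult (star f) (star ζ) := by
  obtain ⟨h0, F, hF, hf⟩ := h
  exact ⟨h0.star, _, hF.star, fun x y => by rw [map_star, map_star, hf]⟩

lemma norm_le (h : EvenComult f ζ) : ‖ζ‖ ≤ 2 * ‖f‖ := by
  obtain ⟨h0, F, hF, hf⟩ := h
  exact hF.norm_le (norm_nonneg f) fun x => norm_funS_le (norm_nonneg f) fun y => by
    rw [hf]; exact norm_evS_le _ _

end EvenComult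

variable (𝕜) in
/-- The element `u ⊗ v + v ⊗ u` of `𝒮 ⊗ 𝒮`. -/
def vComult : (funS 𝕜 ⊗ᵍ funS 𝕜 : GCAlg 𝕜) := uS 𝕜 ⊗ₑ vS 𝕜 + vS 𝕜 ⊗ₑ uS 𝕜

lemma EvenComult.comm_v {f : funS 𝕜} {ζ : (funS 𝕜 ⊗ᵍ funS 𝕜 : GCAlg 𝕜)} (h : EvenComult f ζ) :
    ζ * vComult 𝕜 = vComult 𝕜 * ζ := by
  obtain ⟨-, F, hF, -⟩ := h
  rw [vComult, mul_add, add_mul, hF.mul_comm_tmul, hF.mul_comm_tmul]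

lemma star_vComult : star (vComult 𝕜) = vComult 𝕜 := by
  rw [vComult, star_add, star_tmul homog_uS homog_vS, star_tmul homog_vS homog_uS, star_uS, star_vS]
  simp

lemma homog_vComult : (funS 𝕜 ⊗ᵍ funS 𝕜 : GCAlg 𝕜).Homog 1 (vComult 𝕜) :=
  (homog_tmul (homog_uS (𝕜 := 𝕜)) homog_vS).add
    ((homog_tmul (homog_vS (𝕜 := 𝕜)) homog_uS).congr (by decide))

lemma evenComult_u : EvenComult (uS 𝕜) (uS 𝕜 ⊗ₑ uS 𝕜) := by
  refine ⟨homog_uS, _, .tmul _ _ homog_uS homog_uS, fun x y => ?_⟩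
  rw [map_smul, evS_uS, evS_uS, evS_uS, smul_eq_mul, ← RCLike.ofReal_mul, ← Real.exp_add,
    Real.sq_sqrt (by positivity)]
  congr 2
  ring

/-- The cross terms in `(u ⊗ v + v ⊗ u)²` cancel, because `v` is odd. -/
lemma vComult_mul_self : vComult 𝕜 * vComult 𝕜 =
    (uS 𝕜 * uS 𝕜) ⊗ₑ (vS 𝕜 * vS 𝕜) + (vS 𝕜 * vS 𝕜) ⊗ₑ (uS 𝕜 * uS 𝕜) := by
  rw [vComult, mul_add, add_mul, add_mul, tmul_mul_tmul homog_vS homog_uS,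
    tmul_mul_tmul homog_uS homog_uS, tmul_mul_tmul homog_vS homog_vS,
    tmul_mul_tmul homog_uS homog_vS, funS_mul_comm (vS 𝕜) (uS 𝕜)]
  simp only [mul_zero, mul_one, pow_zero, one_smul, pow_one, neg_smul]
  abel

lemma evenComult_v_sq : EvenComult (vS 𝕜 * vS 𝕜) (vComult 𝕜 * vComult 𝕜) := by
  have h2 : (funS 𝕜).Homog 0 (vS 𝕜 * vS 𝕜) := (homog_vS.mul homog_vS).congr (by decide)
  have h3 : (funS 𝕜).Homog 0 (uS 𝕜 * uS 𝕜) := homog_uS.mul homog_uS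
  rw [vComult_mul_self]
  refine ⟨h2, _, .add _ _ _ _ (.tmul _ _ h3 h2) (.tmul _ _ h2 h3), fun x y => ?_⟩
  simp only [map_add, map_smul, map_mul (evS _), evS_uS, evS_vS, smul_eq_mul]
  simp only [← RCLike.ofReal_mul, ← RCLike.ofReal_add]
  congr 1
  have h4 : 0 ≤ x ^ 2 + y ^ 2 := by positivity
  have h5 : Real.exp (-(x ^ 2 + y ^ 2)) = Real.exp (-x ^ 2) * Real.exp (-y ^ 2) := by
    rw [← Real.exp_add]; congr 1; ring
  rw [mul_mul_mul_comm (Real.sqrt _), Real.mul_self_sqrt h4, Real.sq_sqrt h4, h5]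
  ring

/-- The relation `ζ = f(X ⊗ 1 + 1 ⊗ X)` on the `*`-algebra generated by `(u, u ⊗ u)` and
`(v, u ⊗ v + v ⊗ u)`: there `f = f₁ + f₂ v + c v` with `f₁` and `f₂` even. -/
def AlgComult (z : funS 𝕜 × (funS 𝕜 ⊗ᵍ funS 𝕜 : GCAlg 𝕜)) : Prop :=
  ∃ (f₁ f₂ : funS 𝕜) (ζ₁ ζ₂ : (funS 𝕜 ⊗ᵍ funS 𝕜 : GCAlg 𝕜)) (c : 𝕜), EvenComult f₁ ζ₁ ∧
    EvenComult f₂ ζ₂ ∧ z.1 = f₁ + (f₂ * vS 𝕜 + c • vS 𝕜) ∧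
    z.2 = ζ₁ + (ζ₂ * vComult 𝕜 + c • vComult 𝕜)

lemma evenComult_zero : EvenComult (0 : funS 𝕜) 0 := by
  have := (evenComult_u (𝕜 := 𝕜)).smul 0
  rwa [zero_smul, zero_smul] at this

/-- The square of the odd part of an element of the algebra is even. -/
lemma EvenComult.odd_mul_odd {f g : funS 𝕜} {ζ ξ : (funS 𝕜 ⊗ᵍ funS 𝕜 : GCAlg 𝕜)}
    (h : EvenComult f ζ) (h' : EvenComult g ξ) (c d : 𝕜) :
    EvenComult ((f * vS 𝕜 + c • vS 𝕜) * (g * vS 𝕜 + d • vS 𝕜))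
      ((ζ * vComult 𝕜 + c • vComult 𝕜) * (ξ * vComult 𝕜 + d • vComult 𝕜)) := by
  have hv := evenComult_v_sq (𝕜 := 𝕜)
  have key : EvenComult _ _ := (((h.mul h').mul hv).add ((h.mul hv).smul d)).add
    (((h'.mul hv).smul c).add (hv.smul (c * d)))
  convert key using 1
  · refine evS_ext fun x => ?_
    simp only [map_add, map_mul, map_smul, smul_eq_mul]
    ring
  · have e1 : vComult 𝕜 * (ξ * vComult 𝕜) = ξ * (vComult 𝕜 * vComult 𝕜) := by
      rw [← mul_assoc, ← h'.comm_v, mul_assoc]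
    simp only [add_mul, mul_add, smul_mul_assoc, mul_smul_comm, mul_assoc, e1, smul_add, smul_smul]
    rw [mul_comm d c]
    abel

lemma AlgComult.mul {z z' : funS 𝕜 × (funS 𝕜 ⊗ᵍ funS 𝕜 : GCAlg 𝕜)} (h : AlgComult z)
    (h' : AlgComult z') : AlgComult (z * z') := by
  obtain ⟨f₁, f₂, ζ₁, ζ₂, c, h₁, h₂, e₁, e₂⟩ := h
  obtain ⟨g₁, g₂, ξ₁, ξ₂, d, k₁, k₂, e₃, e₄⟩ := h'
  refine ⟨_, _, _, _, 0, (h₁.mul k₁).add (h₂.odd_mul_odd k₂ c d),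
    ((h₁.mul k₂).add (h₂.mul k₁)).add ((h₁.smul d).add (k₁.smul c)), ?_, ?_⟩
  · rw [Prod.fst_mul, e₁, e₃]
    refine evS_ext fun x => ?_
    simp only [map_add, map_mul, map_smul, smul_eq_mul]
    ring
  · rw [Prod.snd_mul, e₂, e₄]
    have e1 : vComult 𝕜 * ξ₁ = ξ₁ * vComult 𝕜 := k₁.comm_v.symm
    simp only [add_mul, mul_add, smul_mul_assoc, mul_smul_comm, mul_assoc, e1, zero_smul, add_zero,
      smul_add]
    abel

lemma AlgComult.add {z z' : funS 𝕜 × (funS 𝕜 ⊗ᵍ funS 𝕜 : GCAlg 𝕜)} (h : AlgComult z)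
    (h' : AlgComult z') : AlgComult (z + z') := by
  obtain ⟨f₁, f₂, ζ₁, ζ₂, c, h₁, h₂, e₁, e₂⟩ := h
  obtain ⟨g₁, g₂, ξ₁, ξ₂, d, k₁, k₂, e₃, e₄⟩ := h'
  refine ⟨_, _, _, _, c + d, h₁.add k₁, h₂.add k₂, ?_, ?_⟩
  · rw [Prod.fst_add, e₁, e₃, add_mul, add_smul]; abel
  · rw [Prod.snd_add, e₂, e₄, add_mul, add_smul]; abel

lemma AlgComult.smul {z : funS 𝕜 × (funS 𝕜 ⊗ᵍ funS 𝕜 : GCAlg 𝕜)} (r : 𝕜) (h : AlgComult z) :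
    AlgComult (r • z) := by
  obtain ⟨f₁, f₂, ζ₁, ζ₂, c, h₁, h₂, e₁, e₂⟩ := h
  refine ⟨_, _, _, _, r * c, h₁.smul r, h₂.smul r, ?_, ?_⟩
  · rw [Prod.smul_fst, e₁, smul_add, smul_add, smul_smul, smul_mul_assoc]
  · rw [Prod.smul_snd, e₂, smul_add, smul_add, smul_smul, smul_mul_assoc]

lemma AlgComult.star {z : funS 𝕜 × (funS 𝕜 ⊗ᵍ funS 𝕜 : GCAlg 𝕜)} (h : AlgComult z) :
    AlgComult (star z) := by
  obtain ⟨f₁, f₂, ζ₁, ζ₂, c, h₁, h₂, e₁, e₂⟩ := h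
  refine ⟨_, _, _, _, Star.star c, h₁.star, h₂.star, ?_, ?_⟩
  · rw [Prod.fst_star, e₁, star_add, star_add, star_mul, star_smul, star_vS, funS_mul_comm (vS 𝕜)]
  · rw [Prod.snd_star, e₂, star_add, star_add, star_mul, star_smul, star_vComult, h₂.star.comm_v]

/-- The even and the odd part of `f` are bounded by `f`. The even part of `ζ` is bounded by twice that
of `f`, and so is the odd part, because its square is even. -/
lemma AlgComult.norm_le {z : funS 𝕜 × (funS 𝕜 ⊗ᵍ funS 𝕜 : GCAlg 𝕜)} (h : AlgComult z) :
    ‖z.2‖ ≤ 4 * ‖z.1‖ := by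
  obtain ⟨f₁, f₂, ζ₁, ζ₂, c, h₁, h₂, e₁, e₂⟩ := h
  set g : funS 𝕜 := f₂ * vS 𝕜 + c • vS 𝕜 with hg
  set ξ := ζ₂ * vComult 𝕜 + c • vComult 𝕜 with hξ
  have hgo : (funS 𝕜).Homog 1 g := (h₂.1.mul homog_vS).add (homog_vS.smul c)
  have hev : ∀ x, evS x z.1 = evS x f₁ + evS x g := fun x => by rw [e₁, map_add]
  have hev' : ∀ x, evS (-x) z.1 = evS x f₁ - evS x g := fun x => by
    rw [e₁, map_add, homog_zero_funS_iff.1 h₁.1, homog_one_funS_iff.1 hgo, sub_eq_add_neg]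
  have half : ∀ a b : 𝕜, ‖a + b‖ ≤ ‖z.1‖ → ‖a - b‖ ≤ ‖z.1‖ → ‖a‖ ≤ ‖z.1‖ := fun a b h h' => by
    have h2 : ‖(2 : 𝕜) * a‖ ≤ ‖z.1‖ + ‖z.1‖ := by
      have : (2 : 𝕜) * a = (a + b) + (a - b) := by ring
      rw [this]
      exact (norm_add_le _ _).trans (add_le_add h h')
    rw [norm_mul, RCLike.norm_two] at h2
    linarith
  have n1 : ‖f₁‖ ≤ ‖z.1‖ := norm_funS_le (norm_nonneg _) fun x => half _ (evS x g)
    (by rw [← hev]; exact norm_evS_le _ _) (by rw [← hev']; exact norm_evS_le _ _)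
  have n2 : ‖g‖ ≤ ‖z.1‖ := norm_funS_le (norm_nonneg _) fun x => half _ (evS x f₁)
    (by rw [add_comm, ← hev]; exact norm_evS_le _ _)
    (by rw [← norm_neg, neg_sub, ← hev']; exact norm_evS_le _ _)
  have hs1 : Star.star g = Star.star f₂ * vS 𝕜 + Star.star c • vS 𝕜 := by
    rw [hg, star_add, star_mul, star_smul, star_vS, funS_mul_comm (vS 𝕜)]
  have hs2 : Star.star ξ = Star.star ζ₂ * vComult 𝕜 + Star.star c • vComult 𝕜 := by
    rw [hξ, star_add, star_mul, star_smul, star_vComult, h₂.star.comm_v]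
  -- The bound for even elements, applied to `ξ⋆ ξ`.
  have n3 := (h₂.star.odd_mul_odd h₂ (Star.star c) c).norm_le
  rw [← hg, ← hξ, ← hs1, ← hs2, CStarRing.norm_star_mul_self, CStarRing.norm_star_mul_self] at n3
  have n4 : ‖ξ‖ ≤ 2 * ‖g‖ := by nlinarith [norm_nonneg ξ, norm_nonneg g]
  rw [e₂]
  calc _ ≤ ‖ζ₁‖ + ‖ξ‖ := norm_add_le _ _
    _ ≤ 2 * ‖z.1‖ + 2 * ‖z.1‖ := add_le_add (h₁.norm_le.trans (by linarith)) (by linarith)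
    _ = 4 * ‖z.1‖ := by ring

lemma isComult_iff {Δ : GHom (funS 𝕜) (funS 𝕜 ⊗ᵍ funS 𝕜)} :
    IsComult 𝕜 Δ ↔ Δ (uS 𝕜) = uS 𝕜 ⊗ₑ uS 𝕜 ∧ Δ (vS 𝕜) = vComult 𝕜 := by
  constructor
  · intro h
    exact h (uS 𝕜) (vS 𝕜) (fun x => evS_uS x) (fun x => evS_vS x)
  · rintro h u v hu hv
    obtain rfl : (u : funS 𝕜) = uS 𝕜 := evS_ext hu
    obtain rfl : (v : funS 𝕜) = vS 𝕜 := evS_ext hv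
    exact h

/-- The pairs `(f, f(X ⊗ 1 + 1 ⊗ X))` form the graph of a bounded homomorphism on a dense subalgebra of
`𝒮`, which extends to the comultiplication. -/
lemma existsUnique_isComult : ∃! Δ, IsComult 𝕜 Δ := by
  let T := (funS 𝕜 ⊗ᵍ funS 𝕜 : GCAlg.{0} 𝕜)
  let gen : Set (funS 𝕜 × T) := {(uS 𝕜, uS 𝕜 ⊗ₑ uS 𝕜), (vS 𝕜, vComult 𝕜)}
  let R := NonUnitalStarAlgebra.adjoin 𝕜 gen
  have hu : ((uS 𝕜, uS 𝕜 ⊗ₑ uS 𝕜) : funS 𝕜 × T) ∈ R :=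
    NonUnitalStarAlgebra.subset_adjoin 𝕜 gen (by simp [gen])
  have hv : ((vS 𝕜, vComult 𝕜) : funS 𝕜 × T) ∈ R :=
    NonUnitalStarAlgebra.subset_adjoin 𝕜 gen (by simp [gen])
  have hR : ∀ z ∈ R, AlgComult z := fun z hz => by
    induction hz using NonUnitalStarAlgebra.adjoin_induction with
    | mem x hx =>
      rcases hx with rfl | rfl
      · exact ⟨_, _, _, _, 0, evenComult_u, evenComult_zero, by simp, by simp⟩
      · exact ⟨_, _, _, _, 1, evenComult_zero, evenComult_zero, by simp, by simp⟩
    | add x y _ _ hx hy => exact hx.add hy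
    | zero => exact ⟨_, _, _, _, 0, evenComult_zero, evenComult_zero, by simp, by simp⟩
    | mul x y _ _ hx hy => exact hx.mul hy
    | smul r x _ hx => exact hx.smul r
    | star x _ hx => exact hx.star
  -- The generators are homogeneous, so the graph is invariant under the gradings.
  have hgr : ∀ z ∈ R, ((funS 𝕜).grading z.1, T.grading z.2) ∈ R := fun z hz => by
    induction hz using NonUnitalStarAlgebra.adjoin_induction with
    | mem x hx =>
      rcases hx with rfl | rfl
      · have e1 := (homog_uS (𝕜 := 𝕜)).grading_eq
        have e2 := (homog_tmul (homog_uS (𝕜 := 𝕜)) homog_uS).grading_eq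
        simp only [pow_zero, one_smul, add_zero] at e1 e2
        dsimp only
        rw [e1, e2]
        exact hu
      · have e1 := (homog_vS (𝕜 := 𝕜)).grading_eq
        have e2 := (homog_vComult (𝕜 := 𝕜)).grading_eq
        dsimp only
        rw [e1, e2]
        exact SMulMemClass.smul_mem ((-1 : 𝕜) ^ 1) hv
    | add x y _ _ hx hy => rw [Prod.fst_add, Prod.snd_add, map_add, map_add]; exact add_mem hx hy
    | zero => rw [Prod.fst_zero, Prod.snd_zero, map_zero, map_zero]; exact zero_mem R
    | mul x y _ _ hx hy => rw [Prod.fst_mul, Prod.snd_mul, map_mul, map_mul]; exact mul_mem hx hy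
    | smul r x _ hx =>
      rw [Prod.smul_fst, Prod.smul_snd, map_smul, map_smul]; exact SMulMemClass.smul_mem r hx
    | star x _ hx => rw [Prod.fst_star, Prod.snd_star, map_star, map_star]; exact star_mem hx
  let ι : R →⋆ₙₐ[𝕜] funS 𝕜 :=
    (NonUnitalStarAlgHom.fst 𝕜 (funS 𝕜) T).comp (NonUnitalStarSubalgebraClass.subtype R)
  let f : R →⋆ₙₐ[𝕜] T :=
    (NonUnitalStarAlgHom.snd 𝕜 (funS 𝕜) T).comp (NonUnitalStarSubalgebraClass.subtype R)
  -- The first projection has dense range by the Stone–Weierstrass theorem, and the second projection is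
  -- bounded by the first.
  have hd : DenseRange ι := fun x => by
    let N := (NonUnitalAlgHom.range (ι : R →ₙₐ[𝕜] funS 𝕜)).topologicalClosure
    have hN : ∀ r : R, ι r ∈ N := fun r =>
      NonUnitalSubalgebra.le_topologicalClosure _ ⟨r, rfl⟩
    have : x ∈ N := by
      induction x using funS_ind with
      | closed => exact NonUnitalSubalgebra.isClosed_topologicalClosure _
      | add x y hx hy => exact add_mem hx hy
      | smul r x hx => exact SMulMemClass.smul_mem r hx
      | mul x y hx hy => exact mul_mem hx hy
      | u => exact hN ⟨_, hu⟩
      | v => exact hN ⟨_, hv⟩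
    exact this
  obtain ⟨Δ, hΔ⟩ := GHom.exists_extend ι f hd 4 (fun x => (hR x.1 x.2).norm_le)
    (fun x => ⟨_, hgr x.1 x.2⟩) (fun x => rfl) (fun x => rfl)
  refine ⟨Δ, isComult_iff.2 ⟨hΔ ⟨_, hu⟩, hΔ ⟨_, hv⟩⟩, fun Δ' h' => ?_⟩
  have h := isComult_iff.1 h'
  exact GHom.ext_funS (h.1.trans (hΔ ⟨_, hu⟩).symm) (h.2.trans (hΔ ⟨_, hv⟩).symm)

lemma comult_uS : comult 𝕜 (uS 𝕜) = uS 𝕜 ⊗ₑ uS 𝕜 :=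
  (isComult_iff.1 (GHom.the_eq existsUnique_isComult)).1

lemma comult_vS : comult 𝕜 (vS 𝕜) = uS 𝕜 ⊗ₑ vS 𝕜 + vS 𝕜 ⊗ₑ uS 𝕜 :=
  (isComult_iff.1 (GHom.the_eq existsUnique_isComult)).2

end GradedE

end

/-! ### Clifford algebras and the Bott map -/

noncomputable section

namespace GradedE

universe u' v' w'

variable {𝕜 : Type} [RCLike 𝕜]

namespace Cliff

variable {m n k : ℕ}

variable (𝕜 m) in
/-- The canonical map from the algebraic Clifford algebra to the Clifford C*-algebra. -/
def incl : 𝕜 ⊗[ℝ] RealCliff m →⋆ₙₐ[𝕜] Cliff 𝕜 m := (cliffEnv 𝕜 m).toEnvelopeHom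

lemma denseRange_incl : DenseRange (incl 𝕜 m) := (cliffEnv 𝕜 m).denseRange_toEnvelopeHom

lemma one_def : one 𝕜 m = incl 𝕜 m 1 := rfl
lemma vec_def (v : Euc m) : vec 𝕜 v = incl 𝕜 m (1 ⊗ₜ cliffι m v) := rfl

/-- Clifford algebras are generated by the unit and the vectors. -/
lemma ind {P : Cliff 𝕜 m → Prop} (closed : IsClosed {c | P c})
    (add : ∀ a b, P a → P b → P (a + b)) (smul : ∀ (r : 𝕜) a, P a → P (r • a))
    (mul : ∀ a b, P a → P b → P (a * b)) (one : P (one 𝕜 m)) (vec : ∀ v, P (vec 𝕜 v)) (c) : P c := by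
  refine denseRange_incl.induction_on c closed fun x => ?_
  induction x using TensorProduct.induction_on with
  | zero =>
    have := smul 0 _ one
    rwa [zero_smul] at this
  | add x y hx hy => rw [map_add]; exact add _ _ hx hy
  | tmul r x =>
    have : r ⊗ₜ[ℝ] x = r • ((1 : 𝕜) ⊗ₜ[ℝ] x) := by
      rw [TensorProduct.smul_tmul', smul_eq_mul, mul_one]
    rw [this, map_smul]
    refine smul _ _ ?_
    clear this
    induction x using cliff_ind with
    | h₁ s =>
      have : (1 : 𝕜) ⊗ₜ[ℝ] algebraMap ℝ (RealCliff m) s = (s : 𝕜) • 1 := by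
        rw [Algebra.algebraMap_eq_smul_one, TensorProduct.tmul_smul,
          ← Algebra.TensorProduct.one_def, RCLike.real_smul_eq_coe_smul (K := 𝕜)]
      rw [this, map_smul]
      exact smul _ _ one
    | h₂ v => exact vec v
    | h₃ x y hx hy =>
      have : (1 : 𝕜) ⊗ₜ[ℝ] (x * y) = (1 ⊗ₜ x) * (1 ⊗ₜ y) := by
        rw [Algebra.TensorProduct.tmul_mul_tmul, mul_one]
      rw [this, map_mul]
      exact mul _ _ hx hy
    | h₄ x y hx hy => rw [TensorProduct.tmul_add, map_add]; exact add _ _ hx hy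

lemma _root_.GradedE.GHom.ext_cliff {B : GCAlg.{v} 𝕜} {f g : GHom (Cliff 𝕜 m) B}
    (h₁ : f (one 𝕜 m) = g (one 𝕜 m)) (h₂ : ∀ v, f (vec 𝕜 v) = g (vec 𝕜 v)) : f = g :=
  GHom.ext fun c => by
    induction c using ind with
    | closed => exact isClosed_eq f.continuous g.continuous
    | add a b ha hb => rw [map_add, map_add, ha, hb]
    | smul r a ha => rw [map_smul, map_smul, ha]
    | mul a b ha hb => rw [map_mul, map_mul, ha, hb]
    | one => exact h₁
    | vec v => exact h₂ v

lemma one_mul (c : Cliff 𝕜 m) : one 𝕜 m * c = c := by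
  refine denseRange_incl.induction_on c
    (isClosed_eq (continuous_const_mul _) continuous_id) fun x => ?_
  rw [one_def, ← map_mul, _root_.one_mul]

lemma mul_one (c : Cliff 𝕜 m) : c * one 𝕜 m = c := by
  refine denseRange_incl.induction_on c
    (isClosed_eq (continuous_mul_const _) continuous_id) fun x => ?_
  rw [one_def, ← map_mul, _root_.mul_one]

lemma star_one : star (one 𝕜 m) = one 𝕜 m := by
  rw [one_def, ← map_star, _root_.star_one]

lemma star_vec (v : Euc m) : star (vec 𝕜 v) = vec 𝕜 v := by
  rw [vec_def, ← map_star, TensorProduct.star_tmul, star_cliffι, _root_.star_one]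

lemma homog_one : (Cliff 𝕜 m).Homog 0 (one 𝕜 m) := by
  rw [GCAlg.homog_zero_iff]
  refine ((cliffEnv 𝕜 m).grading_toEnvelope 1).trans (congrArg _ ?_)
  exact map_one (Algebra.TensorProduct.map (AlgHom.id 𝕜 𝕜) (cliffInvolute m))

lemma homog_vec (v : Euc m) : (Cliff 𝕜 m).Homog 1 (vec 𝕜 v) := by
  rw [GCAlg.homog_one_iff, vec_def, ← map_neg]
  refine ((cliffEnv 𝕜 m).grading_toEnvelope _).trans (congrArg _ ?_)
  rw [← TensorProduct.tmul_neg]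
  exact congrArg ((1 : 𝕜) ⊗ₜ[ℝ] ·) (CliffordAlgebra.involute_ι v)

lemma vec_add (v w : Euc m) : vec 𝕜 (v + w) = vec 𝕜 v + vec 𝕜 w := by
  rw [vec_def, map_add, TensorProduct.tmul_add, map_add]; rfl

lemma vec_smul (r : ℝ) (v : Euc m) : vec 𝕜 (r • v) = (r : 𝕜) • vec 𝕜 v := by
  rw [vec_def, map_smul, TensorProduct.tmul_smul, RCLike.real_smul_eq_coe_smul (K := 𝕜), map_smul]
  rfl

lemma vec_zero : vec 𝕜 (0 : Euc m) = 0 := by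
  rw [vec_def, map_zero, TensorProduct.tmul_zero, map_zero]

lemma vec_mul_self (v : Euc m) : vec 𝕜 v * vec 𝕜 v = ((‖v‖ ^ 2 : ℝ) : 𝕜) • one 𝕜 m := by
  have : cliffι m v * cliffι m v = (‖v‖ ^ 2) • (1 : RealCliff m) := by
    rw [← Algebra.algebraMap_eq_smul_one, ← normSqForm_apply]
    exact CliffordAlgebra.ι_sq_scalar (normSqForm m) v
  rw [vec_def, ← map_mul, Algebra.TensorProduct.tmul_mul_tmul, _root_.mul_one, this,
    TensorProduct.tmul_smul, ← Algebra.TensorProduct.one_def,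
    RCLike.real_smul_eq_coe_smul (K := 𝕜), map_smul, one_def]

/-- Orthogonal vectors anticommute. -/
lemma vec_mul_vec {v w : Euc m} (h : inner ℝ v w = 0) : vec 𝕜 v * vec 𝕜 w = -(vec 𝕜 w * vec 𝕜 v) := by
  have h1 := vec_mul_self (𝕜 := 𝕜) (v + w)
  rw [@norm_add_sq_real, h, mul_zero, add_zero, vec_add, add_mul, mul_add, mul_add, vec_mul_self,
    vec_mul_self, RCLike.ofReal_add, add_smul] at h1
  rw [eq_neg_iff_add_eq_zero]
  have h2 := sub_eq_zero.2 h1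
  rw [← h2]
  abel

lemma norm_one_le : ‖one 𝕜 m‖ ≤ 1 := by
  refine ((cliffEnv 𝕜 m).norm_toEnvelope 1).trans_le ?_
  exact EnvData.sup_le _ zero_le_one fun p hp => hp.1

lemma norm_vec_le (v : Euc m) : ‖vec 𝕜 v‖ ≤ ‖v‖ := by
  refine ((cliffEnv 𝕜 m).norm_toEnvelope _).trans_le ?_
  exact EnvData.sup_le _ (norm_nonneg v) fun p hp => hp.2 v

lemma continuous_vec : Continuous (vec 𝕜 : Euc m → Cliff 𝕜 m) :=
  AddMonoidHomClass.continuous_of_bound (AddMonoidHom.mk' (vec 𝕜) vec_add) 1 fun v => by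
    rw [_root_.one_mul]; exact norm_vec_le v

lemma map_one (T : Euc m →ₗᵢ[ℝ] Euc n) : map 𝕜 T (one 𝕜 m) = one 𝕜 n :=
  (EnvData.envelopeMap_toEnvelope _ _ _ _ _).trans (congrArg _
    (_root_.map_one (Algebra.TensorProduct.map (AlgHom.id 𝕜 𝕜) (cliffMap T))))

lemma map_vec (T : Euc m →ₗᵢ[ℝ] Euc n) (v : Euc m) : map 𝕜 T (vec 𝕜 v) = vec 𝕜 (T v) :=
  (EnvData.envelopeMap_toEnvelope _ _ _ _ _).trans (congrArg _
    (congrArg ((1 : 𝕜) ⊗ₜ[ℝ] ·) (cliffMap_ι T v)))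

lemma map_id : map 𝕜 (LinearIsometry.id : Euc m →ₗᵢ[ℝ] Euc m) = GHom.id _ :=
  GHom.ext_cliff (map_one _) fun v => map_vec _ v

lemma map_map (T : Euc n →ₗᵢ[ℝ] Euc k) (S : Euc m →ₗᵢ[ℝ] Euc n) (c : Cliff 𝕜 m) :
    map 𝕜 T (map 𝕜 S c) = map 𝕜 (T.comp S) c := by
  have : (map 𝕜 T).comp (map 𝕜 S) = map 𝕜 (T.comp S) :=
    GHom.ext_cliff (by rw [GHom.comp_apply, map_one, map_one, map_one])
      fun v => by rw [GHom.comp_apply, map_vec, map_vec, map_vec]; rfl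
  rw [← this, GHom.comp_apply]

section orthogonal

variable {T : Euc m →ₗᵢ[ℝ] Euc n} {S : Euc k →ₗᵢ[ℝ] Euc n}

/-- Moving a vector past the Clifford algebra of an orthogonal subspace applies the grading to that
algebra. In this form the relation is multiplicative in `d`. -/
lemma vec_mul_map (h : ∀ v w, inner ℝ (T v) (S w) = 0) (v : Euc m) (d : Cliff 𝕜 k) :
    vec 𝕜 (T v) * map 𝕜 S d = map 𝕜 S ((Cliff 𝕜 k).grading d) * vec 𝕜 (T v) := by
  induction d using ind with
  | closed =>
    exact isClosed_eq ((continuous_const_mul _).comp (map 𝕜 S).continuous)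
      ((continuous_mul_const _).comp ((map 𝕜 S).continuous.comp (GCAlg.continuous_grading _)))
  | add a b ha hb => simp only [map_add, mul_add, add_mul, ha, hb]
  | smul r a ha => simp only [map_smul, mul_smul_comm, smul_mul_assoc, ha]
  | mul a b ha hb =>
    rw [_root_.map_mul, _root_.map_mul, ← mul_assoc, ha, mul_assoc, hb, ← mul_assoc, _root_.map_mul]
  | one => rw [GCAlg.homog_zero_iff.1 homog_one, map_one, one_mul, mul_one]
  | vec w => rw [GCAlg.homog_one_iff.1 (homog_vec w), map_neg, map_vec, neg_mul, vec_mul_vec (h v w)]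

lemma map_mul_map_of_even (h : ∀ v w, inner ℝ (T v) (S w) = 0) {d : Cliff 𝕜 k}
    (hd : (Cliff 𝕜 k).Homog 0 d) (c : Cliff 𝕜 m) :
    map 𝕜 T c * map 𝕜 S d = map 𝕜 S d * map 𝕜 T c := by
  induction c using ind with
  | closed =>
    exact isClosed_eq ((continuous_mul_const _).comp (map 𝕜 T).continuous)
      ((continuous_const_mul _).comp (map 𝕜 T).continuous)
  | add a b ha hb => simp only [map_add, mul_add, add_mul, ha, hb]
  | smul r a ha => simp only [map_smul, mul_smul_comm, smul_mul_assoc, ha]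
  | mul a b ha hb => rw [_root_.map_mul, mul_assoc, hb, ← mul_assoc, ha, mul_assoc]
  | one => rw [map_one, one_mul, mul_one]
  | vec w => rw [map_vec, vec_mul_map h, GCAlg.homog_zero_iff.1 hd]

lemma map_mul_map_of_odd (h : ∀ v w, inner ℝ (T v) (S w) = 0) {d : Cliff 𝕜 k}
    (hd : (Cliff 𝕜 k).Homog 1 d) (c : Cliff 𝕜 m) :
    map 𝕜 T c * map 𝕜 S d = map 𝕜 S d * map 𝕜 T ((Cliff 𝕜 m).grading c) := by
  induction c using ind with
  | closed =>
    exact isClosed_eq ((continuous_mul_const _).comp (map 𝕜 T).continuous)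
      ((continuous_const_mul _).comp ((map 𝕜 T).continuous.comp (GCAlg.continuous_grading _)))
  | add a b ha hb => simp only [map_add, mul_add, add_mul, ha, hb]
  | smul r a ha => simp only [map_smul, mul_smul_comm, smul_mul_assoc, ha]
  | mul a b ha hb =>
    rw [_root_.map_mul, mul_assoc, hb, ← mul_assoc, ha, mul_assoc, _root_.map_mul, _root_.map_mul]
  | one => rw [GCAlg.homog_zero_iff.1 homog_one, map_one, one_mul, mul_one]
  | vec w =>
    rw [map_vec, vec_mul_map h, GCAlg.homog_one_iff.1 hd, GCAlg.homog_one_iff.1 (homog_vec w),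
      map_neg, map_neg, neg_mul, mul_neg, map_vec]

/-- Clifford algebras of orthogonal subspaces commute in the graded sense. -/
lemma map_mul_map (h : ∀ v w, inner ℝ (T v) (S w) = 0) {i j : ℕ} {c : Cliff 𝕜 m} {d : Cliff 𝕜 k}
    (hc : (Cliff 𝕜 m).Homog i c) (hd : (Cliff 𝕜 k).Homog j d) :
    map 𝕜 T c * map 𝕜 S d = (-1 : 𝕜) ^ (i * j) • (map 𝕜 S d * map 𝕜 T c) := by
  rcases Nat.even_or_odd j with hj | hj
  · rw [map_mul_map_of_even h (hd.congr (by simpa using hj)), (hj.mul_left i).neg_one_pow, one_smul]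
  · rw [map_mul_map_of_odd h (hd.congr (by grind)), hc.grading_eq, map_smul, mul_smul_comm]
    congr 1
    apply negOne_pow_congr
    grind

end orthogonal

end Cliff

lemma Euc.inner_inl_inr (m k : ℕ) (v : Euc m) (w : Euc k) :
    inner ℝ (Euc.inl m k v) (Euc.inr m k w) = 0 := by
  simp [Euc.inl, Euc.inr, PiLp.inner_apply, Fin.sum_univ_add]

lemma Euc.inner_inr_inl (m k : ℕ) (v : Euc m) (w : Euc k) :
    inner ℝ (Euc.inr m k w) (Euc.inl m k v) = 0 := by
  rw [real_inner_comm, Euc.inner_inl_inr]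

/-! ### The Bott map at a vector -/

/-- Functional calculus with an odd self-adjoint unitary `w`: the homomorphism with `f ↦ f(r) 1` for
`f` even and `f ↦ f(r) w` for `f` odd. For `r = 0` the odd functions vanish, and nothing is needed
of `w²`. -/
lemma exists_bott {n : ℕ} (r : ℝ) {w : Cliff 𝕜 n} (hw : (Cliff 𝕜 n).Homog 1 w) (hs : star w = w)
    (hww : r ≠ 0 → w * w = Cliff.one 𝕜 n) : ∃ β : GHom (funS 𝕜) (Cliff 𝕜 n), ∀ f,
      β f = (2⁻¹ * (evS r f + evS (-r) f)) • Cliff.one 𝕜 n + (2⁻¹ * (evS r f - evS (-r) f)) • w := by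
  have h2 : star (2⁻¹ : 𝕜) = 2⁻¹ := by simp
  have hww' : ∀ f g : funS 𝕜, ((2⁻¹ * (evS r f - evS (-r) f)) * (2⁻¹ * (evS r g - evS (-r) g))) •
      (w * w) = ((2⁻¹ * (evS r f - evS (-r) f)) * (2⁻¹ * (evS r g - evS (-r) g))) •
        Cliff.one 𝕜 n := fun f g => by
    rcases eq_or_ne r 0 with rfl | hr
    · rw [neg_zero, sub_self, mul_zero, zero_mul, zero_smul, zero_smul]
    · rw [hww hr]
  have hmul : ∀ a b c d : 𝕜, (b * d) • (w * w) = (b * d) • Cliff.one 𝕜 n →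
      (a • Cliff.one 𝕜 n + b • w) * (c • Cliff.one 𝕜 n + d • w) =
        (a * c + b * d) • Cliff.one 𝕜 n + (a * d + b * c) • w := fun a b c d h => by
    rw [add_mul, mul_add, mul_add, smul_mul_smul_comm, smul_mul_smul_comm, smul_mul_smul_comm,
      smul_mul_smul_comm, h, Cliff.one_mul, Cliff.one_mul, Cliff.mul_one, add_smul, add_smul]
    abel
  let F : funS 𝕜 →⋆ₙₐ[𝕜] Cliff 𝕜 n :=
    { toFun := fun f => (2⁻¹ * (evS r f + evS (-r) f)) • Cliff.one 𝕜 n +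
        (2⁻¹ * (evS r f - evS (-r) f)) • w
      map_smul' := fun c f => by
        simp only [map_smul, smul_eq_mul, smul_add, smul_smul, MonoidHom.id_apply]
        congr 2 <;> ring
      map_zero' := by simp
      map_add' := fun f g => by
        simp only [map_add]
        rw [show ∀ a b c d : 𝕜, 2⁻¹ * (a + b + (c + d)) = 2⁻¹ * (a + c) + 2⁻¹ * (b + d) by
          intros; ring, show ∀ a b c d : 𝕜, 2⁻¹ * (a + b - (c + d)) = 2⁻¹ * (a - c) + 2⁻¹ * (b - d) by
          intros; ring, add_smul, add_smul]
        abel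
      map_mul' := fun f g => by
        rw [hmul _ _ _ _ (hww' f g), map_mul, map_mul]
        congr 2 <;> ring
      map_star' := fun f => by
        simp only [star_add, star_smul, Cliff.star_one, hs, map_star, star_mul', h2, star_sub] }
  refine ⟨GHom.ofStarHom F fun f => ?_, fun f => rfl⟩
  change _ • _ + _ • _ = (Cliff 𝕜 n).grading (_ • _ + _ • _)
  rw [map_add, map_smul, map_smul, GCAlg.homog_zero_iff.1 Cliff.homog_one, GCAlg.homog_one_iff.1 hw,
    evS_grading, evS_grading, neg_neg, smul_neg, ← neg_smul]
  congr 2 <;> ring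

end GradedE

end

noncomputable section

namespace GradedE

universe u' v' w'

variable {𝕜 : Type} [RCLike 𝕜]

/-- The generators `u` and `v` of `𝒮` are homogeneous, so the conditions on even and odd functions
determine the homomorphism. -/
lemma existsUnique_isBott (r : ℝ) : ∃! b, IsBott 𝕜 r b := by
  set e : Euc 1 := EuclideanSpace.single (0 : Fin 1) (1 : ℝ) with he
  have hne : ‖e‖ = 1 := by rw [he, PiLp.norm_single, norm_one]
  obtain ⟨β, hβ⟩ := exists_bott (𝕜 := 𝕜) r (Cliff.homog_vec e) (Cliff.star_vec e) fun _ => by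
    rw [Cliff.vec_mul_self, hne, one_pow, RCLike.ofReal_one, one_smul]
  have key : IsBott 𝕜 r β := by
    refine fun f => ⟨fun hf => ?_, fun hf => ?_⟩
    · refine (hβ (f : funS 𝕜)).trans ?_
      rw [homog_zero_funS_iff.1 hf, sub_self, mul_zero, zero_smul, add_zero, ← two_mul,
        inv_mul_cancel_left₀ two_ne_zero, evS_def]
    · refine (hβ (f : funS 𝕜)).trans ?_
      rw [homog_one_funS_iff.1 hf, sub_neg_eq_add, add_neg_cancel, mul_zero, zero_smul,
        zero_add, ← two_mul, inv_mul_cancel_left₀ two_ne_zero, evS_def]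
  refine ⟨β, key, fun b hb => GHom.ext_funS ?_ ?_⟩
  · exact ((hb (uS 𝕜)).1 homog_uS).trans ((key (uS 𝕜)).1 homog_uS).symm
  · exact ((hb (vS 𝕜)).2 homog_vS).trans ((key (vS 𝕜)).2 homog_vS).symm

variable (𝕜) in
/-- The Bott map at a vector `v`: functional calculus `f ↦ f(v)` with the Clifford element `v`. It is
characterized by its values on the two generators of `𝒮`. -/
def bottVec {n : ℕ} (v : Euc n) : GHom (funS 𝕜) (Cliff 𝕜 n) := GHom.the fun β =>
  β (uS 𝕜) = ((Real.exp (-‖v‖ ^ 2) : ℝ) : 𝕜) • Cliff.one 𝕜 n ∧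
    β (vS 𝕜) = ((Real.exp (-‖v‖ ^ 2) : ℝ) : 𝕜) • Cliff.vec 𝕜 v

lemma bottVec_spec {n : ℕ} (v : Euc n) :
    bottVec 𝕜 v (uS 𝕜) = ((Real.exp (-‖v‖ ^ 2) : ℝ) : 𝕜) • Cliff.one 𝕜 n ∧
      bottVec 𝕜 v (vS 𝕜) = ((Real.exp (-‖v‖ ^ 2) : ℝ) : 𝕜) • Cliff.vec 𝕜 v := by
  -- For `v = 0` the direction `w` is `0`.
  set w : Euc n := ‖v‖⁻¹ • v with hw
  have hvw : v = ‖v‖ • w := by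
    rcases eq_or_ne v 0 with rfl | h
    · simp
    · rw [hw, smul_smul, mul_inv_cancel₀ (norm_ne_zero_iff.2 h), one_smul]
  obtain ⟨β, hβ⟩ := exists_bott (𝕜 := 𝕜) ‖v‖ (Cliff.homog_vec w) (Cliff.star_vec w) fun h => by
    rw [Cliff.vec_mul_self, hw, norm_smul, norm_inv, norm_norm, inv_mul_cancel₀ h, one_pow,
      RCLike.ofReal_one, one_smul]
  refine GHom.the_eq (P := fun β : GHom (funS 𝕜) (Cliff 𝕜 n) =>
    β (uS 𝕜) = ((Real.exp (-‖v‖ ^ 2) : ℝ) : 𝕜) • Cliff.one 𝕜 n ∧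
      β (vS 𝕜) = ((Real.exp (-‖v‖ ^ 2) : ℝ) : 𝕜) • Cliff.vec 𝕜 v) ⟨β, ⟨?_, ?_⟩, fun b hb => GHom.ext_funS (hb.1.trans ?_) (hb.2.trans ?_)⟩
  all_goals
    rw [hβ]
    simp only [homog_zero_funS_iff.1 homog_uS, homog_one_funS_iff.1 homog_vS, evS_uS, evS_vS,
      sub_self, sub_neg_eq_add, add_neg_cancel, mul_zero, zero_smul, add_zero, zero_add, ← two_mul,
      inv_mul_cancel_left₀ (two_ne_zero (α := 𝕜))]
  · rw [mul_comm, RCLike.ofReal_mul, mul_smul, ← Cliff.vec_smul ‖v‖, ← hvw]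
  · rw [mul_comm, RCLike.ofReal_mul, mul_smul, ← Cliff.vec_smul ‖v‖, ← hvw]

lemma bottVec_uS {n : ℕ} (v : Euc n) : bottVec 𝕜 v (uS 𝕜) =
    ((Real.exp (-‖v‖ ^ 2) : ℝ) : 𝕜) • Cliff.one 𝕜 n := (bottVec_spec v).1
lemma bottVec_vS {n : ℕ} (v : Euc n) : bottVec 𝕜 v (vS 𝕜) =
    ((Real.exp (-‖v‖ ^ 2) : ℝ) : 𝕜) • Cliff.vec 𝕜 v := (bottVec_spec v).2

variable (𝕜) in
/-- The Bott map at a point of the sphere `ℝⁿ ∪ {∞}`. -/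
def bottPt {n : ℕ} (v : OnePoint (Euc n)) : GHom (funS 𝕜) (Cliff 𝕜 n) := OnePoint.rec 0 (bottVec 𝕜) v

lemma bottPt_infty {n : ℕ} : bottPt 𝕜 (OnePoint.infty : OnePoint (Euc n)) = 0 := rfl
lemma bottPt_coe {n : ℕ} (v : Euc n) : bottPt 𝕜 (v : OnePoint (Euc n)) = bottVec 𝕜 v := rfl

lemma bott_infty : bott 𝕜 OnePoint.infty = 0 := rfl

lemma bott_coe (r : ℝ) : bott 𝕜 (r : OnePoint ℝ) = bottVec 𝕜 (EuclideanSpace.single (0 : Fin 1) r) := by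
  have h : IsBott 𝕜 r (bott 𝕜 (r : OnePoint ℝ)) := GHom.the_eq (existsUnique_isBott r)
  have hn : ‖(EuclideanSpace.single (0 : Fin 1) r : Euc 1)‖ ^ 2 = r ^ 2 := by
    rw [PiLp.norm_single, Real.norm_eq_abs, sq_abs]
  have hs : (EuclideanSpace.single (0 : Fin 1) r : Euc 1) = r • EuclideanSpace.single 0 1 := by
    ext i; simp
  refine GHom.ext_funS ?_ ?_
  · rw [bottVec_uS, hn]
    exact (h (uS 𝕜)).1 homog_uS
  · rw [bottVec_vS, hn, hs, Cliff.vec_smul, smul_smul, ← RCLike.ofReal_mul, mul_comm _ r]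
    exact (h (vS 𝕜)).2 homog_vS

/-- The Bott maps depend continuously on the point of the sphere: they are contractions, so it suffices
to consider the generators of `𝒮`. -/
lemma continuous_bottPt {n : ℕ} (f : funS 𝕜) :
    Continuous fun v : OnePoint (Euc n) => bottPt 𝕜 v f := by
  induction f using funS_ind with
  | closed =>
    rw [← isSeqClosed_iff_isClosed]
    intro f f₀ hf hlim
    refine (TendstoUniformly.continuous (F := fun n v => bottPt 𝕜 v (f n)) (p := atTop) ?_
      (Frequently.of_forall hf))
    rw [Metric.tendstoUniformly_iff]
    intro ε hε
    filter_upwards [Metric.tendsto_nhds.1 hlim ε hε] with k hk v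
    refine lt_of_le_of_lt ?_ hk
    rw [dist_comm, dist_eq_norm, dist_eq_norm, ← map_sub]
    exact (bottPt 𝕜 v).norm_le _
  | add f g hf hg => simp only [map_add]; exact hf.add hg
  | smul r f hf => simp only [map_smul]; exact hf.const_smul r
  | mul f g hf hg => simp only [map_mul]; exact hf.mul hg
  | u =>
    have hexp : Continuous fun v : Euc n => ((Real.exp (-‖v‖ ^ 2) : ℝ) : 𝕜) :=
      RCLike.continuous_ofReal.comp (by fun_prop)
    rw [OnePoint.continuous_iff]
    simp only [bottPt_infty, bottPt_coe, GHom.zero_apply, bottVec_uS, Filter.coclosedCompact_eq_cocompact]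
    constructor
    · refine squeeze_zero_norm (a := fun v : Euc n => Real.exp (-‖v‖ ^ 2)) (fun v => ?_) ?_
      · rw [norm_smul, RCLike.norm_ofReal, abs_of_nonneg (Real.exp_nonneg _)]
        exact mul_le_of_le_one_right (Real.exp_nonneg _) Cliff.norm_one_le
      · exact (tendsto_exp_neg_sq.mono_left atTop_le_cocompact).comp
          (tendsto_norm_cocompact_atTop (E := Euc n))
    · exact hexp.smul continuous_const
  | v =>
    have hexp : Continuous fun v : Euc n => ((Real.exp (-‖v‖ ^ 2) : ℝ) : 𝕜) :=
      RCLike.continuous_ofReal.comp (by fun_prop)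
    rw [OnePoint.continuous_iff]
    simp only [bottPt_infty, bottPt_coe, GHom.zero_apply, bottVec_vS, Filter.coclosedCompact_eq_cocompact]
    constructor
    · refine squeeze_zero_norm (a := fun v : Euc n => ‖v‖ * Real.exp (-‖v‖ ^ 2)) (fun v => ?_) ?_
      · rw [norm_smul, RCLike.norm_ofReal, abs_of_nonneg (Real.exp_nonneg _), mul_comm]
        exact mul_le_mul_of_nonneg_right (Cliff.norm_vec_le v) (Real.exp_nonneg _)
      · exact (tendsto_mul_exp_neg_sq.mono_left atTop_le_cocompact).comp
          (tendsto_norm_cocompact_atTop (E := Euc n))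
    · exact hexp.smul Cliff.continuous_vec

/-! ### Isometries of Euclidean space -/

/-- The identification `ℝᵐ = ℝⁿ` for `m = n`. -/
def Euc.cast {m n : ℕ} (h : m = n) : Euc m →ₗᵢ[ℝ] Euc n :=
  (LinearIsometryEquiv.piLpCongrLeft 2 ℝ ℝ (finCongr h)).toLinearIsometry

lemma Euc.cast_apply {m n : ℕ} (h : m = n) (v : Euc m) (i : Fin n) :
    Euc.cast h v i = v (Fin.cast h.symm i) := rfl

lemma Euc.inl_castAdd {m k : ℕ} (v : Euc m) (i : Fin m) : Euc.inl m k v (Fin.castAdd k i) = v i :=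
  Fin.append_left _ _ i
lemma Euc.inl_natAdd {m k : ℕ} (v : Euc m) (i : Fin k) : Euc.inl m k v (Fin.natAdd m i) = 0 :=
  Fin.append_right _ _ i
lemma Euc.inr_castAdd {m k : ℕ} (v : Euc k) (i : Fin m) : Euc.inr m k v (Fin.castAdd k i) = 0 :=
  Fin.append_left _ _ i
lemma Euc.inr_natAdd {m k : ℕ} (v : Euc k) (i : Fin k) : Euc.inr m k v (Fin.natAdd m i) = v i :=
  Fin.append_right _ _ i

lemma Euc.ext_add {m k : ℕ} {v w : Euc (m + k)}
    (h₁ : ∀ i, v (Fin.castAdd k i) = w (Fin.castAdd k i))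
    (h₂ : ∀ i, v (Fin.natAdd m i) = w (Fin.natAdd m i)) : v = w := by
  ext i
  exact Fin.addCases h₁ h₂ i

namespace O

lemma isom_apply {n : ℕ} (a : O n) (v : Euc n) (i : Fin n) : isom a v i = ∑ j, a.1 i j * v j := rfl

lemma isom_one {n : ℕ} : isom (1 : O n) = LinearIsometry.id := by
  ext v i
  simp [isom_apply, Matrix.one_apply]

lemma isom_mul {n : ℕ} (a b : O n) : isom (a * b) = (isom a).comp (isom b) := by
  ext v i
  have : (isom a (isom b v)) i = ∑ j, a.1 i j * (∑ k, b.1 j k * v k) := rfl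
  refine Eq.trans ?_ this.symm
  rw [isom_apply]
  simp only [Submonoid.coe_mul, Matrix.mul_apply, Finset.sum_mul, Finset.mul_sum, mul_assoc]
  exact Finset.sum_comm

lemma isom_blk_inl {m k : ℕ} (a : O m) (b : O k) (v : Euc m) :
    isom (blk rfl a b) (Euc.inl m k v) = Euc.inl m k (isom a v) := by
  refine Euc.ext_add (fun i => ?_) fun i => ?_
  · simp only [isom_apply, Fin.sum_univ_add, blk_LL, blk_LR, Euc.inl_castAdd, Euc.inl_natAdd, mul_zero,
      Finset.sum_const_zero, add_zero]
  · simp only [isom_apply, Fin.sum_univ_add, blk_RL, blk_RR, Euc.inl_castAdd, Euc.inl_natAdd, mul_zero,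
      zero_mul, Finset.sum_const_zero, add_zero]

lemma isom_blk_inr {m k : ℕ} (a : O m) (b : O k) (v : Euc k) :
    isom (blk rfl a b) (Euc.inr m k v) = Euc.inr m k (isom b v) := by
  refine Euc.ext_add (fun i => ?_) fun i => ?_
  · simp only [isom_apply, Fin.sum_univ_add, blk_LL, blk_LR, Euc.inr_castAdd, Euc.inr_natAdd, mul_zero,
      zero_mul, Finset.sum_const_zero, add_zero]
  · simp only [isom_apply, Fin.sum_univ_add, blk_RL, blk_RR, Euc.inr_castAdd, Euc.inr_natAdd, mul_zero,
      Finset.sum_const_zero, zero_add]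

lemma isom_χ (q : ℕ) (v : Euc (q + 1)) (i : Fin (q + 1)) :
    isom (χ q) v (finRotate (q + 1) i) = v i := by
  have : ∀ j, (χ q).1 (finRotate (q + 1) i) j = if i = j then 1 else 0 := fun j => by
    change (if finRotate (q + 1) i = finRotate (q + 1) j then (1 : ℝ) else 0) = _
    simp
  rw [isom_apply, Finset.sum_congr rfl fun j _ => by rw [this j]]
  simp

lemma isom_χ_succ (q : ℕ) (v : Euc (q + 1)) (i : Fin q) : isom (χ q) v i.succ = v i.castSucc := by
  rw [← isom_χ q v i.castSucc]
  exact congrArg (isom (χ q) v) (finRotate_of_lt (k := i) i.2).symm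

lemma isom_χ_zero (q : ℕ) (v : Euc (q + 1)) : isom (χ q) v 0 = v (Fin.last q) := by
  rw [← isom_χ q v, finRotate_last]

end O

lemma Euc.inl_inl (m n : ℕ) (v : Euc m) : Euc.inl (m + n) 1 (Euc.inl m n v) = Euc.inl m (n + 1) v := by
  refine Euc.ext_add (m := m + n) (k := 1) (fun i => ?_) fun i => ?_
  · rw [Euc.inl_castAdd]
    refine Fin.addCases (fun i => ?_) (fun i => ?_) i
    · rw [Euc.inl_castAdd]; exact (Euc.inl_castAdd (k := n + 1) v i).symm
    · rw [Euc.inl_natAdd]; exact (Euc.inl_natAdd (k := n + 1) v i.castSucc).symm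
  · rw [Euc.inl_natAdd]
    fin_cases i
    exact (Euc.inl_natAdd (k := n + 1) v (Fin.last n)).symm

/-- A vector of `ℝⁿ⁺¹` is the sum of its first `n` coordinates and of its last coordinate. -/
lemma Euc.inr_succ (m n : ℕ) (v : Euc (n + 1)) : Euc.inr m (n + 1) v =
    Euc.inl (m + n) 1 (Euc.inr m n (WithLp.toLp 2 fun i => v i.castSucc)) +
      Euc.inr (m + n) 1 (EuclideanSpace.single (0 : Fin 1) (v (Fin.last n))) := by
  refine Euc.ext_add (m := m + n) (k := 1) (fun i => ?_) fun i => ?_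
  · rw [PiLp.add_apply, Euc.inl_castAdd, Euc.inr_castAdd, add_zero]
    refine Fin.addCases (fun i => ?_) (fun i => ?_) i
    · rw [Euc.inr_castAdd]; exact Euc.inr_castAdd (k := n + 1) v i
    · rw [Euc.inr_natAdd]; exact Euc.inr_natAdd (k := n + 1) v i.castSucc
  · rw [PiLp.add_apply, Euc.inl_natAdd, Euc.inr_natAdd, zero_add]
    fin_cases i
    exact (Euc.inr_natAdd (k := n + 1) v (Fin.last n)).trans (by simp)

section sphere

variable (p q : ℕ) (h : p + 1 + q = p + (q + 1))

lemma Euc.cast_inl_inl (v : Euc p) :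
    Euc.cast h (Euc.inl (p + 1) q (Euc.inl p 1 v)) = Euc.inl p (q + 1) v := by
  refine Euc.ext_add (fun i => ?_) fun i => ?_
  · rw [Euc.cast_apply, Euc.inl_castAdd]
    exact (Euc.inl_castAdd (k := q) (Euc.inl p 1 v) (Fin.castAdd 1 i)).trans (Euc.inl_castAdd v i)
  · rw [Euc.cast_apply, Euc.inl_natAdd]
    refine Fin.cases ?_ (fun i => ?_) i
    · exact (Euc.inl_castAdd (k := q) (Euc.inl p 1 v) (Fin.natAdd p 0)).trans (Euc.inl_natAdd v 0)
    · have : Fin.cast h.symm (Fin.natAdd p i.succ) = Fin.natAdd (p + 1) i := by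
        ext; simp; omega
      rw [this, Euc.inl_natAdd]

lemma Euc.cast_inl_inr (w : Euc 1) : Euc.cast h (Euc.inl (p + 1) q (Euc.inr p 1 w)) =
    Euc.inr p (q + 1) (O.isom (O.χ q) (Euc.inr q 1 w)) := by
  refine Euc.ext_add (fun i => ?_) fun i => ?_
  · rw [Euc.cast_apply, Euc.inr_castAdd]
    exact (Euc.inl_castAdd (k := q) (Euc.inr p 1 w) (Fin.castAdd 1 i)).trans (Euc.inr_castAdd w i)
  · rw [Euc.cast_apply, Euc.inr_natAdd]
    refine Fin.cases ?_ (fun i => ?_) i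
    · rw [O.isom_χ_zero]
      exact (Euc.inl_castAdd (k := q) (Euc.inr p 1 w) (Fin.natAdd p 0)).trans
        ((Euc.inr_natAdd w 0).trans (Euc.inr_natAdd (m := q) w 0).symm)
    · have : Fin.cast h.symm (Fin.natAdd p i.succ) = Fin.natAdd (p + 1) i := by
        ext; simp; omega
      rw [this, Euc.inl_natAdd, O.isom_χ_succ]
      exact (Euc.inr_castAdd w i).symm

lemma Euc.cast_inr (v : Euc q) : Euc.cast h (Euc.inr (p + 1) q v) =
    Euc.inr p (q + 1) (O.isom (O.χ q) (Euc.inl q 1 v)) := by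
  refine Euc.ext_add (fun i => ?_) fun i => ?_
  · rw [Euc.cast_apply, Euc.inr_castAdd]
    exact Euc.inr_castAdd (k := q) (m := p + 1) v (Fin.castAdd 1 i)
  · rw [Euc.cast_apply, Euc.inr_natAdd]
    refine Fin.cases ?_ (fun i => ?_) i
    · rw [O.isom_χ_zero]
      exact (Euc.inr_castAdd (k := q) (m := p + 1) v (Fin.natAdd p 0)).trans
        (Euc.inl_natAdd (k := 1) v 0).symm
    · have : Fin.cast h.symm (Fin.natAdd p i.succ) = Fin.natAdd (p + 1) i := by
        ext; simp; omega
      rw [this, Euc.inr_natAdd, O.isom_χ_succ]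
      exact (Euc.inl_castAdd v i).symm

end sphere

end GradedE

end

/-! ### The algebra of bounded paths modulo null paths -/

noncomputable section

namespace GradedE

universe u' v' w'

variable {𝕜 : Type} [RCLike 𝕜]

/-- Bounded continuous functions on `[1, ∞)`. -/
abbrev Ray (B : GCAlg.{u} 𝕜) : Type u := BoundedContinuousFunction (Set.Ici (1 : ℝ)) B

section Ray

variable (B : GCAlg.{u} 𝕜)

instance : NonUnitalRing (Ray B) := inferInstance
instance : StarRing (Ray B) := inferInstance
instance : Module 𝕜 (Ray B) := inferInstance
instance : IsScalarTower 𝕜 (Ray B) (Ray B) := ⟨fun r f g => by ext t; exact smul_mul_assoc r (f t) (g t)⟩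
instance : SMulCommClass 𝕜 (Ray B) (Ray B) := ⟨fun r f g => by
  ext t; exact (mul_smul_comm r (f t) (g t)).symm⟩
instance : StarModule 𝕜 (Ray B) := ⟨fun r f => by ext t; exact star_smul r (f t)⟩

end Ray

namespace Ray

variable {B : GCAlg.{u} 𝕜} {C : GCAlg.{v} 𝕜}

/-- The limit superior of the norm of a bounded path. -/
def lim (f : Ray B) : ℝ := sInf {M | 0 ≤ M ∧ ∀ᶠ t in atTop, ‖f t‖ ≤ M}

lemma lim_le {f : Ray B} {M : ℝ} (hM : 0 ≤ M) (h : ∀ᶠ t in atTop, ‖f t‖ ≤ M) : lim f ≤ M :=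
  csInf_le ⟨0, fun _ h => h.1⟩ ⟨hM, h⟩

lemma lim_nonneg (f : Ray B) : 0 ≤ lim f := Real.sInf_nonneg fun _ h => h.1

lemma eventually_le (f : Ray B) {M : ℝ} (h : lim f < M) : ∀ᶠ t in atTop, ‖f t‖ ≤ M := by
  obtain ⟨M', ⟨-, h1⟩, h2⟩ := exists_lt_of_csInf_lt
    (s := {M | 0 ≤ M ∧ ∀ᶠ t in atTop, ‖f t‖ ≤ M}) ⟨‖f‖, norm_nonneg f, Eventually.of_forall fun t => f.norm_coe_le_norm t⟩ h
  exact h1.mono fun t ht => ht.trans h2.le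

lemma lim_eq_zero_iff {f : Ray B} : lim f = 0 ↔ Tendsto (fun t => ‖f t‖) atTop (𝓝 0) := by
  constructor
  · intro h
    rw [Metric.tendsto_nhds]
    intro ε hε
    filter_upwards [eventually_le f (M := ε / 2) (by rw [h]; exact half_pos hε)] with t ht
    rw [Real.dist_eq, sub_zero, abs_of_nonneg (norm_nonneg _)]
    linarith
  · intro h
    refine le_antisymm (le_of_forall_pos_le_add fun ε hε => ?_) (lim_nonneg f)
    rw [zero_add]
    exact lim_le hε.le ((h.eventually_lt_const hε).mono fun _ h => h.le)

lemma lim_add_le (f g : Ray B) : lim (f + g) ≤ lim f + lim g := by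
  refine le_of_forall_pos_le_add fun ε hε => lim_le
    (by linarith [lim_nonneg f, lim_nonneg g]) ?_
  filter_upwards [eventually_le f (lt_add_of_pos_right _ (half_pos hε)),
    eventually_le g (lt_add_of_pos_right _ (half_pos hε))] with t h1 h2
  exact (norm_add_le (f t) (g t)).trans (by linarith)

lemma lim_smul_le (r : 𝕜) (f : Ray B) : lim (r • f) ≤ ‖r‖ * lim f := by
  refine le_of_forall_pos_le_add fun ε hε => lim_le
    (by have := lim_nonneg f; positivity) ?_
  have h : 0 < ε / (‖r‖ + 1) := by positivity
  filter_upwards [eventually_le f (lt_add_of_pos_right _ h)] with t h1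
  rw [BoundedContinuousFunction.coe_smul, norm_smul]
  have h2 : ‖r‖ * (ε / (‖r‖ + 1)) ≤ ε := by
    rw [mul_div_assoc', div_le_iff₀ (by positivity)]
    nlinarith [norm_nonneg r]
  nlinarith [norm_nonneg r]

lemma lim_mul_le (f g : Ray B) : lim (f * g) ≤ lim f * lim g := by
  have key : ∀ ε : ℝ, 0 < ε → lim (f * g) ≤ (lim f + ε) * (lim g + ε) := fun ε hε => by
    have h1 := lim_nonneg f
    have h2 := lim_nonneg g
    refine lim_le (by positivity) ?_
    filter_upwards [eventually_le f (lt_add_of_pos_right _ hε),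
      eventually_le g (lt_add_of_pos_right _ hε)] with t h1 h2
    exact (norm_mul_le (f t) (g t)).trans (mul_le_mul h1 h2 (norm_nonneg _) (by linarith [norm_nonneg (f t)]))
  have h3 : Tendsto (fun ε : ℝ => (lim f + ε) * (lim g + ε)) (𝓝[>] 0) (𝓝 (lim f * lim g)) := by
    have : Continuous fun ε : ℝ => (lim f + ε) * (lim g + ε) := by fun_prop
    have h4 := this.tendsto 0
    simp only [add_zero] at h4
    exact h4.mono_left nhdsWithin_le_nhds
  exact ge_of_tendsto h3 (eventually_mem_nhdsWithin.mono key)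

/-- The inequality `‖f‖² ≤ ‖f⋆f + g⋆g‖` passes to the limit superior. -/
lemma lim_sq_le (f g : Ray B) : lim f ^ 2 ≤ lim (star f * f + star g * g) := by
  rw [← Real.le_sqrt (lim_nonneg _) (lim_nonneg _)]
  have key : ∀ M, lim (star f * f + star g * g) < M → lim f ≤ Real.sqrt M := fun M hM => by
    refine lim_le (Real.sqrt_nonneg _) ?_
    filter_upwards [eventually_le _ hM] with t ht
    rw [Real.le_sqrt (norm_nonneg _) ((norm_nonneg _).trans ht)]
    exact (B.norm_sq_le (f t) (g t)).trans ht
  have h3 : Tendsto Real.sqrt (𝓝[>] (lim (star f * f + star g * g)))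
      (𝓝 (Real.sqrt (lim (star f * f + star g * g)))) :=
    (Real.continuous_sqrt.tendsto _).mono_left nhdsWithin_le_nhds
  exact ge_of_tendsto h3 (eventually_mem_nhdsWithin.mono key)

variable (B) in
/-- The limit superior of the norm, as a C*-seminorm. -/
def limSeminorm : CStarSeminorm 𝕜 (Ray B) where
  toFun := lim
  map_zero' := lim_eq_zero_iff.2 (by simp)
  add_le' := lim_add_le
  neg' f := by
    have h := lim_smul_le (-1 : 𝕜) f
    have h' := lim_smul_le (-1 : 𝕜) (-f)
    rw [neg_one_smul, norm_neg, norm_one, one_mul] at h h'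
    rw [neg_neg] at h'
    exact le_antisymm h h'
  smul' r f := by
    refine le_antisymm (lim_smul_le r f) ?_
    rcases eq_or_ne r 0 with rfl | hr
    · rw [norm_zero, zero_mul]; exact lim_nonneg _
    · have h := lim_smul_le r⁻¹ (r • f)
      rwa [smul_smul, inv_mul_cancel₀ hr, one_smul, norm_inv, ← div_eq_inv_mul,
        le_div_iff₀' (norm_pos_iff.2 hr)] at h
  mul_le := lim_mul_le
  sq_le := lim_sq_le

/-- Composition of a path with a `*`-homomorphism. -/
def comp (g : GHom B C) : Ray B →⋆ₙₐ[𝕜] Ray C where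
  toFun f := BoundedContinuousFunction.ofNormedAddCommGroup (fun t => g (f t))
    (g.continuous.comp f.continuous) ‖f‖ fun t => (g.norm_le _).trans (f.norm_coe_le_norm t)
  map_smul' r f := by ext t; exact map_smul g.toHom r (f t)
  map_zero' := by ext t; exact map_zero g.toHom
  map_add' f f' := by ext t; exact map_add g.toHom (f t) (f' t)
  map_mul' f f' := by ext t; exact map_mul g.toHom (f t) (f' t)
  map_star' f := by ext t; exact map_star g.toHom (f t)

lemma lim_comp_le (g : GHom B C) (f : Ray B) : lim (comp g f) ≤ lim f :=
  le_of_forall_pos_le_add fun ε hε => lim_le (by have := lim_nonneg f; linarith)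
    ((eventually_le f (lt_add_of_pos_right _ hε)).mono fun t ht => (g.norm_le _).trans ht)

end Ray

/-- The grading as an endomorphism of the graded algebra. -/
def GCAlg.gradingHom (B : GCAlg.{u} 𝕜) : GHom B B := ⟨B.grading, fun _ => rfl, B.norm_grading_le⟩

/-- The limit superior of the norm defines the C*-algebra of bounded paths modulo null paths. -/
def rayEnv (B : GCAlg.{u} 𝕜) : EnvData 𝕜 (Ray B) where
  grading := Ray.comp B.gradingHom
  grading_grading f := by ext t; exact B.grading_grading (f t)
  adm := {Ray.limSeminorm B}
  bdd f := ⟨Ray.lim f, fun p hp => by rw [Set.mem_singleton_iff.1 hp]; exact le_rfl⟩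
  adm_grading p hp := ⟨p, hp, fun f => by
    rw [Set.mem_singleton_iff.1 hp]
    refine le_antisymm ?_ (Ray.lim_comp_le B.gradingHom f)
    have h := Ray.lim_comp_le B.gradingHom (Ray.comp B.gradingHom f)
    have e : Ray.comp B.gradingHom (Ray.comp B.gradingHom f) = f := by
      ext t; exact B.grading_grading (f t)
    rwa [e] at h⟩

/-- The C*-algebra `C_b([1, ∞), B) / C₀([1, ∞), B)`.  Classes of asymptotic morphisms to `B` are
homomorphisms to this algebra. -/
def Q (B : GCAlg.{u} 𝕜) : GCAlg.{u} 𝕜 := (rayEnv B).envelope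

namespace Q

variable {A : GCAlg.{w} 𝕜} {B : GCAlg.{u} 𝕜} {C : GCAlg.{v} 𝕜} {D : GCAlg.{u'} 𝕜}

/-- The class of a bounded path. -/
def of : Ray B →⋆ₙₐ[𝕜] Q B := (rayEnv B).toEnvelopeHom

lemma norm_of (f : Ray B) : ‖(of f : Q B)‖ = Ray.lim f := by
  refine ((rayEnv B).norm_toEnvelope f).trans (le_antisymm ?_ ?_)
  · exact EnvData.sup_le _ (Ray.lim_nonneg f) fun p hp => by
      rw [Set.mem_singleton_iff.1 hp]; exact le_rfl
  · exact (rayEnv B).le_sup ⟨Ray.limSeminorm B, rfl⟩ f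

lemma of_eq_iff {f g : Ray B} :
    (of f : Q B) = of g ↔ Tendsto (fun t => ‖f t - g t‖) atTop (𝓝 0) := by
  rw [← sub_eq_zero, ← map_sub, ← norm_eq_zero, norm_of, Ray.lim_eq_zero_iff]
  rfl

lemma grading_of (f : Ray B) : (Q B).grading (of f) = of (Ray.comp B.gradingHom f) :=
  (rayEnv B).grading_toEnvelope f

/-- Every element is represented by a path: paths can be changed on a bounded interval so that their
norm is close to the norm of their class, so that the image of the complete space of paths is closed. -/
lemma of_surjective : Function.Surjective (of : Ray B → Q B) := by
  let F : NormedAddGroupHom (Ray B) (Q B) :=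
    { toFun := of
      map_add' := map_add of
      bound' := ⟨1, fun f => by
        rw [norm_of, one_mul]
        exact Ray.lim_le (norm_nonneg f) (Eventually.of_forall fun t => f.norm_coe_le_norm t)⟩ }
  have hK : F.SurjectiveOnWith F.range 2 := by
    rintro _ ⟨f, rfl⟩
    change ∃ g, of g = of f ∧ ‖g‖ ≤ 2 * ‖of f‖
    rcases (norm_nonneg (of f)).eq_or_lt with h0 | h0
    · exact ⟨0, by rw [map_zero, norm_eq_zero.1 h0.symm], by rw [norm_zero, ← h0, mul_zero]⟩
    · have h1 : Ray.lim f < 2 * ‖of f‖ := by rw [norm_of] at h0 ⊢; linarith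
      obtain ⟨T, hT⟩ := (Ray.eventually_le f h1).exists_forall_of_atTop
      refine ⟨BoundedContinuousFunction.ofNormedAddCommGroup (fun t => f (max t T))
        (by fun_prop) _ fun t => hT _ (le_max_right _ _), of_eq_iff.2 ?_,
        BoundedContinuousFunction.norm_ofNormedAddCommGroup_le _ (mul_pos two_pos h0).le
          fun t => hT _ (le_max_right _ _)⟩
      refine tendsto_const_nhds.congr' ?_
      filter_upwards [eventually_ge_atTop T] with t ht
      change 0 = ‖f (max t T) - f t‖
      rw [max_eq_left ht, sub_self, norm_zero]
  have h := controlled_closure_of_complete two_pos one_pos hK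
  intro x
  have hx : x ∈ F.range.topologicalClosure := by
    have hd : DenseRange (of : Ray B → Q B) := (rayEnv B).denseRange_toEnvelopeHom
    exact hd x
  obtain ⟨g, hg, -⟩ := h x hx
  exact ⟨g, hg⟩

/-- A path representing a given class. -/
def rep (x : Q B) : Ray B := Function.surjInv of_surjective x
lemma of_rep (x : Q B) : of (rep x) = x := Function.surjInv_eq of_surjective x

lemma ind {P : Q B → Prop} (h : ∀ f, P (of f)) (x) : P x := by
  rw [← of_rep x]; exact h _

/-- Homogeneous classes are represented by paths of homogeneous elements. -/
lemma exists_homog_rep {i : ℕ} {x : Q B} (hx : (Q B).Homog i x) :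
    ∃ f, of f = x ∧ ∀ t, B.Homog i (f t) := by
  refine ⟨(2⁻¹ : 𝕜) • (rep x + (-1 : 𝕜) ^ i • Ray.comp B.gradingHom (rep x)), ?_, fun t => ?_⟩
  · rw [map_smul, map_add, map_smul, ← grading_of, of_rep, hx.grading_eq, negOne_pow_smul_smul,
      ← two_smul 𝕜, smul_smul, inv_mul_cancel₀ two_ne_zero, one_smul]
  · change B.grading ((2⁻¹ : 𝕜) • (rep x t + (-1 : 𝕜) ^ i • B.grading (rep x t))) =
      (-1 : 𝕜) ^ i • ((2⁻¹ : 𝕜) • (rep x t + (-1 : 𝕜) ^ i • B.grading (rep x t)))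
    rw [map_smul, map_add, map_smul, B.grading_grading, smul_comm ((-1 : 𝕜) ^ i) (2⁻¹ : 𝕜)]
    congr 1
    rw [smul_add, negOne_pow_smul_smul, add_comm]

lemma homog_of {i : ℕ} {f : Ray B} (hf : ∀ t, B.Homog i (f t)) : (Q B).Homog i (of f) := by
  rw [GCAlg.Homog, grading_of, ← map_smul]
  congr 1
  ext t
  exact hf t

/-- Functoriality of `Q`. -/
lemma exists_map (g : GHom B C) : ∃ G : GHom (Q B) (Q C), ∀ f, G (of f) = of (Ray.comp g f) := by
  have h0 : ∀ f f' : Ray B, of f = of f' → (of (Ray.comp g f) : Q C) = of (Ray.comp g f') := by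
    intro f f' h
    rw [← sub_eq_zero, ← map_sub, ← map_sub, ← norm_le_zero_iff, norm_of]
    refine (Ray.lim_comp_le g _).trans ?_
    rw [← norm_of, map_sub, h, sub_self, norm_zero]
  let F : Q B → Q C := fun x => of (Ray.comp g (rep x))
  have hF : ∀ f, F (of f) = of (Ray.comp g f) := fun f => h0 _ _ (of_rep _)
  refine ⟨GHom.ofStarHom
    { toFun := F
      map_smul' := fun r x => ?_
      map_zero' := ?_
      map_add' := fun x y => ?_
      map_mul' := fun x y => ?_
      map_star' := fun x => ?_ } fun x => ?_, hF⟩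
  · induction x using ind with | h f => ?_
    rw [← map_smul, hF, hF, map_smul, map_smul]; rfl
  · rw [← map_zero of, hF, map_zero, map_zero]
  · induction x using ind with | h f => ?_
    induction y using ind with | h f' => ?_
    rw [← map_add, hF, hF, hF, map_add, map_add]
  · induction x using ind with | h f => ?_
    induction y using ind with | h f' => ?_
    rw [← map_mul, hF, hF, hF, map_mul, map_mul]
  · induction x using ind with | h f => ?_
    rw [← map_star, hF, hF, map_star, map_star]
  · change F _ = (Q C).grading (F x)
    induction x using ind with | h f => ?_
    rw [grading_of, hF, hF, grading_of]
    congr 1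
    ext t
    exact g.map_grading (f t)

/-- The homomorphism induced by a homomorphism of coefficients. -/
def map (g : GHom B C) : GHom (Q B) (Q C) := (exists_map g).choose
lemma map_of (g : GHom B C) (f : Ray B) : map g (of f) = of (Ray.comp g f) :=
  (exists_map g).choose_spec f

lemma map_map (g : GHom B C) (f : GHom A B) (x : Q A) : map g (map f x) = map (g.comp f) x := by
  induction x using ind with | h f => ?_
  rw [map_of, map_of, map_of]
  rfl

lemma map_id (x : Q B) : map (GHom.id B) x = x := by
  induction x using ind with | h f => ?_
  rw [map_of]
  rfl

/-- Constant paths. -/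
def const (B : GCAlg.{u} 𝕜) : GHom B (Q B) := GHom.ofStarHom
  (of.comp
    { toFun := fun b => BoundedContinuousFunction.const _ b
      map_smul' := fun _ _ => rfl
      map_zero' := rfl
      map_add' := fun _ _ => rfl
      map_mul' := fun _ _ => rfl
      map_star' := fun _ => rfl }) fun b => (grading_of (B := B) (BoundedContinuousFunction.const _ b)).symm

lemma const_injective : Function.Injective (const B) := fun b b' h => by
  have h1 := of_eq_iff.1 h
  have h2 : ‖b - b'‖ = 0 := tendsto_nhds_unique tendsto_const_nhds h1
  exact sub_eq_zero.1 (norm_eq_zero.1 h2)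

lemma map_const (g : GHom B C) (b : B) : map g (const B b) = const C (g b) := map_of g _

end Q

end GradedE

end

/-! ### Classes of asymptotic morphisms as homomorphisms -/

noncomputable section

namespace GradedE

universe u' v' w'

variable {𝕜 : Type} [RCLike 𝕜]

section AsyClass

variable {A : GCAlg.{u} 𝕜} {B : GCAlg.{v} 𝕜} {C : GCAlg.{w} 𝕜} {D : GCAlg.{u'} 𝕜}

/-- The path `t ↦ φ_t(a)` of an asymptotic morphism. -/
def Asy.ray (φ : Asy A B) (a : A) : Ray B :=
  BoundedContinuousFunction.ofNormedAddCommGroup (fun t => φ.toFun t a) (φ.continuous a) _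
    (φ.bounded a).choose_spec

/-- The homomorphism to the algebra of paths modulo null paths defined by an asymptotic morphism. -/
def Asy.hat (φ : Asy A B) : GHom A (Q B) :=
  have hlin : ∀ (a b : A) (r : 𝕜), Q.of (φ.ray (a + r • b)) = Q.of (φ.ray a) + r • Q.of (φ.ray b) :=
    fun a b r => by
      rw [← map_smul, ← map_add, Q.of_eq_iff]
      refine (φ.asymp_add_smul a b r).congr fun t => ?_
      rw [sub_sub]; rfl
  have h0 : Q.of (φ.ray 0) = 0 := by
    have h := hlin 0 0 1
    rw [one_smul, add_zero, one_smul] at h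
    exact left_eq_add.1 h
  GHom.ofStarHom
    { toFun := fun a => Q.of (φ.ray a)
      map_smul' := fun r a => by
        have h := hlin 0 a r
        rwa [zero_add, h0, zero_add] at h
      map_zero' := h0
      map_add' := fun a b => by
        have h := hlin a b 1
        rwa [one_smul, one_smul] at h
      map_mul' := fun a b => by
        rw [← map_mul, Q.of_eq_iff]
        exact φ.asymp_mul a b
      map_star' := fun a => by
        rw [← map_star, Q.of_eq_iff]
        exact φ.asymp_star a } fun a => by
    change Q.of (φ.ray _) = (Q B).grading (Q.of (φ.ray a))
    rw [Q.grading_of, Q.of_eq_iff]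
    exact φ.asymp_grading a

lemma Asy.hat_apply (φ : Asy A B) (a : A) : φ.hat a = Q.of (φ.ray a) := rfl

lemma Asy.hat_eq_iff {φ ψ : Asy A B} : φ.hat = ψ.hat ↔ AsyClass.mk φ = AsyClass.mk ψ := by
  refine Iff.trans ?_ (Quotient.eq (r := Asy.setoid A B)).symm
  constructor
  · intro h a
    have h1 : φ.hat a = ψ.hat a := by rw [h]
    exact Q.of_eq_iff.1 h1
  · intro h
    ext a
    exact Q.of_eq_iff.2 (h a)

/-- Homomorphisms to `Q B` are represented by asymptotic morphisms: choose representing paths. No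
continuity of `φ_t` in the argument is required. -/
lemma Asy.exists_hat (F : GHom A (Q B)) : ∃ φ : Asy A B, φ.hat = F := by
  have h : ∀ {f g : Ray B}, Q.of f = Q.of g → Tendsto (fun t => ‖f t - g t‖) atTop (𝓝 0) :=
    Q.of_eq_iff.1
  refine ⟨{ toFun := fun t a => Q.rep (F a) t
            continuous := fun a => (Q.rep (F a)).continuous
            bounded := fun a => ⟨_, fun t => (Q.rep (F a)).norm_coe_le_norm t⟩
            asymp_mul := fun a b => h (g := Q.rep (F a) * Q.rep (F b)) ?_
            asymp_add_smul := fun a b r => ?_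
            asymp_star := fun a => h (g := star (Q.rep (F a))) ?_
            asymp_grading := fun a => h (g := Ray.comp B.gradingHom (Q.rep (F a))) ?_ }, ?_⟩
  · rw [map_mul, map_mul, Q.of_rep, Q.of_rep, Q.of_rep]
  · refine (h (f := Q.rep (F (a + r • b))) (g := Q.rep (F a) + r • Q.rep (F b)) ?_).congr fun t => ?_
    · rw [map_add, map_smul, map_add, map_smul, Q.of_rep, Q.of_rep, Q.of_rep]
    · rw [sub_sub]; rfl
  · rw [map_star, map_star, Q.of_rep, Q.of_rep]
  · rw [← Q.grading_of, Q.of_rep, Q.of_rep, F.map_grading]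
  · ext a
    exact Q.of_rep _

namespace AsyClass

/-- The homomorphism to the algebra of paths modulo null paths defined by a class of asymptotic
morphisms. -/
def hat (x : AsyClass A B) : GHom A (Q B) := Quotient.lift Asy.hat (fun _ _ h =>
  Asy.hat_eq_iff.2 (Quotient.sound h)) x

lemma exists_mk (x : AsyClass A B) : ∃ φ, mk φ = x := Quotient.exists_rep x

lemma hat_injective : Function.Injective (hat : AsyClass A B → GHom A (Q B)) := fun x y h => by
  obtain ⟨φ, rfl⟩ := x.exists_mk
  obtain ⟨ψ, rfl⟩ := y.exists_mk
  exact Asy.hat_eq_iff.1 h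

lemma exists_hat (F : GHom A (Q B)) : ∃ x : AsyClass A B, x.hat = F := by
  obtain ⟨φ, h⟩ := Asy.exists_hat F
  exact ⟨mk φ, h⟩

lemma hat_compHom (x : AsyClass B C) (f : GHom A B) : (x.compHom f).hat = x.hat.comp f := by
  obtain ⟨φ, rfl⟩ := x.exists_mk
  rfl

lemma hat_homComp (g : GHom B C) (x : AsyClass A B) : (x.homComp g).hat = (Q.map g).comp x.hat := by
  obtain ⟨φ, rfl⟩ := x.exists_mk
  ext a
  exact (Q.map_of g (φ.ray a)).symm

lemma hat_zero : (0 : AsyClass A B).hat = 0 := by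
  ext a
  change Q.of ((0 : Asy A B).ray a) = 0
  rw [← map_zero Q.of]
  rfl

end AsyClass

end AsyClass

namespace Q

variable {A : GCAlg.{w} 𝕜} {B : GCAlg.{u} 𝕜} {C : GCAlg.{v} 𝕜} {D : GCAlg.{u'} 𝕜}

/-- The product of an element and a path. -/
def tmulRay (d : D) (f : Ray B) : Ray (D ⊗ᵍ B) :=
  BoundedContinuousFunction.ofNormedAddCommGroup (fun t => d ⊗ₑ f t)
    ((continuous_tmul_right d).comp f.continuous) (‖d‖ * ‖f‖) fun t => (norm_tmul_le _ _).trans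
      (mul_le_mul_of_nonneg_left (f.norm_coe_le_norm t) (norm_nonneg d))

/-- The product of a path and an element. -/
def rayTmul (f : Ray B) (d : D) : Ray (B ⊗ᵍ D) :=
  BoundedContinuousFunction.ofNormedAddCommGroup (fun t => f t ⊗ₑ d)
    ((continuous_tmul_left d).comp f.continuous) (‖f‖ * ‖d‖) fun t => (norm_tmul_le _ _).trans
      (mul_le_mul_of_nonneg_right (f.norm_coe_le_norm t) (norm_nonneg d))

lemma of_tmulRay_congr (d : D) {f g : Ray B} (h : of f = of g) :
    of (tmulRay d f) = of (tmulRay d g) := by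
  rw [of_eq_iff] at h ⊢
  refine squeeze_zero (fun _ => norm_nonneg _) (g := fun t => ‖d‖ * ‖f t - g t‖) (fun t => ?_)
    (by simpa using h.const_mul ‖d‖)
  change ‖d ⊗ₑ f t - d ⊗ₑ g t‖ ≤ _
  rw [← tmul_sub']
  exact norm_tmul_le _ _

lemma of_rayTmul_congr (d : D) {f g : Ray B} (h : of f = of g) :
    of (rayTmul f d) = of (rayTmul g d) := by
  rw [of_eq_iff] at h ⊢
  refine squeeze_zero (fun _ => norm_nonneg _) (g := fun t => ‖f t - g t‖ * ‖d‖) (fun t => ?_)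
    (by simpa using h.mul_const ‖d‖)
  change ‖f t ⊗ₑ d - g t ⊗ₑ d‖ ≤ _
  rw [← sub_tmul']
  exact norm_tmul_le _ _

/-- The products `d ⊗ f` of an element and a class of paths satisfy the relations of a graded tensor
product, since homogeneous classes are represented by homogeneous paths. -/
lemma exists_left (D : GCAlg.{u'} 𝕜) (B : GCAlg.{u} 𝕜) : ∃ F : GHom (D ⊗ᵍ Q B) (Q (D ⊗ᵍ B)),
    ∀ d f, F (d ⊗ₑ of f) = of (tmulRay d f) := by
  let F : D → Q B → Q (D ⊗ᵍ B) := fun d x => of (tmulRay d (rep x))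
  have hF : ∀ d f, F d (of f) = of (tmulRay d f) := fun d f => of_tmulRay_congr d (of_rep _)
  let Φ : D →ₗ[𝕜] Q B →ₗ[𝕜] Q (D ⊗ᵍ B) := LinearMap.mk₂ 𝕜 F
    (fun d d' x => (congrArg of (by ext t; exact add_tmul' _ _ _)).trans
      (map_add of (tmulRay d (rep x)) (tmulRay d' (rep x))))
    (fun r d x => (congrArg of (by ext t; exact smul_tmul' _ _ _)).trans
      (map_smul of r (tmulRay d (rep x))))
    (fun d x y => by
      induction x using ind with | h f => ?_
      induction y using ind with | h g => ?_
      rw [← map_add, hF, hF, hF, ← map_add]; congr 1; ext t; exact tmul_add' _ _ _)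
    (fun r d x => by
      induction x using ind with | h f => ?_
      rw [← map_smul, hF, hF, ← map_smul]; congr 1; ext t; exact tmul_smul' _ _ _)
  have hΦ : ∀ d f, Φ d (of f) = of (tmulRay d f) := hF
  obtain ⟨G, hG⟩ := GHom.exists_lift Φ
    (fun i j k l d x d' x' hd hx hd' hx' => by
      obtain ⟨f, rfl, hf⟩ := exists_homog_rep hx
      obtain ⟨f', rfl, hf'⟩ := exists_homog_rep hx'
      rw [← map_mul, hΦ, hΦ, hΦ, ← map_mul, ← map_smul]
      congr 1
      ext t
      exact tmul_mul_tmul (hf t) hd')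
    (fun i j d x hd hx => by
      obtain ⟨f, rfl, hf⟩ := exists_homog_rep hx
      rw [← map_star of, hΦ, hΦ, ← map_star of, ← map_smul]
      congr 1
      ext t
      exact star_tmul hd (hf t))
    (fun i j d x hd hx => by
      obtain ⟨f, rfl, hf⟩ := exists_homog_rep hx
      rw [hΦ]
      exact homog_of fun t => homog_tmul hd (hf t))
  exact ⟨G, fun d f => (hG _ _).trans (hΦ d f)⟩

/-- The products `f ⊗ d` of a class of paths and an element satisfy the relations of a graded tensor
product. -/
lemma exists_right (B : GCAlg.{u} 𝕜) (D : GCAlg.{u'} 𝕜) : ∃ F : GHom (Q B ⊗ᵍ D) (Q (B ⊗ᵍ D)),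
    ∀ f d, F (of f ⊗ₑ d) = of (rayTmul f d) := by
  let F : Q B → D → Q (B ⊗ᵍ D) := fun x d => of (rayTmul (rep x) d)
  have hF : ∀ f d, F (of f) d = of (rayTmul f d) := fun f d => of_rayTmul_congr d (of_rep _)
  let Φ : Q B →ₗ[𝕜] D →ₗ[𝕜] Q (B ⊗ᵍ D) := LinearMap.mk₂ 𝕜 F
    (fun x y d => by
      induction x using ind with | h f => ?_
      induction y using ind with | h g => ?_
      rw [← map_add, hF, hF, hF, ← map_add]; congr 1; ext t; exact add_tmul' _ _ _)
    (fun r x d => by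
      induction x using ind with | h f => ?_
      rw [← map_smul, hF, hF, ← map_smul]; congr 1; ext t; exact smul_tmul' _ _ _)
    (fun x d d' => (congrArg of (by ext t; exact tmul_add' _ _ _)).trans
      (map_add of (rayTmul (rep x) d) (rayTmul (rep x) d')))
    (fun r x d => (congrArg of (by ext t; exact tmul_smul' _ _ _)).trans
      (map_smul of r (rayTmul (rep x) d)))
  have hΦ : ∀ f d, Φ (of f) d = of (rayTmul f d) := hF
  obtain ⟨G, hG⟩ := GHom.exists_lift Φ
    (fun i j k l x d x' d' hx hd hx' hd' => by
      obtain ⟨f, rfl, hf⟩ := exists_homog_rep hx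
      obtain ⟨f', rfl, hf'⟩ := exists_homog_rep hx'
      rw [← map_mul, hΦ, hΦ, hΦ, ← map_mul, ← map_smul]
      congr 1
      ext t
      exact tmul_mul_tmul hd (hf' t))
    (fun i j x d hx hd => by
      obtain ⟨f, rfl, hf⟩ := exists_homog_rep hx
      rw [← map_star of, hΦ, hΦ, ← map_star of, ← map_smul]
      congr 1
      ext t
      exact star_tmul (hf t) hd)
    (fun i j x d hx hd => by
      obtain ⟨f, rfl, hf⟩ := exists_homog_rep hx
      rw [hΦ]
      exact homog_of fun t => homog_tmul (hf t) hd)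
  exact ⟨G, fun f d => (hG _ _).trans (hΦ f d)⟩

/-- The homomorphism `D ⊗ Q B → Q (D ⊗ B)`. -/
def left (D : GCAlg.{u'} 𝕜) (B : GCAlg.{u} 𝕜) : GHom (D ⊗ᵍ Q B) (Q (D ⊗ᵍ B)) :=
  (exists_left D B).choose
lemma left_tmul (d : D) (f : Ray B) : left D B (d ⊗ₑ of f) = of (tmulRay d f) :=
  (exists_left D B).choose_spec d f

/-- The homomorphism `Q B ⊗ D → Q (B ⊗ D)`. -/
def right (B : GCAlg.{u} 𝕜) (D : GCAlg.{u'} 𝕜) : GHom (Q B ⊗ᵍ D) (Q (B ⊗ᵍ D)) :=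
  (exists_right B D).choose
lemma right_tmul (f : Ray B) (d : D) : right B D (of f ⊗ₑ d) = of (rayTmul f d) :=
  (exists_right B D).choose_spec f d

end Q

namespace AsyClass

variable {A : GCAlg.{u} 𝕜} {B : GCAlg.{v} 𝕜} {C : GCAlg.{w} 𝕜} {D : GCAlg.{u'} 𝕜}

/-- The class `id ⊗ φ` corresponds to the homomorphism `D ⊗ A → D ⊗ Q B → Q (D ⊗ B)`. This gives its
existence and uniqueness at once. -/
lemma isLeftTensor_iff {x : AsyClass A B} {z : AsyClass (D ⊗ᵍ A) (D ⊗ᵍ B)} :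
    IsLeftTensor D x z ↔ z.hat = (Q.left D B).comp ((GHom.id D).tensor x.hat) := by
  have key : ∀ (φ : Asy A B) (γ : Asy (D ⊗ᵍ A) (D ⊗ᵍ B)),
      (∀ (d : D) (a : A), Tendsto (fun t => ‖γ.toFun t (d ⊗ₑ a) - d ⊗ₑ φ.toFun t a‖) atTop (𝓝 0)) ↔
        γ.hat = (Q.left D B).comp ((GHom.id D).tensor φ.hat) := fun φ γ => by
    have e : ∀ d a, (Q.left D B).comp ((GHom.id D).tensor φ.hat) (d ⊗ₑ a) =
        Q.of (Q.tmulRay d (φ.ray a)) := fun d a => by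
      rw [GHom.comp_apply, GHom.tensor_tmul, Asy.hat_apply, Q.left_tmul]; rfl
    constructor
    · intro h
      refine GHom.ext_tensor fun _ _ d a _ _ => ?_
      rw [e, Asy.hat_apply, Q.of_eq_iff]
      exact h d a
    · intro h d a
      have h1 : γ.hat (d ⊗ₑ a) = Q.of (Q.tmulRay d (φ.ray a)) := by rw [h, e]
      exact Q.of_eq_iff.1 h1
  constructor
  · rintro ⟨φ, γ, rfl, rfl, h⟩
    exact (key φ γ).1 h
  · intro h
    obtain ⟨φ, rfl⟩ := x.exists_mk
    obtain ⟨γ, rfl⟩ := z.exists_mk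
    exact ⟨φ, γ, rfl, rfl, (key φ γ).2 h⟩

/-- The class `φ ⊗ id` corresponds to the homomorphism `A ⊗ D → Q B ⊗ D → Q (B ⊗ D)`. -/
lemma isRightTensor_iff {x : AsyClass A B} {z : AsyClass (A ⊗ᵍ D) (B ⊗ᵍ D)} :
    IsRightTensor x D z ↔ z.hat = (Q.right B D).comp (x.hat.tensor (GHom.id D)) := by
  have key : ∀ (φ : Asy A B) (γ : Asy (A ⊗ᵍ D) (B ⊗ᵍ D)),
      (∀ (a : A) (d : D), Tendsto (fun t => ‖γ.toFun t (a ⊗ₑ d) - φ.toFun t a ⊗ₑ d‖) atTop (𝓝 0)) ↔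
        γ.hat = (Q.right B D).comp (φ.hat.tensor (GHom.id D)) := fun φ γ => by
    have e : ∀ a d, (Q.right B D).comp (φ.hat.tensor (GHom.id D)) (a ⊗ₑ d) =
        Q.of (Q.rayTmul (φ.ray a) d) := fun a d => by
      rw [GHom.comp_apply, GHom.tensor_tmul, Asy.hat_apply, GHom.id_apply, Q.right_tmul]
    constructor
    · intro h
      refine GHom.ext_tensor fun _ _ a d _ _ => ?_
      rw [e, Asy.hat_apply, Q.of_eq_iff]
      exact h a d
    · intro h a d
      have h1 : γ.hat (a ⊗ₑ d) = Q.of (Q.rayTmul (φ.ray a) d) := by rw [h, e]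
      exact Q.of_eq_iff.1 h1
  constructor
  · rintro ⟨φ, γ, rfl, rfl, h⟩
    exact (key φ γ).1 h
  · intro h
    obtain ⟨φ, rfl⟩ := x.exists_mk
    obtain ⟨γ, rfl⟩ := z.exists_mk
    exact ⟨φ, γ, rfl, rfl, (key φ γ).2 h⟩

lemma existsUnique_isLeftTensor (D : GCAlg.{u'} 𝕜) (x : AsyClass A B) :
    ∃! z, IsLeftTensor D x z := by
  obtain ⟨z, hz⟩ := exists_hat ((Q.left D B).comp ((GHom.id D).tensor x.hat))
  exact ⟨z, isLeftTensor_iff.2 hz, fun z' hz' => hat_injective ((isLeftTensor_iff.1 hz').trans hz.symm)⟩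

lemma existsUnique_isRightTensor (x : AsyClass A B) (D : GCAlg.{u'} 𝕜) :
    ∃! z, IsRightTensor x D z := by
  obtain ⟨z, hz⟩ := exists_hat ((Q.right B D).comp (x.hat.tensor (GHom.id D)))
  exact ⟨z, isRightTensor_iff.2 hz, fun z' hz' => hat_injective ((isRightTensor_iff.1 hz').trans hz.symm)⟩

lemma the_eq {P : AsyClass A B → Prop} (hP : ∃! x, P x) : P (the P) := by
  rw [the, dif_pos hP]
  exact hP.choose_spec.1

lemma hat_leftTensor (D : GCAlg.{u'} 𝕜) (x : AsyClass A B) :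
    (x.leftTensor D).hat = (Q.left D B).comp ((GHom.id D).tensor x.hat) :=
  isLeftTensor_iff.1 (the_eq (existsUnique_isLeftTensor D x))

lemma hat_rightTensor (x : AsyClass A B) (D : GCAlg.{u'} 𝕜) :
    (x.rightTensor D).hat = (Q.right B D).comp (x.hat.tensor (GHom.id D)) :=
  isRightTensor_iff.1 (the_eq (existsUnique_isRightTensor x D))

end AsyClass

end GradedE

end

/-! ### The canonical identifications -/

noncomputable section

namespace GradedE

universe u' v' w'

variable {𝕜 : Type} [RCLike 𝕜]

namespace GAct

variable {N : GCAlg.{w} 𝕜} {A : GCAlg.{u} 𝕜} {B : GCAlg.{v} 𝕜} {A' : GCAlg.{u'} 𝕜} {B' : GCAlg.{v'} 𝕜}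

lemma comp_r {N' : GCAlg.{w'} 𝕜} (ρ : GAct N A) (f : GHom N' N) (n : N') (x : A) :
    (ρ.comp f).r n x = ρ.r (f n) x := rfl

lemma left_comp {N' : GCAlg.{w'} 𝕜} (ρ : GAct N A) (f : GHom N' N) (B : GCAlg.{v} 𝕜) (n : N')
    (x : (A ⊗ᵍ B : GCAlg 𝕜)) : ((ρ.comp f).left B).r n x = (ρ.left B).r (f n) x := by
  induction x using tensor_ind with
  | closed => exact isClosed_eq (continuous_right _ _) (continuous_right _ _)
  | add x y hx hy => rw [map_add, map_add, hx, hy]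
  | tmul i j a b ha hb => rw [left_tmul, left_tmul, comp_r]

/-- Left multiplication by an elementary tensor is the composition of the multiplications by its
factors. -/
lemma self_comp_tensor (φ : GHom A A') (ψ : GHom B B') (a : A) (b : B)
    (x : (A' ⊗ᵍ B' : GCAlg 𝕜)) : ((self (A' ⊗ᵍ B')).comp (φ.tensor ψ)).r (a ⊗ₑ b) x =
      (((self A').comp φ).left B').r a ((((self B').comp ψ).right A').r b x) := by
  rw [comp_r, self_r, GHom.tensor_tmul]
  induction b using GCAlg.homog_ind with
  | add b b' h h' => simp only [map_add, LinearMap.add_apply, tmul_add', add_mul, h, h']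
  | hom k b hb =>
    induction x using tensor_ind with
    | closed =>
      exact isClosed_eq (continuous_const_mul _) ((continuous_right _ _).comp (continuous_right _ _))
    | add x y hx hy => simp only [map_add, mul_add, hx, hy]
    | tmul i j y z hy hz =>
      rw [tmul_mul_tmul (hb.map ψ) hy, right_tmul _ hb hy, map_smul, left_tmul]
      rfl

lemma Comm.left_tensor {ρ : GAct N A'} {φ : GHom A A'} (h : Comm ρ ((self A').comp φ))
    (ψ : GHom B B') : Comm (ρ.left B') ((self (A' ⊗ᵍ B')).comp (φ.tensor ψ)) :=
  (Comm.pair (self_comp_tensor φ ψ) (h.symm.left B') (comm_left_right _ _).symm).symm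

lemma Comm.right_tensor {ρ : GAct N B'} {ψ : GHom B B'} (h : Comm ρ ((self B').comp ψ))
    (φ : GHom A A') : Comm (ρ.right A') ((self (A' ⊗ᵍ B')).comp (φ.tensor ψ)) :=
  (Comm.pair (self_comp_tensor φ ψ) (comm_left_right _ _) (h.symm.right A')).symm

end GAct

lemma GHom.ext_tensor₄ {A : GCAlg.{u} 𝕜} {B : GCAlg.{v} 𝕜} {C : GCAlg.{w} 𝕜} {D : GCAlg.{u'} 𝕜}
    {E : GCAlg.{v'} 𝕜} {f g : GHom (A ⊗ᵍ B ⊗ᵍ C ⊗ᵍ D) E}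
    (h : ∀ i j k l (a : A) (b : B) (c : C) (d : D), A.Homog i a → B.Homog j b → C.Homog k c →
      D.Homog l d → f (a ⊗ₑ b ⊗ₑ c ⊗ₑ d) = g (a ⊗ₑ b ⊗ₑ c ⊗ₑ d)) : f = g := by
  refine GHom.ext_tensor_right fun i j _ a b z ha hb hz => ?_
  clear hz
  induction z using tensor_ind with
  | closed =>
    exact isClosed_eq (f.continuous.comp ((continuous_tmul_right a).comp (continuous_tmul_right b)))
      (g.continuous.comp ((continuous_tmul_right a).comp (continuous_tmul_right b)))
  | add x y hx hy => rw [tmul_add', tmul_add', map_add, map_add, hx, hy]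
  | tmul k l c d hc hd => exact h i j k l a b c d ha hb hc hd

lemma tensor_ind_right {A : GCAlg.{u} 𝕜} {B : GCAlg.{v} 𝕜} {C : GCAlg.{w} 𝕜}
    {P : (A ⊗ᵍ B ⊗ᵍ C : GCAlg 𝕜) → Prop} (closed : IsClosed {z | P z})
    (add : ∀ x y, P x → P y → P (x + y))
    (tmul : ∀ i j k (a : A) (b : B) (c : C), A.Homog i a → B.Homog j b → C.Homog k c →
      P (a ⊗ₑ b ⊗ₑ c)) (z) : P z := by
  induction z using tensor_ind with
  | closed => exact closed
  | add x y hx hy => exact add x y hx hy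
  | tmul i _ a z ha hz =>
    clear hz
    induction z using tensor_ind with
    | closed => exact closed.preimage (continuous_tmul_right a)
    | add x y hx hy => rw [tmul_add']; exact add _ _ hx hy
    | tmul j k b c hb hc => exact tmul i j k a b c ha hb hc

section

variable (H : GradedHilbert.{u'} 𝕜)

/-- The map `B ⊗ 𝔽_{m,0} ⊗ 𝒦 → B ⊗ 𝔽_{n,0} ⊗ 𝒦` induced by an isometry `ℝᵐ → ℝⁿ`. -/
def tgtIso (B : GCAlg.{v} 𝕜) {m n : ℕ} (T : Euc m →ₗᵢ[ℝ] Euc n) : GHom (tgt H B m) (tgt H B n) :=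
  (GHom.id B).tensor ((Cliff.map 𝕜 T).tensor (GHom.id (compacts H)))

/-- Left multiplication by elements of the Clifford algebra on `B ⊗ 𝔽_{n,0} ⊗ 𝒦`. -/
def cliffAct (B : GCAlg.{v} 𝕜) (n : ℕ) : GAct (Cliff 𝕜 n) (tgt H B n) :=
  ((GAct.self (Cliff 𝕜 n)).left (compacts H)).right B

variable {H} {A : GCAlg.{w} 𝕜} {B : GCAlg.{v} 𝕜} {k m n : ℕ}

lemma tgtIso_tmul (T : Euc m →ₗᵢ[ℝ] Euc n) (b : B) (c : Cliff 𝕜 m) (κ : compacts H) :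
    tgtIso H B T (b ⊗ₑ c ⊗ₑ κ) = b ⊗ₑ Cliff.map 𝕜 T c ⊗ₑ κ := by
  rw [tgtIso, GHom.tensor_tmul, GHom.tensor_tmul]; rfl

lemma tgtMap_tmul (f : GHom A B) (a : A) (c : Cliff 𝕜 m) (κ : compacts H) :
    tgtMap H f m (a ⊗ₑ c ⊗ₑ κ) = f a ⊗ₑ c ⊗ₑ κ := by
  rw [tgtMap, GHom.tensor_tmul]; rfl

lemma cliffAct_tmul {i j : ℕ} {d : Cliff 𝕜 n} {b : B} (hd : (Cliff 𝕜 n).Homog i d)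
    (hb : B.Homog j b) (c : Cliff 𝕜 n) (κ : compacts H) :
    (cliffAct H B n).r d (b ⊗ₑ c ⊗ₑ κ) = (-1 : 𝕜) ^ (i * j) • (b ⊗ₑ (d * c) ⊗ₑ κ) := by
  rw [cliffAct, GAct.right_tmul _ hd hb, GAct.left_tmul, GAct.self_r]

lemma tgtIso_tgtIso (T : Euc m →ₗᵢ[ℝ] Euc n) (S : Euc k →ₗᵢ[ℝ] Euc m) (w : tgt H B k) :
    tgtIso H B T (tgtIso H B S w) = tgtIso H B (T.comp S) w := by
  have : (tgtIso H B T).comp (tgtIso H B S) = tgtIso H B (T.comp S) :=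
    GHom.ext_tensor_right fun _ _ _ b c κ _ _ _ => by
      rw [GHom.comp_apply, tgtIso_tmul, tgtIso_tmul, tgtIso_tmul, Cliff.map_map]
  rw [← this, GHom.comp_apply]

lemma tgtIso_id : tgtIso H B (LinearIsometry.id : Euc m →ₗᵢ[ℝ] Euc m) = GHom.id _ :=
  GHom.ext_tensor_right fun _ _ _ b c κ _ _ _ => by
    rw [tgtIso_tmul, Cliff.map_id]; rfl

lemma tgtMap_tgtIso (f : GHom A B) (T : Euc m →ₗᵢ[ℝ] Euc n) (w : tgt H A m) :
    tgtMap H f n (tgtIso H A T w) = tgtIso H B T (tgtMap H f m w) := by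
  have : (tgtMap H f n).comp (tgtIso H A T) = (tgtIso H B T).comp (tgtMap H f m) :=
    GHom.ext_tensor_right fun _ _ _ b c κ _ _ _ => by
      rw [GHom.comp_apply, GHom.comp_apply, tgtIso_tmul, tgtMap_tmul, tgtMap_tmul, tgtIso_tmul]
  rw [← GHom.comp_apply, this, GHom.comp_apply]

lemma cliffAct_one (w : tgt H B n) : (cliffAct H B n).r (Cliff.one 𝕜 n) w = w := by
  induction w using tensor_ind_right with
  | closed => exact isClosed_eq (GAct.continuous_right _ _) continuous_id
  | add x y hx hy => rw [map_add, hx, hy]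
  | tmul i j l b c κ hb hc hκ =>
    rw [cliffAct_tmul Cliff.homog_one hb, zero_mul, pow_zero, one_smul, Cliff.one_mul]

lemma tgtIso_cliffAct (T : Euc m →ₗᵢ[ℝ] Euc n) (d : Cliff 𝕜 m) (w : tgt H B m) :
    tgtIso H B T ((cliffAct H B m).r d w) =
      (cliffAct H B n).r (Cliff.map 𝕜 T d) (tgtIso H B T w) := by
  induction d using GCAlg.homog_ind with
  | add d d' h h' => simp only [map_add, LinearMap.add_apply, h, h']
  | hom i d hd =>
    induction w using tensor_ind_right with
    | closed =>
      exact isClosed_eq ((tgtIso H B T).continuous.comp (GAct.continuous_right _ _))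
        ((GAct.continuous_right _ _).comp (tgtIso H B T).continuous)
    | add x y hx hy => simp only [map_add, hx, hy]
    | tmul i j l b c κ hb hc hκ =>
      rw [cliffAct_tmul hd hb, map_smul, tgtIso_tmul, tgtIso_tmul, cliffAct_tmul (hd.map _) hb,
        map_mul]

lemma tgtMap_cliffAct (f : GHom A B) (d : Cliff 𝕜 m) (w : tgt H A m) :
    tgtMap H f m ((cliffAct H A m).r d w) = (cliffAct H B m).r d (tgtMap H f m w) := by
  induction d using GCAlg.homog_ind with
  | add d d' h h' => simp only [map_add, LinearMap.add_apply, h, h']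
  | hom i d hd =>
    induction w using tensor_ind_right with
    | closed =>
      exact isClosed_eq ((tgtMap H f m).continuous.comp (GAct.continuous_right _ _))
        ((GAct.continuous_right _ _).comp (tgtMap H f m).continuous)
    | add x y hx hy => simp only [map_add, hx, hy]
    | tmul i j l b c κ hb hc hκ =>
      rw [cliffAct_tmul hd hb, map_smul, tgtMap_tmul, tgtMap_tmul, cliffAct_tmul hd (hb.map f)]

/-- For isometries `T` and `S` with orthogonal ranges, Clifford elements `d` and elements `w` of
`B ⊗ 𝔽_{m,0} ⊗ 𝒦` are multiplied by `d ⊗ w ↦ T(d) · S(w)`. -/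
lemma exists_cliffMul (H : GradedHilbert.{u'} 𝕜) (B : GCAlg.{v} 𝕜) (T : Euc k →ₗᵢ[ℝ] Euc n)
    (S : Euc m →ₗᵢ[ℝ] Euc n) (h : ∀ v w, inner ℝ (T v) (S w) = 0) :
    ∃ F : GHom (Cliff 𝕜 k ⊗ᵍ tgt H B m) (tgt H B n), ∀ d w,
      F (d ⊗ₑ w) = (cliffAct H B n).r (Cliff.map 𝕜 T d) (tgtIso H B S w) := by
  have h0 : GAct.Comm ((GAct.self (Cliff 𝕜 n)).comp (Cliff.map 𝕜 T))
      ((GAct.self (Cliff 𝕜 n)).comp (Cliff.map 𝕜 S)) := fun i j a b x ha hb => by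
    simp only [GAct.comp_r, GAct.self_r]
    rw [← mul_assoc, Cliff.map_mul_map h ha hb, smul_mul_assoc, mul_assoc]
  have h1 := (h0.left_tensor (GHom.id (compacts H))).right_tensor (GHom.id B)
  refine GHom.exists_lift_act ((cliffAct H B n).comp (Cliff.map 𝕜 T)) (tgtIso H B S) ?_
  have e : ∀ a y, ((cliffAct H B n).comp (Cliff.map 𝕜 T)).r a y =
      ((((GAct.self (Cliff 𝕜 n)).comp (Cliff.map 𝕜 T)).left (compacts H)).right B).r a y := by
    intro a y
    induction a using GCAlg.homog_ind with
    | add a a' h h' => simp only [map_add, LinearMap.add_apply, h, h']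
    | hom i a ha =>
      induction y using tensor_ind with
      | closed => exact isClosed_eq (GAct.continuous_right _ _) (GAct.continuous_right _ _)
      | add x y hx hy => rw [map_add, map_add, hx, hy]
      | tmul j _ b z hb hz =>
        rw [GAct.comp_r, cliffAct, GAct.right_tmul _ (ha.map _) hb, GAct.right_tmul _ ha hb,
          GAct.left_comp]
  intro i j a b x ha hb
  rw [e, e]
  exact h1 i j a b x ha hb

lemma cliffMul_def (c : Cliff 𝕜 m) (d : Cliff 𝕜 k) :
    Cliff.mul 𝕜 m k c d = Cliff.map 𝕜 (Euc.inl m k) c * Cliff.map 𝕜 (Euc.inr m k) d := rfl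

/-- The map that puts `k` new generators last: `d ⊗ b ⊗ c ⊗ κ ↦ ± b ⊗ c d ⊗ κ`. The sign does not appear
if `d` acts by left multiplication. -/
lemma exists_shuffle (H : GradedHilbert.{u'} 𝕜) (B : GCAlg.{v} 𝕜) (m k : ℕ) :
    ∃ F : GHom (Cliff 𝕜 k ⊗ᵍ tgt H B m) (tgt H B (m + k)), ∀ d w,
      F (d ⊗ₑ w) = (cliffAct H B (m + k)).r (Cliff.map 𝕜 (Euc.inr m k) d)
        (tgtIso H B (Euc.inl m k) w) :=
  exists_cliffMul H B _ _ fun v w => Euc.inner_inr_inl m k w v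

lemma isShuffle_of {F : GHom (Cliff 𝕜 1 ⊗ᵍ tgt H B m) (tgt H B (m + 1))}
    (h : ∀ d w, F (d ⊗ₑ w) = (cliffAct H B (m + 1)).r (Cliff.map 𝕜 (Euc.inr m 1) d)
        (tgtIso H B (Euc.inl m 1) w)) : IsShuffle H B m F := by
  intro i j l d b c κ hd hb hc
  rw [h, tgtIso_tmul, cliffAct_tmul (hd.map _) hb,
    Cliff.map_mul_map (fun v w => Euc.inner_inr_inl m 1 w v) hd hc, smul_tmul', tmul_smul', smul_smul,
    cliffMul_def, ← pow_add, mul_add]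

lemma existsUnique_isShuffle (H : GradedHilbert.{u'} 𝕜) (B : GCAlg.{v} 𝕜) (m : ℕ) :
    ∃! θ, IsShuffle H B m θ := by
  obtain ⟨F, hF⟩ := exists_shuffle H B m 1
  refine ⟨F, isShuffle_of hF, fun G hG => GHom.ext_tensor₄ fun i j l _ d b c κ hd hb hc _ => ?_⟩
  rw [hG i j l d b c κ hd hb hc, isShuffle_of hF i j l d b c κ hd hb hc]

lemma shuffle_tmul (d : Cliff 𝕜 1) (w : tgt H B m) :
    GHom.the (IsShuffle H B m) (d ⊗ₑ w) =
      (cliffAct H B (m + 1)).r (Cliff.map 𝕜 (Euc.inr m 1) d) (tgtIso H B (Euc.inl m 1) w) := by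
  obtain ⟨F, hF⟩ := exists_shuffle H B m 1
  rw [(existsUnique_isShuffle H B m).unique (GHom.the_eq (existsUnique_isShuffle H B m))
    (isShuffle_of hF), hF]

/-- The map that puts `m` generators first: `b ⊗ c ⊗ κ ⊗ d ↦ ± b ⊗ d c ⊗ κ`, the flip followed by left
multiplication by `d`. -/
lemma exists_moveIn (H : GradedHilbert.{u'} 𝕜) (B : GCAlg.{v} 𝕜) (m n : ℕ) :
    ∃ F : GHom (tgt H B n ⊗ᵍ Cliff 𝕜 m) (tgt H B (m + n)), ∀ i j w d,
      GCAlg.Homog _ i w → GCAlg.Homog _ j d →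
      F (w ⊗ₑ d) = (-1 : 𝕜) ^ (i * j) • (cliffAct H B (m + n)).r (Cliff.map 𝕜 (Euc.inl m n) d)
        (tgtIso H B (Euc.inr m n) w) := by
  obtain ⟨F, hF⟩ := exists_cliffMul H B _ _ (Euc.inner_inl_inr m n)
  obtain ⟨G, hG⟩ := GHom.exists_flip (tgt H B n) (Cliff 𝕜 m)
  refine ⟨F.comp G, fun i j w d hw hd => ?_⟩
  rw [GHom.comp_apply, hG i j w d hw hd, map_smul, hF]

lemma isMoveIn_of {F : GHom (tgt H B n ⊗ᵍ Cliff 𝕜 m) (tgt H B (m + n))}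
    (h : ∀ i j w d, GCAlg.Homog _ i w → GCAlg.Homog _ j d →
      F (w ⊗ₑ d) = (-1 : 𝕜) ^ (i * j) • (cliffAct H B (m + n)).r (Cliff.map 𝕜 (Euc.inl m n) d)
        (tgtIso H B (Euc.inr m n) w)) : IsMoveIn H B m n F := by
  intro i j l b c κ d hd hc hκ
  induction b using GCAlg.homog_ind with
  | add b b' hb hb' => simp only [add_tmul', map_add, smul_add, hb, hb']
  | hom t b hb =>
    rw [h _ i _ d (homog_tmul hb (homog_tmul hc hκ)) hd, tgtIso_tmul, cliffAct_tmul (hd.map _) hb,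
      smul_smul, cliffMul_def, ← pow_add]
    congr 1
    apply negOne_pow_congr
    simp only [Nat.even_add, Nat.even_mul]
    grind

lemma existsUnique_isMoveIn (H : GradedHilbert.{u'} 𝕜) (B : GCAlg.{v} 𝕜) (m n : ℕ) :
    ∃! θ, IsMoveIn H B m n θ := by
  obtain ⟨F, hF⟩ := exists_moveIn H B m n
  refine ⟨F, isMoveIn_of hF, fun G hG => GHom.ext_tensor fun _ i w d hw hd => ?_⟩
  clear hw
  induction w using tensor_ind_right with
  | closed =>
    exact isClosed_eq (G.continuous.comp (continuous_tmul_left d))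
      (F.continuous.comp (continuous_tmul_left d))
  | add x y hx hy => rw [add_tmul', map_add, map_add, hx, hy]
  | tmul _ j l b c κ _ hc hκ => rw [hG i j l b c κ d hd hc hκ, isMoveIn_of hF i j l b c κ d hd hc hκ]

lemma moveIn_tmul {i j : ℕ} {w : tgt H B n} {d : Cliff 𝕜 m} (hw : GCAlg.Homog _ i w)
    (hd : GCAlg.Homog _ j d) :
    GHom.the (IsMoveIn H B m n) (w ⊗ₑ d) = (-1 : 𝕜) ^ (i * j) •
      (cliffAct H B (m + n)).r (Cliff.map 𝕜 (Euc.inl m n) d) (tgtIso H B (Euc.inr m n) w) := by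
  obtain ⟨F, hF⟩ := exists_moveIn H B m n
  rw [(existsUnique_isMoveIn H B m n).unique (GHom.the_eq (existsUnique_isMoveIn H B m n))
    (isMoveIn_of hF), hF i j w d hw hd]

lemma existsUnique_isMoveOut (H : GradedHilbert.{u'} 𝕜) (A : GCAlg.{v} 𝕜) (m : ℕ) :
    ∃! θ, IsMoveOut H A m θ := by
  obtain ⟨τ, hτ⟩ := GHom.exists_flip (Cliff 𝕜 m) (compacts H)
  obtain ⟨α, hα⟩ := exists_assoc_symm A (compacts H) (Cliff 𝕜 m)
  obtain ⟨α', hα'⟩ := exists_assoc_symm (funS 𝕜) (A ⊗ᵍ compacts H) (Cliff 𝕜 m)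
  have h : IsMoveOut H A m
      (α'.comp ((GHom.id _).tensor (α.comp ((GHom.id _).tensor τ)))) := by
    intro i j f a c κ hc hκ
    simp only [GHom.comp_apply, GHom.tensor_tmul, GHom.id_apply, hτ i j c κ hc hκ]
    simp only [tmul_smul', map_smul, hα, hα']
  refine ⟨_, h, fun G hG => GHom.ext_tensor₄ fun _ _ i j f a c κ _ _ hc hκ => ?_⟩
  rw [hG i j f a c κ hc hκ, h i j f a c κ hc hκ]

end

end GradedE

end

/-! ### Translations of homomorphisms on `𝒮 ⊗ A ⊗ 𝒦` -/

noncomputable section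

namespace GradedE

universe u' v' w'

variable {𝕜 : Type} [RCLike 𝕜]

namespace GAct

variable {N : GCAlg.{w} 𝕜} {A : GCAlg.{u} 𝕜}

/-- The action on a path. -/
def ray (ρ : GAct N A) (n : N) (f : Ray A) : Ray A :=
  BoundedContinuousFunction.ofNormedAddCommGroup (fun t => ρ.r n (f t))
    ((ρ.continuous_right n).comp f.continuous) (‖n‖ * ‖f‖) fun t => (ρ.norm_le n (f t)).trans
      (mul_le_mul_of_nonneg_left (f.norm_coe_le_norm t) (norm_nonneg n))

lemma of_ray_congr (ρ : GAct N A) (n : N) {f g : Ray A} (h : Q.of f = Q.of g) :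
    Q.of (ρ.ray n f) = Q.of (ρ.ray n g) := by
  rw [Q.of_eq_iff] at h ⊢
  refine squeeze_zero (fun _ => norm_nonneg _) (g := fun t => ‖n‖ * ‖f t - g t‖) (fun t => ?_)
    (by simpa using h.const_mul ‖n‖)
  change ‖ρ.r n (f t) - ρ.r n (g t)‖ ≤ _
  rw [← map_sub]
  exact ρ.norm_le _ _

/-- The action on paths modulo null paths. -/
def paths (ρ : GAct N A) : GAct N (Q A) :=
  have hF : ∀ n f, Q.of (ρ.ray n (Q.rep (Q.of f))) = Q.of (ρ.ray n f) := fun n f =>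
    ρ.of_ray_congr n (Q.of_rep _)
  { r := LinearMap.mk₂ 𝕜 (fun n x => Q.of (ρ.ray n (Q.rep x)))
      (fun n n' x => (congrArg Q.of (by ext t; exact ρ.r.map_add₂ n n' _)).trans
        (map_add Q.of (ρ.ray n (Q.rep x)) (ρ.ray n' (Q.rep x))))
      (fun r n x => (congrArg Q.of (by ext t; exact ρ.r.map_smul₂ r n _)).trans
        (map_smul Q.of r (ρ.ray n (Q.rep x))))
      (fun n x y => by
        induction x using Q.ind with | h f => ?_
        induction y using Q.ind with | h g => ?_
        rw [← map_add, hF, hF, hF, ← map_add]; congr 1; ext t; exact map_add (ρ.r n) _ _)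
      (fun r n x => by
        induction x using Q.ind with | h f => ?_
        rw [← map_smul, hF, hF, ← map_smul]; congr 1; ext t; exact map_smul (ρ.r n) _ _)
    mul := fun m n x => by
      change Q.of (ρ.ray (m * n) (Q.rep x)) = Q.of (ρ.ray m (Q.rep (Q.of (ρ.ray n (Q.rep x)))))
      rw [hF]; congr 1; ext t; exact ρ.mul m n _
    adj := fun n x y => by
      change star (Q.of (ρ.ray n (Q.rep x))) * y = star x * Q.of (ρ.ray (star n) (Q.rep y))
      induction x using Q.ind with | h f => ?_
      induction y using Q.ind with | h g => ?_
      rw [hF, hF, ← map_star, ← map_star, ← map_mul, ← map_mul]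
      congr 1; ext t; exact ρ.adj n _ _
    grading := fun n x => by
      change Q.of (ρ.ray _ (Q.rep _)) = (Q A).grading (Q.of (ρ.ray n (Q.rep x)))
      induction x using Q.ind with | h f => ?_
      rw [Q.grading_of, hF, hF, Q.grading_of]
      congr 1; ext t; exact ρ.grading n _ }

lemma paths_of (ρ : GAct N A) (n : N) (f : Ray A) : ρ.paths.r n (Q.of f) = Q.of (ρ.ray n f) :=
  ρ.of_ray_congr n (Q.of_rep _)

lemma paths_const (ρ : GAct N A) (n : N) (x : A) :
    ρ.paths.r n (Q.const A x) = Q.const A (ρ.r n x) := ρ.paths_of n _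

end GAct

namespace Q

variable {B : GCAlg.{u} 𝕜} {C : GCAlg.{v} 𝕜} {D : GCAlg.{w} 𝕜} {D' : GCAlg.{w'} 𝕜}

lemma map_act {N : GCAlg.{w} 𝕜} {ρ : GAct N B} {ρ' : GAct N C} {g : GHom B C} {n : N}
    (h : ∀ x, g (ρ.r n x) = ρ'.r n (g x)) (x : Q B) :
    map g (ρ.paths.r n x) = ρ'.paths.r n (map g x) := by
  induction x using ind with | h f => ?_
  rw [GAct.paths_of, map_of, map_of, GAct.paths_of]
  congr 1; ext t; exact h _

lemma left_tensor (g : GHom D D') (d : D) (x : Q B) :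
    map (g.tensor (GHom.id B)) (left D B (d ⊗ₑ x)) = left D' B (g d ⊗ₑ x) := by
  induction x using ind with | h f => ?_
  rw [left_tmul, left_tmul, map_of]
  congr 1; ext t; exact GHom.tensor_tmul _ _ _ _

lemma left_const (d : D) (b : B) : left D B (d ⊗ₑ const B b) = const _ (d ⊗ₑ b) := left_tmul _ _

end Q

section

variable {H : GradedHilbert.{u'} 𝕜} {A : GCAlg.{u} 𝕜} {B : GCAlg.{v} 𝕜} {k l m n m' n' : ℕ}

variable (H B) in
/-- The action of the Clifford algebra on the paths in `B ⊗ 𝔽_{n,0} ⊗ 𝒦`. -/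
def pathAct (n : ℕ) : GAct (Cliff 𝕜 n) (Q (tgt H B n)) := (cliffAct H B n).paths

variable (H B) in
/-- The homomorphism of path algebras induced by an isometry `ℝᵐ → ℝⁿ`. -/
def pathIso (T : Euc m →ₗᵢ[ℝ] Euc n) : GHom (Q (tgt H B m)) (Q (tgt H B n)) := Q.map (tgtIso H B T)

lemma pathIso_act (T : Euc m →ₗᵢ[ℝ] Euc n) (d : Cliff 𝕜 m) (x : Q (tgt H B m)) :
    pathIso H B T ((pathAct H B m).r d x) = (pathAct H B n).r (Cliff.map 𝕜 T d) (pathIso H B T x) :=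
  Q.map_act (ρ' := (cliffAct H B n).comp (Cliff.map 𝕜 T)) (tgtIso_cliffAct T d) x

lemma pathIso_pathIso (T : Euc m →ₗᵢ[ℝ] Euc n) (S : Euc k →ₗᵢ[ℝ] Euc m) (x : Q (tgt H B k)) :
    pathIso H B T (pathIso H B S x) = pathIso H B (T.comp S) x := by
  rw [pathIso, pathIso, Q.map_map, pathIso,
    show (tgtIso H B T).comp (tgtIso H B S) = _ from GHom.ext (tgtIso_tgtIso T S)]

lemma pathAct_one (x : Q (tgt H B n)) : (pathAct H B n).r (Cliff.one 𝕜 n) x = x := by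
  induction x using Q.ind with | h f => ?_
  rw [pathAct, GAct.paths_of]
  congr 1; ext t; exact cliffAct_one _

/-- Clifford multiplication of paths, for a map as provided by `exists_cliffMul`. -/
lemma map_cliffMul {F : GHom (Cliff 𝕜 k ⊗ᵍ tgt H B m) (tgt H B n)} {T : Euc k →ₗᵢ[ℝ] Euc n}
    {S : Euc m →ₗᵢ[ℝ] Euc n}
    (hF : ∀ d w, F (d ⊗ₑ w) = (cliffAct H B n).r (Cliff.map 𝕜 T d) (tgtIso H B S w))
    (d : Cliff 𝕜 k) (x : Q (tgt H B m)) :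
    Q.map F (Q.left _ _ (d ⊗ₑ x)) = (pathAct H B n).r (Cliff.map 𝕜 T d) (pathIso H B S x) := by
  induction x using Q.ind with | h f => ?_
  rw [Q.left_tmul, Q.map_of, pathIso, Q.map_of, pathAct, GAct.paths_of]
  congr 1; ext t; exact hF _ _

/-- `G` is the translate of `T_* F` by the vector `x`.  For an odd `X` which anticommutes with `x`
one has `(X + x)² = X² + ‖x‖²`, hence `u(X + x) = e u(X)` and `v(X + x) = e (v(X) + x u(X))` for
`e = exp(-‖x‖²)`; these formulas are imposed on the generators `u` and `v` of `𝒮`, with an arbitrary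
scalar `e` in order to allow `e = 0` at the point at infinity. -/
def IsTranslate (e : 𝕜) (x : Euc n) (T : Euc m →ₗᵢ[ℝ] Euc n) (F : GHom (src H A) (Q (tgt H B m)))
    (G : GHom (src H A) (Q (tgt H B n))) : Prop :=
  (∀ w, G (uS 𝕜 ⊗ₑ w) = e • pathIso H B T (F (uS 𝕜 ⊗ₑ w))) ∧
  ∀ w, G (vS 𝕜 ⊗ₑ w) = e • (pathIso H B T (F (vS 𝕜 ⊗ₑ w)) +
    (pathAct H B n).r (Cliff.vec 𝕜 x) (pathIso H B T (F (uS 𝕜 ⊗ₑ w))))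

namespace IsTranslate

variable {e e' : 𝕜} {x x' : Euc n} {T T' : Euc m →ₗᵢ[ℝ] Euc n} {F : GHom (src H A) (Q (tgt H B m))}
  {G G' : GHom (src H A) (Q (tgt H B n))}

/-- Translates are determined by the vector, the isometry and the scalar. Identities between maps that
are built from structure maps, rotations and products are thereby reduced to identities between
vectors and isometries. -/
lemma eq (h : IsTranslate e x T F G) (h' : IsTranslate e' x' T' F G') (he : e = e') (hx : x = x')
    (hT : ∀ v, T v = T' v) : G = G' := by
  obtain rfl : T = T' := LinearIsometry.ext hT
  subst he hx
  exact GHom.ext_funS_tensor (fun w => (h.1 w).trans (h'.1 w).symm)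
    fun w => (h.2 w).trans (h'.2 w).symm

/-- Translates compose like affine isometries. -/
lemma trans (h : IsTranslate e x T F G) {e' : 𝕜} {x' : Euc k} {S : Euc n →ₗᵢ[ℝ] Euc k}
    {K : GHom (src H A) (Q (tgt H B k))} (h' : IsTranslate e' x' S G K) :
    IsTranslate (e' * e) (S x + x') (S.comp T) F K := by
  refine ⟨fun w => ?_, fun w => ?_⟩
  · rw [h'.1, h.1, map_smul, smul_smul, pathIso_pathIso]
  · rw [h'.2, h.2, h.1, map_smul, map_smul, map_add, pathIso_pathIso, pathIso_act, pathIso_pathIso,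
      Cliff.map_vec, map_smul, ← smul_add, smul_smul, Cliff.vec_add, map_add, LinearMap.add_apply,
      add_assoc]

lemma comp_iso (T : Euc m →ₗᵢ[ℝ] Euc n) (F : GHom (src H A) (Q (tgt H B m))) :
    IsTranslate 1 0 T F ((pathIso H B T).comp F) := by
  refine ⟨fun w => by rw [one_smul]; rfl, fun w => ?_⟩
  rw [one_smul, Cliff.vec_zero, map_zero, LinearMap.zero_apply, add_zero]
  rfl

end IsTranslate

/-! ### The structure maps as translations -/

lemma comultTensor_uS (w : (A ⊗ᵍ compacts H : GCAlg 𝕜)) :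
    comultTensor H A (uS 𝕜 ⊗ₑ w) = uS 𝕜 ⊗ₑ uS 𝕜 ⊗ₑ w := by
  rw [comultTensor, GHom.comp_apply, GHom.tensor_tmul, comult_uS]
  exact GHom.the_eq (existsUnique_isAssoc _ _ _) _ _ _

lemma comultTensor_vS (w : (A ⊗ᵍ compacts H : GCAlg 𝕜)) :
    comultTensor H A (vS 𝕜 ⊗ₑ w) = uS 𝕜 ⊗ₑ vS 𝕜 ⊗ₑ w + vS 𝕜 ⊗ₑ uS 𝕜 ⊗ₑ w := by
  have h := GHom.the_eq (existsUnique_isAssoc (funS 𝕜) (funS 𝕜) (A ⊗ᵍ compacts H))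
  rw [comultTensor, GHom.comp_apply, GHom.tensor_tmul, comult_vS, add_tmul', map_add]
  exact congrArg₂ _ (h _ _ _) (h _ _ _)

/-- The homomorphism `(b ⊗ id) ∘ (id_𝒮 ⊗ F) ∘ (Δ ⊗ id)` for a homomorphism `F` to a path algebra and a
homomorphism `b : 𝒮 → 𝔽_{k,0}`. -/
def suspend (b : GHom (funS 𝕜) (Cliff 𝕜 k))
    (θ : GHom (Cliff 𝕜 k ⊗ᵍ tgt H B m) (tgt H B (m + k)))
    (F : GHom (src H A) (Q (tgt H B m))) : GHom (src H A) (Q (tgt H B (m + k))) :=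
  (Q.map (θ.comp (b.tensor (GHom.id _)))).comp
    ((Q.left (funS 𝕜) (tgt H B m)).comp (((GHom.id _).tensor F).comp (comultTensor H A)))

/-- The comultiplication replaces `X` by `X ⊗ 1 + 1 ⊗ X`, and the Bott map at `x` replaces the first
summand by the Clifford vector `x`. -/
lemma isTranslate_suspend {b : GHom (funS 𝕜) (Cliff 𝕜 k)} {e : 𝕜} {x : Euc k}
    (hu : b (uS 𝕜) = e • Cliff.one 𝕜 k) (hv : b (vS 𝕜) = e • Cliff.vec 𝕜 x)
    {θ : GHom (Cliff 𝕜 k ⊗ᵍ tgt H B m) (tgt H B (m + k))}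
    (hθ : ∀ d w, θ (d ⊗ₑ w) = (cliffAct H B (m + k)).r (Cliff.map 𝕜 (Euc.inr m k) d)
        (tgtIso H B (Euc.inl m k) w)) (F : GHom (src H A) (Q (tgt H B m))) :
    IsTranslate e (Euc.inr m k x) (Euc.inl m k) F (suspend b θ F) := by
  have key : ∀ f y, Q.map (θ.comp (b.tensor (GHom.id _))) (Q.left (funS 𝕜) (tgt H B m) (f ⊗ₑ y)) =
      (pathAct H B (m + k)).r (Cliff.map 𝕜 (Euc.inr m k) (b f)) (pathIso H B (Euc.inl m k) y) :=
    fun f y => by rw [← Q.map_map, Q.left_tensor, map_cliffMul hθ]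
  refine ⟨fun w => ?_, fun w => ?_⟩
  · simp only [suspend, GHom.comp_apply, comultTensor_uS, GHom.tensor_tmul, GHom.id_apply, key, hu,
      map_smul, Cliff.map_one, LinearMap.smul_apply, pathAct_one]
  · simp only [suspend, GHom.comp_apply, comultTensor_vS, map_add, GHom.tensor_tmul, GHom.id_apply, key,
      hu, hv, map_smul, Cliff.map_one, Cliff.map_vec, LinearMap.smul_apply, pathAct_one, smul_add]

end

end GradedE

end

/-! ### The algebraic laws of the spectrum of asymptotic morphisms -/

noncomputable section

namespace GradedE

universe u' v' w'

variable {𝕜 : Type} [RCLike 𝕜]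

section

variable {H : GradedHilbert.{u'} 𝕜} {A : GCAlg.{u} 𝕜} {B : GCAlg.{v} 𝕜} {k l m n m' n' : ℕ}

variable (𝕜) in
/-- The scalar `exp(-‖v‖²)`. -/
def gauss (v : Euc n) : 𝕜 := (Real.exp (-‖v‖ ^ 2) : ℝ)

lemma gauss_zero : gauss 𝕜 (0 : Euc n) = 1 := by simp [gauss]

lemma gauss_isometry (T : Euc m →ₗᵢ[ℝ] Euc n) (v : Euc m) : gauss 𝕜 (T v) = gauss 𝕜 v := by
  rw [gauss, T.norm_map, gauss]

/-- The Gaussian is multiplicative for the decomposition of a vector into its last coordinate and the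
others. -/
lemma gauss_succ (v : Euc (n + 1)) : gauss 𝕜 v =
    gauss 𝕜 (EuclideanSpace.single (0 : Fin 1) (v (Fin.last n)) : Euc 1) *
      gauss 𝕜 (WithLp.toLp 2 fun i => v i.castSucc : Euc n) := by
  rw [gauss, gauss, gauss, ← RCLike.ofReal_mul, ← Real.exp_add]
  congr 3
  rw [PiLp.norm_single, EuclideanSpace.norm_sq_eq, EuclideanSpace.norm_sq_eq, Fin.sum_univ_castSucc]
  ring

/-- The structure map of the spectrum of asymptotic morphisms. -/
def AsyClass.susp (x : AsyClass (src H A) (tgt H B m)) (s : OnePoint ℝ) :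
    AsyClass (src H A) (tgt H B (m + 1)) :=
  ((x.leftTensor (funS 𝕜)).compHom (comultTensor H A)).homComp (bottTensor H B m s)

lemma AsyClass.hat_susp (x : AsyClass (src H A) (tgt H B m)) (s : OnePoint ℝ) :
    (x.susp s).hat = suspend (bott 𝕜 s) (GHom.the (IsShuffle H B m)) x.hat := by
  rw [AsyClass.susp, AsyClass.hat_homComp, AsyClass.hat_compHom, AsyClass.hat_leftTensor]
  rfl

lemma AsyClass.isTranslate_susp (x : AsyClass (src H A) (tgt H B m)) (r : ℝ) :
    IsTranslate (gauss 𝕜 (EuclideanSpace.single (0 : Fin 1) r : Euc 1))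
      (Euc.inr m 1 (EuclideanSpace.single 0 r)) (Euc.inl m 1) x.hat
      (x.susp (r : OnePoint ℝ)).hat := by
  rw [hat_susp]
  refine isTranslate_suspend ?_ ?_ shuffle_tmul _ <;> rw [bott_coe]
  · exact bottVec_uS _
  · exact bottVec_vS _

lemma suspend_zero {θ : GHom (Cliff 𝕜 n ⊗ᵍ tgt H B m) (tgt H B (m + n))}
    (F : GHom (src H A) (Q (tgt H B m))) : suspend 0 θ F = 0 := by
  have h : (0 : GHom (funS 𝕜) (Cliff 𝕜 n)).tensor (GHom.id (tgt H B m)) = 0 :=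
    GHom.ext_tensor fun _ _ a b _ _ => by
      rw [GHom.tensor_tmul, GHom.zero_apply, GHom.zero_apply, zero_tmul']
  rw [suspend, h]
  ext w
  rw [GHom.comp_apply, GHom.zero_apply]
  generalize (((Q.left (funS 𝕜) (tgt H B m)).comp
    (((GHom.id (funS 𝕜)).tensor F).comp (comultTensor H A)))) w = y
  induction y using Q.ind with | h f => ?_
  rw [Q.map_of, ← map_zero Q.of]
  congr 1; ext t; exact map_zero θ.toHom

lemma AsyClass.susp_infty (x : AsyClass (src H A) (tgt H B m)) : x.susp OnePoint.infty = 0 := by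
  refine hat_injective ?_
  rw [hat_susp, bott_infty, suspend_zero, hat_zero]

lemma AsyClass.homComp_zero {C : GCAlg.{w} 𝕜} {D : GCAlg.{w'} 𝕜} (g : GHom B C) :
    (0 : AsyClass D B).homComp g = 0 := by
  refine AsyClass.hat_injective ?_
  rw [AsyClass.hat_homComp, AsyClass.hat_zero, AsyClass.hat_zero]
  ext d
  exact map_zero (Q.map g).toHom

lemma AsyClass.zero_susp (s : OnePoint ℝ) :
    (0 : AsyClass (src H A) (tgt H B m)).susp s = 0 := by
  induction s using OnePoint.rec with
  | infty => exact susp_infty 0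
  | coe r =>
    have h := isTranslate_susp (0 : AsyClass (src H A) (tgt H B m)) r
    refine hat_injective (GHom.ext_funS_tensor (fun w => ?_) fun w => ?_)
    · rw [h.1 w, hat_zero, hat_zero, GHom.zero_apply, GHom.zero_apply, map_zero, smul_zero]
    · rw [h.2 w]
      simp only [hat_zero, GHom.zero_apply, map_zero, add_zero, smul_zero]

lemma AsyClass.homComp_id (x : AsyClass A B) : x.homComp (GHom.id B) = x := by
  obtain ⟨φ, rfl⟩ := x.exists_mk
  rfl

lemma AsyClass.homComp_tgtIso (T : Euc m →ₗᵢ[ℝ] Euc n) (S : Euc k →ₗᵢ[ℝ] Euc m)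
    (x : AsyClass (src H A) (tgt H B k)) :
    (x.homComp (tgtIso H B S)).homComp (tgtIso H B T) = x.homComp (tgtIso H B (T.comp S)) := by
  refine AsyClass.hat_injective ?_
  simp only [AsyClass.hat_homComp]
  exact GHom.ext fun w => pathIso_pathIso T S _

lemma AsyClass.isTranslate_homComp (T : Euc m →ₗᵢ[ℝ] Euc n) (x : AsyClass (src H A) (tgt H B m)) :
    IsTranslate 1 0 T x.hat (x.homComp (tgtIso H B T)).hat := by
  rw [AsyClass.hat_homComp]
  exact IsTranslate.comp_iso T _

/-- The iterated structure map of the spectrum of asymptotic morphisms. It does not depend on the universe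
of the test spaces of the quasi-topology, which is fixed here. -/
def AsyClass.iter (x : AsyClass (src H A) (tgt H B m)) (n : ℕ) (v : OnePoint (Euc n)) :
    AsyClass (src H A) (tgt H B (m + n)) :=
  (specE.{u, v, 0, u'} H A B).iter m n x v

lemma specE_iter (x : AsyClass (src H A) (tgt H B m)) (n : ℕ) (v : OnePoint (Euc n)) :
    (specE.{u, v, w, u'} H A B).iter m n x v = x.iter n v := by
  induction v using OnePoint.rec with
  | infty => rfl
  | coe v =>
    change (specE.{u, v, w, u'} H A B).iterAux m x n v.ofLp =
      (specE.{u, v, 0, u'} H A B).iterAux m x n v.ofLp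
    induction n with
    | zero => rfl
    | succ n ih =>
      exact congrArg (fun y : AsyClass (src H A) (tgt H B (m + n)) => y.susp (v (Fin.last n) : OnePoint ℝ))
        (ih (WithLp.toLp 2 fun i => v i.castSucc))

/-- The `n`-fold structure map at `v ∈ ℝⁿ` is the translation by `v`: by induction, one coordinate at a
time. -/
lemma AsyClass.isTranslate_iter (x : AsyClass (src H A) (tgt H B m)) (n : ℕ) (v : Euc n) :
    IsTranslate (gauss 𝕜 v) (Euc.inr m n v) (Euc.inl m n) x.hat
      (x.iter n (v : OnePoint (Euc n))).hat := by
  induction n with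
  | zero =>
    obtain rfl : v = 0 := Subsingleton.elim _ _
    have h := isTranslate_homComp (LinearIsometry.id : Euc m →ₗᵢ[ℝ] Euc m) x
    rw [tgtIso_id, homComp_id] at h
    rw [gauss_zero, map_zero]
    have e : Euc.inl m 0 = LinearIsometry.id := by
      ext v i
      exact Euc.inl_castAdd v i
    rw [e]
    exact h
  | succ n ih =>
    have h := (ih (WithLp.toLp 2 fun i => v i.castSucc)).trans
      (isTranslate_susp _ (v (Fin.last n)))
    rw [← gauss_succ, ← Euc.inr_succ] at h
    have e : (Euc.inl (m + n) 1).comp (Euc.inl m n) = Euc.inl m (n + 1) :=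
      LinearIsometry.ext (Euc.inl_inl m n)
    rw [e] at h
    exact h

/-- The iterated structure maps are suspensions by the Bott maps of higher dimension. -/
lemma AsyClass.hat_iter {θ : GHom (Cliff 𝕜 n ⊗ᵍ tgt H B m) (tgt H B (m + n))}
    (hθ : ∀ d w, θ (d ⊗ₑ w) = (cliffAct H B (m + n)).r (Cliff.map 𝕜 (Euc.inr m n) d)
        (tgtIso H B (Euc.inl m n) w)) (x : AsyClass (src H A) (tgt H B m)) (v : OnePoint (Euc n)) :
    (x.iter n v).hat = suspend (bottPt 𝕜 v) θ x.hat := by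
  induction v using OnePoint.rec with
  | infty => rw [bottPt_infty, suspend_zero]; exact hat_zero
  | coe v =>
    exact (isTranslate_iter x n v).eq (isTranslate_suspend (bottVec_uS v) (bottVec_vS v) hθ _)
      rfl rfl fun _ => rfl

lemma AsyClass.iter_infty (x : AsyClass (src H A) (tgt H B m)) :
    x.iter n OnePoint.infty = 0 := rfl

/-- Both sides are translates of `x`, by the vector `b v` and along the isometry given by `a`. -/
lemma AsyClass.iter_act (a : O m) (b : O n) (x : AsyClass (src H A) (tgt H B m))
    (v : OnePoint (Euc n)) :
    (x.homComp (rot H B a)).iter n (OnePoint.map (O.isom b) v) =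
      (x.iter n v).homComp (rot H B (O.blk rfl a b)) := by
  refine AsyClass.hat_injective ?_
  induction v using OnePoint.rec with
  | infty => rw [OnePoint.map_infty, iter_infty, iter_infty, homComp_zero]
  | coe v =>
    refine ((isTranslate_homComp (O.isom a) x).trans (isTranslate_iter _ n (O.isom b v))).eq
      ((isTranslate_iter x n v).trans (isTranslate_homComp (O.isom (O.blk rfl a b)) _)) ?_ ?_ ?_
    · rw [gauss_isometry, mul_comm]
    · rw [map_zero, zero_add, add_zero, O.isom_blk_inr]
    · exact fun v => (O.isom_blk_inl a b v).symm

lemma rot_one : rot H B (1 : O m) = GHom.id _ := by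
  rw [← tgtIso_id, ← O.isom_one]; rfl

lemma AsyClass.mul_act (a b : O m) (x : AsyClass (src H A) (tgt H B m)) :
    x.homComp (rot H B (a * b)) = (x.homComp (rot H B b)).homComp (rot H B a) := by
  have := homComp_tgtIso (O.isom a) (O.isom b) x
  rw [← O.isom_mul] at this
  exact this.symm

end

end GradedE

end

/-! ### The product -/

noncomputable section

namespace GradedE

universe u' v' w'

variable {𝕜 : Type} [RCLike 𝕜]

section

variable {H : GradedHilbert.{u'} 𝕜} {A : GCAlg.{u} 𝕜} {B : GCAlg.{v} 𝕜} {A' : GCAlg.{w} 𝕜}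
  {B' : GCAlg.{v'} 𝕜} {k l m n m' n' : ℕ}

/-- The homomorphism `𝒮 ⊗ A ⊗ 𝔽_{m,0} ⊗ 𝒦 → Q(B ⊗ 𝔽_{m+n,0} ⊗ 𝒦)` induced by a homomorphism `F`
from `𝒮 ⊗ A ⊗ 𝒦` to `Q(B ⊗ 𝔽_{n,0} ⊗ 𝒦)`. -/
def amplify (m : ℕ) (F : GHom (src H A) (Q (tgt H B n))) :
    GHom (funS 𝕜 ⊗ᵍ tgt H A m) (Q (tgt H B (m + n))) :=
  (Q.map (GHom.the (IsMoveIn H B m n))).comp ((Q.right (tgt H B n) (Cliff 𝕜 m)).comp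
    ((F.tensor (GHom.id (Cliff 𝕜 m))).comp (GHom.the (IsMoveOut H A m))))

lemma map_moveIn {i j : ℕ} {y : Q (tgt H B n)} {c : Cliff 𝕜 m} (hy : GCAlg.Homog _ i y)
    (hc : GCAlg.Homog _ j c) :
    Q.map (GHom.the (IsMoveIn H B m n)) (Q.right _ _ (y ⊗ₑ c)) = (-1 : 𝕜) ^ (i * j) •
      (pathAct H B (m + n)).r (Cliff.map 𝕜 (Euc.inl m n) c) (pathIso H B (Euc.inr m n) y) := by
  obtain ⟨f, rfl, hf⟩ := Q.exists_homog_rep hy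
  rw [Q.right_tmul, Q.map_of, pathIso, Q.map_of, pathAct, GAct.paths_of, ← map_smul]
  congr 1; ext t; exact moveIn_tmul (hf t) hc

/-- On elementary tensors the induced homomorphism is left multiplication by the Clifford element `c`,
up to the sign from moving `c` past `f ⊗ a`. -/
lemma amplify_tmul (F : GHom (src H A) (Q (tgt H B n))) {i j k l : ℕ} {f : funS 𝕜} {a : A}
    {c : Cliff 𝕜 m} {κ : compacts H} (hf : GCAlg.Homog _ i f) (ha : GCAlg.Homog _ j a)
    (hc : GCAlg.Homog _ k c) (hκ : GCAlg.Homog _ l κ) :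
    amplify m F (f ⊗ₑ a ⊗ₑ c ⊗ₑ κ) = (-1 : 𝕜) ^ (k * (i + j)) •
      (pathAct H B (m + n)).r (Cliff.map 𝕜 (Euc.inl m n) c)
        (pathIso H B (Euc.inr m n) (F (f ⊗ₑ a ⊗ₑ κ))) := by
  have h := GHom.the_eq (existsUnique_isMoveOut H A m) k l f a c κ hc hκ
  simp only [amplify, GHom.comp_apply]
  rw [h, map_smul, GHom.tensor_tmul, GHom.id_apply, map_smul, map_smul,
    map_moveIn ((homog_tmul hf (homog_tmul ha hκ)).map F) hc, smul_smul, ← pow_add]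
  congr 1
  apply negOne_pow_congr
  simp only [Nat.even_add, Nat.even_mul]
  grind

lemma pathAct_comm (x : Euc n) {i : ℕ} {c : Cliff 𝕜 m} (hc : GCAlg.Homog _ i c)
    (y : Q (tgt H B (m + n))) :
    (pathAct H B (m + n)).r (Cliff.map 𝕜 (Euc.inl m n) c)
        ((pathAct H B (m + n)).r (Cliff.vec 𝕜 (Euc.inr m n x)) y) = (-1 : 𝕜) ^ i •
      (pathAct H B (m + n)).r (Cliff.vec 𝕜 (Euc.inr m n x))
        ((pathAct H B (m + n)).r (Cliff.map 𝕜 (Euc.inl m n) c) y) := by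
  rw [← GAct.mul, ← GAct.mul, ← Cliff.map_vec,
    Cliff.map_mul_map (Euc.inner_inl_inr m n) hc (Cliff.homog_vec x), mul_one, map_smul,
    LinearMap.smul_apply]

section amplify

variable {e : 𝕜} {x : Euc n'} {T : Euc n →ₗᵢ[ℝ] Euc n'} {F : GHom (src H A) (Q (tgt H B n))}
  {G : GHom (src H A) (Q (tgt H B n'))} {S : Euc (m + n) →ₗᵢ[ℝ] Euc (m + n')}

lemma continuous_amplify (F : GHom (src H A) (Q (tgt H B n))) (f : funS 𝕜) :
    Continuous fun z => amplify m F (f ⊗ₑ z) :=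
  (amplify m F).continuous.comp (continuous_tmul_right f)

/-- The induced homomorphism of a translate, on the generator `u`. -/
lemma IsTranslate.amplify_uS (h : IsTranslate e x T F G)
    (hl : ∀ v, S (Euc.inl m n v) = Euc.inl m n' v)
    (hr : ∀ v, S (Euc.inr m n v) = Euc.inr m n' (T v)) (z : tgt H A m) :
    amplify m G (uS 𝕜 ⊗ₑ z) = e • pathIso H B S (amplify m F (uS 𝕜 ⊗ₑ z)) := by
  have hl' : S.comp (Euc.inl m n) = Euc.inl m n' := LinearIsometry.ext hl
  have hr' : S.comp (Euc.inr m n) = (Euc.inr m n').comp T := LinearIsometry.ext hr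
  induction z using tensor_ind_right with
  | closed =>
    exact isClosed_eq (continuous_amplify G _)
      (((pathIso H B S).continuous.comp (continuous_amplify F _)).const_smul e)
  | add z z' hz hz' => simp only [tmul_add', map_add, smul_add, hz, hz']
  | tmul i j k a c κ ha hc hκ =>
    rw [amplify_tmul G homog_uS ha hc hκ, amplify_tmul F homog_uS ha hc hκ, h.1, map_smul, map_smul,
      map_smul, pathIso_act, pathIso_pathIso, pathIso_pathIso, hr', Cliff.map_map, hl', smul_comm]

/-- The induced homomorphism of a translate, on the generator `v`. -/
lemma IsTranslate.amplify_vS (h : IsTranslate e x T F G)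
    (hl : ∀ v, S (Euc.inl m n v) = Euc.inl m n' v)
    (hr : ∀ v, S (Euc.inr m n v) = Euc.inr m n' (T v)) (z : tgt H A m) :
    amplify m G (vS 𝕜 ⊗ₑ z) = e • (pathIso H B S (amplify m F (vS 𝕜 ⊗ₑ z)) +
      (pathAct H B (m + n')).r (Cliff.vec 𝕜 (Euc.inr m n' x))
        (pathIso H B S (amplify m F (uS 𝕜 ⊗ₑ z)))) := by
  have hl' : S.comp (Euc.inl m n) = Euc.inl m n' := LinearIsometry.ext hl
  have hr' : S.comp (Euc.inr m n) = (Euc.inr m n').comp T := LinearIsometry.ext hr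
  induction z using tensor_ind_right with
  | closed =>
    exact isClosed_eq (continuous_amplify G _)
      ((((pathIso H B S).continuous.comp (continuous_amplify F _)).add
        ((GAct.continuous_right _ _).comp
          ((pathIso H B S).continuous.comp (continuous_amplify F _)))).const_smul e)
  | add z z' hz hz' =>
    simp only [tmul_add', map_add, hz, hz', smul_add]
    abel
  | tmul i j k a c κ ha hc hκ =>
    rw [amplify_tmul G homog_vS ha hc hκ, amplify_tmul F homog_vS ha hc hκ,
      amplify_tmul F homog_uS ha hc hκ, h.2]
    simp only [map_smul, map_add, pathIso_act, pathIso_pathIso, hr', Cliff.map_map, hl',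
      Cliff.map_vec, pathAct_comm x hc, smul_add, smul_smul]
    congr 2
    · ring
    · ring_nf
      rw [mul_comm j 2, pow_mul, neg_one_sq, one_pow, mul_one]

end amplify

/-- The induced homomorphism is natural in the isometries of the left Clifford algebra. -/
lemma amplify_tgtIso (F : GHom (src H A) (Q (tgt H B n))) {T : Euc m →ₗᵢ[ℝ] Euc m'}
    {S : Euc (m + n) →ₗᵢ[ℝ] Euc (m' + n)} (hl : ∀ v, S (Euc.inl m n v) = Euc.inl m' n (T v))
    (hr : ∀ v, S (Euc.inr m n v) = Euc.inr m' n v) {i : ℕ} {f : funS 𝕜} (hf : GCAlg.Homog _ i f)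
    (z : tgt H A m) :
    amplify m' F (f ⊗ₑ tgtIso H A T z) = pathIso H B S (amplify m F (f ⊗ₑ z)) := by
  have hl' : S.comp (Euc.inl m n) = (Euc.inl m' n).comp T := LinearIsometry.ext hl
  have hr' : S.comp (Euc.inr m n) = Euc.inr m' n := LinearIsometry.ext hr
  induction z using tensor_ind_right with
  | closed =>
    exact isClosed_eq ((continuous_amplify F _).comp (tgtIso H A T).continuous)
      ((pathIso H B S).continuous.comp (continuous_amplify F _))
  | add z z' hz hz' => simp only [tmul_add', map_add, hz, hz']
  | tmul j k l a c κ ha hc hκ =>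
    rw [tgtIso_tmul, amplify_tmul F hf ha (hc.map _) hκ, amplify_tmul F hf ha hc hκ, map_smul,
      pathIso_act, pathIso_pathIso, hr', Cliff.map_map, Cliff.map_map, hl']

/-- The induced homomorphism commutes with Clifford multiplication from the left; there is no sign
because `u` is even. -/
lemma amplify_cliffAct (F : GHom (src H A) (Q (tgt H B n))) (x : Euc m) (z : tgt H A m) :
    amplify m F (uS 𝕜 ⊗ₑ (cliffAct H A m).r (Cliff.vec 𝕜 x) z) =
      (pathAct H B (m + n)).r (Cliff.vec 𝕜 (Euc.inl m n x)) (amplify m F (uS 𝕜 ⊗ₑ z)) := by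
  induction z using tensor_ind_right with
  | closed =>
    exact isClosed_eq ((continuous_amplify F _).comp (GAct.continuous_right _ _))
      ((GAct.continuous_right _ _).comp (continuous_amplify F _))
  | add z z' hz hz' => simp only [tmul_add', map_add, hz, hz']
  | tmul j k l a c κ ha hc hκ =>
    rw [cliffAct_tmul (Cliff.homog_vec x) ha, tmul_smul', map_smul,
      amplify_tmul F homog_uS ha ((Cliff.homog_vec x).mul hc) hκ, amplify_tmul F homog_uS ha hc hκ,
      map_smul, map_mul, GAct.mul, Cliff.map_vec, smul_smul, ← pow_add]
    congr 1
    apply negOne_pow_congr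
    simp only [Nat.even_add, Nat.even_mul]
    grind

lemma product_hat (α : GHom (src H (scalars 𝕜)) (tgt H A m)) (β : AsyClass (src H A) (tgt H B n)) :
    (product H α β).hat = (amplify m β.hat).comp
      (((GHom.id (funS 𝕜)).tensor α).comp (comultTensor H (scalars 𝕜))) := by
  rw [product, AsyClass.hat_homComp, AsyClass.hat_compHom, AsyClass.hat_rightTensor]
  rfl

lemma product_uS (α : GHom (src H (scalars 𝕜)) (tgt H A m)) (β : AsyClass (src H A) (tgt H B n))
    (w : (scalars 𝕜 ⊗ᵍ compacts H : GCAlg 𝕜)) :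
    (product H α β).hat (uS 𝕜 ⊗ₑ w) = amplify m β.hat (uS 𝕜 ⊗ₑ α (uS 𝕜 ⊗ₑ w)) := by
  rw [product_hat, GHom.comp_apply, GHom.comp_apply, comultTensor_uS, GHom.tensor_tmul, GHom.id_apply]

lemma product_vS (α : GHom (src H (scalars 𝕜)) (tgt H A m)) (β : AsyClass (src H A) (tgt H B n))
    (w : (scalars 𝕜 ⊗ᵍ compacts H : GCAlg 𝕜)) :
    (product H α β).hat (vS 𝕜 ⊗ₑ w) = amplify m β.hat (uS 𝕜 ⊗ₑ α (vS 𝕜 ⊗ₑ w)) +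
      amplify m β.hat (vS 𝕜 ⊗ₑ α (uS 𝕜 ⊗ₑ w)) := by
  rw [product_hat, GHom.comp_apply, GHom.comp_apply, comultTensor_vS, map_add, map_add,
    GHom.tensor_tmul, GHom.id_apply, GHom.tensor_tmul, GHom.id_apply]

/-- The product with a translate in the second variable is a translate of the product. -/
lemma IsTranslate.product_right {e : 𝕜} {x : Euc n'} {T : Euc n →ₗᵢ[ℝ] Euc n'}
    {β : AsyClass (src H A) (tgt H B n)} {β' : AsyClass (src H A) (tgt H B n')}
    (h : IsTranslate e x T β.hat β'.hat) (α : GHom (src H (scalars 𝕜)) (tgt H A m))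
    {S : Euc (m + n) →ₗᵢ[ℝ] Euc (m + n')} (hl : ∀ v, S (Euc.inl m n v) = Euc.inl m n' v)
    (hr : ∀ v, S (Euc.inr m n v) = Euc.inr m n' (T v)) :
    IsTranslate e (Euc.inr m n' x) S (product H α β).hat (product H α β').hat := by
  refine ⟨fun w => ?_, fun w => ?_⟩
  · rw [product_uS, product_uS, h.amplify_uS hl hr]
  · rw [product_vS, product_vS, product_uS, h.amplify_uS hl hr, h.amplify_vS hl hr, map_add, ← smul_add,
      add_assoc]

lemma pathIso_const (T : Euc m →ₗᵢ[ℝ] Euc n) (z : tgt H B m) :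
    pathIso H B T (Q.const _ z) = Q.const _ (tgtIso H B T z) := Q.map_const _ _

/-- The product with a translate in the first variable is a translate of the product. The homomorphism
`α` is regarded as the family of constant paths. -/
lemma IsTranslate.product_left {e : 𝕜} {x : Euc m'} {T : Euc m →ₗᵢ[ℝ] Euc m'}
    {α : GHom (src H (scalars 𝕜)) (tgt H A m)} {α' : GHom (src H (scalars 𝕜)) (tgt H A m')}
    (h : IsTranslate e x T ((Q.const _).comp α) ((Q.const _).comp α'))
    (β : AsyClass (src H A) (tgt H B n)) {S : Euc (m + n) →ₗᵢ[ℝ] Euc (m' + n)}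
    (hl : ∀ v, S (Euc.inl m n v) = Euc.inl m' n (T v))
    (hr : ∀ v, S (Euc.inr m n v) = Euc.inr m' n v) :
    IsTranslate e (Euc.inl m' n x) S (product H α β).hat (product H α' β).hat := by
  have hu : ∀ w, α' (uS 𝕜 ⊗ₑ w) = e • tgtIso H A T (α (uS 𝕜 ⊗ₑ w)) := fun w => by
    have := h.1 w
    rw [GHom.comp_apply, GHom.comp_apply, pathIso_const, ← map_smul] at this
    exact Q.const_injective this
  have hv : ∀ w, α' (vS 𝕜 ⊗ₑ w) = e • (tgtIso H A T (α (vS 𝕜 ⊗ₑ w)) +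
      (cliffAct H A m').r (Cliff.vec 𝕜 x) (tgtIso H A T (α (uS 𝕜 ⊗ₑ w)))) := fun w => by
    have := h.2 w
    rw [GHom.comp_apply, GHom.comp_apply, GHom.comp_apply, pathIso_const, pathIso_const, pathAct,
      GAct.paths_const, ← map_add, ← map_smul] at this
    exact Q.const_injective this
  refine ⟨fun w => ?_, fun w => ?_⟩
  · rw [product_uS, product_uS, hu, tmul_smul', map_smul, amplify_tgtIso _ hl hr homog_uS]
  · rw [product_vS, product_vS, product_uS, hu, hv, tmul_smul', map_smul, tmul_smul', map_smul,
      tmul_add', map_add, amplify_cliffAct, amplify_tgtIso _ hl hr homog_uS,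
      amplify_tgtIso _ hl hr homog_uS, amplify_tgtIso _ hl hr homog_vS, map_add, ← smul_add]
    congr 1
    abel

/-! ### Naturality and bilinearity of the product -/

lemma zero_product (β : AsyClass (src H A) (tgt H B n)) :
    product H (0 : GHom (src H (scalars 𝕜)) (tgt H A m)) β = 0 := by
  refine AsyClass.hat_injective (GHom.ext_funS_tensor (fun w => ?_) fun w => ?_)
  · rw [product_uS, AsyClass.hat_zero, GHom.zero_apply, GHom.zero_apply, tmul_zero', map_zero]
  · rw [product_vS, AsyClass.hat_zero, GHom.zero_apply, GHom.zero_apply, GHom.zero_apply, tmul_zero',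
      tmul_zero', map_zero, add_zero]

lemma amplify_zero : amplify m (0 : GHom (src H A) (Q (tgt H B n))) = 0 := by
  refine GHom.ext_tensor₄ fun i j k l f a c κ hf ha hc hκ => ?_
  rw [amplify_tmul _ hf ha hc hκ, GHom.zero_apply, GHom.zero_apply, map_zero, map_zero, smul_zero]

lemma product_zero (α : GHom (src H (scalars 𝕜)) (tgt H A m)) :
    product H α (0 : AsyClass (src H A) (tgt H B n)) = 0 := by
  refine AsyClass.hat_injective ?_
  rw [product_hat, AsyClass.hat_zero, AsyClass.hat_zero, amplify_zero]
  rfl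

lemma map_tgtMap_pathAct (f : GHom B B') (c : Cliff 𝕜 n) (x : Q (tgt H B n)) :
    Q.map (tgtMap H f n) ((pathAct H B n).r c x) =
      (pathAct H B' n).r c (Q.map (tgtMap H f n) x) :=
  Q.map_act (tgtMap_cliffAct f c) x

lemma map_tgtMap_pathIso (f : GHom B B') (T : Euc m →ₗᵢ[ℝ] Euc n) (x : Q (tgt H B m)) :
    Q.map (tgtMap H f n) (pathIso H B T x) = pathIso H B' T (Q.map (tgtMap H f m) x) := by
  rw [pathIso, pathIso, Q.map_map, Q.map_map,
    show (tgtMap H f n).comp (tgtIso H B T) = (tgtIso H B' T).comp (tgtMap H f m) from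
      GHom.ext (tgtMap_tgtIso f T)]

lemma homComp_tgtMap_tgtIso (f : GHom B B') (T : Euc m →ₗᵢ[ℝ] Euc n) {C : GCAlg.{w'} 𝕜}
    (x : AsyClass C (tgt H B m)) :
    (x.homComp (tgtIso H B T)).homComp (tgtMap H f n) =
      (x.homComp (tgtMap H f m)).homComp (tgtIso H B' T) := by
  refine AsyClass.hat_injective ?_
  simp only [AsyClass.hat_homComp]
  exact GHom.ext fun _ => map_tgtMap_pathIso f T _

/-- Naturality of the product in the coefficients of the second variable. -/
lemma product_homComp (α : GHom (src H (scalars 𝕜)) (tgt H A m))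
    (β : AsyClass (src H A) (tgt H B n)) (f : GHom B B') :
    product H α (β.homComp (tgtMap H f n)) = (product H α β).homComp (tgtMap H f (m + n)) := by
  refine AsyClass.hat_injective ?_
  have h : amplify m (β.homComp (tgtMap H f n)).hat =
      (Q.map (tgtMap H f (m + n))).comp (amplify m β.hat) := by
    refine GHom.ext_tensor₄ fun i j k l s a c κ hs ha hc hκ => ?_
    rw [GHom.comp_apply, amplify_tmul _ hs ha hc hκ, amplify_tmul _ hs ha hc hκ, map_smul,
      map_tgtMap_pathAct, map_tgtMap_pathIso, AsyClass.hat_homComp, GHom.comp_apply]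
  rw [product_hat, h, AsyClass.hat_homComp, product_hat]
  rfl

lemma srcMap_tmul (f : GHom A A') (s : funS 𝕜) (a : A) (κ : compacts H) :
    srcMap H f (s ⊗ₑ a ⊗ₑ κ) = s ⊗ₑ f a ⊗ₑ κ := by
  rw [srcMap, GHom.tensor_tmul, GHom.tensor_tmul]; rfl

/-- Naturality of the product in the middle variable. -/
lemma product_compHom (α : GHom (src H (scalars 𝕜)) (tgt H A m))
    (β : AsyClass (src H A') (tgt H B n)) (f : GHom A A') :
    product H α (β.compHom (srcMap H f)) = product H ((tgtMap H f m).comp α) β := by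
  refine AsyClass.hat_injective ?_
  have h : amplify m (β.compHom (srcMap H f)).hat =
      (amplify m β.hat).comp ((GHom.id (funS 𝕜)).tensor (tgtMap H f m)) := by
    refine GHom.ext_tensor₄ fun i j k l s a c κ hs ha hc hκ => ?_
    rw [GHom.comp_apply, GHom.tensor_tmul, tgtMap_tmul, amplify_tmul _ hs ha hc hκ, GHom.id_apply,
      amplify_tmul _ hs (ha.map f) hc hκ, AsyClass.hat_compHom, GHom.comp_apply, srcMap_tmul]
  have h' : (GHom.id (funS 𝕜)).tensor ((tgtMap H f m).comp α) =
      ((GHom.id (funS 𝕜)).tensor (tgtMap H f m)).comp ((GHom.id (funS 𝕜)).tensor α) :=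
    GHom.ext_tensor fun _ _ s w _ _ => by
      rw [GHom.comp_apply, GHom.tensor_tmul, GHom.tensor_tmul, GHom.tensor_tmul]; rfl
  rw [product_hat, product_hat, h, h']
  rfl

/-! ### The spectrum of homomorphisms -/

/-- A homomorphism as a constant asymptotic morphism. -/
def AsyClass.ofHom (α : GHom A B) : AsyClass A B := (exists_hat ((Q.const B).comp α)).choose

lemma AsyClass.hat_ofHom (α : GHom A B) : (ofHom α).hat = (Q.const B).comp α :=
  (exists_hat ((Q.const B).comp α)).choose_spec

lemma AsyClass.ofHom_injective : Function.Injective (ofHom : GHom A B → AsyClass A B) := fun f g h => by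
  have h1 := congrArg hat h
  rw [hat_ofHom, hat_ofHom] at h1
  refine GHom.ext fun a => Q.const_injective ?_
  exact congrArg (fun F : GHom A (Q B) => F a) h1

lemma AsyClass.ofHom_comp {C : GCAlg.{w'} 𝕜} (g : GHom B C) (α : GHom A B) :
    ofHom (g.comp α) = (ofHom α).homComp g := by
  refine hat_injective ?_
  rw [hat_homComp, hat_ofHom, hat_ofHom]
  exact GHom.ext fun a => (Q.map_const g (α a)).symm

lemma AsyClass.ofHom_zero : ofHom (0 : GHom A B) = 0 := by
  refine hat_injective ?_
  rw [hat_ofHom, hat_zero]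
  ext a
  exact map_zero (Q.const B).toHom

lemma Q.left_comp_const (D : GCAlg.{w'} 𝕜) (α : GHom A B) :
    (Q.left D B).comp ((GHom.id D).tensor ((Q.const B).comp α)) =
      (Q.const (D ⊗ᵍ B)).comp ((GHom.id D).tensor α) :=
  GHom.ext_tensor fun _ _ f w _ _ => by
    simp only [GHom.comp_apply, GHom.tensor_tmul, Q.left_const]

/-- The structure map of the spectrum of homomorphisms. -/
def GHom.susp (α : GHom (src H A) (tgt H B m)) (s : OnePoint ℝ) :
    GHom (src H A) (tgt H B (m + 1)) :=
  (bottTensor H B m s).comp (((GHom.id (funS 𝕜)).tensor α).comp (comultTensor H A))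

lemma AsyClass.ofHom_susp (α : GHom (src H A) (tgt H B m)) (s : OnePoint ℝ) :
    ofHom (α.susp s) = (ofHom α).susp s := by
  refine hat_injective ?_
  rw [AsyClass.susp, hat_homComp, hat_compHom, hat_leftTensor, hat_ofHom, hat_ofHom, Q.left_comp_const]
  exact GHom.ext fun w => (Q.map_const (bottTensor H B m s) _).symm

/-- The iterated structure map of the spectrum of homomorphisms, with a fixed universe of test spaces. -/
def GHom.iter (α : GHom (src H (scalars 𝕜)) (tgt H B m)) (n : ℕ) (v : OnePoint (Euc n)) :
    GHom (src H (scalars 𝕜)) (tgt H B (m + n)) :=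
  (specK.{v, 0, u'} H B).iter m n α v

lemma specK_iter (α : GHom (src H (scalars 𝕜)) (tgt H B m)) (n : ℕ) (v : OnePoint (Euc n)) :
    (specK.{v, w, u'} H B).iter m n α v = α.iter n v := by
  induction v using OnePoint.rec with
  | infty => rfl
  | coe v =>
    change (specK.{v, w, u'} H B).iterAux m α n v.ofLp = (specK.{v, 0, u'} H B).iterAux m α n v.ofLp
    induction n with
    | zero => rfl
    | succ n ih =>
      exact congrArg (fun y : GHom (src H (scalars 𝕜)) (tgt H B (m + n)) =>
        y.susp (v (Fin.last n) : OnePoint ℝ)) (ih (WithLp.toLp 2 fun i => v i.castSucc))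

lemma AsyClass.ofHom_iter (α : GHom (src H (scalars 𝕜)) (tgt H B m)) (n : ℕ) (v : OnePoint (Euc n)) :
    ofHom (α.iter n v) = (ofHom α).iter n v := by
  induction v using OnePoint.rec with
  | infty => exact ofHom_zero
  | coe v =>
    induction n with
    | zero => rfl
    | succ n ih =>
      refine (ofHom_susp (α.iter n ((WithLp.toLp 2 fun i => v i.castSucc : Euc n) :
        OnePoint (Euc n))) (v (Fin.last n) : OnePoint ℝ)).trans ?_
      rw [ih]
      rfl

/-- The iterated structure maps of the spectrum of homomorphisms in terms of the Bott maps of higher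
dimension. -/
lemma GHom.iter_eq {θ : GHom (Cliff 𝕜 n ⊗ᵍ tgt H B m) (tgt H B (m + n))}
    (hθ : ∀ d w, θ (d ⊗ₑ w) = (cliffAct H B (m + n)).r (Cliff.map 𝕜 (Euc.inr m n) d)
        (tgtIso H B (Euc.inl m n) w)) (α : GHom (src H (scalars 𝕜)) (tgt H B m))
    (v : OnePoint (Euc n)) :
    α.iter n v = (θ.comp ((bottPt 𝕜 v).tensor (GHom.id _))).comp
      (((GHom.id (funS 𝕜)).tensor α).comp (comultTensor H (scalars 𝕜))) := by
  refine AsyClass.ofHom_injective (AsyClass.hat_injective ?_)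
  rw [AsyClass.ofHom_iter, AsyClass.hat_iter hθ, AsyClass.hat_ofHom, AsyClass.hat_ofHom, suspend,
    ← GHom.comp_assoc (Q.left _ _), Q.left_comp_const]
  exact GHom.ext fun w => Q.map_const _ _

end

end GradedE

end

/-! ### Continuous families of homomorphisms -/

noncomputable section

namespace GradedE

universe u' v' w'

variable {𝕜 : Type} [RCLike 𝕜]

lemma continuous_tmul {A : GCAlg.{u} 𝕜} {B : GCAlg.{v} 𝕜} {P : Type w} [TopologicalSpace P]
    {a : P → A} {b : P → B} (ha : Continuous a) (hb : Continuous b) :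
    Continuous fun p => a p ⊗ₑ b p :=
  ((tmulL A B).mkContinuous₂ 1 fun a b => by
    rw [one_mul]; exact norm_tmul_le a b).continuous₂.comp (ha.prodMk hb)

namespace GHom

variable {A : GCAlg.{u} 𝕜} {B : GCAlg.{v} 𝕜} {C : GCAlg.{u'} 𝕜} {D : GCAlg.{v'} 𝕜}
  {P : Type w} [TopologicalSpace P]

/-- Pointwise continuity of a family of homomorphisms. -/
def StrongCont (f : P → GHom A B) : Prop := ∀ a, Continuous fun p => f p a

/-- Homomorphisms are contractions, so limits of elements on which a family is continuous are uniform
in the parameter. -/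
lemma isClosed_continuous (f : P → GHom A B) : IsClosed {a | Continuous fun p => f p a} := by
  rw [← isSeqClosed_iff_isClosed]
  intro a a₀ ha hlim
  refine (TendstoUniformly.continuous (F := fun n p => f p (a n)) (p := atTop) ?_
    (Frequently.of_forall ha))
  rw [Metric.tendstoUniformly_iff]
  intro ε hε
  filter_upwards [Metric.tendsto_nhds.1 hlim ε hε] with k hk p
  refine lt_of_le_of_lt ?_ hk
  rw [dist_comm, dist_eq_norm, dist_eq_norm, ← map_sub]
  exact (f p).norm_le _

lemma StrongCont.apply {f : P → GHom A B} (hf : StrongCont f) {a : P → A} (ha : Continuous a) :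
    Continuous fun p => f p (a p) := by
  rw [continuous_iff_continuousAt]
  intro p
  have h1 : Tendsto (fun p' => f p' (a p' - a p)) (𝓝 p) (𝓝 0) := by
    refine squeeze_zero_norm (fun p' => (f p').norm_le _) ?_
    have : Continuous fun p' => ‖a p' - a p‖ := by fun_prop
    simpa using this.tendsto p
  have h2 := h1.add ((hf (a p)).tendsto p)
  rw [zero_add] at h2
  refine h2.congr fun p' => ?_
  rw [← map_add, sub_add_cancel]

lemma StrongCont.const (f : GHom A B) : StrongCont fun _ : P => f := fun _ => continuous_const

lemma StrongCont.comp {g : P → GHom B C} {f : P → GHom A B} (hg : StrongCont g)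
    (hf : StrongCont f) : StrongCont fun p => (g p).comp (f p) := fun a => hg.apply (hf a)

lemma StrongCont.tensor {f : P → GHom A B} {g : P → GHom C D} (hf : StrongCont f)
    (hg : StrongCont g) : StrongCont fun p => (f p).tensor (g p) := by
  intro z
  induction z using tensor_ind with
  | closed => exact isClosed_continuous _
  | add x y hx hy => simp only [map_add]; exact hx.add hy
  | tmul i j a c ha hc =>
    simp only [GHom.tensor_tmul]
    exact continuous_tmul (hf a) (hg c)

/-- A pointwise continuous family of homomorphisms is continuous for the compact-open topology. -/
lemma StrongCont.continuous {f : P → GHom A B} (hf : StrongCont f) : Continuous f := by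
  rw [continuous_generateFrom_iff]
  rintro _ ⟨K, U, hK, hU, rfl⟩
  have h : Continuous fun z : P × A => f z.1 z.2 :=
    StrongCont.apply (P := P × A) (f := fun z => f z.1) (fun a => (hf a).comp continuous_fst)
      continuous_snd
  have h1 := (ContinuousMap.curry ⟨_, h⟩).continuous
  exact (ContinuousMap.isOpen_setOfPred_mapsTo hK hU).preimage h1

lemma strongCont_of_continuous {f : P → GHom A B} (hf : Continuous f) : StrongCont f := by
  intro a
  rw [continuous_def]
  intro U hU
  have h : IsOpen {f : GHom A B | Set.MapsTo f {a} U} :=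
    TopologicalSpace.isOpen_generateFrom_of_mem ⟨{a}, U, isCompact_singleton, hU, rfl⟩
  convert h.preimage hf using 1
  ext p
  simp

end GHom

namespace funC

variable {A : GCAlg.{u} 𝕜} {B : GCAlg.{v} 𝕜} {C : GCAlg.{u'} 𝕜} {D : GCAlg.{v'} 𝕜}
  {Y : Type w} [TopologicalSpace Y] [CompactSpace Y]
  {Y' : Type w'} [TopologicalSpace Y'] [CompactSpace Y']

/-- Evaluation at a point. -/
def ev (B : GCAlg.{v} 𝕜) (y : Y) : GHom (funC Y B) B where
  toHom :=
    { toFun := fun f : C(Y, B) => f y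
      map_smul' := fun _ _ => rfl
      map_zero' := rfl
      map_add' := fun _ _ => rfl
      map_mul' := fun _ _ => rfl
      map_star' := fun _ => rfl }
  map_grading _ := rfl
  norm_le f := ContinuousMap.norm_coe_le_norm (f : C(Y, B)) y

lemma ext {f g : funC Y B} (h : ∀ y, ev B y f = ev B y g) : f = g := ContinuousMap.ext h

lemma norm_le {f : funC Y B} {M : ℝ} (hM : 0 ≤ M) (h : ∀ y, ‖ev B y f‖ ≤ M) : ‖f‖ ≤ M :=
  (ContinuousMap.norm_le (f : C(Y, B)) hM).2 h

lemma continuous_ev (f : funC Y B) : Continuous fun y => ev B y f := ContinuousMap.continuous (f : C(Y, B))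

/-- The homomorphism to an algebra of functions defined by a family of homomorphisms. -/
def family (f : Y → GHom A B) (hf : GHom.StrongCont f) : GHom A (funC Y B) where
  toHom :=
    { toFun := fun a => (⟨fun y => f y a, hf a⟩ : C(Y, B))
      map_smul' := fun r a => ContinuousMap.ext fun y => map_smul (f y).toHom r a
      map_zero' := ContinuousMap.ext fun y => map_zero (f y).toHom
      map_add' := fun a b => ContinuousMap.ext fun y => map_add (f y).toHom a b
      map_mul' := fun a b => ContinuousMap.ext fun y => map_mul (f y).toHom a b
      map_star' := fun a => ContinuousMap.ext fun y => map_star (f y).toHom a }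
  map_grading a := ContinuousMap.ext fun y => (f y).map_grading a
  norm_le a := (ContinuousMap.norm_le _ (norm_nonneg a)).2 fun y => (f y).norm_le a

lemma ev_family (f : Y → GHom A B) (hf : GHom.StrongCont f) (y : Y) :
    (ev B y).comp (family f hf) = f y := rfl

lemma strongCont_ev : GHom.StrongCont (ev B : Y → GHom (funC Y B) B) := continuous_ev

/-- Composition with a continuous map. -/
def pullback (B : GCAlg.{v} 𝕜) (q : Y' → Y) (hq : Continuous q) : GHom (funC Y B) (funC Y' B) :=
  family (fun y => ev B (q y)) fun f => (continuous_ev f).comp hq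

/-- Constant functions. -/
def const (Y : Type w) [TopologicalSpace Y] [CompactSpace Y] (B : GCAlg.{v} 𝕜) : GHom B (funC Y B) :=
  family (fun _ => GHom.id B) (GHom.StrongCont.const _)

lemma ev_const (y : Y) (b : B) : ev B y (const Y B b) = b := rfl

/-- The value of a scalar function. -/
def val (φ : funC Y (scalars 𝕜)) (y : Y) : 𝕜 := ev (scalars 𝕜) y φ

/-- The pointwise product of a scalar function and a function. -/
def smul (φ : C(Y, 𝕜)) (f : C(Y, B)) : C(Y, B) := ⟨fun y => φ y • f y, φ.continuous.smul f.continuous⟩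

/-- The pointwise action of scalar functions. -/
def act (Y : Type w) [TopologicalSpace Y] [CompactSpace Y] (B : GCAlg.{v} 𝕜) :
    GAct (funC Y (scalars 𝕜)) (funC Y B) where
  r := LinearMap.mk₂ 𝕜 (fun φ f => (smul (B := B) φ f : funC Y B))
    (fun φ φ' f => ext fun y => add_smul (val φ y) (val φ' y) (ev B y f))
    (fun r φ f => ext fun y => smul_assoc r (val φ y) (ev B y f))
    (fun φ f g => ext fun y => smul_add (val φ y) (ev B y f) (ev B y g))
    (fun r φ f => ext fun y => smul_comm (val φ y) r (ev B y f))
  mul φ ψ f := ext fun y => mul_smul (val φ y) (val ψ y) (ev B y f)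
  adj φ f g := ext fun y => by
    change star ((val φ y) • ev B y f) * ev B y g =
      star (ev B y f) * (star (val φ y) • ev B y g)
    rw [star_smul, smul_mul_assoc, mul_smul_comm]
  grading φ f := ext fun y => (map_smul B.grading (val φ y) (ev B y f)).symm

lemma ev_act (φ : funC Y (scalars 𝕜)) (f : funC Y B) (y : Y) :
    ev B y ((act Y B).r φ f) = val φ y • ev B y f := rfl

/-- Scalar functions are even. -/
lemma eq_zero_of_homog_odd {φ : funC Y (scalars 𝕜)} {i : ℕ} (hi : Odd i)
    (hφ : (funC Y (scalars 𝕜)).Homog i φ) : φ = 0 := by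
  have h : φ = (-1 : 𝕜) ^ i • φ := hφ
  rw [hi.neg_one_pow, neg_one_smul] at h
  have h2 : (2 : 𝕜) • φ = 0 := by rw [two_smul]; nth_rw 2 [h]; exact add_neg_cancel φ
  exact (smul_eq_zero.1 h2).resolve_left two_ne_zero

end funC

end GradedE

end

/-! ### Composition with varying homomorphisms -/

noncomputable section

namespace GradedE

universe u' v' w'

variable {𝕜 : Type} [RCLike 𝕜]

namespace funC

variable {A : GCAlg.{u} 𝕜} {B : GCAlg.{v} 𝕜} {Y : Type w} [TopologicalSpace Y] [CompactSpace Y]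

/-- Restriction to a compact subset. -/
def res (B : GCAlg.{v} 𝕜) (K : TopologicalSpace.Compacts Y) : GHom (funC Y B) (funC K B) :=
  pullback B (fun y : K => (y : Y)) continuous_subtype_val

/-- The norm of a class of paths of functions can be computed on a finite cover. -/
lemma norm_le_of_cover {ι : Type*} [Finite ι] (K : ι → TopologicalSpace.Compacts Y)
    (hK : ∀ y, ∃ i, y ∈ K i) {z : Q (funC Y B)} {M : ℝ} (hM : 0 ≤ M)
    (h : ∀ i, ‖Q.map (res B (K i)) z‖ ≤ M) : ‖z‖ ≤ M := by
  induction z using Q.ind with | h f => ?_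
  simp only [Q.map_of, Q.norm_of] at h ⊢
  refine le_of_forall_pos_le_add fun ε hε => Ray.lim_le (by positivity) ?_
  have h1 := eventually_all.2 fun i =>
    Ray.eventually_le _ ((h i).trans_lt (lt_add_of_pos_right M hε))
  filter_upwards [h1] with t ht
  refine norm_le (by positivity) fun y => ?_
  obtain ⟨i, hi⟩ := hK y
  exact (ContinuousMap.norm_coe_le_norm (res B (K i) (f t) : C(K i, B)) ⟨y, hi⟩).trans (ht i)

/-- The pointwise product of scalar functions and functions from a homomorphism to a path algebra. The
scalar functions are central and even, so no sign arises. -/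
lemma exists_scalar_mul (γ : GHom A (Q (funC Y B))) :
    ∃ F : GHom (funC Y (scalars 𝕜) ⊗ᵍ A) (Q (funC Y B)), ∀ φ a,
      F (φ ⊗ₑ a) = (act Y B).paths.r φ (γ a) := by
  refine GHom.exists_lift_act _ γ fun i j φ a x hφ ha => ?_
  rcases Nat.even_or_odd i with hi | hi
  · rw [(hi.mul_right j).neg_one_pow, one_smul]
    change (act Y B).paths.r φ (γ a * x) = γ a * (act Y B).paths.r φ x
    generalize γ a = y
    induction x using Q.ind with | h f => ?_
    induction y using Q.ind with | h g => ?_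
    rw [GAct.paths_of, ← map_mul, ← map_mul, GAct.paths_of]
    congr 1; ext t
    exact ContinuousMap.ext fun y => (mul_smul_comm (val φ y) (ev B y (g t)) (ev B y (f t))).symm
  · simp only [eq_zero_of_homog_odd hi hφ, map_zero, LinearMap.zero_apply, smul_zero]

/-- The functions `φ · a` in `C(Y, A)`, as the image of `C(Y) ⊗ A`. -/
lemma exists_scalar_mul_const (Y : Type w) [TopologicalSpace Y] [CompactSpace Y] (A : GCAlg.{u} 𝕜) :
    ∃ F : GHom (funC Y (scalars 𝕜) ⊗ᵍ A) (funC Y A), ∀ φ a,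
      F (φ ⊗ₑ a) = (act Y A).r φ (const Y A a) := by
  refine GHom.exists_lift_act _ (const Y A) fun i j φ a x hφ ha => ?_
  rcases Nat.even_or_odd i with hi | hi
  · rw [(hi.mul_right j).neg_one_pow, one_smul]
    exact ContinuousMap.ext fun y => (mul_smul_comm (val φ y) a (ev A y x)).symm
  · simp only [eq_zero_of_homog_odd hi hφ, map_zero, LinearMap.zero_apply, smul_zero]

/-- The functions `φ · a` span a dense subspace, by partitions of unity. -/
lemma denseRange_scalar_mul [T2Space Y] {J : GHom (funC Y (scalars 𝕜) ⊗ᵍ A) (funC Y A)}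
    (hJ : ∀ φ a, J (φ ⊗ₑ a) = (act Y A).r φ (const Y A a)) : DenseRange J := by
  intro h
  rw [Metric.mem_closure_iff]
  intro ε hε
  have hU : ∀ y : Y, IsOpen {x | ‖ev A x h - ev A y h‖ < ε / 2} := fun y =>
    isOpen_lt ((continuous_ev h).sub continuous_const).norm continuous_const
  obtain ⟨s, hs⟩ := isCompact_univ.elim_finite_subcover
    (fun y : Y => {x | ‖ev A x h - ev A y h‖ < ε / 2}) hU
    (fun x _ => Set.mem_iUnion.2 ⟨x, by simpa using half_pos hε⟩)
  let e := s.equivFin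
  obtain ⟨f, hf, hsum, hf01, -⟩ := exists_continuous_sum_one_of_isOpen_isCompact (n := s.card)
    (s := fun i => {x | ‖ev A x h - ev A (e.symm i : Y) h‖ < ε / 2}) (fun i => hU _)
    isCompact_univ (fun x hx => by
      obtain ⟨y, hy, hxy⟩ := Set.mem_iUnion₂.1 (hs hx)
      refine Set.mem_iUnion.2 ⟨e ⟨y, hy⟩, ?_⟩
      rw [Equiv.symm_apply_apply]
      exact hxy)
  let φ : Fin s.card → funC Y (scalars 𝕜) := fun i =>
    (⟨fun y => ((f i y : ℝ) : 𝕜), RCLike.continuous_ofReal.comp (f i).continuous⟩ : C(Y, 𝕜))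
  let x : (funC Y (scalars 𝕜) ⊗ᵍ A : GCAlg 𝕜) := ∑ i, φ i ⊗ₑ ev A (e.symm i : Y) h
  refine ⟨J x, ⟨x, rfl⟩, lt_of_le_of_lt ?_ (half_lt_self hε)⟩
  rw [dist_eq_norm]
  refine norm_le (half_pos hε).le fun y => ?_
  have e1 : ev A y (J x) = ∑ i, ((f i y : ℝ) : 𝕜) • ev A (e.symm i : Y) h := by
    rw [map_sum, map_sum]
    refine Finset.sum_congr rfl fun i _ => ?_
    rw [hJ]
    rfl
  have hone : ∑ i, f i y = 1 := by
    have := hsum (Set.mem_univ y)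
    simpa using this
  have e2 : ev A y h = ∑ i, ((f i y : ℝ) : 𝕜) • ev A y h := by
    rw [← Finset.sum_smul, ← RCLike.ofReal_sum, hone, RCLike.ofReal_one, one_smul]
  rw [map_sub, e1, e2, ← Finset.sum_sub_distrib]
  calc _ ≤ ∑ i, f i y * (ε / 2) := by
        refine norm_sum_le_of_le _ fun i _ => ?_
        rw [← smul_sub, norm_smul, RCLike.norm_ofReal, abs_of_nonneg (hf01 i y).1]
        rcases (hf01 i y).1.eq_or_lt with h0 | h0
        · rw [← h0, zero_mul, zero_mul]
        · refine mul_le_mul_of_nonneg_left (le_of_lt ?_) h0.le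
          exact hf i (subset_tsupport _ h0.ne')
    _ = ε / 2 := by rw [← Finset.sum_mul, hone, one_mul]

lemma map_ev_act (φ : funC Y (scalars 𝕜)) (z : Q (funC Y B)) (y : Y) :
    Q.map (ev B y) ((act Y B).paths.r φ z) = val φ y • Q.map (ev B y) z := by
  induction z using Q.ind with | h f => ?_
  rw [GAct.paths_of, Q.map_of, Q.map_of, ← map_smul]
  rfl

/-- Near a point, the product `φ · γ(a)` is close to `φ(y) γ(a)`. -/
lemma exists_nhds_near {γ : GHom A (Q (funC Y B))} {F : GHom (funC Y (scalars 𝕜) ⊗ᵍ A) (Q (funC Y B))}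
    (hF : ∀ φ a, F (φ ⊗ₑ a) = (act Y B).paths.r φ (γ a))
    {J : GHom (funC Y (scalars 𝕜) ⊗ᵍ A) (funC Y A)}
    (hJ : ∀ φ a, J (φ ⊗ₑ a) = (act Y A).r φ (const Y A a))
    (y : Y) (x : (funC Y (scalars 𝕜) ⊗ᵍ A : GCAlg 𝕜)) {ε : ℝ} (hε : 0 < ε) :
    ∃ U ∈ 𝓝 y, ∀ K : TopologicalSpace.Compacts Y, (K : Set Y) ⊆ U →
      ‖Q.map (res B K) (F x - γ (ev A y (J x)))‖ ≤ ε := by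
  induction x using tensor_ind generalizing ε with
  | closed =>
    rw [← isSeqClosed_iff_isClosed]
    intro x x₀ hx hlim ε hε
    obtain ⟨n, hn⟩ := (Metric.tendsto_nhds.1 hlim (ε / 4) (by positivity)).exists
    obtain ⟨U, hU, h⟩ := hx n (half_pos hε)
    refine ⟨U, hU, fun K hK => ?_⟩
    -- `x₀` is replaced by a nearby member of the sequence; all maps are contractions.
    have e : F x₀ - γ (ev A y (J x₀)) = (F (x n) - γ (ev A y (J (x n)))) +
        (F (x₀ - x n) - γ (ev A y (J (x₀ - x n)))) := by
      simp only [map_sub]; abel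
    rw [dist_comm, dist_eq_norm] at hn
    rw [e, map_add]
    have h1 : ‖F (x₀ - x n) - γ (ev A y (J (x₀ - x n)))‖ ≤ ε / 4 + ε / 4 :=
      (norm_sub_le _ _).trans (add_le_add ((F.norm_le _).trans hn.le)
        ((γ.norm_le _).trans (((ev A y).norm_le _).trans ((J.norm_le _).trans hn.le))))
    have h2 := (Q.map (res B K)).norm_le (F (x₀ - x n) - γ (ev A y (J (x₀ - x n))))
    refine (norm_add_le _ _).trans ?_
    linarith [h K hK]
  | add x x' h h' =>
    obtain ⟨U, hU, h⟩ := h (half_pos hε)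
    obtain ⟨U', hU', h'⟩ := h' (half_pos hε)
    refine ⟨U ∩ U', inter_mem hU hU', fun K hK => ?_⟩
    have e : F (x + x') - γ (ev A y (J (x + x'))) =
        (F x - γ (ev A y (J x))) + (F x' - γ (ev A y (J x'))) := by
      simp only [map_add]; abel
    rw [e, map_add]
    refine (norm_add_le _ _).trans ?_
    linarith [h K (hK.trans Set.inter_subset_left), h' K (hK.trans Set.inter_subset_right)]
  | tmul i j φ a hφ ha =>
    -- On `U` the function `φ` is close to the constant function `c = φ(y)`.
    have hδ : 0 < ε / (‖a‖ + 1) := by positivity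
    let c : funC Y (scalars 𝕜) := const Y (scalars 𝕜) (ev _ y φ)
    refine ⟨{x | ‖val φ x - val φ y‖ < ε / (‖a‖ + 1)},
      (isOpen_lt ((continuous_ev φ).sub continuous_const).norm continuous_const).mem_nhds
        (by change ‖val φ y - val φ y‖ < _; rwa [sub_self, norm_zero]), fun K hK => ?_⟩
    have e1 : ev A y (J (φ ⊗ₑ a)) = val φ y • a := by rw [hJ]; rfl
    have e2 : val φ y • γ a = (act Y B).paths.r c (γ a) := by
      generalize γ a = z
      induction z using Q.ind with | h f => ?_
      rw [GAct.paths_of, ← map_smul]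
      rfl
    have e3 : ∀ ψ z, Q.map (res B K) ((act Y B).paths.r ψ z) =
        (act K B).paths.r (res _ K ψ) (Q.map (res B K) z) := fun ψ z =>
      Q.map_act (ρ' := (act K B).comp (res _ K)) (fun f => rfl) z
    rw [hF, e1, map_smul, e2, ← LinearMap.sub_apply, ← map_sub, e3]
    refine ((act K B).paths.norm_le _ _).trans ?_
    have h1 : ‖res (scalars 𝕜) K (φ - c)‖ ≤ ε / (‖a‖ + 1) :=
      norm_le hδ.le fun x => (hK x.2).le
    have h2 : ‖Q.map (res B K) (γ a)‖ ≤ ‖a‖ := ((Q.map _).norm_le _).trans (γ.norm_le a)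
    calc _ ≤ ε / (‖a‖ + 1) * ‖a‖ := mul_le_mul h1 h2 (norm_nonneg _) hδ.le
      _ ≤ ε := by
        rw [div_mul_eq_mul_div, div_le_iff₀ (by positivity)]
        nlinarith [norm_nonneg a]

/-- A homomorphism from `A` to the paths in `C(Y, B)` extends to `C(Y, A)`: functions are locally
close to constants, and the norm of paths in `C(Y, B)` is the maximum of the norms on the members of
a finite closed cover. -/
lemma exists_extension [T2Space Y] (γ : GHom A (Q (funC Y B))) :
    ∃ Γ : GHom (funC Y A) (Q (funC Y B)), ∀ f y,
      Q.map (ev B y) (Γ f) = Q.map (ev B y) (γ (ev A y f)) := by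
  obtain ⟨F, hF⟩ := exists_scalar_mul γ
  obtain ⟨J, hJ⟩ := exists_scalar_mul_const Y A
  -- On a small neighbourhood `K` of `y`, `F x` is within `ε` of `γ (J x (y))`.
  have hle : ∀ x, ‖F x‖ ≤ 1 * ‖J x‖ := by
    intro x
    rw [one_mul]
    refine le_of_forall_pos_le_add fun ε hε => ?_
    choose U hU hUK using fun y => exists_nhds_near hF hJ y x hε
    choose K hK hKU hKc using fun y => local_compact_nhds (hU y)
    obtain ⟨s, hs⟩ := isCompact_univ.elim_nhds_subcover K fun y _ => hK y
    refine norm_le_of_cover (ι := s) (fun y => (⟨K y, hKc y⟩ : TopologicalSpace.Compacts Y))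
      (fun x => ?_) (by positivity) fun y => ?_
    · obtain ⟨y, hy, hxy⟩ := Set.mem_iUnion₂.1 (hs.2 (Set.mem_univ x))
      exact ⟨⟨y, hy⟩, hxy⟩
    · have h1 := hUK y ⟨K y, hKc y⟩ (hKU y)
      rw [map_sub] at h1
      have h2 : ‖Q.map (res B ⟨K y, hKc y⟩) (γ (ev A (y : Y) (J x)))‖ ≤ ‖J x‖ :=
        ((Q.map _).norm_le _).trans ((γ.norm_le _).trans ((ev A (y : Y)).norm_le _))
      have h3 := norm_sub_norm_le (Q.map (res B ⟨K y, hKc y⟩) (F x))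
        (Q.map (res B ⟨K y, hKc y⟩) (γ (ev A (y : Y) (J x))))
      linarith
  obtain ⟨Γ, hΓ⟩ := GHom.exists_extend J.toHom F.toHom (denseRange_scalar_mul hJ) 1 hle
    (funC Y (scalars 𝕜) ⊗ᵍ A : GCAlg 𝕜).grading J.map_grading F.map_grading
  refine ⟨Γ, fun f y => ?_⟩
  refine (denseRange_scalar_mul hJ).induction_on (p := fun f =>
    Q.map (ev B y) (Γ f) = Q.map (ev B y) (γ (ev A y f))) f
    (isClosed_eq ((Q.map (ev B y)).continuous.comp Γ.continuous)
      ((Q.map (ev B y)).continuous.comp (γ.continuous.comp (ev A y).continuous))) fun x => ?_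
  rw [hΓ]
  induction x using tensor_ind with
  | closed =>
    exact isClosed_eq ((Q.map (ev B y)).continuous.comp F.continuous)
      ((Q.map (ev B y)).continuous.comp (γ.continuous.comp ((ev A y).continuous.comp J.continuous)))
  | add x x' h h' => rw [map_add, map_add, h, h', map_add, map_add, map_add, map_add]
  | tmul i j φ a _ _ =>
    rw [hF, map_ev_act, hJ, ev_act, ev_const, map_smul, map_smul]

end funC

end GradedE

end

/-! ### Quasi-continuity -/

noncomputable section

namespace GradedE

universe u' v' w'

namespace QTop

variable {X : Type u} {Y : Type v} {P : Type u'} [TopologicalSpace P]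

/-- Joint quasi-continuity on a generated quasi-topology can be tested on the generating families, if
these contain the constant families and are closed under composition with continuous maps. -/
lemma qcont₂_generate
    {S : ∀ (C : Type w) [TopologicalSpace C] [CompactSpace C] [T2Space C], Set (C → X)}
    {TY : QTop.{v, w} Y} {f : P → X → Y}
    (hconst : ∀ (C : Type w) [TopologicalSpace C] [CompactSpace C] [T2Space C] (x : X),
      (fun _ => x) ∈ S C)
    (hcomp : ∀ (C D : Type w) [TopologicalSpace C] [CompactSpace C] [T2Space C]
      [TopologicalSpace D] [CompactSpace D] [T2Space D] (g : C → D) (k : D → X),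
      Continuous g → k ∈ S D → k ∘ g ∈ S C)
    (hS : ∀ (C : Type w) [TopologicalSpace C] [CompactSpace C] [T2Space C] (p : C → P) (k : C → X),
      Continuous p → k ∈ S C → (fun c => f (p c) (k c)) ∈ TY.Q C) :
    QCont₂ (generate S) TY f := by
  let T : QTop.{u, w} X :=
    { Q := fun C _ _ _ => {k | ∀ (C' : Type w) [TopologicalSpace C'] [CompactSpace C'] [T2Space C']
        (g : C' → C) (p : C' → P), Continuous g → Continuous p →
          (fun c => f (p c) (k (g c))) ∈ TY.Q C'}
      const := fun C _ _ _ x C' _ _ _ g p hg hp => hS C' p _ hp (hconst C' x)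
      comp := fun g k hg hk C' _ _ _ g' p hg' hp => hk C' (g ∘ g') p (hg.comp hg') hp
      sum := fun {C D} _ _ _ _ _ _ k => by
        refine ⟨fun hk => ⟨fun C' _ _ _ g p hg hp => hk C' (Sum.inl ∘ g) p (continuous_inl.comp hg) hp,
          fun C' _ _ _ g p hg hp => hk C' (Sum.inr ∘ g) p (continuous_inr.comp hg) hp⟩, ?_⟩
        rintro ⟨h1, h2⟩ C' _ _ _ g p hg hp
        -- decompose the parameter space into the preimages of the two summands
        let U : Set C' := g ⁻¹' Set.range Sum.inl
        let V : Set C' := g ⁻¹' Set.range Sum.inr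
        have hU : CompactSpace U := isCompact_iff_compactSpace.1
          (isClosed_range_inl.preimage hg).isCompact
        have hV : CompactSpace V := isCompact_iff_compactSpace.1
          (isClosed_range_inr.preimage hg).isCompact
        have hj : Continuous (Sum.elim (fun c : U => (c : C')) fun c : V => (c : C')) :=
          continuous_subtype_val.sumElim continuous_subtype_val
        refine TY.surj (Sum.elim (fun c : U => (c : C')) fun c : V => (c : C')) _ hj (fun c => ?_) ?_
        · rcases hc : g c with d | d
          · exact ⟨Sum.inl ⟨c, d, hc.symm⟩, rfl⟩
          · exact ⟨Sum.inr ⟨c, d, hc.symm⟩, rfl⟩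
        · refine (TY.sum _).2 ⟨?_, ?_⟩
          · have hgU : ∀ c : U, ∃ d : C, Sum.inl d = g c := fun c => c.2
            choose d hd using hgU
            have hdc : Continuous d := by
              rw [(Topology.IsEmbedding.inl (X := C) (Y := D)).continuous_iff]
              exact (hg.comp continuous_subtype_val).congr fun c => (hd c).symm
            convert h1 U d (fun c => p c) hdc (hp.comp continuous_subtype_val) using 1
            funext c
            change f (p c) (k (g c)) = f (p c) (k (Sum.inl (d c)))
            rw [hd]
          · have hgV : ∀ c : V, ∃ d : D, Sum.inr d = g c := fun c => c.2
            choose d hd using hgV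
            have hdc : Continuous d := by
              rw [(Topology.IsEmbedding.inr (X := C) (Y := D)).continuous_iff]
              exact (hg.comp continuous_subtype_val).congr fun c => (hd c).symm
            convert h2 V d (fun c => p c) hdc (hp.comp continuous_subtype_val) using 1
            funext c
            change f (p c) (k (g c)) = f (p c) (k (Sum.inr (d c)))
            rw [hd]
      surj := fun {C D} _ _ _ _ _ _ q k hq hs hk C' _ _ _ g p hg hp => by
        -- pull the surjection back to the parameter space
        let E : Set (C × C') := {z | q z.1 = g z.2}
        have hE : CompactSpace E := isCompact_iff_compactSpace.1
          (isClosed_eq (hq.comp continuous_fst) (hg.comp continuous_snd)).isCompact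
        refine TY.surj (fun z : E => z.1.2) _ (continuous_snd.comp continuous_subtype_val)
          (fun c => ?_) ?_
        · obtain ⟨d, hd⟩ := hs (g c)
          exact ⟨⟨(d, c), hd⟩, rfl⟩
        · convert hk E (fun z => z.1.1) (fun z => p z.1.2)
            (continuous_fst.comp continuous_subtype_val)
            (hp.comp (continuous_snd.comp continuous_subtype_val)) using 1
          funext z
          change f (p z.1.2) (k (g z.1.2)) = f (p z.1.2) (k (q z.1.1))
          rw [show q z.1.1 = g z.1.2 from z.2] }
  intro C _ _ _ p k hp hk
  exact hk T (fun D _ _ _ k hk C' _ _ _ g p hg hp =>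
    hS C' p (k ∘ g) hp (hcomp C' D g k hg hk)) C id p continuous_id hp

/-- A map on a generated quasi-topology is quasi-continuous if it maps generating families to
quasi-continuous families. -/
lemma qcont_generate
    {S : ∀ (C : Type w) [TopologicalSpace C] [CompactSpace C] [T2Space C], Set (C → X)}
    {TY : QTop.{v, w} Y} {f : X → Y}
    (hS : ∀ (C : Type w) [TopologicalSpace C] [CompactSpace C] [T2Space C] (k : C → X),
      k ∈ S C → f ∘ k ∈ TY.Q C) : QCont (generate S) TY f := by
  let T : QTop.{u, w} X :=
    { Q := fun C _ _ _ => {k | f ∘ k ∈ TY.Q C}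
      const := fun C _ _ _ x => TY.const C (f x)
      comp := fun g k hg hk => TY.comp g (f ∘ k) hg hk
      sum := fun k => TY.sum (f ∘ k)
      surj := fun g k hg hs hk => TY.surj g (f ∘ k) hg hs hk }
  intro C _ _ _ k hk
  exact hk T fun D _ _ _ k hk => hS D k hk

end QTop

variable {𝕜 : Type} [RCLike 𝕜]

namespace AsyClass

variable {A : GCAlg.{u} 𝕜} {B : GCAlg.{v} 𝕜} {C : GCAlg.{u'} 𝕜} {Y : Type w} [TopologicalSpace Y]
  [CompactSpace Y]

/-- Families of classes represented by an asymptotic morphism to an algebra of functions. -/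
def IsFamily (x : Y → AsyClass A B) : Prop := ∃ Φ : Asy A (funC Y B), x = fun y => mk (Φ.eval y)

/-- A family over `Y` is represented by an asymptotic morphism to `C(Y, B)` if and only if it comes from
a homomorphism to `Q (C(Y, B))`. -/
lemma isFamily_iff {x : Y → AsyClass A B} :
    IsFamily x ↔ ∃ γ : GHom A (Q (funC Y B)), ∀ y a, (x y).hat a = Q.map (funC.ev B y) (γ a) := by
  have key : ∀ (Φ : Asy A (funC Y B)) y, (mk (Φ.eval y)).hat = (Q.map (funC.ev B y)).comp Φ.hat :=
    fun Φ y => hat_homComp (funC.ev B y) (mk Φ)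
  constructor
  · rintro ⟨Φ, rfl⟩
    refine ⟨Φ.hat, fun y a => ?_⟩
    rw [key]; rfl
  · rintro ⟨γ, h⟩
    obtain ⟨Φ, rfl⟩ := Asy.exists_hat γ
    exact ⟨Φ, funext fun y => hat_injective (GHom.ext fun a => (h y a).trans (by rw [key]; rfl))⟩

lemma isFamily_const (x : AsyClass A B) : IsFamily fun _ : Y => x :=
  isFamily_iff.2 ⟨(Q.map (funC.const Y B)).comp x.hat, fun y a => by
    rw [GHom.comp_apply, Q.map_map]
    exact (Q.map_id _).symm⟩

lemma IsFamily.pullback {Y' : Type w'} [TopologicalSpace Y'] [CompactSpace Y'] {x : Y → AsyClass A B}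
    (hx : IsFamily x) {q : Y' → Y} (hq : Continuous q) : IsFamily (x ∘ q) := by
  obtain ⟨γ, h⟩ := isFamily_iff.1 hx
  refine isFamily_iff.2 ⟨(Q.map (funC.pullback B q hq)).comp γ, fun y a => ?_⟩
  rw [GHom.comp_apply, Q.map_map]
  exact h (q y) a

lemma IsFamily.homComp {x : Y → AsyClass A B} (hx : IsFamily x) {g : Y → GHom B C}
    (hg : GHom.StrongCont g) : IsFamily fun y => (x y).homComp (g y) := by
  obtain ⟨γ, h⟩ := isFamily_iff.1 hx
  refine isFamily_iff.2 ⟨(Q.map (funC.family _ (hg.comp funC.strongCont_ev))).comp γ, fun y a => ?_⟩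
  rw [GHom.comp_apply, Q.map_map, hat_homComp, GHom.comp_apply, h, Q.map_map]
  rfl

/-- Composition with a varying homomorphism `f y` of the source: the extension of `γ` to `C(Y, A)` is
applied to the function `y ↦ f y a`. -/
lemma IsFamily.compHom [T2Space Y] {x : Y → AsyClass A B} (hx : IsFamily x) {f : Y → GHom C A}
    (hf : GHom.StrongCont f) : IsFamily fun y => (x y).compHom (f y) := by
  obtain ⟨γ, h⟩ := isFamily_iff.1 hx
  obtain ⟨Γ, hΓ⟩ := funC.exists_extension γ
  refine isFamily_iff.2 ⟨Γ.comp (funC.family f hf), fun y a => ?_⟩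
  rw [GHom.comp_apply, hΓ, hat_compHom, GHom.comp_apply, h]
  rfl

lemma IsFamily.leftTensor {D : GCAlg.{v'} 𝕜} {x : Y → AsyClass A B} (hx : IsFamily x) :
    IsFamily fun y => (x y).leftTensor D := by
  obtain ⟨γ, h⟩ := isFamily_iff.1 hx
  have hs : GHom.StrongCont fun y : Y => (GHom.id D).tensor (funC.ev B y) :=
    (GHom.StrongCont.const _).tensor funC.strongCont_ev
  refine isFamily_iff.2 ⟨(Q.map (funC.family _ hs)).comp ((Q.left D (funC Y B)).comp
    ((GHom.id D).tensor γ)), fun y z => ?_⟩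
  have e : ∀ d w, Q.map ((GHom.id D).tensor (funC.ev B y)) (Q.left D (funC Y B) (d ⊗ₑ w)) =
      Q.left D B (d ⊗ₑ Q.map (funC.ev B y) w) := fun d w => by
    induction w using Q.ind with | h f => ?_
    rw [Q.left_tmul, Q.map_of, Q.map_of, Q.left_tmul]
    congr 1; ext t; exact GHom.tensor_tmul _ _ _ _
  rw [hat_leftTensor, GHom.comp_apply, GHom.comp_apply, GHom.comp_apply, Q.map_map, funC.ev_family]
  induction z using tensor_ind with
  | closed =>
    exact isClosed_eq (GHom.continuous ((Q.left D B).comp ((GHom.id D).tensor (x y).hat)))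
      (GHom.continuous ((Q.map ((GHom.id D).tensor (funC.ev B y))).comp
        ((Q.left D (funC Y B)).comp ((GHom.id D).tensor γ))))
  | add z z' hz hz' => simp only [map_add, hz, hz']
  | tmul i j d a _ _ => rw [GHom.tensor_tmul, GHom.tensor_tmul, e, h]

lemma IsFamily.rightTensor {D : GCAlg.{v'} 𝕜} {x : Y → AsyClass A B} (hx : IsFamily x) :
    IsFamily fun y => (x y).rightTensor D := by
  obtain ⟨γ, h⟩ := isFamily_iff.1 hx
  have hs : GHom.StrongCont fun y : Y => (funC.ev B y).tensor (GHom.id D) :=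
    funC.strongCont_ev.tensor (GHom.StrongCont.const _)
  refine isFamily_iff.2 ⟨(Q.map (funC.family _ hs)).comp ((Q.right (funC Y B) D).comp
    (γ.tensor (GHom.id D))), fun y z => ?_⟩
  have e : ∀ w d, Q.map ((funC.ev B y).tensor (GHom.id D)) (Q.right (funC Y B) D (w ⊗ₑ d)) =
      Q.right B D (Q.map (funC.ev B y) w ⊗ₑ d) := fun w d => by
    induction w using Q.ind with | h f => ?_
    rw [Q.right_tmul, Q.map_of, Q.map_of, Q.right_tmul]
    congr 1; ext t; exact GHom.tensor_tmul _ _ _ _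
  rw [hat_rightTensor, GHom.comp_apply, GHom.comp_apply, GHom.comp_apply, Q.map_map, funC.ev_family]
  induction z using tensor_ind with
  | closed =>
    exact isClosed_eq
      (GHom.continuous ((Q.right B D).comp ((x y).hat.tensor (GHom.id D))))
      (GHom.continuous ((Q.map ((funC.ev B y).tensor (GHom.id D))).comp
        ((Q.right (funC Y B) D).comp (γ.tensor (GHom.id D)))))
  | add z z' hz hz' => simp only [map_add, hz, hz']
  | tmul i j a d _ _ => rw [GHom.tensor_tmul, GHom.tensor_tmul, e, h]

/-- Joint quasi-continuity on spaces of asymptotic morphisms can be tested on families of asymptotic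
morphisms. -/
lemma qcont₂_qtop {P : Type u'} [TopologicalSpace P] {Z : Type v'} {TZ : QTop.{v', w} Z}
    {f : P → AsyClass A B → Z}
    (h : ∀ (C : Type w) [TopologicalSpace C] [CompactSpace C] [T2Space C] (p : C → P)
      (x : C → AsyClass A B), Continuous p → IsFamily x → (fun c => f (p c) (x c)) ∈ TZ.Q C) :
    QTop.QCont₂ (qtop A B) TZ f :=
  QTop.qcont₂_generate (fun _ _ _ _ x => isFamily_const x)
    (fun _ _ _ _ _ _ _ _ _ _ hg hk => IsFamily.pullback hk hg) h

lemma IsFamily.mem_qtop {C : Type w} [TopologicalSpace C] [CompactSpace C] [T2Space C]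
    {x : C → AsyClass A B} (hx : IsFamily x) : x ∈ (qtop.{u, v, w} A B).Q C :=
  fun _ hT => hT C hx

end AsyClass

end GradedE

end

/-! ### The spectra are orthogonal quasi-spectra -/

noncomputable section

namespace GradedE

universe u' v' w'

variable {𝕜 : Type} [RCLike 𝕜]

section

variable {H : GradedHilbert.{u'} 𝕜} {A : GCAlg.{u} 𝕜} {B : GCAlg.{v} 𝕜} {k l m n : ℕ}
  {P : Type v'} [TopologicalSpace P]

lemma GHom.StrongCont.comp_continuous {f : P → GHom A B} (hf : StrongCont f) {Y : Type w'}
    [TopologicalSpace Y] {q : Y → P} (hq : Continuous q) : StrongCont fun y => f (q y) :=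
  fun a => (hf a).comp hq

lemma O.continuous_isom (v : Euc n) : Continuous fun a : O n => O.isom a v := by
  have h : ∀ i j, Continuous fun a : O n => a.1 i j := fun i j =>
    (continuous_subtype_val (p := fun M : Matrix (Fin n) (Fin n) ℝ =>
      M ∈ Matrix.orthogonalGroup (Fin n) ℝ)).matrix_elem i j
  have h' : Continuous fun (a : O n) i => ∑ j, a.1 i j * v j := continuous_pi fun i =>
    continuous_finsetSum _ fun j _ => (h i j).mul continuous_const
  exact (PiLp.continuous_toLp 2 fun _ : Fin n => ℝ).comp h'

lemma strongCont_cliffMap {T : P → Euc m →ₗᵢ[ℝ] Euc n} (hT : ∀ v, Continuous fun p => T p v) :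
    GHom.StrongCont fun p => Cliff.map 𝕜 (T p) := by
  intro c
  induction c using Cliff.ind with
  | closed => exact GHom.isClosed_continuous _
  | add a b ha hb => simp only [map_add]; exact ha.add hb
  | smul r a ha => simp only [map_smul]; exact ha.const_smul r
  | mul a b ha hb => simp only [map_mul]; exact ha.mul hb
  | one => simp only [Cliff.map_one]; exact continuous_const
  | vec v => simp only [Cliff.map_vec]; exact Cliff.continuous_vec.comp (hT v)

lemma strongCont_tgtIso {T : P → Euc m →ₗᵢ[ℝ] Euc n} (hT : ∀ v, Continuous fun p => T p v) :
    GHom.StrongCont fun p => tgtIso H B (T p) :=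
  (GHom.StrongCont.const _).tensor ((strongCont_cliffMap hT).tensor (GHom.StrongCont.const _))

lemma strongCont_rot : GHom.StrongCont fun a : O m => rot H B a :=
  strongCont_tgtIso O.continuous_isom

/-- The Bott maps of the circle are those of the sphere of dimension one. -/
lemma strongCont_bott : GHom.StrongCont (bott 𝕜) := by
  have hi : Isometry fun r : ℝ => (EuclideanSpace.single (0 : Fin 1) r : Euc 1) :=
    Isometry.of_dist_eq fun r s => PiLp.dist_single_same 2 (fun _ : Fin 1 => ℝ) 0 r s
  have hc : Continuous (OnePoint.map fun r : ℝ => (EuclideanSpace.single (0 : Fin 1) r : Euc 1)) := by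
    refine OnePoint.continuous_map hi.continuous ?_
    rw [Filter.coclosedCompact_eq_cocompact, Filter.coclosedCompact_eq_cocompact]
    exact hi.isClosedEmbedding.tendsto_cocompact
  intro f
  refine ((continuous_bottPt f).comp hc).congr fun s => ?_
  induction s using OnePoint.rec with
  | infty => rfl
  | coe r => rw [bott_coe]; rfl

lemma strongCont_bottTensor : GHom.StrongCont (bottTensor H B m) :=
  (GHom.StrongCont.const _).comp (strongCont_bott.tensor (GHom.StrongCont.const _))

lemma AsyClass.iter_eq {θ : GHom (Cliff 𝕜 n ⊗ᵍ tgt H B m) (tgt H B (m + n))}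
    (hθ : ∀ d w, θ (d ⊗ₑ w) = (cliffAct H B (m + n)).r (Cliff.map 𝕜 (Euc.inr m n) d)
        (tgtIso H B (Euc.inl m n) w)) (x : AsyClass (src H A) (tgt H B m)) (v : OnePoint (Euc n)) :
    x.iter n v = ((x.leftTensor (funS 𝕜)).compHom (comultTensor H A)).homComp
      (θ.comp ((bottPt 𝕜 v).tensor (GHom.id _))) := by
  refine hat_injective ?_
  rw [hat_iter hθ, hat_homComp, hat_compHom, hat_leftTensor]
  rfl

lemma strongCont_bottPt_tensor (θ : GHom (Cliff 𝕜 n ⊗ᵍ tgt H B m) (tgt H B (m + n))) :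
    GHom.StrongCont fun v : OnePoint (Euc n) => θ.comp ((bottPt 𝕜 v).tensor (GHom.id _)) :=
  (GHom.StrongCont.const _).comp
    (GHom.StrongCont.tensor continuous_bottPt (GHom.StrongCont.const _))

/-- The algebraic laws hold because structure maps and rotations are translations; quasi-continuity
holds because the iterated structure maps are given by a family of homomorphisms, the Bott maps, that
is continuous on the whole sphere. -/
theorem isOQS_specE (H : GradedHilbert.{u'} 𝕜) (A : GCAlg.{u} 𝕜) (B : GCAlg.{v} 𝕜) :
    IsOQS (specE.{u, v, w, u'} H A B) where
  one_act m (x : AsyClass (src H A) (tgt H B m)) := by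
    change AsyClass.homComp (rot H B 1) x = x
    rw [rot_one, AsyClass.homComp_id]
  mul_act _ a b x := AsyClass.mul_act a b x
  act_pt _ _ := AsyClass.homComp_zero _
  act_qcont m := AsyClass.qcont₂_qtop fun C _ _ _ p x hp hx =>
    (hx.homComp (strongCont_rot.comp_continuous hp)).mem_qtop
  σ_pt _ s := AsyClass.zero_susp s
  σ_infty _ x := AsyClass.susp_infty x
  σ_qcont m := AsyClass.qcont₂_qtop fun C _ _ _ p x hp hx =>
    ((hx.leftTensor.compHom (GHom.StrongCont.const _)).homComp
      (strongCont_bottTensor.comp_continuous hp)).mem_qtop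
  iter_qcont m n := by
    obtain ⟨θ, hθ⟩ := exists_shuffle H B m n
    refine AsyClass.qcont₂_qtop fun C _ _ _ p x hp hx => ?_
    have e : (fun c => (specE.{u, v, w, u'} H A B).iter m n (x c) (p c)) = fun c =>
        (((x c).leftTensor (funS 𝕜)).compHom (comultTensor H A)).homComp
          (θ.comp ((bottPt 𝕜 (p c)).tensor (GHom.id _))) := funext fun c =>
      (specE_iter (x c) n (p c)).trans (AsyClass.iter_eq hθ (x c) (p c))
    rw [e]
    exact ((hx.leftTensor.compHom (GHom.StrongCont.const _)).homComp
      ((strongCont_bottPt_tensor θ).comp_continuous hp)).mem_qtop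
  iter_act m n a b (x : AsyClass (src H A) (tgt H B m)) v :=
    (specE_iter (x.homComp (rot H B a)) n _).trans ((AsyClass.iter_act a b x v).trans
      (congrArg (AsyClass.homComp (rot H B _)) (specE_iter x n v).symm))

/-- The laws are inherited from the spectrum of asymptotic morphisms, of which the homomorphisms form
a subobject. -/
theorem isOQS_specK (H : GradedHilbert.{u'} 𝕜) (A : GCAlg.{u} 𝕜) : IsOQS (specK.{u, w, u'} H A) where
  one_act m x := by
    change (rot H A 1).comp x = x
    rw [rot_one]; rfl
  mul_act m a b (x : GHom (src H (scalars 𝕜)) (tgt H A m)) := by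
    change (rot H A (a * b)).comp x = (rot H A a).comp ((rot H A b).comp x)
    refine AsyClass.ofHom_injective ?_
    rw [AsyClass.ofHom_comp, AsyClass.ofHom_comp, AsyClass.ofHom_comp, AsyClass.mul_act]
  act_pt m a := GHom.ext fun _ => map_zero (rot H A a).toHom
  act_qcont m C _ _ _ p x hp hx := ((strongCont_rot.comp_continuous hp).comp
    (GHom.strongCont_of_continuous hx)).continuous
  σ_pt m s := by
    change GHom.susp 0 s = 0
    refine AsyClass.ofHom_injective ?_
    rw [AsyClass.ofHom_susp, AsyClass.ofHom_zero, AsyClass.zero_susp, AsyClass.ofHom_zero]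
  σ_infty m (x : GHom (src H (scalars 𝕜)) (tgt H A m)) := by
    change GHom.susp x _ = 0
    refine AsyClass.ofHom_injective ?_
    rw [AsyClass.ofHom_susp, AsyClass.susp_infty, AsyClass.ofHom_zero]
  σ_qcont m C _ _ _ p x hp hx := ((strongCont_bottTensor.comp_continuous hp).comp
    (((GHom.StrongCont.const _).tensor (GHom.strongCont_of_continuous hx)).comp
      (GHom.StrongCont.const _))).continuous
  iter_qcont m n C _ _ _ p x hp hx := by
    obtain ⟨θ, hθ⟩ := exists_shuffle H A m n
    have e : (fun c => (specK.{u, w, u'} H A).iter m n (x c) (p c)) = fun c =>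
        (θ.comp ((bottPt 𝕜 (p c)).tensor (GHom.id _))).comp
          (((GHom.id (funS 𝕜)).tensor (x c)).comp (comultTensor H (scalars 𝕜))) := funext fun c =>
      (specK_iter (x c) n (p c)).trans (GHom.iter_eq hθ (x c) (p c))
    rw [e]
    exact (((strongCont_bottPt_tensor θ).comp_continuous hp).comp
      (((GHom.StrongCont.const _).tensor (GHom.strongCont_of_continuous hx)).comp
        (GHom.StrongCont.const _))).continuous
  iter_act m n a b (x : GHom (src H (scalars 𝕜)) (tgt H A m)) v := by
    refine (specK_iter ((rot H A a).comp x) n _).trans (Eq.trans ?_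
      (congrArg (GHom.comp (rot H A _)) (specK_iter x n v).symm))
    refine AsyClass.ofHom_injective ?_
    rw [AsyClass.ofHom_iter, AsyClass.ofHom_comp, AsyClass.ofHom_comp, AsyClass.ofHom_iter,
      AsyClass.iter_act]

end

end GradedE

end

/-! ### The smash product is an orthogonal quasi-spectrum -/

noncomputable section

namespace GradedE

universe u' v' w'

namespace O

variable {p q n : ℕ}

lemma blk_one_one (h : p + q = n) : blk h (1 : O p) (1 : O q) = 1 := by
  apply Subtype.ext
  change Matrix.reindex _ _ (Matrix.fromBlocks 1 0 0 1) = 1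
  rw [Matrix.fromBlocks_one, Matrix.reindex_apply, Matrix.submatrix_one_equiv]

lemma blk_zero (g : O n) (b : O 0) : blk rfl g b = g := by
  ext i j
  exact blk_LL g b i j

lemma continuous_blk_left (b : O q) : Continuous fun g : O p => blk (n := p + q) rfl g b := by
  refine Continuous.subtype_mk (continuous_matrix fun i j => ?_) _
  have h : ∀ i j, Continuous fun a : O p => a.1 i j := fun i j =>
    (continuous_subtype_val (p := fun M : Matrix (Fin p) (Fin p) ℝ =>
      M ∈ Matrix.orthogonalGroup (Fin p) ℝ)).matrix_elem i j
  refine Fin.addCases (fun i => ?_) (fun i => ?_) i <;>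
    refine Fin.addCases (fun j => ?_) (fun j => ?_) j
  · exact (h i j).congr fun g => (blk_LL g b i j).symm
  · exact (continuous_const (y := (0 : ℝ))).congr fun g => (blk_LR g b i j).symm
  · exact (continuous_const (y := (0 : ℝ))).congr fun g => (blk_RL g b i j).symm
  · exact (continuous_const (y := b.1 i j)).congr fun g => (blk_RR g b i j).symm

end O

namespace OQSData

variable {X : OQSData.{u, w}} {Y : OQSData.{v, w}} (hY : Y.IsOQS) {n p q : ℕ}

lemma smashMk_pt_right (h : p + q = n) (g : O n) (x : X.X p) :
    smashMk (Y := Y) h g x (Y.pt q) = Quot.mk _ .base :=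
  Quot.sound (.right p q h g x)

lemma smash_iter_pt (k : ℕ) (v : OnePoint (Euc k)) :
    (smash X Y hY).iter n k ((smash X Y hY).pt n) v = (smash X Y hY).pt (n + k) := by
  induction v using OnePoint.rec with
  | infty => rfl
  | coe v =>
    induction k with
    | zero => rfl
    | succ k ih =>
      exact congrArg (fun z => (smash X Y hY).σ (n + k) z (v (Fin.last k) : OnePoint ℝ))
        (ih (WithLp.toLp 2 fun i => v i.castSucc))

/-- The iterated structure maps of the smash product are those of the second factor. -/
lemma smash_iter_mk (h : p + q = n) (g : O n) (x : X.X p) (y : Y.X q) (k : ℕ)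
    (v : OnePoint (Euc k)) :
    (smash X Y hY).iter n k (smashMk h g x y) v =
      smashMk (p := p) (q := q + k) (n := n + k) (by omega) (O.blk rfl g 1) x (Y.iter q k y v) := by
  induction v using OnePoint.rec with
  | infty => exact (smashMk_pt_right _ _ x).symm
  | coe v =>
    induction k with
    | zero =>
      rw [O.blk_zero]
      rfl
    | succ k ih =>
      have e : O.blk (n := n + k + 1) rfl (O.blk rfl g (1 : O k)) (1 : O 1) =
          O.blk (n := n + (k + 1)) rfl g 1 := by
        rw [O.blk_assoc, O.blk_one_one]
      refine (congrArg (fun z => (smash X Y hY).σ (n + k) z (v (Fin.last k) : OnePoint ℝ))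
        (ih (WithLp.toLp 2 fun i => v i.castSucc))).trans ?_
      exact congrArg (fun g => smashMk (p := p) (q := q + (k + 1)) (n := n + (k + 1)) (by omega) g x
        (Y.iter q (k + 1) y v)) e

lemma smash_ind {P : SmashSpace X Y n → Prop} (base : P (Quot.mk _ .base))
    (mk : ∀ p q h g x y, P (smashMk (p := p) (q := q) h g x y)) (z : SmashSpace X Y n) : P z := by
  induction z using Quot.ind with
  | mk z =>
    cases z with
    | base => exact base
    | mk p q h g x y => exact mk p q h g x y

/-- Joint quasi-continuity on a smash product can be tested on families of representatives. -/
lemma qcont₂_smash {P : Type u'} [TopologicalSpace P] {Z : Type v'} {TZ : QTop.{v', w} Z}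
    {f : P → SmashSpace X Y n → Z}
    (hf : ∀ (C : Type w) [TopologicalSpace C] [CompactSpace C] [T2Space C] (t : C → P) (p q : ℕ)
      (e : p + q = n) (g : C → O n) (x : C → X.X p) (y : C → Y.X q), Continuous t → Continuous g →
      x ∈ (X.top p).Q C → y ∈ (Y.top q).Q C →
      (fun c => f (t c) (smashMk e (g c) (x c) (y c))) ∈ TZ.Q C) :
    QTop.QCont₂ ((smash X Y hY).top n) TZ f := by
  refine QTop.qcont₂_generate ?_ ?_ ?_
  · intro C _ _ _ z
    induction z using smash_ind with
    | base =>
      exact ⟨n, 0, rfl, fun _ => 1, fun _ => X.pt n, fun _ => Y.pt 0, continuous_const,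
        (X.top n).const C _, (Y.top 0).const C _, funext fun _ => (smashMk_pt_right _ _ _).symm⟩
    | mk p q h g x y =>
      exact ⟨p, q, h, fun _ => g, fun _ => x, fun _ => y, continuous_const, (X.top p).const C _,
        (Y.top q).const C _, rfl⟩
  · rintro C D _ _ _ _ _ _ t _ ht ⟨p, q, e, g, x, y, hg, hx, hy, rfl⟩
    exact ⟨p, q, e, g ∘ t, x ∘ t, y ∘ t, hg.comp ht, (X.top p).comp t x ht hx,
      (Y.top q).comp t y ht hy, rfl⟩
  · rintro C _ _ _ t _ ht ⟨p, q, e, g, x, y, hg, hx, hy, rfl⟩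
    exact hf C t p q e g x y ht hg hx hy

lemma smashMk_mem {C : Type w} [TopologicalSpace C] [CompactSpace C] [T2Space C] (e : p + q = n)
    {g : C → O n} {x : C → X.X p} {y : C → Y.X q} (hg : Continuous g) (hx : x ∈ (X.top p).Q C)
    (hy : y ∈ (Y.top q).Q C) :
    (fun c => smashMk e (g c) (x c) (y c)) ∈ ((smash X Y hY).top n).Q C :=
  fun _ hT => hT C ⟨p, q, e, g, x, y, hg, hx, hy, rfl⟩

/-- The laws of the smash product follow from those of the second factor, up to the relation that
balances the actions of the orthogonal groups. -/
theorem isOQS_smash (hX : X.IsOQS) : (smash X Y hY).IsOQS where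
  one_act m z := by
    induction z using smash_ind with
    | base => rfl
    | mk p q h g x y => exact congrArg (fun g => smashMk h g x y) (one_mul g)
  mul_act m a b z := by
    induction z using smash_ind with
    | base => rfl
    | mk p q h g x y => exact congrArg (fun g => smashMk h g x y) (mul_assoc a b g)
  act_pt _ _ := rfl
  act_qcont m := qcont₂_smash hY fun C _ _ _ t p q e g x y ht hg hx hy =>
    smashMk_mem hY e (ht.mul hg) hx hy
  σ_pt _ _ := rfl
  σ_infty m z := by
    induction z using smash_ind with
    | base => rfl
    | mk p q h g x y =>
      change smashMk _ (O.blk rfl g 1) x (Y.σ q y OnePoint.infty) = _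
      rw [hY.σ_infty]
      exact smashMk_pt_right _ _ _
  σ_qcont m := qcont₂_smash hY fun C _ _ _ t p q e g x y ht hg hx hy =>
    smashMk_mem hY (q := q + 1) (n := m + 1) (by omega) ((O.continuous_blk_left 1).comp hg) hx
      (hY.σ_qcont q C t y ht hy)
  iter_qcont m k := qcont₂_smash hY fun C _ _ _ t p q e g x y ht hg hx hy => by
    simp only [smash_iter_mk]
    exact smashMk_mem hY _ ((O.continuous_blk_left 1).comp hg) hx (hY.iter_qcont q k C t y ht hy)
  iter_act m k a b z v := by
    induction z using smash_ind with
    | base =>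
      refine (smash_iter_pt hY k _).trans ?_
      exact congrArg ((smash X Y hY).act (m + k) (O.blk rfl a b)) (smash_iter_pt hY k v).symm
    | mk p q h g x y =>
      refine (smash_iter_mk hY h (a * g) x y k _).trans (Eq.trans ?_
        (congrArg ((smash X Y hY).act (m + k) (O.blk rfl a b)) (smash_iter_mk hY h g x y k v).symm))
      -- the second factor of the block sum acts on the second factor of the smash product
      have h1 := hY.iter_act q k 1 b y v
      rw [hY.one_act] at h1
      have h2 := Quot.sound (SmashRel.balanced (X := X) (Y := Y) p (q + k) (n := m + k) (by omega)
        (O.blk rfl (a * g) 1) 1 (O.blk rfl 1 b) x (Y.iter q k y v))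
      rw [hX.one_act, ← h1, ← O.blk_assoc h, O.blk_one_one, ← O.blk_mul, mul_one, one_mul] at h2
      refine h2.symm.trans ?_
      have h3 : O.blk rfl (a * g) b = O.blk rfl a b * O.blk (n := m + k) rfl g 1 := by
        rw [← O.blk_mul, mul_one]
      rw [h3]
      rfl

end OQSData

end GradedE

end

/-! ### The product on the smash product -/

noncomputable section

namespace GradedE

universe u' v' w'

variable {𝕜 : Type} [RCLike 𝕜]

lemma Euc.inl_inr (m n : ℕ) (v : Euc n) :
    Euc.inl (m + n) 1 (Euc.inr m n v) = Euc.inr m (n + 1) (Euc.inl n 1 v) := by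
  refine Euc.ext_add (m := m + n) (k := 1) (fun i => ?_) fun i => ?_
  · rw [Euc.inl_castAdd]
    refine Fin.addCases (fun i => ?_) (fun i => ?_) i
    · rw [Euc.inr_castAdd]
      exact (Euc.inr_castAdd (k := n + 1) (Euc.inl n 1 v) i).symm
    · rw [Euc.inr_natAdd]
      exact ((Euc.inr_natAdd (k := n + 1) (Euc.inl n 1 v) i.castSucc).trans
        (Euc.inl_castAdd v i)).symm
  · rw [Euc.inl_natAdd]
    fin_cases i
    exact ((Euc.inr_natAdd (k := n + 1) (Euc.inl n 1 v) (Fin.last n)).trans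
      (Euc.inl_natAdd v 0)).symm

lemma Euc.inr_inr (m n : ℕ) (v : Euc 1) :
    Euc.inr m (n + 1) (Euc.inr n 1 v) = Euc.inr (m + n) 1 v := by
  refine Euc.ext_add (m := m + n) (k := 1) (fun i => ?_) fun i => ?_
  · rw [Euc.inr_castAdd]
    refine Fin.addCases (fun i => ?_) (fun i => ?_) i
    · exact Euc.inr_castAdd (k := n + 1) (Euc.inr n 1 v) i
    · exact (Euc.inr_natAdd (k := n + 1) (Euc.inr n 1 v) i.castSucc).trans (Euc.inr_castAdd v i)
  · rw [Euc.inr_natAdd]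
    fin_cases i
    exact (Euc.inr_natAdd (k := n + 1) (Euc.inr n 1 v) (Fin.last n)).trans (Euc.inr_natAdd v 0)

section

variable {H : GradedHilbert.{u'} 𝕜} {A : GCAlg.{u} 𝕜} {B : GCAlg.{v} 𝕜} {m n k : ℕ}

lemma GHom.susp_infty (α : GHom (src H A) (tgt H B m)) : α.susp OnePoint.infty = 0 := by
  refine AsyClass.ofHom_injective ?_
  rw [AsyClass.ofHom_susp, AsyClass.susp_infty, AsyClass.ofHom_zero]

lemma isTranslate_const_susp (α : GHom (src H A) (tgt H B m)) (r : ℝ) :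
    IsTranslate (gauss 𝕜 (EuclideanSpace.single (0 : Fin 1) r : Euc 1))
      (Euc.inr m 1 (EuclideanSpace.single 0 r)) (Euc.inl m 1) ((Q.const _).comp α)
      ((Q.const _).comp (α.susp (r : OnePoint ℝ))) := by
  have h := AsyClass.isTranslate_susp (AsyClass.ofHom α) r
  rwa [← AsyClass.ofHom_susp, AsyClass.hat_ofHom, AsyClass.hat_ofHom] at h

lemma isTranslate_const_comp (T : Euc m →ₗᵢ[ℝ] Euc n) (α : GHom (src H A) (tgt H B m)) :
    IsTranslate 1 0 T ((Q.const _).comp α) ((Q.const _).comp ((tgtIso H B T).comp α)) := by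
  have h := IsTranslate.comp_iso T ((Q.const _).comp α)
  rwa [show (pathIso H B T).comp ((Q.const _).comp α) = (Q.const _).comp ((tgtIso H B T).comp α) from
    GHom.ext fun w => pathIso_const T (α w)] at h

/-- The product is equivariant. -/
lemma product_act (a : O m) (b : O n) (α : GHom (src H (scalars 𝕜)) (tgt H A m))
    (β : AsyClass (src H A) (tgt H B n)) :
    product H ((rot H A a).comp α) (β.homComp (rot H B b)) =
      (product H α β).homComp (rot H B (O.blk rfl a b)) := by
  refine AsyClass.hat_injective ?_
  have h1 := (AsyClass.isTranslate_homComp (O.isom b) β).product_right α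
    (S := O.isom (O.blk rfl 1 b)) (fun v => by rw [O.isom_blk_inl, O.isom_one]; rfl)
    fun v => O.isom_blk_inr _ _ v
  have h2 := (isTranslate_const_comp (O.isom a) α).product_left (β.homComp (rot H B b))
    (S := O.isom (O.blk rfl a 1)) (fun v => O.isom_blk_inl _ _ v)
    (fun v => by rw [O.isom_blk_inr, O.isom_one]; rfl)
  refine (h1.trans h2).eq (AsyClass.isTranslate_homComp (O.isom (O.blk rfl a b)) (product H α β))
    (mul_one _) ?_ fun v => ?_
  · simp only [map_zero, add_zero]
  · rw [← O.isom_mul, ← O.blk_mul, mul_one, one_mul]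

/-- The product is compatible with the structure maps in the second variable. -/
lemma product_susp (α : GHom (src H (scalars 𝕜)) (tgt H A m)) (β : AsyClass (src H A) (tgt H B n))
    (s : OnePoint ℝ) : product H α (β.susp s) = (product H α β).susp s := by
  induction s using OnePoint.rec with
  | infty => rw [AsyClass.susp_infty, AsyClass.susp_infty, product_zero]
  | coe r =>
    refine AsyClass.hat_injective ?_
    exact ((AsyClass.isTranslate_susp β r).product_right α (S := Euc.inl (m + n) 1) (Euc.inl_inl m n)
      (Euc.inl_inr m n)).eq (AsyClass.isTranslate_susp (product H α β) r) rfl (Euc.inr_inr m n _)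
        fun _ => rfl

/-- The product is balanced over the sphere spectrum.  The coordinate of the sphere, which in
`σ(α, s) × β` stands between those of `α` and of `β`, is the last one in `α × σ(β, s)` and has to be
moved to the front of the coordinates of `β`. -/
lemma susp_product (h : m + 1 + n = m + (n + 1)) (α : GHom (src H (scalars 𝕜)) (tgt H A m))
    (β : AsyClass (src H A) (tgt H B n)) (s : OnePoint ℝ) :
    (product H (α.susp s) β).homComp (tgtIso H B (Euc.cast h)) =
      product H α ((β.susp s).homComp (rot H B (O.χ n))) := by
  induction s using OnePoint.rec with
  | infty =>
    rw [AsyClass.susp_infty, GHom.susp_infty, zero_product, AsyClass.homComp_zero,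
      AsyClass.homComp_zero, product_zero]
  | coe r =>
    refine AsyClass.hat_injective ?_
    -- `T` adds a last coordinate and moves it to the front of the coordinates of `β`. Both sides are
    -- translates of `product H α β` along `T`, by `r` times the new unit vector.
    let T : Euc (m + n) →ₗᵢ[ℝ] Euc (m + (n + 1)) :=
      (O.isom (O.blk rfl 1 (O.χ n))).comp (Euc.inl (m + n) 1)
    have hl : ∀ v, T (Euc.inl m n v) = Euc.inl m (n + 1) v := fun v => by
      refine (congrArg (O.isom (O.blk rfl 1 (O.χ n))) (Euc.inl_inl m n v)).trans ?_
      rw [O.isom_blk_inl, O.isom_one]; rfl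
    have hr : ∀ v, T (Euc.inr m n v) = Euc.inr m (n + 1) (O.isom (O.χ n) (Euc.inl n 1 v)) :=
      fun v => (congrArg (O.isom (O.blk rfl 1 (O.χ n))) (Euc.inl_inr m n v)).trans
        (O.isom_blk_inr _ _ _)
    have hc : ∀ v, Euc.cast h (Euc.cast h.symm v) = v := fun _ => rfl
    have hc' : ∀ v, Euc.cast h.symm (Euc.cast h v) = v := fun _ => rfl
    have h1 := (isTranslate_const_susp α r).product_left β (S := (Euc.cast h.symm).comp T)
      (fun v => by
        rw [LinearIsometry.coe_comp, Function.comp_apply, hl, ← Euc.cast_inl_inl m n h, hc'])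
      fun v => by
        rw [LinearIsometry.coe_comp, Function.comp_apply, hr, ← Euc.cast_inr m n h, hc']
    have h2 := ((AsyClass.isTranslate_susp β r).trans
      (AsyClass.isTranslate_homComp (O.isom (O.χ n)) _)).product_right α (S := T) hl hr
    refine (h1.trans (AsyClass.isTranslate_homComp (Euc.cast h) _)).eq h2 rfl ?_ fun v => hc _
    rw [add_zero, add_zero, Euc.cast_inl_inr]

variable (H B) in
/-- The automorphism `g` of the target of a product in degree `p + q = k`. -/
def castRot {p q : ℕ} (e : p + q = k) (g : O k) : GHom (tgt H B (p + q)) (tgt H B k) :=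
  tgtIso H B ((O.isom g).comp (Euc.cast e))

lemma homComp_castRot_rfl {C : GCAlg.{w'} 𝕜} (x : AsyClass (src H C) (tgt H B (m + n)))
    (g : O (m + n)) : x.homComp (castRot H B rfl g) = x.homComp (rot H B g) := rfl

lemma product_castRot (e : m + n = k) (g : O k) (a : O m) (b : O n)
    (α : GHom (src H (scalars 𝕜)) (tgt H A m)) (β : AsyClass (src H A) (tgt H B n)) :
    (product H α β).homComp (castRot H B e (g * O.blk e a b)) =
      (product H ((rot H A a).comp α) (β.homComp (rot H B b))).homComp (castRot H B e g) := by
  subst e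
  rw [homComp_castRot_rfl, homComp_castRot_rfl, product_act, AsyClass.mul_act]

lemma susp_product_castRot (e : m + 1 + n = k) (e' : m + (n + 1) = k) (g : O k)
    (α : GHom (src H (scalars 𝕜)) (tgt H A m)) (β : AsyClass (src H A) (tgt H B n))
    (s : OnePoint ℝ) : (product H (α.susp s) β).homComp (castRot H B e g) =
      (product H α ((β.susp s).homComp (rot H B (O.χ n)))).homComp (castRot H B e' g) := by
  subst e'
  rw [← susp_product e]
  exact (AsyClass.homComp_tgtIso _ _ _).symm

/-- The map induced by the product commutes with the structure maps. -/
lemma product_susp_castRot (e : m + n = k) (e' : m + (n + 1) = k + 1) (g : O k)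
    (α : GHom (src H (scalars 𝕜)) (tgt H A m)) (β : AsyClass (src H A) (tgt H B n))
    (s : OnePoint ℝ) : (product H α (β.susp s)).homComp (castRot H B e' (O.blk rfl g 1)) =
      ((product H α β).homComp (castRot H B e g)).susp s := by
  subst e
  refine (homComp_castRot_rfl (m := m) (n := n + 1) (product H α (β.susp s))
    (O.blk (n := m + n + 1) rfl g 1)).trans ?_
  refine (congrArg (AsyClass.homComp (rot H B (m := m + n + 1) (O.blk rfl g 1)))
    (product_susp α β s)).trans ?_
  rw [homComp_castRot_rfl]
  induction s using OnePoint.rec with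
  | infty => rw [AsyClass.susp_infty, AsyClass.susp_infty, AsyClass.homComp_zero]
  | coe r =>
    refine AsyClass.hat_injective ?_
    refine ((AsyClass.isTranslate_susp _ r).trans
      (AsyClass.isTranslate_homComp (O.isom (O.blk rfl g 1)) _)).eq
      ((AsyClass.isTranslate_homComp (O.isom g) _).trans (AsyClass.isTranslate_susp _ r)) ?_ ?_ ?_
    · rw [mul_comm]
    · rw [map_zero, zero_add, add_zero, O.isom_blk_inr, O.isom_one]; rfl
    · exact fun v => O.isom_blk_inl g 1 v

/-- The map induced by the product on representatives of points of the smash product. -/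
def smashPreProduct : SmashPre (specK.{u, w, u'} H A) (specE.{u, v, w, u'} H A B) k →
    AsyClass (src H (scalars 𝕜)) (tgt H B k)
  | .base => 0
  | .mk _ _ e g α β => (product H α β).homComp (castRot H B e g)

lemma smashPreProduct_eq {z z' : SmashPre (specK.{u, w, u'} H A) (specE.{u, v, w, u'} H A B) k}
    (hz : SmashRel _ _ k z z') : smashPreProduct z = smashPreProduct z' := by
  cases hz with
  | left p q e g β =>
    exact (congrArg (AsyClass.homComp _) (zero_product _)).trans (AsyClass.homComp_zero _)
  | right p q e g α =>
    exact (congrArg (AsyClass.homComp _) (product_zero _)).trans (AsyClass.homComp_zero _)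
  | balanced p q e g a b α β =>
    exact product_castRot e g a b α β
  | sphere p q e e' g α s β => exact susp_product_castRot e e' g α β s

/-- The map induced by the product on the smash product. -/
def smashProduct (H : GradedHilbert.{u'} 𝕜) (A : GCAlg.{u} 𝕜) (B : GCAlg.{v} 𝕜) (k : ℕ) :
    SmashSpace (specK.{u, w, u'} H A) (specE.{u, v, w, u'} H A B) k →
      AsyClass (src H (scalars 𝕜)) (tgt H B k) :=
  Quot.lift smashPreProduct fun _ _ => smashPreProduct_eq

lemma smashProduct_mk (e : m + n = k) (g : O k) (α : GHom (src H (scalars 𝕜)) (tgt H A m))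
    (β : AsyClass (src H A) (tgt H B n)) :
    smashProduct.{u, v, w, u'} H A B k (smashMk e g α β) =
      (product H α β).homComp (castRot H B e g) := rfl

/-- Quasi-continuity is only known for products of generating families of asymptotic morphisms, so a
quasi-continuous family `β` is first replaced by an independent variable. -/
theorem isMorphism_smashProduct (hE : IsOQS (specE.{u, v, w, u'} H A B)) :
    IsMorphism (smash (specK H A) (specE H A B) hE) (specK'.{v, w, u'} H B)
      (smashProduct.{u, v, w, u'} H A B) where
  map_pt _ := rfl
  qcont k := QTop.qcont_generate fun C _ _ _ f hf => by
    obtain ⟨m, n, e, g, α, β, hg, hα, hβ, rfl⟩ := hf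
    -- joint quasi-continuity in the space of parameters and in the asymptotic morphism
    have key : QTop.QCont₂ (AsyClass.qtop.{max u u', max v u', w} (src H A) (tgt H B n))
        (AsyClass.qtop.{u', max v u', w} (src H (scalars 𝕜)) (tgt H B k))
        fun (c : C) (y : AsyClass (src H A) (tgt H B n)) =>
          (product H (α c) y).homComp (castRot H B e (g c)) := by
      refine AsyClass.qcont₂_qtop fun D _ _ _ t y ht hy => AsyClass.IsFamily.mem_qtop ?_
      have h1 : GHom.StrongCont fun d => α (t d) :=
        (GHom.strongCont_of_continuous hα).comp_continuous ht
      refine ((hy.rightTensor.compHom ((GHom.StrongCont.const _).comp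
        (((GHom.StrongCont.const _).tensor h1).comp (GHom.StrongCont.const _)))).homComp
          (GHom.StrongCont.const _)).homComp (strongCont_tgtIso fun v => ?_)
      exact (O.continuous_isom (Euc.cast e v)).comp (hg.comp ht)
    exact key C id β continuous_id hβ
  map_act k a z := by
    induction z using smash_ind with
    | base => exact (AsyClass.homComp_zero _).symm
    | mk m n e g α β =>
      refine Eq.trans ?_ (AsyClass.homComp_tgtIso (O.isom a) _ (product H α β)).symm
      change (product H α β).homComp (tgtIso H B ((O.isom (a * g)).comp (Euc.cast e))) = _
      rw [O.isom_mul]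
      rfl
  map_σ k z s := by
    induction z using smash_ind with
    | base => exact (AsyClass.zero_susp s).symm
    | mk m n e g α β => exact product_susp_castRot e _ g α β s

end

end GradedE

end

theorem mainTheorem8 (𝕜 : Type) [RCLike 𝕜] (H : GradedHilbert.{h} 𝕜) :
    -- the canonical homomorphisms and the tensor products of asymptotic morphisms with identity
    -- morphisms, from which the spectra and the product are built, exist and are unique
    ((∃! Δ, IsComult 𝕜 Δ) ∧ (∀ r : ℝ, ∃! b, IsBott 𝕜 r b) ∧
      (∀ A : GCAlg.{p} 𝕜,
        ∃! θ : GHom ((funS 𝕜 ⊗ᵍ funS 𝕜) ⊗ᵍ A) (funS 𝕜 ⊗ᵍ funS 𝕜 ⊗ᵍ A), IsAssoc θ) ∧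
      (∀ (B : GCAlg.{p} 𝕜) (m : ℕ), ∃! θ, IsShuffle H B m θ) ∧
      (∀ (A : GCAlg.{p} 𝕜) (m : ℕ), ∃! θ, IsMoveOut H A m θ) ∧
      (∀ (B : GCAlg.{p} 𝕜) (m n : ℕ), ∃! θ, IsMoveIn H B m n θ) ∧
      (∀ (A : GCAlg.{p} 𝕜) (B : GCAlg.{q} 𝕜) (D : GCAlg.{0} 𝕜) (x : AsyClass A B),
        (∃! z, AsyClass.IsLeftTensor D x z) ∧ (∃! z, AsyClass.IsRightTensor x D z))) ∧
    -- `𝕂(A)`, `𝔼(A, B)` and `𝕂'(B)` are orthogonal quasi-spectra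
    (∀ A : GCAlg.{u} 𝕜, IsOQS (specK.{u, w, h} H A)) ∧
    (∀ B : GCAlg.{v} 𝕜, IsOQS (specK'.{v, w, h} H B)) ∧
    ∃ hE : ∀ (A : GCAlg.{u} 𝕜) (B : GCAlg.{v} 𝕜), IsOQS (specE.{u, v, w, h} H A B),
      -- so are the smash products `𝕂(A) ∧ 𝔼(A, B)`
      (∀ (A : GCAlg.{u} 𝕜) (B : GCAlg.{v} 𝕜),
        IsOQS (smash (specK H A) (specE H A B) (hE A B))) ∧
      ∃ ν : ∀ (A : GCAlg.{u} 𝕜) (B : GCAlg.{v} 𝕜) (n : ℕ),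
          (smash (specK H A) (specE H A B) (hE A B)).X n → (specK'.{v, w, h} H B).X n,
        -- a morphism of orthogonal quasi-spectra
        (∀ A B, IsMorphism (smash (specK H A) (specE H A B) (hE A B)) (specK' H B) (ν A B)) ∧
        -- given on `α ∧ β` by the product
        (∀ A B (m n : ℕ) (α : (specK.{u, w, h} H A).X m) (β : (specE.{u, v, w, h} H A B).X n),
          ν A B (m + n) (smashMk rfl 1 α β) = product H α β) ∧
        -- natural in `B`
        (∀ (A : GCAlg.{u} 𝕜) (B B' : GCAlg.{v} 𝕜) (f : GHom B B') (m n k : ℕ) (e : m + n = k)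
          (g : O k) (α : (specK.{u, w, h} H A).X m) (β : (specE.{u, v, w, h} H A B).X n),
          ν A B' k (smashMk e g α (AsyClass.homComp (tgtMap H f n) β)) =
            AsyClass.homComp (tgtMap H f k) (ν A B k (smashMk e g α β))) ∧
        -- natural in `A`
        (∀ (A A' : GCAlg.{u} 𝕜) (B : GCAlg.{v} 𝕜) (f : GHom A A') (m n k : ℕ) (e : m + n = k)
          (g : O k) (α : (specK.{u, w, h} H A).X m) (β : (specE.{u, v, w, h} H A' B).X n),
          ν A B k (smashMk e g α (AsyClass.compHom β (srcMap H f))) =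
            ν A' B k (smashMk e g ((tgtMap H f m).comp α) β)) := by 
  refine ⟨⟨existsUnique_isComult, existsUnique_isBott, fun A => existsUnique_isAssoc _ _ A,
    existsUnique_isShuffle H, existsUnique_isMoveOut H, existsUnique_isMoveIn H,
    fun A B D x => ⟨AsyClass.existsUnique_isLeftTensor D x, AsyClass.existsUnique_isRightTensor x D⟩⟩,
    isOQS_specK H, isOQS_specE H (scalars 𝕜), isOQS_specE H,
    fun A B => isOQS_smash (isOQS_specE H A B) (isOQS_specK H A),
    smashProduct.{u, v, w, h} H, fun A B => isMorphism_smashProduct _, fun A B m n α β => ?_,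
    fun A B B' f m n k e g α β => ?_, fun A A' B f m n k e g α β => ?_⟩
  -- The rotation by the identity matrix is the identity.
  · refine (smashProduct_mk rfl 1 α β).trans ?_
    rw [homComp_castRot_rfl, rot_one]
    exact AsyClass.homComp_id (product H α β)
  · refine (congrArg (AsyClass.homComp (castRot H B' e g)) (product_homComp α β f)).trans ?_
    exact (homComp_tgtMap_tgtIso f _ (product H α β)).symm
  · exact congrArg (AsyClass.homComp (castRot H B e g)) (product_compHom α β f)
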